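/- Let $X$ be a compact complex manifold of dimension $d$, $L\to X$ a holomorphic line bundle, $s$ a holomorphic section of $L$ whose zero set $D=\{s=0\}$ is a hypersurface with normal crossings (around every point there are holomorphic coordinates with $D=\{z_1\cdots z_m=0\}$, $m\ge 0$; $D=\varnothing$ is allowed). Let $X=D_0\supset D=D_1\supset D_2\supset\cdots$ be the natural stratification: for $k\ge 1$, $D_{k+1}$ is the singular locus of $D_k$ together with the components of $D_k$ of codimension larger than $k$. Let $\kappa$ be the largest number with $D_\kappa\neq\varnothing$. Let $\alpha,\beta$ be semi-meromorphic forms with poles along $D$ (locally a smooth form divided by a holomorphic function that vanishes at most on $D$), of degrees $k$ and $l$ with $k+l=2d$ (for instance, two $(d,0)$-forms). Put $\omega=\alpha\wedge\bar\beta$. Notation. For $x\in D_\kappa$ let $o_x(s)=I_1\cdots I_\kappa$, where $s=z^{I}u$ with $u$ holomorphic and non-vanishing, in coordinates centred at $x$ with $D=\{z_1\cdots z_\kappa=0\}$ and a local holomorphic frame of $L$; this is a locally constant function on $D_\kappa$. The Aeppli residue $\mathrm{Res}_A(\omega)$ on the compact manifold $D_\kappa$ is represented by $$\sum_i\frac{1}{(J-1)!\,(K-1)!}\,\frac{\partial^{|J-1|+|K-1|}(\rho_i\widetilde\omega_i)}{\partial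 z^{J-1}\,\partial\bar z^{K-1}}\bigg|_{D_\kappa},\qquad \omega=\frac{dz_1\wedge d\bar z_1\wedge\cdots\wedge dz_\kappa\wedge d\bar z_\kappa}{z^{J}\bar z^{K}}\wedge\widetilde\omega_i ,$$ where the $\rho_i$ are smooth functions with supports in coordinate charts with $D=\{z_1\cdots z_\kappa=0\}$ and $\sum_i\rho_i=1$ near $D_\kappa$, the multi-indices satisfy $J_j,K_j\ge1$ for $j\le\kappa$ and $J_j=K_j=0$ for $j>\kappa$, $\widetilde\omega_i$ is smooth and does not contain $dz_j,d\bar z_j$ for $j\le\kappa$, and $J-1$, $K-1$ refer to the first $\kappa$ entries. ($J$, $K$ and the coordinates may depend on $i$.) Fix a smooth metric $|\cdot|_0$ on $L$. Theorem. For $0\le r\le\kappa$ and $0\le j\le\kappa-r$ there are differential operators $Q_{r,j}$ with integrable coefficients from functions on $X$ to $(d,d)$-forms on $X$, and differential operators $P_{r,j}$ (in the variables of $X$) with integrable coefficients from functions on $X$ to $(d-r,d-r)$-forms on $D_r\setminus D_{r+1}$, the codimension $r$ part of $D_r$, such that the following holds for every smooth metric $|\cdot|=|\cdot|_0e^{-\varphi}$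 on $L$. The integral $\int_X|s|^{2\lambda}\alpha\wedge\bar\beta$ converges for $\mathrm{Re}\,\lambda$ large and has a meromorphic continuation to $\mathbb C$ with $$\int_X|s|^{2\lambda}\alpha\wedge\bar\beta=C_{-\kappa}\lambda^{-\kappa}+\dots+C_{-1}\lambda^{-1}+C_0+O(|\lambda|)\qquad(\lambda\to0),$$ and for $0\le r\le\kappa$ the coefficient $C_{-r}=C_{-r}(\varphi)$ satisfies: (a) $C_{-r}(\varphi)=\sum_{j=0}^{\kappa-r}\int_XQ_{r,j}(\varphi^j)$; in particular it is a polynomial of degree at most $\kappa-r$ in $\varphi$. (b) The term of top degree is $$\int_XQ_{r,\kappa-r}(\varphi^{\kappa-r})=\frac{(-2\pi i)^\kappa(-2)^{\kappa-r}}{(\kappa-r)!}\int_{D_\kappa}\frac{1}{o_x(s)}\,\mathrm{Res}_A\big(\varphi^{\kappa-r}\alpha\wedge\bar\beta\big).$$ (If $o_x(s)=o(s)$ is the same for all $x\in D_\kappa$, the right hand side is $\frac{(-2\pi i)^\kappa(-2)^{\kappa-r}}{o(s)(\kappa-r)!}\int_{D_\kappa}\mathrm{Res}_A(\varphi^{\kappa-r}\alpha\wedge\bar\beta)$.)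 (c) $C_{-r}$ is an integral over $D_r$: $C_{-r}(\varphi)=\sum_{j=0}^{\kappa-r}\int_{D_r\setminus D_{r+1}}P_{r,j}(\varphi^j)$. -/

import Mathlib

open Set Filter Topology MeasureTheory Bundle Manifold
open scoped ContDiff

noncomputable section

namespace DivInt

/-- The model space `ℂ^d` of a complex manifold of dimension `d`. -/
abbrev Cd (d : ℕ) : Type := Fin d → ℂ

/-! ### Differential forms on the underlying real manifold -/

/-- A (not necessarily continuous) complex valued differential `k`-form on `X`: at each point an
`ℝ`-multilinear alternating form on the real tangent space. -/
abbrev FormField (d : ℕ) (X : Type*) [TopologicalSpace X] [ChartedSpace (Cd d) X] (k : ℕ) :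
    Type _ :=
  ∀ x : X, TangentSpace 𝓘(ℝ, Cd d) x [⋀^Fin k]→ₗ[ℝ] ℂ

section Forms

variable {d : ℕ} {X : Type*} [TopologicalSpace X] [ChartedSpace (Cd d) X]

/-- Holomorphic coordinate charts of `X`. -/
abbrev HolChart (e : OpenPartialHomeomorph X (Cd d)) : Prop :=
  e ∈ IsManifold.maximalAtlas 𝓘(ℂ, Cd d) ω X

/-- The form `η` written in the chart `e`: the pullback of `η` under `e⁻¹`. -/
def inChart (e : OpenPartialHomeomorph X (Cd d)) {k : ℕ} (η : FormField d X k) (w : Cd d) :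
    Cd d [⋀^Fin k]→ₗ[ℝ] ℂ :=
  (η (e.symm w)).compLinearMap
    (mfderiv 𝓘(ℝ, Cd d) 𝓘(ℝ, Cd d) e.symm w).toLinearMap

/-- The conjugate form. -/
def conjForm {k : ℕ} (β : FormField d X k) : FormField d X k :=
  fun x => (Complex.conjAe.toLinearMap).compAlternatingMap (β x)

/-- The wedge product of a `k`-form and an `l`-form, as a form of top degree `2d = k + l`. -/
def wedgeTop {k l : ℕ} (hkl : k + l = 2 * d) (α : FormField d X k) (β : FormField d X l) :
    FormField d X (2 * d) :=
  fun x => ((LinearMap.mul' ℝ ℂ).compAlternatingMap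
    ((α x).domCoprod (β x))).domDomCongr (finSumFinEquiv.trans (finCongr hkl))

/-- Semi-meromorphic forms with poles along `D`: locally `α = α̃ / f` off `D` with `α̃` a smooth form
and `f` a holomorphic function which vanishes at most on `D`. -/
def IsSemiMeromorphic (D : Set X) {k : ℕ} (α : FormField d X k) : Prop :=
  ∀ x : X, ∃ e : OpenPartialHomeomorph X (Cd d), HolChart e ∧ x ∈ e.source ∧
    ∃ (f : Cd d → ℂ) (a : Cd d → Cd d [⋀^Fin k]→L[ℝ] ℂ),
      DifferentiableOn ℂ f e.target ∧
      (∀ w ∈ e.target, f w = 0 → e.symm w ∈ D) ∧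
      ContDiffOn ℝ ∞ a e.target ∧
      ∀ w ∈ e.target, e.symm w ∉ D → ∀ v, inChart e α w v = a w v / f w

end Forms

/-! ### Hypersurfaces with normal crossings and their stratification -/

section Strata

variable {d : ℕ} {X : Type*} [TopologicalSpace X] [ChartedSpace (Cd d) X]

/-- `D` has normal crossings: around every point there are holomorphic coordinates in which `D` is
`{z₁ ⋯ z_m = 0}` for some `m ≥ 0`. -/
def IsNormalCrossing (D : Set X) : Prop :=
  ∀ x : X, ∃ e : OpenPartialHomeomorph X (Cd d), HolChart e ∧ x ∈ e.source ∧
    ∃ m : ℕ, ∀ y ∈ e.source, y ∈ D ↔ ∃ j : Fin d, (j : ℕ) < m ∧ e y j = 0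

/-- A chart in which `S` is the coordinate plane `{z₁ = ⋯ = z_c = 0}` of codimension `c`. -/
def IsSliceChart (S : Set X) (c : ℕ) (e : OpenPartialHomeomorph X (Cd d)) : Prop :=
  HolChart e ∧ c ≤ d ∧ ∀ y ∈ e.source, y ∈ S ↔ ∀ j : Fin d, (j : ℕ) < c → e y j = 0

/-- The natural stratification of an analytic hypersurface `D`: `D₀ = X`, `D₁ = D`, and `D_{k+1}` is
the singular locus of `D_k` together with the components of `D_k` of codimension larger than `k`;
that is, one removes from `D_k` the points near which it is a submanifold of codimension `k`. -/
def stratum (D : Set X) : ℕ → Set X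
  | 0 => univ
  | 1 => D
  | (k + 2) => {x ∈ stratum D (k + 1) | ¬ ∃ e : OpenPartialHomeomorph X (Cd d),
      IsSliceChart (stratum D (k + 1)) (k + 1) e ∧ x ∈ e.source}

end Strata

/-! ### Integration over complex submanifolds -/

section Integration

variable {d : ℕ} {X : Type*} [TopologicalSpace X] [ChartedSpace (Cd d) X]

/-- The parametrisation `w ↦ (0, …, 0, w)` of the coordinate plane `{z₁ = ⋯ = z_c = 0}`. -/
def slice (d c : ℕ) (w : Cd (d - c)) : Cd d :=
  fun j => if h : c ≤ (j : ℕ) then w ⟨(j : ℕ) - c, by have := j.isLt; omega⟩ else 0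

/-- The oriented real frame `∂/∂x_{c+1}, ∂/∂y_{c+1}, …, ∂/∂x_d, ∂/∂y_d` of that plane, where
`z_j = x_j + i y_j`. -/
def sliceFrame (d c : ℕ) (m : Fin (2 * (d - c))) : Cd d :=
  Pi.single ⟨c + (m : ℕ) / 2, by have := m.isLt; omega⟩ (if (m : ℕ) % 2 = 0 then 1 else Complex.I)

/-- The coefficient `g` in `η|_{z₁ = ⋯ = z_c = 0} = g(w) dx_{c+1} ∧ dy_{c+1} ∧ ⋯ ∧ dx_d ∧ dy_d`, at the
point with coordinates `(0, w)`. -/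
def sliceCoeff (e : OpenPartialHomeomorph X (Cd d)) (c : ℕ) (η : FormField d X (2 * (d - c)))
    (w : Cd (d - c)) : ℂ :=
  inChart e η (slice d c w) (sliceFrame d c)

/-- `η` is integrable over the complex submanifold `S` of codimension `c` and `∫_S η = I` (with the
complex orientation): computed in finitely many charts, weighted so that the weights add up to `1`
on `S`. Here `η` is a form on `X` along `S`, of which only the restriction to `S` matters. -/
def HasIntegralOver (S : Set X) (c : ℕ) (η : FormField d X (2 * (d - c))) (I : ℂ) : Prop :=
  ∃ (n : ℕ) (e : Fin n → OpenPartialHomeomorph X (Cd d)) (ρ : Fin n → X → ℝ),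
    (∀ i, IsSliceChart S c (e i)) ∧
    (∀ i x, 0 ≤ ρ i x) ∧ (∀ i, ∀ x ∉ (e i).source, ρ i x = 0) ∧
    (∀ x ∈ S, ∑ i, ρ i x = 1) ∧
    (∀ i, IntegrableOn
      (fun w => (ρ i ((e i).symm (slice d c w)) : ℂ) * sliceCoeff (e i) c η w)
      (slice d c ⁻¹' (e i).target) volume) ∧
    I = ∑ i, ∫ w in slice d c ⁻¹' (e i).target,
      (ρ i ((e i).symm (slice d c w)) : ℂ) * sliceCoeff (e i) c η w

/-! ### Differential operators with integrable coefficients -/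

/-- Smooth real valued functions on the underlying real manifold. -/
abbrev SmoothFn (f : X → ℝ) : Prop := ContMDiff 𝓘(ℝ, Cd d) 𝓘(ℝ, ℝ) ∞ f

/-- A differential operator `P`, from functions on `X` to forms of top degree on the submanifold `S`
of codimension `c`, which lives in one holomorphic chart `e` of `X`. The set `U` is an open part
of the chart in which `S` is `{z₁ = ⋯ = z_c = 0}`, and on it `P` is given by integrable functions
`A m` with values in the linear forms on derivatives of order `m ≤ N`. The coefficients vanish
outside a compact subset `K` of the domain of the chart (`U` need not contain `K`). -/
def IsLocalDiffOp (S : Set X) (c : ℕ) (P : (X → ℝ) → FormField d X (2 * (d - c))) : Prop :=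
  ∃ (e : OpenPartialHomeomorph X (Cd d)) (U K : Set X) (N : ℕ)
    (A : ∀ m : ℕ, Cd (d - c) → ((Cd d [×m]→L[ℝ] ℝ) →ₗ[ℝ] ℂ)),
    HolChart e ∧ c ≤ d ∧ IsOpen U ∧ U ⊆ e.source ∧
    (∀ y ∈ U, y ∈ S ↔ ∀ j : Fin d, (j : ℕ) < c → e y j = 0) ∧
    IsCompact K ∧ K ⊆ e.source ∧
    (∀ m t, Integrable (fun w => A m w t) volume) ∧
    (∀ m w, ¬ (slice d c w ∈ e.target ∧ e.symm (slice d c w) ∈ U ∩ K) → A m w = 0) ∧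
    ∀ f : X → ℝ, SmoothFn (d := d) f →
      (∀ x ∉ U, P f x = 0) ∧
      ∀ w, slice d c w ∈ e.target → e.symm (slice d c w) ∈ U →
        sliceCoeff e c (P f) w =
          ∑ m ∈ Finset.range (N + 1), A m w (iteratedFDeriv ℝ m (f ∘ e.symm) (slice d c w))

/-- Differential operators with integrable coefficients from functions on `X` to forms of top degree
on the submanifold `S` of codimension `c` (for `S = X` and `c = 0` these are the usual ones):
finite sums of such operators in charts. -/
def IsDiffOp (S : Set X) (c : ℕ) (Q : (X → ℝ) → FormField d X (2 * (d - c))) : Prop :=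
  ∃ (n : ℕ) (P : Fin n → (X → ℝ) → FormField d X (2 * (d - c))),
    (∀ i, IsLocalDiffOp S c (P i)) ∧
    ∀ f : X → ℝ, SmoothFn (d := d) f → ∀ x ∈ S, Q f x = ∑ i, P i f x

end Integration

/-! ### Sections and metrics of a line bundle -/

section LineBundle

variable {d : ℕ} {X : Type*} [TopologicalSpace X] [ChartedSpace (Cd d) X]
  (L : X → Type*) [TopologicalSpace (TotalSpace ℂ L)]
  [∀ x, AddCommGroup (L x)] [∀ x, Module ℂ (L x)] [∀ x, TopologicalSpace (L x)]
  [FiberBundle ℂ L] [VectorBundle ℂ ℂ L]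

/-- A smooth hermitian metric `|·|` on the line bundle `L`. -/
structure LineMetric (d : ℕ) {X : Type*} [TopologicalSpace X] [ChartedSpace (Cd d) X]
    (L : X → Type*) [TopologicalSpace (TotalSpace ℂ L)]
    [∀ x, AddCommGroup (L x)] [∀ x, Module ℂ (L x)] [∀ x, TopologicalSpace (L x)]
    [FiberBundle ℂ L] [VectorBundle ℂ ℂ L] where
  /-- the length of a vector in the fibre -/
  nrm : ∀ x : X, L x → ℝ
  nrm_smul : ∀ (x : X) (c : ℂ) (v : L x), nrm x (c • v) = ‖c‖ * nrm x v
  nrm_pos : ∀ (x : X) (v : L x), v ≠ 0 → 0 < nrm x v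
  smooth : ∀ x₀ : X, ContMDiffOn 𝓘(ℝ, Cd d) 𝓘(ℝ, ℝ) ∞
    (fun x => nrm x ((trivializationAt ℂ L x₀).symm x (1 : ℂ))) (trivializationAt ℂ L x₀).baseSet

variable {L}

/-- `o = ∏ I_j`, where `s = z^I u` in holomorphic coordinates centred at `x`, with respect to a
holomorphic frame of `L`, with `u` holomorphic and non-vanishing; the product is over the `j` with
`I_j ≠ 0`, i.e. over the local branches `{z_j = 0}` of `{s = 0}` through `x`. -/
def IsOrderProduct (s : ∀ x : X, L x) (x : X) (o : ℕ) : Prop :=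
  ∃ e : OpenPartialHomeomorph X (Cd d), HolChart e ∧ x ∈ e.source ∧ e x = 0 ∧
    e.source ⊆ (trivializationAt ℂ L x).baseSet ∧
    ∃ (I : Fin d → ℕ) (u : Cd d → ℂ),
      DifferentiableOn ℂ u e.target ∧ (∀ w ∈ e.target, u w ≠ 0) ∧
      (∀ y ∈ e.source, (trivializationAt ℂ L x (⟨y, s y⟩ : TotalSpace ℂ L)).2 =
        (∏ j, e y j ^ I j) * u (e y)) ∧
      o = ∏ j with I j ≠ 0, I j

end LineBundle

/-! ### The Aeppli residue on the deepest stratum -/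

section Residue

variable {d : ℕ} {X : Type*} [TopologicalSpace X] [ChartedSpace (Cd d) X]

/-- `∂g/∂z_j`. -/
def dz (j : Fin d) (g : Cd d → ℂ) (w : Cd d) : ℂ :=
  (fderiv ℝ g w (Pi.single j 1) - Complex.I * fderiv ℝ g w (Pi.single j Complex.I)) / 2

/-- `∂g/∂z̄_j`. -/
def dzbar (j : Fin d) (g : Cd d → ℂ) (w : Cd d) : ℂ :=
  (fderiv ℝ g w (Pi.single j 1) + Complex.I * fderiv ℝ g w (Pi.single j Complex.I)) / 2

/-- `∂^{A+B} g / ∂z^A ∂z̄^B` for multi-indices `A` and `B`. -/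
def dzMulti (A B : Fin d → ℕ) (g : Cd d → ℂ) : Cd d → ℂ :=
  (List.finRange d).foldr (fun j h => (dz j)^[A j] ((dzbar j)^[B j] h)) g

/-- `η` is a representative of the Aeppli residue `Res_A(ω)` on the stratum `E = D_κ`, where `κ` is the
largest number of local branches of `D`: there are holomorphic charts `e i` around `E`, in
which `D` is `{z₁ ⋯ z_κ = 0}` and `E` is `{z₁ = ⋯ = z_κ = 0}`, and smooth functions `ρ i` with support
in these charts and sum `1` near `E`, such that
`ω = dz₁ ∧ dz̄₁ ∧ ⋯ ∧ dz_κ ∧ dz̄_κ ∧ ω̃ / (z^J z̄^K)` with `J_j, K_j ≥ 1` for `j ≤ κ` and `ω̃` smooth,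
`ω̃ = ψ dx_{κ+1} ∧ dy_{κ+1} ∧ ⋯ ∧ dx_d ∧ dy_d`, and `η` is on `E` the sum of the forms
`((J-1)! (K-1)!)⁻¹ ∂^{J-1} ∂̄^{K-1}(ρ ω̃)|_E`.
The factor `(-2i)^κ` below is from `dz_j ∧ dz̄_j = -2i dx_j ∧ dy_j`. -/
def IsAeppliResidue (D : Set X) (κ : ℕ) (Ω : FormField d X (2 * d))
    (η : FormField d X (2 * (d - κ))) : Prop :=
  ∃ (n : ℕ) (e : Fin n → OpenPartialHomeomorph X (Cd d)) (ρ : Fin n → X → ℝ)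
    (J K : Fin n → Fin d → ℕ) (ψ : Fin n → Cd d → ℂ)
    (θ : Fin n → FormField d X (2 * (d - κ))),
    (∀ i, HolChart (e i) ∧
      (∀ y ∈ (e i).source, y ∈ D ↔ ∃ j : Fin d, (j : ℕ) < κ ∧ e i y j = 0) ∧
      SmoothFn (d := d) (ρ i) ∧ tsupport (ρ i) ⊆ (e i).source ∧
      (∀ j : Fin d, (j : ℕ) < κ → 1 ≤ J i j ∧ 1 ≤ K i j) ∧
      (∀ j : Fin d, κ ≤ (j : ℕ) → J i j = 0 ∧ K i j = 0) ∧
      ContDiffOn ℝ ∞ (ψ i) (e i).target ∧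
      (∀ w ∈ (e i).target, (e i).symm w ∉ D →
        sliceCoeff (e i) 0 Ω w =
          (-2 * Complex.I) ^ κ * ψ i w /
            ∏ j, (w j ^ J i j * (starRingEnd ℂ (w j)) ^ K i j)) ∧
      (∀ x ∉ (e i).source, θ i x = 0) ∧
      ∀ w, slice d κ w ∈ (e i).target →
        sliceCoeff (e i) κ (θ i) w =
          dzMulti (fun j => J i j - 1) (fun j => K i j - 1)
              (fun z => (ρ i ((e i).symm z) : ℂ) * ψ i z) (slice d κ w) /
            ∏ j, (((J i j - 1).factorial * (K i j - 1).factorial : ℕ) : ℂ)) ∧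
    (∀ᶠ x in 𝓝ˢ (stratum (d := d) D κ), ∑ i, ρ i x = 1) ∧
    ∀ x ∈ stratum (d := d) D κ, η x = ∑ i, θ i x

/-- `∫_{D_κ} o(s)⁻¹ Res_A(ω) = I`, where `o(s)` is the locally constant function on `D_κ` which at `x`
is the product of the vanishing orders of `s` along the branches of `D` through `x`. -/
def HasResidueIntegral {L : X → Type*} [TopologicalSpace (TotalSpace ℂ L)]
    [∀ x, AddCommGroup (L x)] [∀ x, Module ℂ (L x)] [∀ x, TopologicalSpace (L x)]
    [FiberBundle ℂ L] [VectorBundle ℂ ℂ L]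
    (s : ∀ x : X, L x) (D : Set X) (κ : ℕ) (Ω : FormField d X (2 * d)) (I : ℂ) : Prop :=
  ∃ (o : X → ℕ) (η : FormField d X (2 * (d - κ))),
    (∀ x ∈ stratum (d := d) D κ, IsOrderProduct (d := d) s x (o x)) ∧
    IsAeppliResidue D κ Ω η ∧
    HasIntegralOver (stratum (d := d) D κ) κ (fun x => ((o x : ℂ)⁻¹) • η x) I

end Residue

/-- `C 0, C 1, …, C κ` are the coefficients of `λ⁰, λ⁻¹, …, λ^{-κ}` in the Laurent expansion at `0` of
the meromorphic continuation to `ℂ` of `λ ↦ ∫_X |s|^{2λ} Ω`, which has a pole of order at most `κ`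
there: the integral converges for `Re λ` large and is there equal to a function `F`, meromorphic
on `ℂ`, with `F(λ) = C κ λ^{-κ} + ⋯ + C 0 + O(|λ|)`. -/
def HasLaurentCoeffs {d : ℕ} {X : Type*} [TopologicalSpace X] [ChartedSpace (Cd d) X]
    {L : X → Type*} [TopologicalSpace (TotalSpace ℂ L)]
    [∀ x, AddCommGroup (L x)] [∀ x, Module ℂ (L x)] [∀ x, TopologicalSpace (L x)]
    [FiberBundle ℂ L] [VectorBundle ℂ ℂ L]
    (h : LineMetric d L) (s : ∀ x : X, L x) (Ω : FormField d X (2 * d)) (κ : ℕ) (C : ℕ → ℂ) :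
    Prop :=
  ∃ F : ℂ → ℂ, Meromorphic F ∧
    (∃ R : ℝ, ∀ z : ℂ, R < z.re →
      HasIntegralOver (univ : Set X) 0
        (fun x => ((h.nrm x (s x) : ℂ) ^ (2 * z)) • Ω x) (F z)) ∧
    (fun z : ℂ => F z - ∑ r ∈ Finset.range (κ + 1), C r * z ^ (-(r : ℤ)))
      =O[𝓝[≠] 0] (fun z : ℂ => z)

end DivInt

end

/-!
The theorem is local. Near a point with `m` branches of `D` there are coordinates on a polydisc in which
`D = {z₁ ⋯ z_m = 0}`, the section is `z^I u` with `u` free of zeros, its length is `|z^I| e^{a/2}` and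
`α ∧ β̄` has the coefficient `G / (z^J z̄^K)`, where `a` and `G` are smooth
(`DivInt.exists_localDatum`). The factorisation of the section follows from Hurwitz' theorem
(`DivInt.exists_monomial_factor`). After multiplication by a cutoff function, the integral becomes
`∫ |z^I|^{2λ} z^{-J} z̄^{-K} g e^{λ(a - 2φ)}` over `ℂ^d`.

Integration by parts in the kernel gives the meromorphic continuation. To reach the origin, `J_j - 1` and
`K_j - 1` derivatives make the poles simple, and one further derivative `∂/∂z̄_j` in each branch leaves the
integrable kernel `∏ z_j⁻¹` and the factor `λ^{-m}`. The Taylor expansion of `|z^I|^{2λ}` and of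
`e^{λ(a - 2φ)}` then expresses the coefficient of `λ^{-r}` by integrals with `p` factors `log |z^I|²`
and `j` factors `φ`, where `p + j ≤ m - r` (`DivInt.exists_local_expansion`). This shows that it is a
polynomial in `φ` of degree at most `m - r`, and an integral over `X`.

A product of `p ≤ m - r` logarithms involves at most `m - r` of the branches. In `r` of the remaining
branches the kernel is `z_j⁻¹` and the integrand a derivative `∂/∂z̄_j`, so that the Cauchy–Pompeiu formula
evaluates the integral over these variables at `z_j = 0`. Hence the coefficient of `λ^{-r}` is also a sum of
integrals over intersections of `r` branches, with the locally integrable kernels that remain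
(`DivInt.exists_coefInt_expansion`). Intersections of `r` branches are the strata: in a normal crossings
chart the stratum of index `r` consists of the points on at least `r` branches (`DivInt.mem_stratum_iff`).

In the degree `κ - r` in `φ` only charts with `m = κ` matter, and there only the term with neither
logarithms nor factors `a`. The formula of Cauchy and Pompeiu applies to all `κ` branches and leaves the
integral over the deepest stratum of a derivative of order `(J - 1, K - 1)`, which is the Aeppli residue
divided by `∏ I_j` (`DivInt.hasResidueIntegral_of_charts`). This product is independent of the coordinates,
since a change of coordinates permutes the branches (`DivInt.IsFactored.prod_eq`).

Finally, the local contributions are added by means of a partition of unity. The integral of a form over a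
stratum can be computed in any family of charts adapted to the pieces of the form, by the change of
variables formula and the positivity of the real determinants of complex linear maps
(`DivInt.hasIntegralOver_sum`).
-/

noncomputable section
namespace DivInt

/-! ### Wirtinger derivatives -/

section Wirtinger

variable {d : ℕ}

/-- The first order operator `(∂/∂x_j + c i ∂/∂y_j) / 2`, which is `∂/∂z_j` for `c = -1` and
`∂/∂z̄_j` for `c = 1`. -/
def wirt (c : ℂ) (j : Fin d) (g : Cd d → ℂ) (w : Cd d) : ℂ :=
  (fderiv ℝ g w (Pi.single j 1) + c * (Complex.I * fderiv ℝ g w (Pi.single j Complex.I))) / 2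

theorem dz_eq_wirt (j : Fin d) : dz j = wirt (-1) j := by
  funext g w; simp [dz, wirt, sub_eq_add_neg]

theorem dzbar_eq_wirt (j : Fin d) : dzbar j = wirt 1 j := by
  funext g w; simp [dzbar, wirt]

theorem contDiff_fderiv_apply_const {g : Cd d → ℂ} (hg : ContDiff ℝ ∞ g) (v : Cd d) :
    ContDiff ℝ ∞ (fun w => fderiv ℝ g w v) :=
  (hg.fderiv_right (m := ∞) (by simp)).clm_apply contDiff_const

theorem wirt_contDiff (c : ℂ) (j : Fin d) {g : Cd d → ℂ} (hg : ContDiff ℝ ∞ g) :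
    ContDiff ℝ ∞ (wirt c j g) := by
  unfold wirt
  have h1 := contDiff_fderiv_apply_const hg (Pi.single j 1)
  have h2 := contDiff_fderiv_apply_const hg (Pi.single j Complex.I)
  exact (h1.add (contDiff_const.mul (contDiff_const.mul h2))).div_const 2

theorem wirt_congr (c : ℂ) (j : Fin d) {g g' : Cd d → ℂ} {z : Cd d} (h : g =ᶠ[𝓝 z] g') :
    wirt c j g =ᶠ[𝓝 z] wirt c j g' := by
  filter_upwards [h.eventuallyEq_nhds] with y hy
  simp only [wirt, hy.fderiv_eq]

theorem wirt_zero (c : ℂ) (j : Fin d) : wirt c j (0 : Cd d → ℂ) = 0 := by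
  funext w; simp [wirt]

theorem tsupport_wirt (c : ℂ) (j : Fin d) (g : Cd d → ℂ) :
    tsupport (wirt c j g) ⊆ tsupport g := by
  refine closure_minimal (fun z hz => ?_) (isClosed_tsupport g)
  by_contra h
  have h0 : g =ᶠ[𝓝 z] 0 := notMem_tsupport_iff_eventuallyEq.1 h
  exact hz (by simpa [wirt_zero] using (wirt_congr c j h0).eq_of_nhds)

theorem wirt_sum (c : ℂ) (j : Fin d) {ι : Type*} (s : Finset ι) {f : ι → Cd d → ℂ}
    (hf : ∀ i ∈ s, ContDiff ℝ ∞ (f i)) :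
    wirt c j (fun z => ∑ i ∈ s, f i z) = fun z => ∑ i ∈ s, wirt c j (f i) z := by
  funext z
  have h1 : ∀ i ∈ s, DifferentiableAt ℝ (f i) z :=
    fun i hi => ((hf i hi).differentiable (by simp)) z
  simp only [wirt, fderiv_fun_sum h1, _root_.sum_apply, Finset.mul_sum,
    ← Finset.sum_add_distrib, Finset.sum_div]

theorem wirt_mul (c : ℂ) (j : Fin d) {f g : Cd d → ℂ} (hf : ContDiff ℝ ∞ f)
    (hg : ContDiff ℝ ∞ g) :
    wirt c j (fun z => f z * g z) = fun z => wirt c j f z * g z + f z * wirt c j g z := by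
  funext z
  have h1 := (hf.differentiable (by simp)) z
  have h2 := (hg.differentiable (by simp)) z
  simp only [wirt, fderiv_fun_mul h1 h2, _root_.add_apply,
    _root_.smul_apply, smul_eq_mul]
  ring

theorem wirt_const_mul (c : ℂ) (j : Fin d) (a : ℂ) {f : Cd d → ℂ} (hf : ContDiff ℝ ∞ f) :
    wirt c j (fun z => a * f z) = fun z => a * wirt c j f z := by
  funext z
  have h1 := (hf.differentiable (by simp)) z
  simp only [wirt, fderiv_const_mul h1, _root_.smul_apply, smul_eq_mul]
  ring

/-- Post-composition with a function of one complex variable given with its derivative. -/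
theorem wirt_comp (c : ℂ) (j : Fin d) {w : Cd d → ℂ} (hw : ContDiff ℝ ∞ w) {E E' : ℂ → ℂ}
    (hE : ∀ x, HasDerivAt E (E' x) x) :
    wirt c j (fun z => E (w z)) = fun z => E' (w z) * wirt c j w z := by
  funext z
  have h1 := ((hw.differentiable (by simp)) z).hasFDerivAt
  have h2 := ((hE (w z)).hasFDerivAt.restrictScalars ℝ).comp z h1
  have h3 : fderiv ℝ (fun z => E (w z)) z = _ := h2.fderiv
  simp only [wirt, h3, ContinuousLinearMap.comp_apply, ContinuousLinearMap.coe_restrictScalars',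
    ContinuousLinearMap.toSpanSingleton_apply, smul_eq_mul]
  ring

theorem wirt_comm (c c' : ℂ) (j j' : Fin d) {g : Cd d → ℂ} (hg : ContDiff ℝ ∞ g) :
    wirt c j (wirt c' j' g) = wirt c' j' (wirt c j g) := by
  have key : ∀ (z u v : Cd d), fderiv ℝ (fun w => fderiv ℝ g w u) z v =
      fderiv ℝ (fun w => fderiv ℝ g w v) z u := by
    intro z u v
    have hs : IsSymmSndFDerivAt ℝ g z := (hg.contDiffAt (x := z)).isSymmSndFDerivAt
      (by simp only [minSmoothness_of_isRCLikeNormedField]; exact ENat.LEInfty.out)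
    have hd : DifferentiableAt ℝ (fderiv ℝ g) z :=
      ((hg.fderiv_right (m := ∞) (by simp)).differentiable (by simp)) z
    have e : ∀ u v : Cd d, fderiv ℝ (fun w => fderiv ℝ g w u) z v = fderiv ℝ (fderiv ℝ g) z v u := by
      intro u v
      rw [fderiv_clm_apply hd (differentiableAt_const u)]
      simp
    rw [e, e]
    exact hs v u
  have exp : ∀ (c c' : ℂ) (j j' : Fin d) (z : Cd d), wirt c j (wirt c' j' g) z =
      ((fderiv ℝ (fun w => fderiv ℝ g w (Pi.single j' 1)) z (Pi.single j 1)
        + c' * (Complex.I * fderiv ℝ (fun w => fderiv ℝ g w (Pi.single j' Complex.I)) z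
          (Pi.single j 1)))
       + c * (Complex.I * (fderiv ℝ (fun w => fderiv ℝ g w (Pi.single j' 1)) z
            (Pi.single j Complex.I)
        + c' * (Complex.I * fderiv ℝ (fun w => fderiv ℝ g w (Pi.single j' Complex.I)) z
          (Pi.single j Complex.I))))) / 4 := by
    intro c c' j j' z
    have h1 : DifferentiableAt ℝ (fun w => fderiv ℝ g w (Pi.single j' 1)) z :=
      ((contDiff_fderiv_apply_const hg _).differentiable (by simp)) z
    have h2 : DifferentiableAt ℝ (fun w => fderiv ℝ g w (Pi.single j' Complex.I)) z :=
      ((contDiff_fderiv_apply_const hg _).differentiable (by simp)) z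
    have h3 : fderiv ℝ (wirt c' j' g) z =
        (2⁻¹ : ℂ) • (fderiv ℝ (fun w => fderiv ℝ g w (Pi.single j' 1)) z +
          (c' * Complex.I) • fderiv ℝ (fun w => fderiv ℝ g w (Pi.single j' Complex.I)) z) := by
      have : wirt c' j' g = fun w => (2⁻¹ : ℂ) * (fderiv ℝ g w (Pi.single j' 1) +
          (c' * Complex.I) * fderiv ℝ g w (Pi.single j' Complex.I)) := by
        funext w; simp only [wirt]; ring
      rw [this]
      exact ((h1.hasFDerivAt.add (h2.hasFDerivAt.const_mul (c' * Complex.I))).const_mul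
        (2⁻¹ : ℂ)).fderiv
    simp only [wirt] at h3 ⊢
    rw [h3]
    simp only [_root_.smul_apply, _root_.add_apply, smul_eq_mul]
    ring
  funext z
  rw [exp, exp, key z (Pi.single j 1) (Pi.single j' 1),
    key z (Pi.single j Complex.I) (Pi.single j' 1),
    key z (Pi.single j 1) (Pi.single j' Complex.I),
    key z (Pi.single j Complex.I) (Pi.single j' Complex.I)]
  ring

/-- Compositions of the operators `wirt c j`. -/
inductive IsWord : ((Cd d → ℂ) → Cd d → ℂ) → Prop
  | id : IsWord (fun g => g)
  | step (c : ℂ) (j : Fin d) {D : (Cd d → ℂ) → Cd d → ℂ} : IsWord D → IsWord (fun g => wirt c j (D g))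

namespace IsWord

variable {D D' : (Cd d → ℂ) → Cd d → ℂ}

theorem comp (hD : IsWord D) (hD' : IsWord D') : IsWord (fun g => D (D' g)) := by
  induction hD with
  | id => exact hD'
  | step c j _ ih => exact .step c j ih

theorem contDiff (hD : IsWord D) {g : Cd d → ℂ} (hg : ContDiff ℝ ∞ g) : ContDiff ℝ ∞ (D g) := by
  induction hD with
  | id => exact hg
  | step c j _ ih => exact wirt_contDiff c j ih

theorem tsupport_subset (hD : IsWord D) (g : Cd d → ℂ) : tsupport (D g) ⊆ tsupport g := by
  induction hD with
  | id => exact subset_rfl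
  | step c j _ ih => exact (tsupport_wirt c j _).trans ih

theorem hasCompactSupport (hD : IsWord D) {g : Cd d → ℂ} (hg : HasCompactSupport g) :
    HasCompactSupport (D g) := hg.mono' ((subset_tsupport _).trans (hD.tsupport_subset g))

theorem congr (hD : IsWord D) {g g' : Cd d → ℂ} {z : Cd d} (h : g =ᶠ[𝓝 z] g') :
    D g =ᶠ[𝓝 z] D g' := by
  induction hD with
  | id => exact h
  | step c j _ ih => exact wirt_congr c j ih

theorem const_mul (hD : IsWord D) (a : ℂ) {g : Cd d → ℂ} (hg : ContDiff ℝ ∞ g) :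
    D (fun z => a * g z) = fun z => a * D g z := by
  induction hD with
  | id => rfl
  | step c j h ih => simp only [ih, wirt_const_mul c j a (h.contDiff hg)]

theorem sum (hD : IsWord D) {ι : Type*} (s : Finset ι) {f : ι → Cd d → ℂ}
    (hf : ∀ i ∈ s, ContDiff ℝ ∞ (f i)) :
    D (fun z => ∑ i ∈ s, f i z) = fun z => ∑ i ∈ s, D (f i) z := by
  induction hD with
  | id => rfl
  | step c j h ih => simp only [ih, wirt_sum c j s (fun i hi => h.contDiff (hf i hi))]

theorem iterate_dz (j : Fin d) (hD : IsWord D) (n : ℕ) : IsWord (fun g => (dz j)^[n] (D g)) := by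
  induction n with
  | zero => exact hD
  | succ n ih =>
    simp only [Function.iterate_succ_apply', dz_eq_wirt] at ih ⊢
    exact .step _ j ih

theorem iterate_dzbar (j : Fin d) (hD : IsWord D) (n : ℕ) :
    IsWord (fun g => (dzbar j)^[n] (D g)) := by
  induction n with
  | zero => exact hD
  | succ n ih =>
    simp only [Function.iterate_succ_apply', dzbar_eq_wirt] at ih ⊢
    exact .step _ j ih

end IsWord

theorem isWord_dzMulti (A B : Fin d → ℕ) : IsWord (dzMulti A B) := by
  unfold dzMulti
  induction List.finRange d with
  | nil => exact .id
  | cons j l ih => exact (IsWord.iterate_dzbar j ih _).iterate_dz j _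

/-- The iterated operator `∂/∂z̄_{j₁} ⋯ ∂/∂z̄_{j_k}` for a list `j₁, …, j_k` of indices. -/
def dbarL (l : List (Fin d)) (g : Cd d → ℂ) : Cd d → ℂ := l.foldr dzbar g

theorem isWord_dbarL (l : List (Fin d)) : IsWord (dbarL l) := by
  unfold dbarL
  induction l with
  | nil => exact .id
  | cons j l ih =>
    simp only [List.foldr_cons, dzbar_eq_wirt j]
    exact .step _ j ih

theorem dbarL_append (l l' : List (Fin d)) (g : Cd d → ℂ) :
    dbarL (l ++ l') g = dbarL l (dbarL l' g) := by simp [dbarL]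

theorem dbarL_perm {l l' : List (Fin d)} (h : l.Perm l') {g : Cd d → ℂ} (hg : ContDiff ℝ ∞ g) :
    dbarL l g = dbarL l' g := by
  induction h with
  | nil => rfl
  | cons j _ ih => simp only [dbarL, List.foldr_cons] at ih ⊢; rw [ih]
  | swap i j l =>
    simp only [dbarL, List.foldr_cons, dzbar_eq_wirt i, dzbar_eq_wirt j]
    exact wirt_comm _ _ _ _ ((isWord_dbarL l).contDiff hg)
  | trans _ _ h1 h2 => exact h1.trans h2

/-- A word applied to `g e^{tw}`, respectively to `g w^q / q!`, in terms of the same functions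
`G n`. -/
theorem IsWord.exp_expansion {D : (Cd d → ℂ) → Cd d → ℂ} (hD : IsWord D) {g w : Cd d → ℂ}
    (hg : ContDiff ℝ ∞ g) (hw : ContDiff ℝ ∞ w) :
    ∃ (M : ℕ) (G : ℕ → Cd d → ℂ), (∀ n, ContDiff ℝ ∞ (G n)) ∧ (∀ n, tsupport (G n) ⊆ tsupport g) ∧
      (∀ n, M < n → G n = 0) ∧
      (∀ t : ℂ, D (fun z => g z * Complex.exp (t * w z)) =
        fun z => (∑ n ∈ Finset.range (M + 1), t ^ n * G n z) * Complex.exp (t * w z)) ∧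
      ∀ q : ℕ, D (fun z => g z * (w z ^ q / (q.factorial : ℂ))) =
        fun z => ∑ n ∈ Finset.range (q + 1), G n z * (w z ^ (q - n) / ((q - n).factorial : ℂ)) := by
  induction hD with
  | id =>
    refine ⟨0, fun n => if n = 0 then g else 0, ?_, ?_, ?_, ?_, ?_⟩
    · intro n; dsimp only; split_ifs
      · exact hg
      · exact contDiff_const
    · intro n; dsimp only; split_ifs
      · exact subset_rfl
      · rw [show tsupport (0 : Cd d → ℂ) = ∅ from tsupport_eq_empty_iff.2 rfl]; exact empty_subset _
    · intro n hn; simp [hn.ne']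
    · intro t; simp
    · intro q
      funext z
      rw [Finset.sum_range_succ']
      simp
  | step c j h ih =>
    obtain ⟨M, G, hG, hGs, hG0, h1, h2⟩ := ih
    -- the product rule for `G n t^n e^{tw}` gives the same recursion for `G` as the one for `w^q / q!`
    refine ⟨M + 1, fun n z => wirt c j (G n) z + (if n = 0 then 0 else G (n - 1) z) * wirt c j w z,
      ?_, ?_, ?_, ?_, ?_⟩
    · intro n
      refine (wirt_contDiff c j (hG n)).add (ContDiff.mul ?_ (wirt_contDiff c j hw))
      split_ifs
      · exact contDiff_const
      · exact hG _
    · intro n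
      refine closure_minimal (fun z hz => ?_) (isClosed_tsupport g)
      by_contra hzg
      have a1 : wirt c j (G n) z = 0 :=
        image_eq_zero_of_notMem_tsupport fun h' => hzg (hGs n (tsupport_wirt c j _ h'))
      have a2 : G (n - 1) z = 0 := image_eq_zero_of_notMem_tsupport fun h' => hzg (hGs _ h')
      exact hz (by simp [a1, a2])
    · intro n hn
      funext z
      have e1 : G n = 0 := hG0 n (by omega)
      have e2 : G (n - 1) = 0 := hG0 (n - 1) (by omega)
      simp [e1, e2, wirt_zero]
    · intro t
      simp only [h1 t]
      have hE : ∀ x : ℂ, HasDerivAt (fun x => Complex.exp (t * x)) (Complex.exp (t * x) * t) x := by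
        intro x
        simpa using ((hasDerivAt_id x).const_mul t).cexp
      have hs : ContDiff ℝ ∞ (fun z => ∑ n ∈ Finset.range (M + 1), t ^ n * G n z) :=
        ContDiff.sum fun n _ => contDiff_const.mul (hG n)
      have he : ContDiff ℝ ∞ (fun z => Complex.exp (t * w z)) :=
        (contDiff_const.mul hw).cexp
      rw [wirt_mul c j hs he, wirt_comp c j hw hE,
        wirt_sum c j _ (fun n _ => contDiff_const.mul (hG n))]
      funext z
      rw [Finset.sum_range_succ' _ (M + 1)]
      simp only [wirt_const_mul c j _ (hG _), Nat.add_eq_zero_iff, one_ne_zero, and_false,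
        if_false, if_true, Nat.add_sub_cancel, mul_add, Finset.sum_add_distrib]
      have e1 : ∑ n ∈ Finset.range (M + 1), t ^ n * wirt c j (G n) z =
          ∑ n ∈ Finset.range (M + 1), t ^ (n + 1) * wirt c j (G (n + 1)) z +
            t ^ 0 * wirt c j (G 0) z := by
        rw [← Finset.sum_range_succ' (fun n => t ^ n * wirt c j (G n) z),
          Finset.sum_range_succ _ (M + 1), hG0 (M + 1) (by omega)]
        simp [wirt_zero]
      rw [e1]
      have e2 : ∑ n ∈ Finset.range (M + 1), t ^ (n + 1) * (G n z * wirt c j w z) =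
          t * (∑ n ∈ Finset.range (M + 1), t ^ n * G n z) * wirt c j w z := by
        rw [Finset.mul_sum, Finset.sum_mul]
        exact Finset.sum_congr rfl fun n _ => by ring
      rw [e2]
      ring
    · intro q
      simp only [h2 q]
      have hE : ∀ n : ℕ, ∀ x : ℂ, HasDerivAt (fun x : ℂ => x ^ (n + 1) / ((n + 1).factorial : ℂ))
          (x ^ n / (n.factorial : ℂ)) x := by
        intro n x
        have := (hasDerivAt_pow (n + 1) x).div_const ((n + 1).factorial : ℂ)
        refine this.congr_deriv ?_
        have : (n.factorial : ℂ) ≠ 0 := by exact_mod_cast n.factorial_ne_zero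
        have : (n + 1 : ℂ) ≠ 0 := by exact_mod_cast n.succ_ne_zero
        rw [Nat.factorial_succ]; push_cast; field_simp
      have hp : ∀ n : ℕ, ContDiff ℝ ∞ (fun z => w z ^ n / (n.factorial : ℂ)) :=
        fun n => (hw.pow n).div_const _
      rw [wirt_sum c j _ (fun n _ => (hG n).mul (hp (q - n)))]
      funext z
      have e0 : ∀ n, wirt c j (fun z => G n z * (w z ^ (q - n) / ((q - n).factorial : ℂ))) z =
        wirt c j (G n) z * (w z ^ (q - n) / ((q - n).factorial : ℂ)) +
          G n z * wirt c j (fun z => w z ^ (q - n) / ((q - n).factorial : ℂ)) z := by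
        intro n; rw [wirt_mul c j (hG n) (hp (q - n))]
      simp only [e0, Finset.sum_add_distrib, add_mul]
      congr 1
      rw [Finset.sum_range_succ, Finset.sum_range_succ']
      simp only [Nat.sub_self, pow_zero, Nat.factorial_zero, Nat.cast_one, div_one, if_true,
        zero_mul, Nat.add_sub_cancel, Nat.add_eq_zero_iff, one_ne_zero, and_false, if_false]
      have e1 : wirt c j (fun _ => (1 : ℂ)) z = 0 := by simp [wirt]
      rw [e1, mul_zero]
      congr 1
      refine Finset.sum_congr rfl fun n hn => ?_
      have hn' : n < q := Finset.mem_range.1 hn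
      obtain ⟨k, hk⟩ : ∃ k, q - n = k + 1 := ⟨q - n - 1, by omega⟩
      rw [hk, show q - (n + 1) = k by omega, wirt_comp c j hw (hE k)]
      ring

/-- A word applied to a product `g f`, as a linear differential operator in the real valued
function `f`. -/
theorem IsWord.diff_expansion {D : (Cd d → ℂ) → Cd d → ℂ} (hD : IsWord D) {g : Cd d → ℂ}
    (hg : ContDiff ℝ ∞ g) :
    ∃ (ι : Type) (_ : Fintype ι) (m : ι → ℕ) (v : ι → ℕ → Cd d) (b : ι → Cd d → ℂ),
      (∀ i, ContDiff ℝ ∞ (b i)) ∧ (∀ i, tsupport (b i) ⊆ tsupport g) ∧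
      ∀ f : Cd d → ℝ, ContDiff ℝ ∞ f → D (fun z => g z * (f z : ℂ)) =
        fun z => ∑ i, b i z * ((iteratedFDeriv ℝ (m i) f z (fun k => v i k) : ℝ) : ℂ) := by
  induction hD with
  | id =>
    refine ⟨Unit, inferInstance, fun _ => 0, fun _ _ => 0, fun _ => g, fun _ => hg,
      fun _ => subset_rfl, fun f _ => ?_⟩
    funext z; simp
  | step c j h ih =>
    obtain ⟨ι, hι, m, v, b, hb, hbs, hf⟩ := ih
    let cons : Cd d → (ℕ → Cd d) → ℕ → Cd d := fun u v k => Nat.casesOn k u v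
    refine ⟨ι ⊕ (ι ⊕ ι), inferInstance, Sum.elim m (Sum.elim (fun i => m i + 1) (fun i => m i + 1)),
      Sum.elim v (Sum.elim (fun i => cons (Pi.single j 1) (v i))
        (fun i => cons (Pi.single j Complex.I) (v i))),
      Sum.elim (fun i => wirt c j (b i)) (Sum.elim (fun i z => 1 / 2 * b i z)
        (fun i z => c * Complex.I / 2 * b i z)), ?_, ?_, ?_⟩
    · rintro (i | i | i)
      · exact wirt_contDiff c j (hb i)
      · exact contDiff_const.mul (hb i)
      · exact contDiff_const.mul (hb i)
    · rintro (i | i | i)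
      · exact (tsupport_wirt c j _).trans (hbs i)
      · exact (tsupport_mul_subset_right).trans (hbs i)
      · exact (tsupport_mul_subset_right).trans (hbs i)
    · intro f hfs
      simp only [hf f hfs]
      have hi : ∀ n : ℕ, ContDiff ℝ ∞ (iteratedFDeriv ℝ n f) := fun n =>
        hfs.iteratedFDeriv_right (m := ∞) (i := n) (by exact_mod_cast le_top)
      have hT : ∀ (n : ℕ) (u : Fin n → Cd d),
          ContDiff ℝ ∞ (fun z => ((iteratedFDeriv ℝ n f z u : ℝ) : ℂ)) := by
        intro n u
        exact Complex.ofRealCLM.contDiff.comp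
          ((ContinuousMultilinearMap.apply ℝ (fun _ : Fin n => Cd d) ℝ u).contDiff.comp (hi n))
      have hd : ∀ (n : ℕ) (u : Fin n → Cd d) (z e : Cd d),
          fderiv ℝ (fun z => ((iteratedFDeriv ℝ n f z u : ℝ) : ℂ)) z e =
            ((fderiv ℝ (iteratedFDeriv ℝ n f) z e u : ℝ) : ℂ) := by
        intro n u z e
        have h1 := (((hi n).differentiable (by simp)) z).hasFDerivAt
        have h2 := (Complex.ofRealCLM.hasFDerivAt
          (x := iteratedFDeriv ℝ n f z u)).comp z
          ((ContinuousMultilinearMap.apply ℝ (fun _ : Fin n => Cd d) ℝ u).hasFDerivAt.comp z h1)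
        have h3 : fderiv ℝ (fun z => ((iteratedFDeriv ℝ n f z u : ℝ) : ℂ)) z = _ := h2.fderiv
        rw [h3]; rfl
      have hcons : ∀ (n : ℕ) (u : Cd d) (v : ℕ → Cd d) (z : Cd d),
          iteratedFDeriv ℝ (n + 1) f z (fun k => cons u v k) =
            fderiv ℝ (iteratedFDeriv ℝ n f) z u (fun k => v k) := by
        intro n u v z
        rw [iteratedFDeriv_succ_apply_left]
        rfl
      have hstep : ∀ (i : ι) (z : Cd d),
          wirt c j (fun z => b i z * ((iteratedFDeriv ℝ (m i) f z (fun k => v i k) : ℝ) : ℂ)) z =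
          wirt c j (b i) z * ((iteratedFDeriv ℝ (m i) f z (fun k => v i k) : ℝ) : ℂ) +
          (1 / 2 * b i z *
            ((iteratedFDeriv ℝ (m i + 1) f z (fun k => cons (Pi.single j 1) (v i) k) : ℝ) : ℂ) +
          c * Complex.I / 2 * b i z *
            ((iteratedFDeriv ℝ (m i + 1) f z (fun k => cons (Pi.single j Complex.I) (v i) k) : ℝ) :
              ℂ)) := by
        intro i z
        rw [wirt_mul c j (hb i) (hT _ _), hcons, hcons, ← hd, ← hd]
        simp only [wirt]
        ring
      rw [wirt_sum c j _ (fun i _ => (hb i).mul (hT _ _))]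
      funext z
      simp only [Fintype.sum_sum_type, Sum.elim_inl, Sum.elim_inr, ← Finset.sum_add_distrib]
      refine Finset.sum_congr rfl fun i _ => ?_
      exact hstep i z

end Wirtinger

end DivInt
end

noncomputable section
namespace DivInt

/-! ### Integration by parts against monomial kernels -/

section Kernel

/-- The kernel `|z|^{2It} z^{-J} z̄^{-K}` in one variable. -/
def kerOne (I : ℕ) (J K : ℤ) (t z : ℂ) : ℂ :=
  ((‖z‖ : ℝ) : ℂ) ^ (2 * (I : ℂ) * t) * z ^ (-J) * (starRingEnd ℂ z) ^ (-K)

theorem kerOne_trivial (t z : ℂ) : kerOne 0 0 0 t z = 1 := by simp [kerOne]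

theorem kerOne_zero {I : ℕ} (hI : 1 ≤ I) (J K : ℤ) {t : ℂ} (ht : 0 < t.re) :
    kerOne I J K t 0 = 0 := by
  have h1 : (I : ℂ) ≠ 0 := by exact_mod_cast (by omega : I ≠ 0)
  have h2 : t ≠ 0 := by rintro rfl; simp at ht
  simp [kerOne, Complex.zero_cpow (show (2 * (I : ℂ) * t) ≠ 0 by simp [h1, h2])]

theorem norm_kerOne (I : ℕ) (J K : ℤ) (t : ℂ) {z : ℂ} (hz : z ≠ 0) :
    ‖kerOne I J K t z‖ = ‖z‖ ^ (2 * I * t.re - J - K) := by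
  have h : 0 < ‖z‖ := norm_pos_iff.2 hz
  rw [kerOne, norm_mul, norm_mul, Complex.norm_cpow_eq_rpow_re_of_pos h, norm_zpow, norm_zpow,
    RCLike.norm_conj, ← Real.rpow_intCast, ← Real.rpow_intCast, ← Real.rpow_add h,
    ← Real.rpow_add h]
  congr 1
  simp
  ring

theorem kerOne_hasFDerivAt_of_ne (I : ℕ) (J K : ℤ) (t : ℂ) {z : ℂ} (hz : z ≠ 0) :
    HasFDerivAt (kerOne I J K t)
      (((I * t - J) * kerOne I (J + 1) K t z) • (ContinuousLinearMap.id ℝ ℂ) +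
        ((I * t - K) * kerOne I J (K + 1) t z) • (Complex.conjCLE : ℂ →L[ℝ] ℂ)) z := by
  have hc : starRingEnd ℂ z ≠ 0 := by simpa using hz
  have hpow : ∀ y : ℂ, y ≠ 0 → ((‖y‖ : ℝ) : ℂ) ^ (2 * (I : ℂ) * t) =
      (y * starRingEnd ℂ y) ^ ((I : ℂ) * t) := by
    intro y hy
    have hy' : (0 : ℝ) < ‖y‖ := norm_pos_iff.2 hy
    rw [Complex.mul_conj', Complex.cpow_def_of_ne_zero (by exact_mod_cast hy'.ne'),
      Complex.cpow_def_of_ne_zero (by exact_mod_cast (pow_pos hy' 2).ne'),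
      ← Complex.ofReal_pow, ← Complex.ofReal_log hy'.le, ← Complex.ofReal_log (by positivity),
      Real.log_pow]
    congr 1
    push_cast
    ring
  have heq : kerOne I J K t =ᶠ[𝓝 z] fun y => (y * starRingEnd ℂ y) ^ ((I : ℂ) * t) * y ^ (-J) *
      (starRingEnd ℂ y) ^ (-K) := by
    filter_upwards [isOpen_ne.mem_nhds hz] with y hy
    rw [kerOne, hpow y hy]
  have hid : HasFDerivAt (fun y : ℂ => y) (ContinuousLinearMap.id ℝ ℂ) z := hasFDerivAt_id z
  have hcj : HasFDerivAt (fun y : ℂ => starRingEnd ℂ y) (Complex.conjCLE : ℂ →L[ℝ] ℂ) z :=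
    Complex.conjCLE.hasFDerivAt
  have hn0 : z * starRingEnd ℂ z ≠ 0 := mul_ne_zero hz hc
  have hslit : z * starRingEnd ℂ z ∈ Complex.slitPlane := by
    rw [Complex.mul_conj']
    left
    have : (0 : ℝ) < ‖z‖ := norm_pos_iff.2 hz
    rw [← Complex.ofReal_pow, Complex.ofReal_re]
    positivity
  have d1 := (((hasDerivAt_id (z * starRingEnd ℂ z)).cpow_const (c := (I : ℂ) * t)
    hslit).hasFDerivAt.restrictScalars ℝ).comp z (hid.mul hcj)
  have d2 := ((hasDerivAt_zpow (-J) z (Or.inl hz)).hasFDerivAt.restrictScalars ℝ)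
  have d3 := ((hasDerivAt_zpow (-K) (starRingEnd ℂ z) (Or.inl hc)).hasFDerivAt.restrictScalars
    ℝ).comp z hcj
  refine ((d1.mul d2).mul d3).congr_of_eventuallyEq heq |>.congr_fderiv ?_
  ext v
  simp only [kerOne, hpow z hz, Function.comp_apply, neg_add, id_eq]
  simp only [zpow_add₀ hz, zpow_add₀ hc, zpow_sub_one₀ hz, zpow_sub_one₀ hc, zpow_neg_one,
    Complex.cpow_sub _ _ hn0, Complex.cpow_one]
  simp
  field_simp
  ring

theorem kerOne_bound {I : ℕ} (hI : 1 ≤ I) (J K : ℤ) {t : ℂ} (ht : 0 < t.re)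
    (hs : 0 < 2 * I * t.re - J - K) (z : ℂ) :
    ‖kerOne I J K t z‖ ≤ ‖z‖ ^ (2 * I * t.re - J - K) := by
  rcases eq_or_ne z 0 with rfl | hz
  · rw [kerOne_zero hI J K ht]; simp [Real.zero_rpow hs.ne']
  · exact (norm_kerOne I J K t hz).le

theorem kerOne_hasFDerivAt {I : ℕ} (hI : 1 ≤ I) (J K : ℤ) {t : ℂ} (ht : 0 < t.re)
    (hs : 1 < 2 * I * t.re - J - K) (z : ℂ) :
    HasFDerivAt (kerOne I J K t)
      (((I * t - J) * kerOne I (J + 1) K t z) • (ContinuousLinearMap.id ℝ ℂ) +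
        ((I * t - K) * kerOne I J (K + 1) t z) • (Complex.conjCLE : ℂ →L[ℝ] ℂ)) z := by
  rcases eq_or_ne z 0 with rfl | hz
  · rw [kerOne_zero hI _ _ ht, kerOne_zero hI _ _ ht]
    refine HasFDerivAt.congr_fderiv (f' := 0) ?_ (by ext v; simp)
    refine hasFDerivAt_iff_isLittleO_nhds_zero.2 ?_
    simp only [zero_add, kerOne_zero hI _ _ ht, sub_zero, _root_.zero_apply]
    refine (Asymptotics.IsBigO.of_bound 1 ?_).trans_isLittleO (g := fun h : ℂ =>
      ‖h‖ ^ (2 * I * t.re - J - K)) ?_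
    · filter_upwards with h
      rw [one_mul, Real.norm_of_nonneg (by positivity)]
      exact kerOne_bound hI J K ht (by linarith) h
    · rw [Asymptotics.isLittleO_iff]
      intro c hc
      have hlim : Tendsto (fun h : ℂ => ‖h‖ ^ (2 * I * t.re - J - K - 1)) (𝓝 0) (𝓝 0) := by
        have h1 : Tendsto (fun h : ℂ => ‖h‖) (𝓝 0) (𝓝 0) := by simpa using (continuous_norm.tendsto (0:ℂ))
        have h2 := (Real.continuousAt_rpow_const 0 (2 * I * t.re - J - K - 1)
          (Or.inr (by linarith))).tendsto.comp h1
        simpa [Real.zero_rpow (show 2 * I * t.re - J - K - 1 ≠ 0 by linarith),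
          Function.comp_def] using h2
      filter_upwards [hlim.eventually_le_const hc] with h hh
      rw [Real.norm_of_nonneg (by positivity)]
      rcases eq_or_ne h 0 with rfl | h0
      · simp [Real.zero_rpow (show 2 * I * t.re - J - K ≠ 0 by linarith)]
      · have hp : 0 < ‖h‖ := norm_pos_iff.2 h0
        have : ‖h‖ ^ (2 * I * t.re - J - K) = ‖h‖ ^ (2 * I * t.re - J - K - 1) * ‖h‖ := by
          rw [← Real.rpow_add_one hp.ne']; congr 1; ring
        rw [this]
        gcongr
  · exact kerOne_hasFDerivAt_of_ne I J K t hz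

theorem continuous_kerOne {I : ℕ} (hI : 1 ≤ I) (J K : ℤ) {t : ℂ} (ht : 0 < t.re)
    (hs : 0 < 2 * I * t.re - J - K) : Continuous (kerOne I J K t) := by
  rw [continuous_iff_continuousAt]
  intro z
  rcases eq_or_ne z 0 with rfl | hz
  · rw [ContinuousAt, kerOne_zero hI _ _ ht]
    refine squeeze_zero_norm (a := fun h : ℂ => ‖h‖ ^ (2 * I * t.re - J - K))
      (fun h => kerOne_bound hI J K ht hs h) ?_
    have h1 : Tendsto (fun h : ℂ => ‖h‖) (𝓝 0) (𝓝 0) := by simpa using (continuous_norm.tendsto (0:ℂ))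
    have h2 := (Real.continuousAt_rpow_const 0 (2 * I * t.re - J - K)
      (Or.inr hs.le)).tendsto.comp h1
    simpa [Real.zero_rpow hs.ne', Function.comp_def] using h2
  · exact (kerOne_hasFDerivAt_of_ne I J K t hz).continuousAt

variable {d : ℕ}

/-- The kernel `∏ |z_j|^{2 I_j t} z_j^{-J_j} z̄_j^{-K_j}`. -/
def ker (I : Fin d → ℕ) (J K : Fin d → ℤ) (t : ℂ) (z : Cd d) : ℂ :=
  ∏ j, kerOne (I j) (J j) (K j) t (z j)

/-- Conditions under which the kernel is continuous; the variables with `I_j = 0` do not occur. -/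
def Adm (I : Fin d → ℕ) (J K : Fin d → ℤ) (t : ℂ) : Prop :=
  0 < t.re ∧ ∀ j, (I j = 0 ∧ J j = 0 ∧ K j = 0) ∨
    (1 ≤ I j ∧ 0 < 2 * I j * t.re - J j - K j)

theorem Adm.continuous {I : Fin d → ℕ} {J K : Fin d → ℤ} {t : ℂ} (h : Adm I J K t) :
    Continuous (ker I J K t) := by
  refine continuous_finsetProd _ fun j _ => ?_
  rcases h.2 j with ⟨h1, h2, h3⟩ | ⟨h1, h2⟩
  · simp only [h1, h2, h3, kerOne_trivial]; exact continuous_const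
  · exact (continuous_kerOne h1 _ _ h.1 h2).comp (continuous_apply j)

theorem Adm.integrable {I : Fin d → ℕ} {J K : Fin d → ℤ} {t : ℂ} (h : Adm I J K t)
    {g : Cd d → ℂ} (hg : Continuous g) (hgs : HasCompactSupport g) :
    Integrable (fun z => ker I J K t z * g z) volume :=
  (h.continuous.mul hg).integrable_of_hasCompactSupport hgs.mul_left

theorem Adm.mono {I : Fin d → ℕ} {J K J' K' : Fin d → ℤ} {t : ℂ} (h : Adm I J K t)
    (hJ : ∀ j, J' j ≤ J j) (hK : ∀ j, K' j ≤ K j)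
    (h0 : ∀ j, I j = 0 → J' j = J j ∧ K' j = K j) : Adm I J' K' t := by
  refine ⟨h.1, fun j => ?_⟩
  rcases h.2 j with ⟨h1, h2, h3⟩ | ⟨h1, h2⟩
  · left; exact ⟨h1, by rw [(h0 j h1).1, h2], by rw [(h0 j h1).2, h3]⟩
  · right
    have a : (J' j : ℝ) ≤ J j := by exact_mod_cast hJ j
    have b : (K' j : ℝ) ≤ K j := by exact_mod_cast hK j
    exact ⟨h1, by linarith⟩

/-- The derivatives of the kernel are kernels with one exponent raised by one, as long as the kernel
vanishes to order greater than one along `{z_j = 0}`. -/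
theorem ker_hasLineDerivAt {I : Fin d → ℕ} {J K : Fin d → ℤ} {t : ℂ} (ht : 0 < t.re) {j : Fin d}
    (hI : 1 ≤ I j) (hs : 1 < 2 * I j * t.re - J j - K j) (c : ℂ) (z : Cd d) :
    HasLineDerivAt ℝ (ker I J K t)
      ((I j * t - J j) * ker I (J + Pi.single j 1) K t z * c +
        (I j * t - K j) * ker I J (K + Pi.single j 1) t z * starRingEnd ℂ c) z (Pi.single j c) := by
  have split : ∀ (J K : Fin d → ℤ) (y : Cd d), ker I J K t y =
      kerOne (I j) (J j) (K j) t (y j) *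
        ∏ i ∈ Finset.univ.erase j, kerOne (I i) (J i) (K i) t (y i) := by
    intro J K y
    exact (Finset.mul_prod_erase Finset.univ (fun i => kerOne (I i) (J i) (K i) t (y i))
      (Finset.mem_univ j)).symm
  have h1 := kerOne_hasFDerivAt hI (J j) (K j) ht hs (z j)
  have h2 : HasDerivAt (fun s : ℝ => z j + s • c) c 0 := by
    simpa using ((hasDerivAt_id (0 : ℝ)).smul_const c).const_add (z j)
  have h3 := (show HasFDerivAt (kerOne (I j) (J j) (K j) t) _ (z j + (0 : ℝ) • c) by
    simpa using h1).comp_hasDerivAt (0 : ℝ) h2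
  have h4 := h3.mul_const (∏ i ∈ Finset.univ.erase j, kerOne (I i) (J i) (K i) t (z i))
  rw [HasLineDerivAt]
  have hfun : (fun s : ℝ => ker I J K t (z + s • (Pi.single j c : Cd d))) = fun s : ℝ =>
      (kerOne (I j) (J j) (K j) t ∘ fun s : ℝ => z j + s • c) s *
        ∏ i ∈ Finset.univ.erase j, kerOne (I i) (J i) (K i) t (z i) := by
    funext s
    rw [split]
    congr 1
    · simp
    · refine Finset.prod_congr rfl fun i hi => ?_
      simp [Pi.single_eq_of_ne (Finset.ne_of_mem_erase hi)]
  rw [hfun]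
  refine h4.congr_deriv ?_
  have e1 : ∏ i ∈ Finset.univ.erase j,
      kerOne (I i) ((J + Pi.single j 1 : Fin d → ℤ) i) (K i) t (z i) =
      ∏ i ∈ Finset.univ.erase j, kerOne (I i) (J i) (K i) t (z i) :=
    Finset.prod_congr rfl fun i hi => by
      simp [Pi.single_eq_of_ne (Finset.ne_of_mem_erase hi)]
  have e2 : ∏ i ∈ Finset.univ.erase j,
      kerOne (I i) (J i) ((K + Pi.single j 1 : Fin d → ℤ) i) t (z i) =
      ∏ i ∈ Finset.univ.erase j, kerOne (I i) (J i) (K i) t (z i) :=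
    Finset.prod_congr rfl fun i hi => by
      simp [Pi.single_eq_of_ne (Finset.ne_of_mem_erase hi)]
  rw [split (J + Pi.single j 1), split J (K + Pi.single j 1), e1, e2]
  simp
  ring

/-- Integration by parts against the kernel in the variable `z_j`, simultaneously for the two Wirtinger
derivatives `ε = -1` and `ε = 1`. -/
theorem ker_wirt {I : Fin d → ℕ} {J K : Fin d → ℤ} {t : ℂ} {j : Fin d} (hI : 1 ≤ I j)
    (hJ : Adm I (J + Pi.single j 1) K t) (ε : ℂ) {g : Cd d → ℂ} (hg : ContDiff ℝ ∞ g)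
    (hgs : HasCompactSupport g) :
    ∫ z, ker I J K t z * wirt ε j g z =
      -((1 - ε) / 2 * ((I j * t - J j) * ∫ z, ker I (J + Pi.single j 1) K t z * g z) +
        (1 + ε) / 2 * ((I j * t - K j) * ∫ z, ker I J (K + Pi.single j 1) t z * g z)) := by
  have hs : 1 < 2 * I j * t.re - J j - K j := by
    rcases hJ.2 j with ⟨h1, _⟩ | ⟨_, h2⟩
    · omega
    · simp at h2; linarith
  have hK : Adm I J (K + Pi.single j 1) t := by
    refine ⟨hJ.1, fun i => ?_⟩
    rcases eq_or_ne i j with rfl | hij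
    · right
      simp
      exact ⟨hI, by linarith⟩
    · have := hJ.2 i
      simpa [Pi.single_eq_of_ne hij] using this
  have h0 : Adm I J K t := hJ.mono (fun i => by simp [Pi.single_apply]; split_ifs <;> simp)
    (fun _ => le_rfl) (fun i hi => ⟨by
      have : i ≠ j := by rintro rfl; omega
      simp [Pi.single_eq_of_ne this], rfl⟩)
  have hgc := hg.continuous
  have hd : ∀ c : ℂ, Continuous (fun z => fderiv ℝ g z (Pi.single j c)) :=
    fun c => (contDiff_fderiv_apply_const hg _).continuous
  have hdc : ∀ c : ℂ, HasCompactSupport (fun z => fderiv ℝ g z (Pi.single j c)) :=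
    fun c => hgs.fderiv_apply ℝ _
  have iP := hJ.integrable hgc hgs
  have iQ := hK.integrable hgc hgs
  have parts : ∀ c : ℂ, ∫ z, ker I J K t z * fderiv ℝ g z (Pi.single j c) =
      -(c * ((I j * t - J j) * ∫ z, ker I (J + Pi.single j 1) K t z * g z) +
        starRingEnd ℂ c * ((I j * t - K j) * ∫ z, ker I J (K + Pi.single j 1) t z * g z)) := by
    intro c
    have hform : ∀ z, ((I j * t - J j) * ker I (J + Pi.single j 1) K t z * c +
        (I j * t - K j) * ker I J (K + Pi.single j 1) t z * starRingEnd ℂ c) * g z =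
        (c * (I j * t - J j)) * (ker I (J + Pi.single j 1) K t z * g z) +
        (starRingEnd ℂ c * (I j * t - K j)) * (ker I J (K + Pi.single j 1) t z * g z) := by
      intro z; ring
    have := integral_bilinear_hasLineDerivAt_right_eq_neg_left_of_integrable
      (μ := (volume : Measure (Cd d))) (B := ContinuousLinearMap.mul ℝ ℂ)
      (f := ker I J K t) (g := g) (v := (Pi.single j c : Cd d))
      (f' := fun z => (I j * t - J j) * ker I (J + Pi.single j 1) K t z * c +
        (I j * t - K j) * ker I J (K + Pi.single j 1) t z * starRingEnd ℂ c)
      (g' := fun z => fderiv ℝ g z (Pi.single j c)) ?_ ?_ ?_ ?_ ?_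
    · simp only [ContinuousLinearMap.mul_apply', hform] at this
      rw [this, integral_add (iP.const_mul _) (iQ.const_mul _), integral_const_mul,
        integral_const_mul]
      ring
    · simp only [ContinuousLinearMap.mul_apply', hform]
      exact (iP.const_mul _).add (iQ.const_mul _)
    · exact h0.integrable (hd c) (hdc c)
    · exact h0.integrable hgc hgs
    · exact fun z _ => ker_hasLineDerivAt hJ.1 hI hs c z
    · exact fun z _ => ((hg.differentiable (by simp)) z).hasFDerivAt.hasLineDerivAt _
  have hw : ∀ z, ker I J K t z * wirt ε j g z =
      1 / 2 * (ker I J K t z * fderiv ℝ g z (Pi.single j 1)) +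
      ε * Complex.I / 2 * (ker I J K t z * fderiv ℝ g z (Pi.single j Complex.I)) := by
    intro z; simp only [wirt]; ring
  simp only [hw]
  rw [integral_add ((h0.integrable (hd 1) (hdc 1)).const_mul _)
    ((h0.integrable (hd _) (hdc _)).const_mul _), integral_const_mul, integral_const_mul,
    parts, parts]
  simp only [map_one, Complex.conj_I]
  ring_nf
  simp only [Complex.I_sq]
  ring

/-- The factor produced by `n` integrations by parts in one variable. -/
def polOne (I : ℕ) (J : ℤ) (n : ℕ) (t : ℂ) : ℂ := ∏ a ∈ Finset.range n, (J - a - 1 - I * t)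

theorem polOne_succ (I : ℕ) (J : ℤ) (n : ℕ) (t : ℂ) :
    polOne I J (n + 1) t = polOne I J n t * ((J - n : ℤ) - 1 - I * t) := by
  rw [polOne, Finset.prod_range_succ, polOne]; push_cast; rfl

theorem ker_dz_iterate {I : Fin d → ℕ} {J K : Fin d → ℤ} {t : ℂ} {j : Fin d} {g : Cd d → ℂ}
    (hg : ContDiff ℝ ∞ g) (hgs : HasCompactSupport g) (h : Adm I J K t) (n : ℕ)
    (hn : I j = 0 → n = 0) :
    polOne (I j) (J j) n t * ∫ z, ker I J K t z * g z =
      ∫ z, ker I (J - Pi.single j (n : ℤ)) K t z * (dz j)^[n] g z := by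
  induction n with
  | zero => simp [polOne]
  | succ n ih =>
    have hI : 1 ≤ I j := by by_contra h'; have := hn (by omega); omega
    rw [polOne_succ, mul_right_comm, ih (fun h' => by omega)]
    have e : J - Pi.single j (n : ℤ) = (J - Pi.single j ((n + 1 : ℕ) : ℤ)) + Pi.single j 1 := by
      funext i; by_cases hij : i = j
      · subst hij; simp; omega
      · simp [Pi.single_eq_of_ne hij]
    have hA : Adm I (J - Pi.single j (n : ℤ)) K t := h.mono
      (fun i => by simp [Pi.single_apply]; split_ifs <;> simp) (fun _ => le_rfl)
      (fun i hi => ⟨by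
        have : i ≠ j := by rintro rfl; omega
        simp [Pi.single_eq_of_ne this], rfl⟩)
    have hw := (IsWord.iterate_dz j (.id (d := d)) n)
    have := ker_wirt hI (e ▸ hA) (-1) (hw.contDiff hg) (hw.hasCompactSupport hgs)
    rw [← dz_eq_wirt] at this
    rw [Function.iterate_succ_apply', this, ← e]
    simp
    ring

theorem ker_dzbar_iterate {I : Fin d → ℕ} {J K : Fin d → ℤ} {t : ℂ} {j : Fin d} {g : Cd d → ℂ}
    (hg : ContDiff ℝ ∞ g) (hgs : HasCompactSupport g) (h : Adm I J K t) (n : ℕ)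
    (hn : I j = 0 → n = 0) :
    polOne (I j) (K j) n t * ∫ z, ker I J K t z * g z =
      ∫ z, ker I J (K - Pi.single j (n : ℤ)) t z * (dzbar j)^[n] g z := by
  induction n with
  | zero => simp [polOne]
  | succ n ih =>
    have hI : 1 ≤ I j := by by_contra h'; have := hn (by omega); omega
    rw [polOne_succ, mul_right_comm, ih (fun h' => by omega)]
    have e : K - Pi.single j (n : ℤ) = (K - Pi.single j ((n + 1 : ℕ) : ℤ)) + Pi.single j 1 := by
      funext i; by_cases hij : i = j
      · subst hij; simp; omega
      · simp [Pi.single_eq_of_ne hij]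
    have hs : 0 < 2 * I j * t.re - J j - K j := by
      rcases h.2 j with ⟨h1, _⟩ | ⟨_, h2⟩
      · omega
      · exact h2
    have hA : Adm I (J + Pi.single j 1) (K - Pi.single j ((n + 1 : ℕ) : ℤ)) t := by
      refine ⟨h.1, fun i => ?_⟩
      rcases eq_or_ne i j with rfl | hij
      · right; refine ⟨hI, ?_⟩; simp
        have : (0 : ℝ) ≤ n := by positivity
        linarith
      · simpa [Pi.single_eq_of_ne hij] using h.2 i
    have hw := (IsWord.iterate_dzbar j (.id (d := d)) n)
    have := ker_wirt hI hA 1 (hw.contDiff hg) (hw.hasCompactSupport hgs)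
    rw [← dzbar_eq_wirt] at this
    rw [Function.iterate_succ_apply', this, ← e]
    simp
    ring

/-- The factor produced by integration by parts with `dzMulti A B`. -/
def pol (I : Fin d → ℕ) (J K : Fin d → ℤ) (A B : Fin d → ℕ) (t : ℂ) : ℂ :=
  ∏ j, (polOne (I j) (J j) (A j) t * polOne (I j) (K j) (B j) t)

/-- Integration by parts lowers the orders `(J, K)` of the poles to `(J - A, K - B)`, at the price of
the polynomial factor `pol` in the parameter. -/
theorem ker_dzMulti {I : Fin d → ℕ} {J K : Fin d → ℤ} {A B : Fin d → ℕ} {t : ℂ} {g : Cd d → ℂ}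
    (hg : ContDiff ℝ ∞ g) (hgs : HasCompactSupport g) (h : Adm I J K t)
    (h0 : ∀ j, I j = 0 → A j = 0 ∧ B j = 0) :
    pol I J K A B t * ∫ z, ker I J K t z * g z =
      ∫ z, ker I (fun j => J j - A j) (fun j => K j - B j) t z * dzMulti A B g z := by
  have key : ∀ l : List (Fin d), l.Nodup →
      IsWord (fun g => l.foldr (fun j h => (dz j)^[A j] ((dzbar j)^[B j] h)) g) ∧
      (l.map fun j => polOne (I j) (J j) (A j) t * polOne (I j) (K j) (B j) t).prod *
        ∫ z, ker I J K t z * g z =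
      ∫ z, ker I (fun j => J j - if j ∈ l then (A j : ℤ) else 0)
        (fun j => K j - if j ∈ l then (B j : ℤ) else 0) t z *
        l.foldr (fun j h => (dz j)^[A j] ((dzbar j)^[B j] h)) g z := by
    intro l
    induction l with
    | nil => intro _; exact ⟨.id, by simp⟩
    | cons j l ih =>
      intro hl
      obtain ⟨hjl, hl⟩ := List.nodup_cons.1 hl
      obtain ⟨hw, ih⟩ := ih hl
      have hw1 := IsWord.iterate_dzbar j hw (B j)
      refine ⟨IsWord.iterate_dz j hw1 (A j), ?_⟩
      set J' : Fin d → ℤ := fun j => J j - if j ∈ l then (A j : ℤ) else 0 with hJ'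
      set K' : Fin d → ℤ := fun j => K j - if j ∈ l then (B j : ℤ) else 0 with hK'
      have hJj : J' j = J j := by simp [hJ', hjl]
      have hKj : K' j = K j := by simp [hK', hjl]
      have hA1 : Adm I J' K' t := h.mono
        (fun i => by simp only [hJ']; split_ifs <;> simp)
        (fun i => by simp only [hK']; split_ifs <;> simp)
        (fun i hi => by simp [hJ', hK', h0 i hi])
      have hA2 : Adm I J' (K' - Pi.single j (B j : ℤ)) t := hA1.mono (fun _ => le_rfl)
        (fun i => by simp [Pi.single_apply]; split_ifs <;> simp)
        (fun i hi => ⟨rfl, by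
          rcases eq_or_ne i j with rfl | hij
          · simp [(h0 i hi).2]
          · simp [Pi.single_eq_of_ne hij]⟩)
      rw [List.map_cons, List.prod_cons, mul_assoc, ih, mul_assoc, ← hKj,
        ker_dzbar_iterate (hw.contDiff hg) (hw.hasCompactSupport hgs) hA1 (B j)
          (fun hi => (h0 j hi).2), ← hJj,
        ker_dz_iterate (hw1.contDiff hg) (hw1.hasCompactSupport hgs) hA2 (A j)
          (fun hi => (h0 j hi).1), List.foldr_cons]
      congr 3 with z
      congr 2
      · funext i
        by_cases hij : i = j
        · subst hij; simp [hJ', hjl]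
        · simp [hJ', hij]
      · funext i
        by_cases hij : i = j
        · subst hij; simp [hK', hjl]
        · simp [hK', hij]
  have := (key (List.finRange d) (List.nodup_finRange d)).2
  simp only [List.mem_finRange, if_true] at this
  rw [pol, ← List.prod_ofFn, List.ofFn_eq_map, this]
  rfl

end Kernel

end DivInt
end

noncomputable section
namespace DivInt

/-! ### Taylor expansions -/

section Taylor

/-- `∑ c n z^n` converges to `f z` for all `z` near `0`. -/
def HasTaylor (f : ℂ → ℂ) (c : ℕ → ℂ) : Prop := ∀ᶠ z in 𝓝 (0 : ℂ), HasSum (fun n => c n * z ^ n) (f z)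

theorem HasTaylor.hasFPowerSeriesAt {f : ℂ → ℂ} {c : ℕ → ℂ} (h : HasTaylor f c) :
    HasFPowerSeriesAt f (FormalMultilinearSeries.ofScalars ℂ c) 0 := by
  rw [hasFPowerSeriesAt_iff]
  filter_upwards [h] with z hz
  simpa [FormalMultilinearSeries.coeff_ofScalars, mul_comm] using hz

theorem exists_hasTaylor {f : ℂ → ℂ} (h : AnalyticAt ℂ f 0) :
    ∃ c, HasTaylor f c ∧ c 0 = f 0 := by
  obtain ⟨p, hp⟩ := h
  refine ⟨fun n => p.coeff n, ?_, ?_⟩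
  · have := hasFPowerSeriesAt_iff.1 hp
    filter_upwards [this] with z hz
    simpa [mul_comm] using hz
  · exact hp.coeff_zero 1

theorem HasTaylor.isBigO {f : ℂ → ℂ} {c : ℕ → ℂ} (h : HasTaylor f c) (N : ℕ) :
    (fun z => f z - ∑ n ∈ Finset.range N, c n * z ^ n) =O[𝓝 0] fun z => z ^ N := by
  have := h.hasFPowerSeriesAt.isBigO_sub_partialSum_pow N
  simp only [zero_add, FormalMultilinearSeries.partialSum,
    FormalMultilinearSeries.ofScalars_apply_eq, smul_eq_mul] at this
  refine this.trans (Asymptotics.IsBigO.of_bound 1 ?_)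
  filter_upwards with z
  simp

theorem HasTaylor.mul {f g : ℂ → ℂ} {a b : ℕ → ℂ} (hf : HasTaylor f a) (hg : HasTaylor g b) :
    HasTaylor (fun z => f z * g z)
      (fun N => ∑ x ∈ Finset.HasAntidiagonal.antidiagonal N, a x.1 * b x.2) := by
  filter_upwards [hf, hg] with z h1 h2
  have n1 := h1.summable.norm
  have n2 := h2.summable.norm
  have hs := summable_norm_sum_mul_antidiagonal_of_summable_norm n1 n2
  have ht := tsum_mul_tsum_eq_tsum_sum_antidiagonal_of_summable_norm n1 n2
  rw [h1.tsum_eq, h2.tsum_eq] at ht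
  rw [ht]
  convert! hs.of_norm.hasSum using 2 with N
  rw [Finset.sum_mul]
  refine Finset.sum_congr rfl fun x hx => ?_
  rw [← Finset.HasAntidiagonal.mem_antidiagonal.1 hx, pow_add]
  ring

theorem HasTaylor.sum {ι : Type*} (s : Finset ι) {f : ι → ℂ → ℂ} {c : ι → ℕ → ℂ}
    (h : ∀ i ∈ s, HasTaylor (f i) (c i)) :
    HasTaylor (fun z => ∑ i ∈ s, f i z) (fun N => ∑ i ∈ s, c i N) := by
  have := (Filter.eventually_all_finset s).2 h
  filter_upwards [this] with z hz
  simp only [Finset.sum_mul]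
  exact hasSum_sum hz

theorem HasTaylor.pow_mul {f : ℂ → ℂ} {c : ℕ → ℂ} (h : HasTaylor f c) (n : ℕ) :
    HasTaylor (fun z => z ^ n * f z) (fun N => if n ≤ N then c (N - n) else 0) := by
  filter_upwards [h] with z hz
  have h1 := hz.mul_left (z ^ n)
  have h2 : Function.Injective (fun k : ℕ => k + n) := add_left_injective n
  rw [← h2.hasSum_iff]
  · convert! h1 using 2 with k
    simp [pow_add]; ring
  · intro N hN
    have : ¬ n ≤ N := fun h => hN ⟨N - n, by simp [h]⟩
    simp [this]

theorem HasTaylor.congr {f : ℂ → ℂ} {c c' : ℕ → ℂ} (h : HasTaylor f c) (hc : ∀ n, c n = c' n) :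
    HasTaylor f c' := by rwa [show c' = c from (funext hc).symm]

end Taylor

/-! ### Exponential integrals -/

section ExpIntegral

variable {α : Type*} [MeasurableSpace α] {μ : Measure α}

theorem integrable_mul_pow_of_exp {h : α → ℂ} {L : α → ℝ} (hm : AEStronglyMeasurable h μ)
    (hL : AEStronglyMeasurable L μ) {ε : ℝ} (hε : 0 < ε)
    (h1 : Integrable (fun x => ‖h x‖ * Real.exp (ε * L x)) μ)
    (h2 : Integrable (fun x => ‖h x‖ * Real.exp (-ε * L x)) μ) (n : ℕ) :
    Integrable (fun x => h x * (L x : ℂ) ^ n) μ := by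
  have hLc : AEStronglyMeasurable (fun x => (L x : ℂ)) μ :=
    Complex.continuous_ofReal.comp_aestronglyMeasurable hL
  refine ((h1.add h2).const_mul (n.factorial / ε ^ n)).mono' (hm.mul (hLc.pow n)) ?_
  filter_upwards with x
  have e1 : (ε * |L x|) ^ n / n.factorial ≤ Real.exp (ε * |L x|) :=
    Real.pow_div_factorial_le_exp _ (by positivity) n
  have e2 : Real.exp (ε * |L x|) ≤ Real.exp (ε * L x) + Real.exp (-ε * L x) := by
    rcases abs_cases (L x) with ⟨h, _⟩ | ⟨h, _⟩
    · rw [h]; linarith [Real.exp_pos (-ε * L x)]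
    · rw [h, mul_neg, ← neg_mul]; linarith [Real.exp_pos (ε * L x)]
  have e3 : |L x| ^ n ≤ n.factorial / ε ^ n * (Real.exp (ε * L x) + Real.exp (-ε * L x)) := by
    have hf : (0 : ℝ) < n.factorial := by exact_mod_cast n.factorial_pos
    rw [div_mul_eq_mul_div, le_div_iff₀ (by positivity)]
    have := (div_le_iff₀ hf).1 (e1.trans e2)
    rw [mul_pow] at this
    linarith
  rw [norm_mul, norm_pow, Complex.norm_real, Real.norm_eq_abs]
  simp only [Pi.add_apply]
  calc ‖h x‖ * |L x| ^ n ≤ ‖h x‖ * (n.factorial / ε ^ n *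
      (Real.exp (ε * L x) + Real.exp (-ε * L x))) := by gcongr
    _ = _ := by ring

/-- The Taylor series at `0` of `t ↦ ∫ h e^{tL}` arises from that of the exponential, if `h e^{± εL}` is
integrable. -/
theorem hasTaylor_integral_exp {h : α → ℂ} {L : α → ℝ} (hm : AEStronglyMeasurable h μ)
    (hL : AEStronglyMeasurable L μ) {ε : ℝ} (hε : 0 < ε)
    (h1 : Integrable (fun x => ‖h x‖ * Real.exp (ε * L x)) μ)
    (h2 : Integrable (fun x => ‖h x‖ * Real.exp (-ε * L x)) μ) :
    HasTaylor (fun t => ∫ x, h x * Complex.exp (t * L x) ∂μ)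
      (fun n => ∫ x, h x * ((L x : ℂ) ^ n / (n.factorial : ℂ)) ∂μ) := by
  have hLc : AEStronglyMeasurable (fun x => (L x : ℂ)) μ :=
    Complex.continuous_ofReal.comp_aestronglyMeasurable hL
  filter_upwards [Metric.ball_mem_nhds (0 : ℂ) hε] with t ht
  have ht' : ‖t‖ ≤ ε := by simpa using (mem_ball_zero_iff.1 ht).le
  have hb : ∀ x, HasSum (fun n : ℕ => ‖h x‖ * ((ε * |L x|) ^ n / n.factorial))
      (‖h x‖ * Real.exp (ε * |L x|)) := by
    intro x
    have := NormedSpace.expSeries_div_hasSum_exp (𝔸 := ℝ) (ε * |L x|)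
    rw [← Real.exp_eq_exp_ℝ] at this
    exact this.mul_left _
  have := hasSum_integral_of_dominated_convergence (μ := μ)
    (F := fun n x => h x * ((t * (L x : ℂ)) ^ n / (n.factorial : ℂ)))
    (f := fun x => h x * Complex.exp (t * L x))
    (fun n x => ‖h x‖ * ((ε * |L x|) ^ n / n.factorial)) ?_ ?_ ?_ ?_ ?_
  · convert! this using 2 with n
    rw [mul_comm, ← integral_const_mul]
    refine integral_congr_ae ?_
    filter_upwards with x
    rw [mul_pow]; ring
  · intro n
    have := (((hLc.const_mul t).pow n).const_mul ((n.factorial : ℂ)⁻¹))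
    refine hm.mul (this.congr ?_)
    filter_upwards with x
    simp [div_eq_mul_inv]; ring
  · intro n
    filter_upwards with x
    rw [norm_mul, norm_div, norm_pow, norm_mul, Complex.norm_real, Real.norm_eq_abs,
      Complex.norm_natCast]
    gcongr
  · filter_upwards with x using (hb x).summable
  · have : (fun x => ∑' n : ℕ, ‖h x‖ * ((ε * |L x|) ^ n / n.factorial)) =
        fun x => ‖h x‖ * Real.exp (ε * |L x|) := funext fun x => (hb x).tsum_eq
    rw [this]
    refine (h1.add h2).mono' (hm.norm.mul ?_) ?_
    · exact Real.continuous_exp.comp_aestronglyMeasurable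
        ((continuous_abs.comp_aestronglyMeasurable hL).const_mul ε)
    · filter_upwards with x
      rw [Real.norm_of_nonneg (by positivity)]
      simp only [Pi.add_apply]
      rw [← mul_add]
      gcongr
      rcases abs_cases (L x) with ⟨h, _⟩ | ⟨h, _⟩
      · rw [h]; linarith [Real.exp_pos (-ε * L x)]
      · rw [h, mul_neg, ← neg_mul]; linarith [Real.exp_pos (ε * L x)]
  · filter_upwards with x
    have := NormedSpace.expSeries_div_hasSum_exp (𝔸 := ℂ) (t * L x)
    rw [← Complex.exp_eq_exp_ℂ] at this
    exact this.mul_left _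

/-- Differentiation under the integral for `t ↦ ∫ h e^{tL}`, on a half plane of absolute convergence. -/
theorem analyticAt_integral_exp {h : α → ℂ} {L : α → ℝ} (hm : AEStronglyMeasurable h μ)
    (hL : AEStronglyMeasurable L μ) {σ : ℝ}
    (hi : ∀ τ : ℝ, σ < τ → Integrable (fun x => ‖h x‖ * Real.exp (τ * L x)) μ)
    {t₀ : ℂ} (ht₀ : σ < t₀.re) :
    AnalyticAt ℂ (fun t => ∫ x, h x * Complex.exp (t * L x) ∂μ) t₀ := by
  have hLc : AEStronglyMeasurable (fun x => (L x : ℂ)) μ :=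
    Complex.continuous_ofReal.comp_aestronglyMeasurable hL
  have hε : 0 < (t₀.re - σ) / 2 := by linarith
  have hn : ∀ e : ℝ, ∀ x, ‖h x * Complex.exp (t₀ * L x)‖ * Real.exp (e * L x) =
      ‖h x‖ * Real.exp ((t₀.re + e) * L x) := by
    intro e x
    rw [norm_mul, Complex.norm_exp, mul_assoc, ← Real.exp_add]
    congr 2
    simp
    ring
  have := (hasTaylor_integral_exp (μ := μ) (h := fun x => h x * Complex.exp (t₀ * L x)) (L := L)
    (hm.mul (Complex.continuous_exp.comp_aestronglyMeasurable (hLc.const_mul t₀))) hL hε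
    (by simp only [hn]; exact hi _ (by linarith))
    (by simp only [hn]; exact hi _ (by linarith))).hasFPowerSeriesAt.analyticAt
  have h3 : (fun t => ∫ x, h x * Complex.exp (t * L x) ∂μ) =
      (fun t => ∫ x, h x * Complex.exp (t₀ * L x) * Complex.exp (t * L x) ∂μ) ∘
        fun t => t - t₀ := by
    funext t
    simp only [Function.comp]
    refine integral_congr_ae ?_
    filter_upwards with x
    rw [mul_assoc, ← Complex.exp_add]
    congr 2
    ring
  rw [h3]
  refine AnalyticAt.comp ?_ (analyticAt_id.sub analyticAt_const)
  simpa using this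

end ExpIntegral

/-! ### Gluing meromorphic functions on half planes -/

section Glue

/-- The identity theorem for meromorphic functions on a half plane. -/
theorem eventuallyEq_of_halfPlane {F G : ℂ → ℂ} {σ R : ℝ}
    (hF : ∀ t : ℂ, σ < t.re → MeromorphicAt F t) (hG : ∀ t : ℂ, σ < t.re → MeromorphicAt G t)
    (hFG : ∀ t : ℂ, R < t.re → F t = G t) {t : ℂ} (ht : σ < t.re) : F =ᶠ[𝓝[≠] t] G := by
  have hm : MeromorphicOn (F - G) {t : ℂ | σ < t.re} := fun t ht => (hF t ht).sub (hG t ht)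
  have hconv : Convex ℝ {t : ℂ | σ < t.re} := convex_halfSpace_re_gt σ
  have hne : ({t : ℂ | σ < t.re}).Nonempty := ⟨t, ht⟩
  have hc : IsConnected {t : ℂ | σ < t.re} := ⟨hne, hconv.isPreconnected⟩
  have hall := hm.exists_meromorphicOrderAt_ne_top_iff_forall_mem hc
  have htop : meromorphicOrderAt (F - G) t = ⊤ := by
    by_contra hcon
    have h1 := hall.1 ⟨t, ht, hcon⟩
    set t₁ : ℂ := ((max σ R + 1 : ℝ) : ℂ) with ht₁
    have hre : t₁.re = max σ R + 1 := Complex.ofReal_re _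
    refine h1 t₁ (by simp only [mem_ofPred_eq, hre]; linarith [le_max_left σ R]) ?_
    rw [meromorphicOrderAt_eq_top_iff]
    have hopen : IsOpen {t : ℂ | R < t.re} := isOpen_lt continuous_const Complex.continuous_re
    have : ∀ᶠ z in 𝓝 t₁, z ∈ {t : ℂ | R < t.re} :=
      hopen.mem_nhds (by simp only [mem_ofPred_eq, hre]; linarith [le_max_right σ R])
    filter_upwards [this.filter_mono nhdsWithin_le_nhds] with z hz
    simp [hFG z hz]
  rw [meromorphicOrderAt_eq_top_iff] at htop
  filter_upwards [htop] with z hz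
  exact sub_eq_zero.1 hz

/-- Meromorphic continuations to all the half planes `-N < re t` fit together. -/
theorem exists_meromorphic_glue {f : ℂ → ℂ} {F : ℕ → ℂ → ℂ} {R : ℝ}
    (hF : ∀ (N : ℕ) (t : ℂ), -(N : ℝ) < t.re → MeromorphicAt (F N) t)
    (hf : ∀ (N : ℕ) (t : ℂ), R < t.re → F N t = f t) :
    ∃ G : ℂ → ℂ, Meromorphic G ∧ (∀ t : ℂ, R < t.re → G t = f t) := by
  refine ⟨fun t => F (⌈-t.re⌉₊ + 1) t, fun t₀ => ?_, fun t ht => hf _ t ht⟩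
  set n₀ := ⌈-t₀.re⌉₊ + 1 with hn₀
  have hval : ∀ t : ℂ, ∀ N : ℕ, ‖t - t₀‖ < 1 → N = ⌈-t.re⌉₊ + 1 → -(N : ℝ) < t₀.re := by
    intro t N ht hN
    have h1 : -t.re ≤ (⌈-t.re⌉₊ : ℝ) := Nat.le_ceil _
    have h2 : |(t - t₀).re| < 1 := (Complex.abs_re_le_norm _).trans_lt ht
    rw [Complex.sub_re, abs_lt] at h2
    rw [hN]; push_cast; linarith [h2.1, h2.2]
  have h0 : -(n₀ : ℝ) < t₀.re := hval t₀ n₀ (by simp) hn₀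
  refine (hF n₀ t₀ h0).congr ?_
  -- near `t₀` only finitely many of the functions `F N` are involved
  set n₁ := ⌈-t₀.re + 1⌉₊ + 1 with hn₁
  have hev : ∀ᶠ t in 𝓝[≠] t₀, ∀ N ∈ Finset.range (n₁ + 1), -(N : ℝ) < t₀.re →
      F n₀ t = F N t := by
    rw [Filter.eventually_all_finset]
    intro N _
    by_cases hN : -(N : ℝ) < t₀.re
    · have := eventuallyEq_of_halfPlane (F := F n₀) (G := F N)
        (σ := max (-(n₀ : ℝ)) (-(N : ℝ))) (R := R)
        (fun t ht => hF _ t ((le_max_left _ _).trans_lt ht))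
        (fun t ht => hF _ t ((le_max_right _ _).trans_lt ht))
        (fun t ht => (hf _ t ht).trans (hf _ t ht).symm) (t := t₀) (max_lt h0 hN)
      filter_upwards [this] with t ht _ using ht
    · exact Eventually.of_forall fun t h => absurd h hN
  have hball : ∀ᶠ t in 𝓝[≠] t₀, ‖t - t₀‖ < 1 := by
    have : ∀ᶠ t in 𝓝 t₀, t ∈ Metric.ball t₀ 1 := Metric.ball_mem_nhds t₀ one_pos
    filter_upwards [this.filter_mono nhdsWithin_le_nhds] with t ht
    simpa [dist_eq_norm] using ht
  filter_upwards [hev, hball] with t h1 h2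
  refine h1 _ ?_ (hval t _ h2 rfl)
  have h3 : |(t - t₀).re| < 1 := (Complex.abs_re_le_norm _).trans_lt h2
  rw [Complex.sub_re, abs_lt] at h3
  have : ⌈-t.re⌉₊ ≤ ⌈-t₀.re + 1⌉₊ := Nat.ceil_le_ceil (by linarith [h3.1])
  simp only [Finset.mem_range]
  omega

end Glue

/-! ### Integrability of monomials -/

section Monomial

variable {d : ℕ}

theorem integrable_indicator_norm_rpow {s : ℝ} (hs : -2 < s) {R : ℝ} (hR : 0 < R) :
    Integrable ((Metric.ball (0 : ℂ) R).indicator fun x => ‖x‖ ^ s) := by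
  rw [integrable_indicator_iff Metric.isOpen_ball.measurableSet]
  rw [integrableOn_fun_norm_addHaar (volume : Measure ℂ) (f := fun y => y ^ s)]
  have h1 : IntegrableOn (fun y : ℝ => y ^ (s + 1)) (Ioo 0 R) :=
    (intervalIntegral.integrableOn_Ioo_rpow_iff hR).2 (by linarith)
  refine h1.congr_fun (fun y hy => ?_) measurableSet_Ioo
  simp [Complex.finrank_real_complex, Real.rpow_add_one hy.1.ne', mul_comm]

theorem ae_ne_zero : ∀ᵐ z : Cd d, ∀ j, z j ≠ 0 := by
  rw [ae_all_iff]
  intro j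
  exact compl_mem_ae_iff.2 (Measure.pi_hyperplane (fun _ : Fin d => (volume : Measure ℂ)) j 0)

/-- A function with bounded support which is dominated by a monomial with exponents larger than
`-2` is integrable. -/
theorem integrable_of_le_monomial {h : Cd d → ℂ} (hm : AEStronglyMeasurable h volume)
    {s : Fin d → ℝ} (hs : ∀ j, -2 < s j) {R C : ℝ} (hR : ∀ z, R ≤ ‖z‖ → h z = 0)
    (hb : ∀ᵐ z : Cd d, ‖h z‖ ≤ C * ∏ j, ‖z j‖ ^ s j) : Integrable h volume := by
  set R' := max R 1 with hR'
  have hR'pos : 0 < R' := lt_max_of_lt_right one_pos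
  have hi : Integrable (fun z : Cd d =>
      ∏ j, (Metric.ball (0 : ℂ) R').indicator (fun x => ‖x‖ ^ s j) (z j)) volume :=
    Integrable.fintype_prod (f := fun j => (Metric.ball (0 : ℂ) R').indicator fun x => ‖x‖ ^ s j)
      fun j => integrable_indicator_norm_rpow (hs j) hR'pos
  refine (hi.const_mul C).mono' hm ?_
  filter_upwards [hb] with z hz
  by_cases hzR : ‖z‖ < R'
  · refine hz.trans (le_of_eq ?_)
    congr 1
    refine Finset.prod_congr rfl fun j _ => ?_
    rw [indicator_of_mem]
    exact mem_ball_zero_iff.2 ((norm_le_pi_norm z j).trans_lt hzR)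
  · rw [hR z ((le_max_left _ _).trans (not_lt.1 hzR)), norm_zero]
    have hC : 0 ≤ C * ∏ j, ‖z j‖ ^ s j := (norm_nonneg _).trans hz
    rcases le_or_gt 0 C with hC0 | hC0
    · exact mul_nonneg hC0 (Finset.prod_nonneg fun j _ =>
        indicator_nonneg (fun x _ => by positivity) _)
    · have hp : 0 ≤ ∏ j, ‖z j‖ ^ s j := Finset.prod_nonneg fun j _ => by positivity
      have h0 : ∏ j, ‖z j‖ ^ s j = 0 := by nlinarith
      obtain ⟨j, -, hj⟩ := Finset.prod_eq_zero_iff.1 h0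
      rw [Finset.prod_eq_zero (Finset.mem_univ j), mul_zero]
      by_cases hmem : z j ∈ Metric.ball (0 : ℂ) R'
      · rw [indicator_of_mem hmem, hj]
      · rw [indicator_of_notMem hmem]

end Monomial

end DivInt
end

noncomputable section
namespace DivInt

/-! ### Meromorphic continuation of the local integrals -/

section LocalIntegral

variable {d : ℕ}

/-- The function `log ∏ |z_j|^{2 I_j}`. -/
def logW (I : Fin d → ℕ) (z : Cd d) : ℝ := ∑ j, 2 * (I j : ℝ) * Real.log ‖z j‖

/-- The monomial `z^{-J} z̄^{-K}`. -/
def mono (J K : Fin d → ℤ) (z : Cd d) : ℂ := ∏ j, (z j ^ (-J j) * starRingEnd ℂ (z j) ^ (-K j))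

theorem measurable_logW (I : Fin d → ℕ) : Measurable (logW I) := by
  unfold logW
  fun_prop

theorem measurable_mono (J K : Fin d → ℤ) : Measurable (mono J K) := by
  unfold mono
  have h : ∀ n : ℤ, Measurable fun x : ℂ => x ^ n := by
    intro n
    cases n with
    | ofNat n => simpa using (measurable_id (α := ℂ)).pow_const n
    | negSucc n =>
      simp only [zpow_negSucc]
      exact ((measurable_id (α := ℂ)).pow_const (n + 1)).inv
  refine Finset.measurable_fun_prod _ fun j _ => ?_
  exact ((h _).comp (measurable_pi_apply j)).mul
    ((h _).comp (Complex.continuous_conj.measurable.comp (measurable_pi_apply j)))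

theorem ker_eq {I : Fin d → ℕ} {J K : Fin d → ℤ} (t : ℂ) {z : Cd d} (hz : ∀ j, z j ≠ 0) :
    ker I J K t z = mono J K z * Complex.exp (t * (logW I z : ℝ)) := by
  rw [ker, mono, logW]
  push_cast
  rw [Finset.mul_sum, Complex.exp_sum, ← Finset.prod_mul_distrib]
  refine Finset.prod_congr rfl fun j _ => ?_
  have h : 0 < ‖z j‖ := norm_pos_iff.2 (hz j)
  rw [kerOne, Complex.cpow_def_of_ne_zero (by exact_mod_cast h.ne'), ← Complex.ofReal_log h.le]
  rw [show ((Real.log ‖z j‖ : ℝ) : ℂ) * (2 * (I j : ℂ) * t) =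
    t * (2 * (I j : ℂ) * (Real.log ‖z j‖ : ℝ)) by ring]
  ring

theorem norm_mono_mul_exp {I : Fin d → ℕ} {J K : Fin d → ℤ} (τ : ℝ) {z : Cd d}
    (hz : ∀ j, z j ≠ 0) :
    ‖mono J K z‖ * Real.exp (τ * logW I z) = ∏ j, ‖z j‖ ^ (2 * I j * τ - J j - K j) := by
  rw [mono, logW, norm_prod, Finset.mul_sum, Real.exp_sum, ← Finset.prod_mul_distrib]
  refine Finset.prod_congr rfl fun j _ => ?_
  have h : 0 < ‖z j‖ := norm_pos_iff.2 (hz j)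
  rw [norm_mul, norm_zpow, norm_zpow, RCLike.norm_conj, ← Real.rpow_intCast, ← Real.rpow_intCast,
    ← Real.rpow_add h, show τ * (2 * (I j : ℝ) * Real.log ‖z j‖) =
      Real.log ‖z j‖ * (2 * I j * τ) by ring, ← Real.rpow_def_of_pos h, ← Real.rpow_add h]
  congr 1
  push_cast
  ring

/-- The integrand of the continued integral is dominated by the monomial with exponents
`2 I_j τ - J_j - K_j`. -/
theorem integrable_mono_exp {I : Fin d → ℕ} {J K : Fin d → ℤ} {τ : ℝ}
    (hτ : ∀ j, -2 < 2 * I j * τ - J j - K j) {G : Cd d → ℂ} (hG : Continuous G)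
    (hGs : HasCompactSupport G) {w : Cd d → ℝ} (hw : Continuous w) :
    Integrable (fun z => ‖mono J K z * G z‖ * Real.exp (τ * (logW I z + w z))) volume := by
  have hc : Continuous fun z => G z * (Real.exp (τ * w z) : ℂ) :=
    hG.mul (Complex.continuous_ofReal.comp (Real.continuous_exp.comp (continuous_const.mul hw)))
  have hcs : HasCompactSupport fun z => G z * (Real.exp (τ * w z) : ℂ) := hGs.mul_right
  obtain ⟨C, hC⟩ := hcs.exists_bound_of_continuous hc
  obtain ⟨R, hR⟩ := hGs.isCompact.isBounded.subset_ball (0 : Cd d)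
  have hint : Integrable (fun z => mono J K z * G z * (Real.exp (τ * (logW I z + w z)) : ℂ))
      volume := by
    refine integrable_of_le_monomial (s := fun j => 2 * I j * τ - J j - K j) (R := R) (C := C)
      ?_ hτ ?_ ?_
    · refine Measurable.aestronglyMeasurable ?_
      exact ((measurable_mono J K).mul hG.measurable).mul (Complex.measurable_ofReal.comp
        (Real.measurable_exp.comp (((measurable_logW I).add hw.measurable).const_mul τ)))
    · intro z hz
      have : G z = 0 := by
        by_contra h0
        have := hR (subset_tsupport G h0)
        rw [mem_ball_zero_iff] at this
        linarith
      simp [this]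
    · filter_upwards [ae_ne_zero (d := d)] with z hz
      rw [← norm_mono_mul_exp τ hz, norm_mul, norm_mul, Complex.norm_real,
        Real.norm_of_nonneg (Real.exp_pos _).le, mul_add, Real.exp_add]
      have h1 := hC z
      rw [norm_mul, Complex.norm_real, Real.norm_of_nonneg (Real.exp_pos _).le] at h1
      calc ‖mono J K z‖ * ‖G z‖ * (Real.exp (τ * logW I z) * Real.exp (τ * w z))
          = (‖G z‖ * Real.exp (τ * w z)) * (‖mono J K z‖ * Real.exp (τ * logW I z)) := by ring
        _ ≤ _ := by gcongr
  refine hint.norm.congr ?_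
  filter_upwards with z
  rw [norm_mul (mono J K z * G z), Complex.norm_real, Real.norm_of_nonneg (Real.exp_pos _).le]

/-- The coefficients in a Leibniz expansion along `(l + w)^k / k!`, sorted by powers of `l`. -/
theorem sum_exp_coeff (G : ℕ → ℂ) (l w : ℂ) (N : ℕ) :
    ∑ n ∈ Finset.range (N + 1), G n * ((l + w) ^ (N - n) / ((N - n).factorial : ℂ)) =
      ∑ x ∈ Finset.HasAntidiagonal.antidiagonal N, l ^ x.1 / (x.1.factorial : ℂ) *
        ∑ n ∈ Finset.range (x.2 + 1), G n * (w ^ (x.2 - n) / ((x.2 - n).factorial : ℂ)) := by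
  have e : ∀ k : ℕ, (l + w) ^ k / (k.factorial : ℂ) =
      ∑ y ∈ Finset.HasAntidiagonal.antidiagonal k,
        l ^ y.1 / (y.1.factorial : ℂ) * (w ^ y.2 / (y.2.factorial : ℂ)) := by
    intro k
    rw [(Commute.all l w).add_pow', Finset.sum_div]
    refine Finset.sum_congr rfl fun y hy => ?_
    have hy' := Finset.HasAntidiagonal.mem_antidiagonal.1 hy
    have hk : (k.factorial : ℂ) = k.choose y.1 * y.1.factorial * y.2.factorial := by
      rw [← hy']; rw [Nat.choose_symm_add]
      exact_mod_cast (Nat.add_choose_mul_factorial_mul_factorial y.1 y.2).symm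
    have h1 : (y.1.factorial : ℂ) ≠ 0 := by exact_mod_cast y.1.factorial_ne_zero
    have h2 : (y.2.factorial : ℂ) ≠ 0 := by exact_mod_cast y.2.factorial_ne_zero
    have h3 : (k.choose y.1 : ℂ) ≠ 0 := by
      exact_mod_cast (Nat.choose_pos (by omega)).ne'
    rw [hk, nsmul_eq_mul]
    field_simp
  have r : ∀ (f : ℕ → ℂ) (k : ℕ), ∑ n ∈ Finset.range (k + 1), G n * f (k - n) =
      ∑ x ∈ Finset.HasAntidiagonal.antidiagonal k, G x.1 * f x.2 := fun f k =>
    (Finset.Nat.sum_antidiagonal_eq_sum_range_succ (fun a b => G a * f b) k).symm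
  rw [r (fun k => (l + w) ^ k / (k.factorial : ℂ))]
  simp only [e, r (fun k => w ^ k / (k.factorial : ℂ))]
  have := congrArg (PowerSeries.coeff N) (mul_left_comm (PowerSeries.mk G)
    (PowerSeries.mk fun k => l ^ k / (k.factorial : ℂ))
    (PowerSeries.mk fun k => w ^ k / (k.factorial : ℂ)))
  simpa only [PowerSeries.coeff_mul, PowerSeries.coeff_mk] using this

/-- A representation `pl(t) ∫ ker ⋅ g e^{tw} = E(t)` with `E` analytic on a half plane, obtained
from an integration by parts formula. -/
theorem exists_analytic_rep {I : Fin d → ℕ} {J K J' K' : Fin d → ℤ} {D : (Cd d → ℂ) → Cd d → ℂ}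
    (hD : IsWord D) {pl : ℂ → ℂ} {R σ : ℝ}
    (hpl : ∀ (t : ℂ) (G : Cd d → ℂ), R < t.re → ContDiff ℝ ∞ G → HasCompactSupport G →
      pl t * ∫ z, ker I J K t z * G z = ∫ z, ker I J' K' t z * D G z)
    (hadm : ∀ t : ℂ, R < t.re → Adm I J' K' t)
    (hσ : ∀ (τ : ℝ), σ < τ → ∀ j, -2 < 2 * I j * τ - J' j - K' j)
    {g : Cd d → ℂ} (hg : ContDiff ℝ ∞ g) (hgs : HasCompactSupport g)
    {w : Cd d → ℝ} (hw : ContDiff ℝ ∞ w) :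
    ∃ E : ℂ → ℂ, (∀ t : ℂ, σ < t.re → AnalyticAt ℂ E t) ∧
      (∀ t : ℂ, R < t.re →
        pl t * ∫ z, ker I J K t z * (g z * Complex.exp (t * (w z : ℝ))) = E t) ∧
      (σ < 0 → HasTaylor E fun N => ∑ x ∈ Finset.HasAntidiagonal.antidiagonal N,
        ∫ z, mono J' K' z * ((logW I z : ℂ) ^ x.1 / (x.1.factorial : ℂ)) *
          D (fun z => g z * ((w z : ℂ) ^ x.2 / (x.2.factorial : ℂ))) z) := by
  have hwc : ContDiff ℝ ∞ fun z => (w z : ℂ) := Complex.ofRealCLM.contDiff.comp hw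
  obtain ⟨M, G, hG, hGs, hG0, hexp, htay⟩ := hD.exp_expansion hg hwc
  have hGc : ∀ n, HasCompactSupport (G n) := fun n =>
    hgs.mono' ((subset_tsupport _).trans (hGs n))
  set L : Cd d → ℝ := fun z => logW I z + w z with hL
  have hLm : AEStronglyMeasurable L volume :=
    ((measurable_logW I).add hw.continuous.measurable).aestronglyMeasurable
  have hmm : ∀ n, AEStronglyMeasurable (fun z => mono J' K' z * G n z) volume := fun n =>
    ((measurable_mono J' K').mul (hG n).continuous.measurable).aestronglyMeasurable
  have hint : ∀ n τ, σ < τ →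
      Integrable (fun z => ‖mono J' K' z * G n z‖ * Real.exp (τ * L z)) volume :=
    fun n τ hτ => integrable_mono_exp (hσ τ hτ) (hG n).continuous (hGc n) hw.continuous
  refine ⟨fun t => ∑ n ∈ Finset.range (M + 1),
    t ^ n * ∫ z, mono J' K' z * G n z * Complex.exp (t * L z), ?_, ?_, ?_⟩
  · intro t ht
    refine Finset.analyticAt_fun_sum _ fun n _ => ?_
    exact (analyticAt_id.pow n).mul (analyticAt_integral_exp (hmm n) hLm (hint n) ht)
  · intro t ht
    have hge : ContDiff ℝ ∞ fun z => g z * Complex.exp (t * (w z : ℝ)) :=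
      hg.mul (contDiff_const.mul hwc).cexp
    rw [hpl t _ ht hge hgs.mul_right, hexp t]
    have hA := hadm t ht
    have i1 : ∀ n ∈ Finset.range (M + 1), Integrable (fun z =>
        t ^ n * (ker I J' K' t z * (G n z * Complex.exp (t * (w z : ℝ))))) volume := fun n _ =>
      (hA.integrable ((hG n).mul (contDiff_const.mul hwc).cexp).continuous
        (hGc n).mul_right).const_mul _
    have e1 : (fun z => ker I J' K' t z * ((∑ n ∈ Finset.range (M + 1), t ^ n * G n z) *
        Complex.exp (t * (w z : ℝ)))) = fun z => ∑ n ∈ Finset.range (M + 1),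
        t ^ n * (ker I J' K' t z * (G n z * Complex.exp (t * (w z : ℝ)))) := by
      funext z
      rw [Finset.sum_mul, Finset.mul_sum]
      exact Finset.sum_congr rfl fun n _ => by ring
    rw [e1, integral_finsetSum _ i1]
    refine Finset.sum_congr rfl fun n _ => ?_
    rw [integral_const_mul]
    congr 1
    refine integral_congr_ae ?_
    filter_upwards [ae_ne_zero (d := d)] with z hz
    rw [ker_eq t hz, hL]
    push_cast
    rw [mul_add, Complex.exp_add]
    ring
  · intro hσ0
    have hε : 0 < -σ / 2 := by linarith
    have h1 : ∀ n, HasTaylor (fun t => ∫ z, mono J' K' z * G n z * Complex.exp (t * L z))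
        (fun k => ∫ z, mono J' K' z * G n z * ((L z : ℂ) ^ k / (k.factorial : ℂ))) := fun n =>
      hasTaylor_integral_exp (hmm n) hLm hε (hint n _ (by linarith)) (hint n _ (by linarith))
    refine (HasTaylor.sum (Finset.range (M + 1)) fun n _ => (h1 n).pow_mul n).congr fun N => ?_
    have e1 : ∑ n ∈ Finset.range (M + 1), (if n ≤ N then
        ∫ z, mono J' K' z * G n z * ((L z : ℂ) ^ (N - n) / ((N - n).factorial : ℂ)) else 0) =
        ∑ n ∈ Finset.range (N + 1),
          ∫ z, mono J' K' z * G n z * ((L z : ℂ) ^ (N - n) / ((N - n).factorial : ℂ)) := by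
      rw [← Finset.sum_filter]
      refine Finset.sum_subset (fun n hn => ?_) fun n hn hn' => ?_
      · simp only [Finset.mem_filter, Finset.mem_range] at hn ⊢; omega
      · have : M < n := by
          simp only [Finset.mem_filter, Finset.mem_range] at hn hn'; omega
        simp [hG0 n this]
    rw [e1]
    have i1 : ∀ n ∈ Finset.range (N + 1), Integrable (fun z =>
        mono J' K' z * G n z * ((L z : ℂ) ^ (N - n) / ((N - n).factorial : ℂ))) volume := by
      intro n _
      have := (integrable_mul_pow_of_exp (hmm n) hLm hε (hint n _ (by linarith))
        (hint n _ (by linarith)) (N - n)).div_const ((N - n).factorial : ℂ)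
      refine this.congr ?_
      filter_upwards with z
      ring
    have i2 : ∀ x ∈ Finset.HasAntidiagonal.antidiagonal N, Integrable (fun z =>
        mono J' K' z * ((logW I z : ℂ) ^ x.1 / (x.1.factorial : ℂ)) *
          D (fun z => g z * ((w z : ℂ) ^ x.2 / (x.2.factorial : ℂ))) z) volume := by
      intro x _
      have hs : ContDiff ℝ ∞ (fun z => g z * ((w z : ℂ) ^ x.2 / (x.2.factorial : ℂ))) :=
        hg.mul ((hwc.pow _).div_const _)
      have hDc := (hD.contDiff hs).continuous
      have hDs := hD.hasCompactSupport (g := fun z => g z * ((w z : ℂ) ^ x.2 /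
        (x.2.factorial : ℂ))) hgs.mul_right
      have h3 := fun τ hτ => integrable_mono_exp (hσ τ hτ) hDc hDs (w := fun _ => 0)
        continuous_const
      simp only [add_zero] at h3
      have := (integrable_mul_pow_of_exp
        ((measurable_mono J' K').mul hDc.measurable).aestronglyMeasurable
        (measurable_logW I).aestronglyMeasurable hε (h3 _ (by linarith))
        (h3 _ (by linarith)) x.1).div_const (x.1.factorial : ℂ)
      refine this.congr ?_
      filter_upwards with z
      simp only [Pi.mul_apply]
      ring
    rw [← integral_finsetSum _ i1, ← integral_finsetSum _ i2]
    refine integral_congr_ae ?_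
    filter_upwards with z
    simp only [htay]
    have := sum_exp_coeff (fun n => G n z) (logW I z) (w z) N
    simp only [hL]
    push_cast
    calc _ = mono J' K' z * ∑ n ∈ Finset.range (N + 1), G n z *
        (((logW I z : ℂ) + (w z : ℂ)) ^ (N - n) / ((N - n).factorial : ℂ)) := by
          rw [Finset.mul_sum]; exact Finset.sum_congr rfl fun n _ => by ring
      _ = _ := by
          rw [this, Finset.mul_sum]; exact Finset.sum_congr rfl fun n _ => by ring

/-- The exponents of a monomial kernel with poles along exactly the first `m` coordinates. -/
structure IsExponents (m : ℕ) (I J K : Fin d → ℕ) : Prop where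
  le : m ≤ d
  pos : ∀ j : Fin d, (j : ℕ) < m → 1 ≤ I j ∧ 1 ≤ J j ∧ 1 ≤ K j
  zero : ∀ j : Fin d, m ≤ (j : ℕ) → I j = 0 ∧ J j = 0 ∧ K j = 0

/-- The list of the first `m` coordinates. -/
def branches (d m : ℕ) : List (Fin d) := (List.finRange d).filter fun j => (j : ℕ) < m

theorem dzMulti_eq_dbarL (p : Fin d → Prop) [DecidablePred p] :
    dzMulti (fun _ => 0) (fun j => if p j then 1 else 0) =
      dbarL ((List.finRange d).filter fun j => p j) := by
  unfold dzMulti dbarL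
  funext g
  induction List.finRange d with
  | nil => rfl
  | cons j l ih =>
    by_cases h : p j
    · simpa [h] using congrArg (dzbar j) ih
    · simpa [h] using ih

/-- The coefficients of the Laurent expansion of a local integral: the integrals of
`log^p |z^I|² / p! ∏_{j ≤ m} z_j^{-1} ∂/∂z̄_j` applied to the derivative of order `(J-1, K-1)`. -/
def coefInt (m : ℕ) (I J K : Fin d → ℕ) (p : ℕ) (G : Cd d → ℂ) : ℂ :=
  ∫ z, mono (fun j => if (j : ℕ) < m then 1 else 0) (fun _ => 0) z *
    ((logW I z : ℂ) ^ p / (p.factorial : ℂ)) *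
    dbarL (branches d m) (dzMulti (fun j => J j - 1) (fun j => K j - 1) G) z

theorem analyticAt_polOne (I : ℕ) (J : ℤ) (n : ℕ) (t : ℂ) : AnalyticAt ℂ (polOne I J n) t := by
  unfold polOne
  exact Finset.analyticAt_fun_prod _ fun a _ =>
    analyticAt_const.sub (analyticAt_const.mul analyticAt_id)

theorem analyticAt_pol (I : Fin d → ℕ) (J K : Fin d → ℤ) (A B : Fin d → ℕ) (t : ℂ) :
    AnalyticAt ℂ (pol I J K A B) t := by
  unfold pol
  exact Finset.analyticAt_fun_prod _ fun a _ =>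
    (analyticAt_polOne _ _ _ _).mul (analyticAt_polOne _ _ _ _)

theorem polOne_ne_zero {I : ℕ} {J : ℤ} {n : ℕ} {t : ℂ} (h : (J : ℝ) < I * t.re + 1) :
    polOne I J n t ≠ 0 := by
  rw [polOne, Finset.prod_ne_zero_iff]
  intro a _ h0
  have := congrArg Complex.re h0
  simp at this
  have ha : (0 : ℝ) ≤ a := by positivity
  linarith

set_option maxHeartbeats 400000 in
/-- The local integral `∫ |z^I|^{2t} z^{-J} z̄^{-K} g e^{tw}` has a meromorphic continuation with a pole
of order at most `m` at `0`. Integration by parts of order `(J - 1, K - 1)` leaves a simple pole in each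
`z_j` and `z̄_j`, and one more derivative `∂/∂z̄_j` per branch removes the poles in `z̄_j`, which makes the
integral converge near `t = 0`. The factors from the integrations by parts are `t^m` times a
function which does not vanish at `0` and whose inverse has the Taylor coefficients `γ`. -/
theorem exists_local_expansion {m : ℕ} {I J K : Fin d → ℕ} (hM : IsExponents m I J K) :
    ∃ (γ : ℕ → ℂ) (R : ℝ),
      γ 0 * ((-1) ^ m * (∏ j ∈ Finset.univ.filter (fun j : Fin d => (j : ℕ) < m), (I j : ℂ)) *
        ∏ j, (((J j - 1).factorial * (K j - 1).factorial : ℕ) : ℂ)) = 1 ∧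
      (∀ t : ℂ, R < t.re → Adm I (fun j => (J j : ℤ)) (fun j => (K j : ℤ)) t) ∧
      ∀ (g : Cd d → ℂ) (w : Cd d → ℝ), ContDiff ℝ ∞ g → HasCompactSupport g → ContDiff ℝ ∞ w →
        ∃ F H : ℂ → ℂ, Meromorphic F ∧
          (∀ t : ℂ, R < t.re → F t =
            ∫ z, ker I (fun j => (J j : ℤ)) (fun j => (K j : ℤ)) t z *
              (g z * Complex.exp (t * (w z : ℝ)))) ∧
          F =ᶠ[𝓝[≠] 0] (fun t => t ^ (-(m : ℤ)) * H t) ∧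
          HasTaylor H fun N => ∑ x ∈ Finset.HasAntidiagonal.antidiagonal N, γ x.1 *
            ∑ y ∈ Finset.HasAntidiagonal.antidiagonal x.2,
              coefInt m I J K y.1 (fun z => g z * ((w z : ℂ) ^ y.2 / (y.2.factorial : ℂ))) := by
  set JZ : Fin d → ℤ := fun j => (J j : ℤ) with hJZ
  set KZ : Fin d → ℤ := fun j => (K j : ℤ) with hKZ
  set R : ℝ := ∑ j, ((J j : ℝ) + K j) with hR
  have hR0 : 0 ≤ R := Finset.sum_nonneg fun j _ => by positivity
  have hRj : ∀ j, (J j : ℝ) + K j ≤ R := fun j =>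
    Finset.single_le_sum (f := fun j => (J j : ℝ) + K j) (fun j _ => by positivity)
      (Finset.mem_univ j)
  have hcase : ∀ j : Fin d, (I j = 0 ∧ J j = 0 ∧ K j = 0) ∨ (1 ≤ I j ∧ 1 ≤ J j ∧ 1 ≤ K j) := by
    intro j
    by_cases h : (j : ℕ) < m
    · exact Or.inr (hM.pos j h)
    · exact Or.inl (hM.zero j (not_lt.1 h))
  have hadm : ∀ t : ℂ, R < t.re → Adm I JZ KZ t := by
    intro t ht
    refine ⟨by linarith, fun j => ?_⟩
    rcases hcase j with ⟨h1, h2, h3⟩ | ⟨h1, -, -⟩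
    · left; simp [hJZ, hKZ, h1, h2, h3]
    · right
      refine ⟨h1, ?_⟩
      have h4 : (1 : ℝ) ≤ I j := by exact_mod_cast h1
      have h5 : t.re ≤ I j * t.re := by nlinarith
      have := hRj j
      simp only [hJZ, hKZ, Int.cast_natCast]
      nlinarith
  have hpolne : ∀ (A B : Fin d → ℕ) (t : ℂ), R < t.re → (∀ j, I j = 0 → A j = 0 ∧ B j = 0) →
      pol I JZ KZ A B t ≠ 0 := by
    intro A B t ht hAB
    rw [pol, Finset.prod_ne_zero_iff]
    intro j _
    have hj := hRj j
    have hJ0 : (0 : ℝ) ≤ J j := by positivity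
    have hK0 : (0 : ℝ) ≤ K j := by positivity
    rcases hcase j with ⟨h1, h2, h3⟩ | ⟨h1, -, -⟩
    · rw [(hAB j h1).1, (hAB j h1).2]; simp [polOne]
    · have h4 : (1 : ℝ) ≤ I j := by exact_mod_cast h1
      have h5 : t.re ≤ I j * t.re := by nlinarith
      refine mul_ne_zero (polOne_ne_zero ?_) (polOne_ne_zero ?_)
      · simp only [hJZ, Int.cast_natCast]; linarith
      · simp only [hKZ, Int.cast_natCast]; linarith
  -- the factor which remains after division by `t^m`
  set e : Fin d → ℕ := fun j => if (j : ℕ) < m then 1 else 0 with he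
  set A₀ : Fin d → ℕ := fun j => J j - 1 with hA₀
  set B₀ : Fin d → ℕ := fun j => K j - 1 with hB₀
  set eZ : Fin d → ℤ := fun j => if (j : ℕ) < m then 1 else 0 with heZ
  set p₁ : ℂ → ℂ := fun t => (-1) ^ m * (∏ j ∈ Finset.univ.filter (fun j : Fin d => (j : ℕ) < m), (I j : ℂ)) *
    pol I JZ KZ A₀ B₀ t with hp₁
  have hcard : (Finset.univ.filter fun j : Fin d => (j : ℕ) < m).card = m := by
    have := Fin.card_filter_val_lt (n := d) (m := m)
    rw [this]; exact min_eq_right hM.le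
  have hp₂ : ∀ t, pol I eZ eZ (fun _ => 0) e t =
      (-1) ^ m * (∏ j ∈ Finset.univ.filter (fun j : Fin d => (j : ℕ) < m), (I j : ℂ)) * t ^ m := by
    intro t
    have : ∀ j, polOne (I j) (eZ j) 0 t * polOne (I j) (eZ j) (e j) t =
        if (j : ℕ) < m then -1 * (I j : ℂ) * t else 1 := by
      intro j
      by_cases h : (j : ℕ) < m
      · simp [polOne, he, heZ, h]
      · simp [polOne, he, h]
    rw [pol]
    simp only [this]
    rw [← Finset.prod_filter, Finset.prod_mul_distrib, Finset.prod_mul_distrib,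
      Finset.prod_const, Finset.prod_const, hcard]
  have hp₁0 : p₁ 0 = (-1) ^ m * (∏ j ∈ Finset.univ.filter (fun j : Fin d => (j : ℕ) < m), (I j : ℂ)) *
        ∏ j, (((J j - 1).factorial * (K j - 1).factorial : ℕ) : ℂ) := by
    have hfac : ∀ n : ℕ, ∀ i : ℕ, polOne i (n : ℤ) (n - 1) 0 = ((n - 1).factorial : ℂ) := by
      intro n i
      rcases n with _ | n
      · simp [polOne]
      · simp only [polOne, Nat.add_sub_cancel]
        rw [← Finset.prod_range_add_one_eq_factorial, ← Finset.prod_range_reflect]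
        push_cast
        refine Finset.prod_congr rfl fun a ha => ?_
        have ha' := Finset.mem_range.1 ha
        rw [Nat.cast_sub (by omega), Nat.cast_sub (by omega)]
        push_cast; ring
    simp only [hp₁, pol, hA₀, hB₀, hJZ, hKZ, hfac]
    push_cast
    rfl
  have hp₁ne : p₁ 0 ≠ 0 := by
    rw [hp₁0]
    refine mul_ne_zero (mul_ne_zero (pow_ne_zero _ (by norm_num)) ?_) ?_
    · rw [Finset.prod_ne_zero_iff]
      intro j hj
      have := (hM.pos j (Finset.mem_filter.1 hj).2).1
      exact_mod_cast (by omega : I j ≠ 0)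
    · rw [Finset.prod_ne_zero_iff]
      intro j _
      exact_mod_cast mul_ne_zero (Nat.factorial_ne_zero _) (Nat.factorial_ne_zero _)
  have hp₁an : AnalyticAt ℂ p₁ 0 := analyticAt_const.mul (analyticAt_pol _ _ _ _ _ _)
  obtain ⟨γ, hγ, hγ0⟩ := exists_hasTaylor (hp₁an.inv hp₁ne)
  refine ⟨γ, R, by rw [hγ0, ← hp₁0]; exact inv_mul_cancel₀ hp₁ne, hadm, ?_⟩
  intro g w hg hgs hw
  set f : ℂ → ℂ := fun t => ∫ z, ker I JZ KZ t z * (g z * Complex.exp (t * (w z : ℝ))) with hf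
  -- the representation near `0`
  have hD₀ : IsWord fun G : Cd d → ℂ => dbarL (branches d m) (dzMulti A₀ B₀ G) :=
    (isWord_dbarL _).comp (isWord_dzMulti _ _)
  have hadm1 : ∀ t : ℂ, R < t.re → Adm I eZ eZ t := by
    intro t ht
    refine (hadm t ht).mono (fun j => ?_) (fun j => ?_) (fun j hj => ?_)
    all_goals
      rcases hcase j with ⟨h1, h2, h3⟩ | ⟨h1, h2, h3⟩
      · have : ¬ (j : ℕ) < m := fun h => by have := (hM.pos j h).1; omega
        simp [heZ, this, hJZ, hKZ, h2, h3]
      · simp only [heZ, hJZ, hKZ]; split_ifs <;> omega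
  have hadm2 : ∀ t : ℂ, R < t.re → Adm I eZ (fun _ => 0) t := by
    intro t ht
    refine (hadm1 t ht).mono (fun j => le_rfl) (fun j => ?_) (fun j hj => ?_)
    · simp only [heZ]; split_ifs <;> simp
    · have : ¬ (j : ℕ) < m := fun h => by have := (hM.pos j h).1; omega
      simp [heZ, this]
  have hrep0 : ∀ (t : ℂ) (G : Cd d → ℂ), R < t.re → ContDiff ℝ ∞ G → HasCompactSupport G →
      (p₁ t * t ^ m) * ∫ z, ker I JZ KZ t z * G z =
        ∫ z, ker I eZ (fun _ => 0) t z * dbarL (branches d m) (dzMulti A₀ B₀ G) z := by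
    intro t G ht hG hGs
    have hw1 := isWord_dzMulti A₀ B₀
    have s1 := ker_dzMulti (A := A₀) (B := B₀) hG hGs (hadm t ht) (fun j hj => by
      rcases hcase j with ⟨h1, h2, h3⟩ | ⟨h1, h2, h3⟩
      · simp [hA₀, hB₀, h2, h3]
      · omega)
    have e1 : (fun j => JZ j - (A₀ j : ℤ)) = eZ := by
      funext j
      simp only [hJZ, hA₀, heZ]
      by_cases h : (j : ℕ) < m
      · have := hM.pos j h; simp only [h, if_true]; omega
      · have := hM.zero j (not_lt.1 h); simp [h, this]
    have e2 : (fun j => KZ j - (B₀ j : ℤ)) = eZ := by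
      funext j
      simp only [hKZ, hB₀, heZ]
      by_cases h : (j : ℕ) < m
      · have := hM.pos j h; simp only [h, if_true]; omega
      · have := hM.zero j (not_lt.1 h); simp [h, this]
    rw [e1, e2] at s1
    have s2 := ker_dzMulti (A := fun _ => 0) (B := e) (hw1.contDiff hG) (hw1.hasCompactSupport hGs)
      (hadm1 t ht) (fun j hj => ⟨rfl, by
        have : ¬ (j : ℕ) < m := fun h => by have := (hM.pos j h).1; omega
        simp [he, this]⟩)
    have e3 : (fun j => eZ j - ((0 : ℕ) : ℤ)) = eZ := by simp
    have e4 : (fun j => eZ j - (e j : ℤ)) = fun _ => 0 := by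
      funext j; simp only [heZ, he]; split_ifs <;> simp
    rw [e3, e4, hp₂, dzMulti_eq_dbarL, ← s1] at s2
    rw [branches, ← s2]
    simp only [hp₁]
    ring
  -- `2 I_j τ > -1` for all `j` as soon as `τ > -1 / (2S)`
  set S : ℝ := 1 + ∑ j, (I j : ℝ) with hS
  have hSj : ∀ j, (I j : ℝ) ≤ S := fun j => by
    have := Finset.single_le_sum (f := fun j => (I j : ℝ)) (fun j _ => by positivity)
      (Finset.mem_univ j)
    simp only [hS]; linarith
  have hS1 : 1 ≤ S := by
    have : (0 : ℝ) ≤ ∑ j, (I j : ℝ) := Finset.sum_nonneg fun j _ => by positivity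
    linarith
  obtain ⟨E₀, hE₀an, hE₀eq, hE₀t⟩ := exists_analytic_rep (σ := -(1 / (2 * S))) hD₀ hrep0 hadm2
    (by
      intro τ hτ j
      have h1 : (eZ j : ℝ) ≤ 1 := by simp only [heZ]; split_ifs <;> simp
      have h2 : -1 < 2 * I j * τ := by
        have h3 : -(1 / (2 * S)) * (2 * S) = -1 := by field_simp
        have h4 : (0 : ℝ) ≤ I j := by positivity
        rcases le_or_gt 0 τ with h | h
        · have := mul_nonneg h4 h; linarith
        · have h5 : S * τ ≤ I j * τ := by have := hSj j; nlinarith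
          nlinarith
      simp only [Int.cast_zero]
      linarith) hg hgs hw
  have hσ0 : -(1 / (2 * S)) < 0 := by
    have : 0 < 1 / (2 * S) := by positivity
    linarith
  -- the representations on large half planes
  have hrepN : ∀ N : ℕ, ∃ F : ℂ → ℂ, (∀ t : ℂ, -(N : ℝ) < t.re → MeromorphicAt F t) ∧
      ∀ t : ℂ, R < t.re → F t = f t := by
    intro N
    -- `n` further derivatives in each variable compensate `|z_j|^{2 I_j t}` for `re t > -N`
    set n : ℕ := N * ∑ j, I j with hn
    set A : Fin d → ℕ := fun j => if (j : ℕ) < m then J j + n else 0 with hA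
    set B : Fin d → ℕ := fun j => if (j : ℕ) < m then K j + n else 0 with hB
    have hAB : ∀ j, I j = 0 → A j = 0 ∧ B j = 0 := by
      intro j hj
      have : ¬ (j : ℕ) < m := fun h => by have := (hM.pos j h).1; omega
      simp [hA, hB, this]
    have hJA : ∀ j : Fin d, JZ j - (A j : ℤ) = if (j : ℕ) < m then -(n : ℤ) else 0 := by
      intro j
      by_cases h : (j : ℕ) < m
      · simp [hJZ, hA, h]
      · simp [hJZ, hA, h, (hM.zero j (not_lt.1 h)).2.1]
    have hKB : ∀ j : Fin d, KZ j - (B j : ℤ) = if (j : ℕ) < m then -(n : ℤ) else 0 := by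
      intro j
      by_cases h : (j : ℕ) < m
      · simp [hKZ, hB, h]
      · simp [hKZ, hB, h, (hM.zero j (not_lt.1 h)).2.2]
    obtain ⟨E, hEan, hEeq, -⟩ := exists_analytic_rep (I := I) (J := JZ) (K := KZ)
      (J' := fun j => JZ j - A j) (K' := fun j => KZ j - B j) (R := R) (σ := -(N : ℝ))
      (isWord_dzMulti A B) (pl := pol I JZ KZ A B)
      (fun t G ht hG hGs => ker_dzMulti hG hGs (hadm t ht) hAB)
      (fun t ht => (hadm t ht).mono (fun j => by simp) (fun j => by simp)
        (fun j hj => by simp [hAB j hj]))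
      (by
        intro τ hτ j
        simp only [hJA, hKB]
        by_cases h : (j : ℕ) < m
        · simp only [h, if_true]
          have h1 : (I j : ℝ) * N ≤ n := by
            have : I j ≤ ∑ j, I j := Finset.single_le_sum (fun j _ => Nat.zero_le _)
              (Finset.mem_univ j)
            have h2 : I j * N ≤ n := by rw [hn, mul_comm]; exact Nat.mul_le_mul_left _ this
            exact_mod_cast h2
          have h3 : (0 : ℝ) ≤ I j := by positivity
          push_cast
          nlinarith
        · simp [h, (hM.zero j (not_lt.1 h)).1]) hg hgs hw
    refine ⟨fun t => E t / pol I JZ KZ A B t, fun t ht => ?_, fun t ht => ?_⟩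
    · exact (hEan t ht).meromorphicAt.div (analyticAt_pol _ _ _ _ _ _).meromorphicAt
    · simp only
      rw [← hEeq t ht, mul_div_cancel_left₀ _ (hpolne A B t ht hAB)]
  choose FN hFNm hFNf using hrepN
  obtain ⟨F, hFm, hFf⟩ := exists_meromorphic_glue hFNm hFNf
  have hT := hγ.mul (hE₀t hσ0)
  refine ⟨F, fun t => p₁⁻¹ t * E₀ t, hFm, hFf, ?_, hT.congr fun N =>
    Finset.sum_congr rfl fun x _ => congrArg _ (Finset.sum_congr rfl fun y _ => ?_)⟩
  swap
  · rfl
  have hmer : ∀ t : ℂ, -(1 / (2 * S)) < t.re →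
      MeromorphicAt (fun t => E₀ t / (p₁ t * t ^ m)) t := fun t ht =>
    (hE₀an t ht).meromorphicAt.div
      (((analyticAt_const.mul (analyticAt_pol _ _ _ _ _ _)).mul
        (analyticAt_id.pow m)).meromorphicAt)
  -- both continuations agree on a half plane and therefore near `0`
  have heq := eventuallyEq_of_halfPlane (F := F) (G := fun t => E₀ t / (p₁ t * t ^ m))
    (σ := -(1 / (2 * S))) (R := R) (fun t _ => hFm t) hmer (fun t ht => by
      have hne : p₁ t * t ^ m ≠ 0 := by
        have h0 : t ≠ 0 := by rintro rfl; simp at ht; linarith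
        refine mul_ne_zero (mul_ne_zero ?_ (hpolne A₀ B₀ t ht fun j hj => ?_)) (pow_ne_zero _ h0)
        · refine mul_ne_zero (pow_ne_zero _ (by norm_num)) ?_
          rw [Finset.prod_ne_zero_iff]
          intro j hj
          have := (hM.pos j (Finset.mem_filter.1 hj).2).1
          exact_mod_cast (by omega : I j ≠ 0)
        · rcases hcase j with ⟨h1, h2, h3⟩ | ⟨h1, h2, h3⟩
          · simp [hA₀, hB₀, h2, h3]
          · omega
      rw [hFf t ht]
      rw [← hE₀eq t ht, mul_div_cancel_left₀ _ hne]) (t := 0) (by simpa using hσ0)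
  filter_upwards [heq] with t ht
  rw [ht, zpow_neg, zpow_natCast, div_eq_mul_inv, mul_inv, Pi.inv_apply]
  ring

end LocalIntegral

end DivInt
end

noncomputable section
namespace DivInt

/-! ### The Cauchy–Pompeiu formula -/

section CauchyPompeiu

/-- The Cauchy–Pompeiu formula at `0` for functions with compact support, in polar coordinates:
`z⁻¹ ∂g/∂z̄` times the density `r` is half of the radial derivative plus `i / (2r)` times the angular one,
and the latter integrates to `0` over circles. -/
theorem integral_inv_mul_dbar {g : ℂ → ℂ} (hg : ContDiff ℝ ∞ g) (hs : HasCompactSupport g) :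
    ∫ z, z⁻¹ * ((fderiv ℝ g z 1 + Complex.I * fderiv ℝ g z Complex.I) / 2)
      = -(Real.pi : ℂ) * g 0 := by
  obtain ⟨R, hR0, hR⟩ : ∃ R : ℝ, 0 < R ∧ ∀ z, R ≤ ‖z‖ → g z = 0 ∧ fderiv ℝ g z = 0 := by
    have h2 := (hs.fderiv (𝕜 := ℝ)).isCompact.isBounded.union hs.isCompact.isBounded
    obtain ⟨R, hR⟩ := h2.subset_ball 0
    refine ⟨max R 1, by positivity, fun z hz => ⟨?_, ?_⟩⟩
    · by_contra h
      have := hR (Or.inr (subset_tsupport _ h))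
      simp only [Metric.mem_ball, dist_zero_right] at this
      linarith [le_max_left R 1]
    · by_contra h
      have := hR (Or.inl (subset_tsupport _ h))
      simp only [Metric.mem_ball, dist_zero_right] at this
      linarith [le_max_left R 1]
  have hdc : Continuous (fderiv ℝ g) := hg.continuous_fderiv (by simp)
  set E : ℝ → ℂ := fun θ => Complex.exp (θ * Complex.I) with hE
  have hEc : Continuous E := by fun_prop
  have hEn : ∀ θ, ‖E θ‖ = 1 := fun θ => Complex.norm_exp_ofReal_mul_I θ
  have hpol : ∀ p : ℝ × ℝ, Complex.polarCoord.symm p = p.1 * E p.2 := by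
    intro p
    simp [Complex.polarCoord_symm_apply, hE, Complex.exp_mul_I]
  set A : ℝ × ℝ → ℂ := fun p => fderiv ℝ g (p.1 * E p.2) (E p.2) with hA
  set B : ℝ × ℝ → ℂ := fun p => fderiv ℝ g (p.1 * E p.2) (Complex.I * E p.2) with hB
  have hAc : Continuous A := by
    refine Continuous.clm_apply (hdc.comp ?_) (by fun_prop)
    fun_prop
  have hBc : Continuous B := by
    refine Continuous.clm_apply (hdc.comp ?_) (by fun_prop)
    fun_prop
  have hlarge : ∀ p : ℝ × ℝ, R ≤ p.1 → g (p.1 * E p.2) = 0 ∧ fderiv ℝ g (p.1 * E p.2) = 0 := by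
    intro p hp
    refine hR _ ?_
    rw [norm_mul, hEn, mul_one, Complex.norm_real, Real.norm_eq_abs]
    exact hp.trans (le_abs_self _)
  have hint : ∀ C : ℝ × ℝ → ℂ, Continuous C → (∀ p, R ≤ p.1 → C p = 0) →
      IntegrableOn C (Ioi 0 ×ˢ Ioo (-Real.pi) Real.pi) := by
    intro C hC h0
    have h1 : IntegrableOn C (Icc 0 R ×ˢ Icc (-Real.pi) Real.pi) :=
      hC.continuousOn.integrableOn_compact (isCompact_Icc.prod isCompact_Icc)
    have h2 : IntegrableOn C ((Ioi R ×ˢ Ioo (-Real.pi) Real.pi)) := by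
      refine (integrableOn_zero (ε' := ℂ)).congr_fun (fun p hp => ?_)
        (measurableSet_Ioi.prod measurableSet_Ioo)
      exact (h0 p (le_of_lt hp.1)).symm
    refine (h1.union h2).mono_set ?_
    rintro ⟨r, θ⟩ ⟨h3, h4⟩
    rcases le_or_gt r R with h | h
    · exact Or.inl ⟨⟨le_of_lt h3, h⟩, ⟨h4.1.le, h4.2.le⟩⟩
    · exact Or.inr ⟨h, h4⟩
  have hAi := hint A hAc (fun p hp => by simp [hA, (hlarge p hp).2])
  have hBi := hint B hBc (fun p hp => by simp [hB, (hlarge p hp).2])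
  have hp2 := Real.pi_pos
  rw [← Complex.integral_comp_polarCoord_symm, polarCoord_target]
  have hcongr : ∀ p ∈ Ioi (0:ℝ) ×ˢ Ioo (-Real.pi) Real.pi,
      p.1 • ((Complex.polarCoord.symm p)⁻¹ * ((fderiv ℝ g (Complex.polarCoord.symm p) 1 +
        Complex.I * fderiv ℝ g (Complex.polarCoord.symm p) Complex.I) / 2))
      = (1 / 2 : ℂ) * A p + (Complex.I / 2) * B p := by
    rintro p ⟨h1, -⟩
    have h1' : (p.1 : ℂ) ≠ 0 := by exact_mod_cast (ne_of_gt h1)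
    have hlin : ∀ (Λ : ℂ →L[ℝ] ℂ) (z : ℂ), Λ z = z.re * Λ 1 + z.im * Λ Complex.I := by
      intro Λ z
      conv_lhs => rw [← Complex.re_add_im z]
      rw [map_add]
      congr 1
      · rw [show ((z.re : ℂ)) = z.re • (1:ℂ) by simp, map_smul]; simp
      · rw [show ((z.im : ℂ) * Complex.I) = z.im • Complex.I by simp, map_smul]; simp
    have hEe : E p.2 = Real.cos p.2 + Real.sin p.2 * Complex.I := by
      rw [hE]; simp only [Complex.exp_mul_I, Complex.ofReal_cos, Complex.ofReal_sin]
    have hEinv : (E p.2)⁻¹ = Real.cos p.2 - Real.sin p.2 * Complex.I := by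
      rw [hE]; simp only
      rw [← Complex.exp_neg, ← neg_mul, Complex.exp_mul_I]
      simp [sub_eq_add_neg]
    rw [hpol, hA, hB]
    simp only
    rw [hlin (fderiv ℝ g (p.1 * E p.2)) (E p.2),
      hlin (fderiv ℝ g (p.1 * E p.2)) (Complex.I * E p.2), mul_inv, hEinv]
    have e1 : (E p.2).re = Real.cos p.2 := by rw [hEe]; simp [-Complex.ofReal_cos, -Complex.ofReal_sin]
    have e2 : (E p.2).im = Real.sin p.2 := by rw [hEe]; simp [-Complex.ofReal_cos, -Complex.ofReal_sin]
    have e3 : (Complex.I * E p.2).re = - Real.sin p.2 := by simp [e2]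
    have e4 : (Complex.I * E p.2).im = Real.cos p.2 := by simp [e1]
    rw [e1, e2, e3, e4, Complex.real_smul]
    push_cast
    field_simp
    linear_combination (-(Complex.sin p.2) * (fderiv ℝ g (p.1 * E p.2) Complex.I)) * Complex.I_sq
  rw [setIntegral_congr_fun (measurableSet_Ioi.prod measurableSet_Ioo) hcongr,
    integral_add (hAi.const_mul _) (hBi.const_mul _), integral_const_mul, integral_const_mul]
  have hder : ∀ (r θ : ℝ), HasDerivAt (fun r : ℝ => g (r * E θ)) (A (r, θ)) r := by
    intro r θ
    have h1 : HasDerivAt (fun r : ℝ => (r : ℂ) * E θ) (E θ) r := by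
      simpa using (Complex.ofRealCLM.hasDerivAt (x := r)).mul_const (E θ)
    exact ((hg.differentiable (by simp)) _).hasFDerivAt.comp_hasDerivAt r h1
  have hdert : ∀ (r θ : ℝ), HasDerivAt (fun θ : ℝ => g (r * E θ)) (r • B (r, θ)) θ := by
    intro r θ
    have h1 : HasDerivAt (fun θ : ℝ => (r : ℂ) * E θ) (r • (Complex.I * E θ)) θ := by
      have := ((Complex.ofRealCLM.hasDerivAt (x := θ)).mul_const Complex.I).cexp.const_mul (r : ℂ)
      convert! this using 1
      simp only [hE, Complex.ofRealCLM_apply, Complex.real_smul]; push_cast; ring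
    have := ((hg.differentiable (by simp)) _).hasFDerivAt.comp_hasDerivAt θ h1
    rwa [map_smul] at this
  have iA : ∫ p in Ioi (0:ℝ) ×ˢ Ioo (-Real.pi) Real.pi, A p = -(2 * Real.pi : ℂ) * g 0 := by
    rw [Measure.volume_eq_prod, ← setIntegral_prod_swap, setIntegral_prod]
    · have : ∀ θ ∈ Ioo (-Real.pi) Real.pi, ∫ r in Ioi (0:ℝ), A (Prod.swap (θ, r)) = - g 0 := by
        intro θ _
        have h := integral_Ioi_of_hasDerivAt_of_tendsto' (f := fun r : ℝ => g (r * E θ))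
          (f' := fun r => A (r, θ)) (a := 0) (m := 0) (fun r _ => hder r θ) ?_ ?_
        · simpa using h
        · have h1 : IntegrableOn (fun r => A (r, θ)) (Icc 0 R) :=
            (hAc.comp (by fun_prop : Continuous fun r : ℝ => (r, θ))).continuousOn.integrableOn_compact isCompact_Icc
          have h2 : IntegrableOn (fun r => A (r, θ)) (Ioi R) :=
            (integrableOn_zero (ε' := ℂ)).congr_fun (fun r hr => by
              simp [hA, (hlarge (r, θ) (le_of_lt hr)).2]) measurableSet_Ioi
          refine (h1.union h2).mono_set fun r hr => ?_
          rcases le_or_gt r R with h | h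
          · exact Or.inl ⟨le_of_lt hr, h⟩
          · exact Or.inr h
        · refine tendsto_const_nhds.congr' ?_
          filter_upwards [eventually_ge_atTop R] with r hr
          exact ((hlarge (r, θ) hr).1).symm
      rw [setIntegral_congr_fun measurableSet_Ioo this, setIntegral_const]
      simp [Real.volume_real_Ioo, hp2.le]
      left
      ring
    · have := hAi
      rw [IntegrableOn, Measure.volume_eq_prod, ← Measure.prod_restrict] at this
      rw [IntegrableOn, ← Measure.prod_restrict]
      exact this.swap
  have iB : ∫ p in Ioi (0:ℝ) ×ˢ Ioo (-Real.pi) Real.pi, B p = 0 := by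
    rw [Measure.volume_eq_prod, setIntegral_prod]
    · rw [← integral_zero (α := ℝ) (G := ℂ) (μ := volume.restrict (Ioi 0))]
      refine setIntegral_congr_fun measurableSet_Ioi fun r hr => ?_
      have hr' : r ≠ 0 := ne_of_gt hr
      have h := intervalIntegral.integral_eq_sub_of_hasDerivAt (a := -Real.pi) (b := Real.pi)
        (fun θ _ => hdert r θ) (Continuous.intervalIntegrable (by fun_prop) _ _)
      have hEp : E Real.pi = E (-Real.pi) := by
        simp only [hE, Complex.ofReal_neg, neg_mul, Complex.exp_neg, Complex.exp_pi_mul_I]; norm_num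
      rw [hEp, sub_self, intervalIntegral.integral_smul, intervalIntegral.integral_of_le (by linarith),
        integral_Ioc_eq_integral_Ioo] at h
      exact (smul_eq_zero.1 h).resolve_left hr'
    · exact hBi
  rw [iA, iB]
  ring

/-- Wirtinger derivatives commute with a coordinate inclusion. -/
theorem dzbar_comp_of_hasFDerivAt {n d : ℕ} {ι : Cd n → Cd d} {Λ : Cd n →L[ℝ] Cd d} {z : Cd n}
    (hι : HasFDerivAt ι Λ z) {k : Fin n} {j : Fin d}
    (hΛ : ∀ a : ℂ, Λ (Pi.single k a) = Pi.single j a) {g : Cd d → ℂ} (hg : ContDiff ℝ ∞ g) :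
    dzbar k (g ∘ ι) z = dzbar j g (ι z) := by
  have h := ((hg.differentiable (by simp)) (ι z)).hasFDerivAt.comp z hι
  simp [dzbar, h.fderiv, hΛ]

theorem dbarL_comp {n d : ℕ} {ι : Cd n → Cd d} {Λ : Cd n →L[ℝ] Cd d}
    (hι : ∀ z, HasFDerivAt ι Λ z) {f : Fin n → Fin d}
    (hΛ : ∀ k (a : ℂ), Λ (Pi.single k a) = Pi.single (f k) a) {g : Cd d → ℂ} (hg : ContDiff ℝ ∞ g)
    (l : List (Fin n)) : dbarL l (g ∘ ι) = dbarL (l.map f) g ∘ ι := by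
  induction l with
  | nil => rfl
  | cons k l ih =>
    funext z
    change dzbar k (dbarL l (g ∘ ι)) z = dzbar (f k) (dbarL (l.map f) g) (ι z)
    rw [ih, dzbar_comp_of_hasFDerivAt (hι z) (hΛ k) ((isWord_dbarL _).contDiff hg)]

/-- The singular kernels `∏_{j ∈ S} w_j⁻¹ ∏_i log |w_{τ i}|` of the coefficient integrals. -/
def logKer {n p : ℕ} (S : Finset (Fin n)) (τ : Fin p → Fin n) (w : Cd n) : ℂ :=
  (∏ j ∈ S, (w j)⁻¹) * ∏ i, (Real.log ‖w (τ i)‖ : ℂ)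

theorem measurable_logKer {n p : ℕ} (S : Finset (Fin n)) (τ : Fin p → Fin n) :
    Measurable (logKer S τ) := by
  unfold logKer
  refine (Finset.measurable_fun_prod _ fun j _ => (measurable_pi_apply j).inv).mul
    (Finset.measurable_fun_prod _ fun i _ => ?_)
  exact Complex.measurable_ofReal.comp (Real.measurable_log.comp (measurable_pi_apply _).norm)

theorem abs_log_le_rpow {a R : ℝ} (ha : 0 < a) (hR : 1 ≤ R) :
    ∃ C : ℝ, 0 ≤ C ∧ ∀ x, 0 < x → x ≤ R → |Real.log x| ≤ C * x ^ (-a) := by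
  refine ⟨1 / a + Real.log R * R ^ a, by have := Real.log_nonneg hR; positivity, fun x hx hxR => ?_⟩
  rw [Real.rpow_neg hx.le, ← div_eq_mul_inv, le_div_iff₀ (Real.rpow_pos_of_pos hx a)]
  have hl := Real.log_nonneg hR
  rcases le_or_gt x 1 with h | h
  · have := (Real.abs_log_mul_self_rpow_lt x a hx h ha).le
    rw [abs_mul, abs_of_pos (Real.rpow_pos_of_pos hx a)] at this
    have : 0 ≤ Real.log R * R ^ a := by positivity
    linarith
  · rw [abs_of_nonneg (Real.log_nonneg h.le)]
    have h1 : Real.log x ≤ Real.log R := Real.log_le_log hx hxR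
    have h2 : x ^ a ≤ R ^ a := Real.rpow_le_rpow hx.le hxR ha.le
    have : Real.log x * x ^ a ≤ Real.log R * R ^ a := by gcongr
    have : 0 < 1 / a := by positivity
    linarith

/-- The kernels are locally integrable: each logarithm is absorbed in a small power of the coordinate. -/
theorem integrable_logKer {n p : ℕ} (S : Finset (Fin n)) (τ : Fin p → Fin n) {b : Cd n → ℂ}
    (hb : Continuous b) (hs : HasCompactSupport b) : Integrable (fun w => logKer S τ w * b w) := by
  obtain ⟨R, hR⟩ := hs.isCompact.isBounded.subset_ball 0
  set R' := max R 1
  obtain ⟨B, hB⟩ := hb.bounded_above_of_compact_support hs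
  -- `p` logarithms cost at most `|w_j|^{-p a}`, with `1 + p a < 2`
  set a : ℝ := 1 / (2 * p + 2) with ha
  have ha0 : 0 < a := by positivity
  obtain ⟨C, hC0, hC⟩ := abs_log_le_rpow ha0 (le_max_right R 1)
  have hB0 : 0 ≤ B := (norm_nonneg _).trans (hB 0)
  refine integrable_of_le_monomial (R := R') (C := C ^ p * B)
    (s := fun j => (if j ∈ S then -1 else 0) + ∑ i, (if τ i = j then -a else 0))
    ((measurable_logKer S τ).aestronglyMeasurable.mul hb.aestronglyMeasurable) (fun j => ?_)
    (fun z hz => ?_) ?_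
  · have h1 : ∑ i, (if τ i = j then -a else 0) ≥ ∑ _i : Fin p, -a :=
      Finset.sum_le_sum fun i _ => by split_ifs <;> linarith
    have h2 : (p : ℝ) * a < 1 := by
      rw [ha, mul_one_div, div_lt_one (by positivity)]
      have : (0:ℝ) ≤ p := by positivity
      linarith
    simp only [Finset.sum_const, Finset.card_univ, Fintype.card_fin, nsmul_eq_mul] at h1
    split_ifs <;> linarith
  · have : b z = 0 := by
      by_contra h
      have := hR (subset_tsupport _ h)
      simp only [Metric.mem_ball, dist_zero_right] at this
      linarith [le_max_left R 1]
    rw [this, mul_zero]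
  · filter_upwards [ae_ne_zero (d := n)] with z hz
    by_cases hzR : R ≤ ‖z‖
    · have : b z = 0 := by
        by_contra h
        have := hR (subset_tsupport _ h)
        simp only [Metric.mem_ball, dist_zero_right] at this
        linarith
      rw [this, mul_zero, norm_zero]
      have : ∀ j, 0 ≤ ‖z j‖ ^ ((if j ∈ S then (-1:ℝ) else 0) + ∑ i, (if τ i = j then -a else 0)) :=
        fun j => by positivity
      exact mul_nonneg (by positivity) (Finset.prod_nonneg fun j _ => this j)
    have hzR' : ∀ j, ‖z j‖ ≤ R' := fun j =>
      (norm_le_pi_norm z j).trans ((not_le.1 hzR).le.trans (le_max_left _ _))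
    have hpos : ∀ j, 0 < ‖z j‖ := fun j => norm_pos_iff.2 (hz j)
    have e1 : ∏ j, ‖z j‖ ^ ((if j ∈ S then (-1:ℝ) else 0) + ∑ i, (if τ i = j then -a else 0))
        = (∏ j ∈ S, ‖z j‖⁻¹) * ∏ i, ‖z (τ i)‖ ^ (-a) := by
      simp_rw [fun j => Real.rpow_add (hpos j)]
      rw [Finset.prod_mul_distrib]
      congr 1
      · rw [← Finset.univ_inter S, ← Finset.prod_ite_mem, Finset.univ_inter]
        refine Finset.prod_congr rfl fun j _ => ?_
        split_ifs <;> simp [Real.rpow_neg_one]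
      · simp_rw [fun j => (Real.rpow_sum_of_pos (hpos j) (fun i => if τ i = j then -a else 0) Finset.univ)]
        rw [Finset.prod_comm]
        refine Finset.prod_congr rfl fun i _ => ?_
        rw [Finset.prod_eq_single (τ i)]
        · simp
        · intro j _ hj; simp [hj.symm]
        · simp
    rw [e1, norm_mul, logKer, norm_mul, norm_prod, norm_prod]
    have e2 : ∏ i, ‖(Real.log ‖z (τ i)‖ : ℂ)‖ ≤ C ^ p * ∏ i, ‖z (τ i)‖ ^ (-a) := by
      calc ∏ i, ‖(Real.log ‖z (τ i)‖ : ℂ)‖ ≤ ∏ i, (C * ‖z (τ i)‖ ^ (-a)) := by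
            refine Finset.prod_le_prod (fun i _ => norm_nonneg _) fun i _ => ?_
            rw [Complex.norm_real, Real.norm_eq_abs]
            exact hC _ (hpos _) (hzR' _)
        _ = _ := by rw [Finset.prod_mul_distrib]; simp
    simp_rw [norm_inv]
    have e3 : 0 ≤ ∏ j ∈ S, ‖z j‖⁻¹ := Finset.prod_nonneg fun j _ => by positivity
    calc (∏ j ∈ S, ‖z j‖⁻¹) * (∏ i, ‖(Real.log ‖z (τ i)‖ : ℂ)‖) * ‖b z‖
        ≤ (∏ j ∈ S, ‖z j‖⁻¹) * (C ^ p * ∏ i, ‖z (τ i)‖ ^ (-a)) * B := by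
          refine mul_le_mul (mul_le_mul_of_nonneg_left e2 e3) (hB z) (norm_nonneg _) ?_
          exact mul_nonneg e3 (mul_nonneg (by positivity) (Finset.prod_nonneg fun j _ => by positivity))
      _ = _ := by ring

/-- The Cauchy–Pompeiu formula in several variables. -/
theorem integral_prod_inv_mul_dbarL {n : ℕ} {g : Cd n → ℂ} (hg : ContDiff ℝ ∞ g)
    (hs : HasCompactSupport g) :
    ∫ u, (∏ j, (u j)⁻¹) * dbarL (List.finRange n) g u = (-(Real.pi : ℂ)) ^ n * g 0 := by
  induction n with
  | zero =>
    simp only [Finset.univ_eq_empty, Finset.prod_empty, one_mul, List.finRange_zero, pow_zero]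
    rw [Measure.volume_pi_eq_dirac (0 : Cd 0), integral_dirac]
    rfl
  | succ n ih =>
    set Φ := (MeasurableEquiv.piFinSuccAbove (fun _ : Fin (n + 1) => ℂ) 0)
    have hΦ : MeasurePreserving Φ := volume_preserving_piFinSuccAbove (fun _ : Fin (n + 1) => ℂ) 0
    have hsymm : ∀ p : ℂ × Cd n, Φ.symm p = Fin.cons p.1 p.2 := fun p => by
      simp [Φ, MeasurableEquiv.piFinSuccAbove, Fin.insertNthEquiv]
    set h : Cd (n + 1) → ℂ := dbarL ((List.finRange n).map Fin.succ) g with hh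
    have hhs : ContDiff ℝ ∞ h := (isWord_dbarL _).contDiff hg
    have hhc : HasCompactSupport h := (isWord_dbarL _).hasCompactSupport hs
    have hlist : dbarL (List.finRange (n + 1)) g = dzbar 0 h := by
      rw [List.finRange_succ]; rfl
    have hI : Integrable (fun u => (∏ j, (u j)⁻¹) * dbarL (List.finRange (n + 1)) g u) := by
      have := integrable_logKer (Finset.univ : Finset (Fin (n + 1))) (Fin.elim0 : Fin 0 → Fin (n + 1))
        ((isWord_dbarL (List.finRange (n + 1))).contDiff hg).continuous
        ((isWord_dbarL (List.finRange (n + 1))).hasCompactSupport hs)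
      simpa [logKer] using this
    rw [← hΦ.symm.integral_comp Φ.symm.measurableEmbedding, Measure.volume_eq_prod,
      integral_prod_symm]
    swap
    · rw [← Measure.volume_eq_prod]
      exact (hΦ.symm.integrable_comp_emb Φ.symm.measurableEmbedding).2 hI
    have hcz : ∀ (u : Cd n), ContDiff ℝ ∞ (fun z : ℂ => (Fin.cons z u : Cd (n + 1))) := fun u => by
      rw [contDiff_pi]
      intro i
      refine Fin.cases ?_ (fun i => ?_) i
      · exact contDiff_id
      · simpa using contDiff_const
    have hbd : ∀ (u : Cd n), HasCompactSupport (fun z : ℂ => h (Fin.cons z u)) := fun u => by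
      obtain ⟨R, hR⟩ := hhc.isCompact.isBounded.subset_closedBall 0
      refine HasCompactSupport.of_support_subset_isCompact (isCompact_closedBall (0:ℂ) R) fun z hz => ?_
      have := hR (subset_tsupport _ hz)
      rw [mem_closedBall_zero_iff] at this ⊢
      refine le_trans ?_ this
      exact norm_le_pi_norm (Fin.cons z u : Cd (n + 1)) 0
    have hin : ∀ u : Cd n, ∫ z : ℂ, (∏ j, (Φ.symm (z, u) j)⁻¹) *
        dbarL (List.finRange (n + 1)) g (Φ.symm (z, u))
        = -(Real.pi : ℂ) * ((∏ j, (u j)⁻¹) * dbarL (List.finRange n) (g ∘ (fun v : Cd n => (Fin.cons (0:ℂ) v : Cd (n + 1)))) u) := by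
      intro u
      have h1 := integral_inv_mul_dbar (hhs.comp (hcz u)) (hbd u)
      have h2 : dbarL (List.finRange n) (g ∘ (fun v : Cd n => (Fin.cons (0:ℂ) v : Cd (n + 1)))) u
          = h (Fin.cons 0 u) := by
        have hL : ∀ z : Cd n, HasFDerivAt (fun u : Cd n => (Fin.cons (0:ℂ) u : Cd (n + 1)))
            (ContinuousLinearMap.pi (Fin.cons (0 : Cd n →L[ℝ] ℂ)
              (fun i => ContinuousLinearMap.proj i)) : Cd n →L[ℝ] Cd (n + 1)) z := fun z => by
          rw [hasFDerivAt_pi']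
          intro i
          refine Fin.cases ?_ (fun i => ?_) i
          · simpa using hasFDerivAt_const (𝕜 := ℝ) (0:ℂ) z
          · exact (ContinuousLinearMap.proj (R := ℝ) (φ := fun _ : Fin n => ℂ) i).hasFDerivAt
        exact congrFun (dbarL_comp hL (f := Fin.succ) (fun k a => by
          ext i
          refine Fin.cases ?_ (fun i => ?_) i
          · simp
          · simp [Pi.single_apply]) hg (List.finRange n)) u
      rw [h2]
      rw [show -(Real.pi:ℂ) * ((∏ j, (u j)⁻¹) * h (Fin.cons 0 u))
        = (∏ j, (u j)⁻¹) * (-(Real.pi:ℂ) * h (Fin.cons 0 u)) by ring]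
      rw [Function.comp_apply] at h1
      rw [← h1, ← integral_const_mul]
      refine integral_congr_ae (ae_of_all _ fun z => ?_)
      simp only
      rw [hsymm, Fin.prod_univ_succ, hlist]
      simp only [Fin.cons_zero, Fin.cons_succ]
      have h3 : HasFDerivAt (fun z : ℂ => (Fin.cons z u : Cd (n + 1)))
          (ContinuousLinearMap.pi (Fin.cons (ContinuousLinearMap.id ℝ ℂ) (fun i => 0)) :
            ℂ →L[ℝ] Cd (n + 1)) z := by
        rw [hasFDerivAt_pi']
        intro i
        refine Fin.cases ?_ (fun i => ?_) i
        · exact hasFDerivAt_id z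
        · exact hasFDerivAt_const (u i) z
      have h4 := (((hhs.differentiable (by simp)) (Fin.cons z u)).hasFDerivAt.comp z h3).fderiv
      have h5 : ∀ a : ℂ, (ContinuousLinearMap.pi (Fin.cons (ContinuousLinearMap.id ℝ ℂ)
          (fun i => 0)) : ℂ →L[ℝ] Cd (n + 1)) a = Pi.single 0 a := by
        intro a
        ext i
        refine Fin.cases ?_ (fun i => ?_) i
        · simp
        · simp
      change _ = _ * (z⁻¹ * ((fderiv ℝ (h ∘ fun z : ℂ => (Fin.cons z u : Cd (n + 1))) z 1 +
        Complex.I * fderiv ℝ (h ∘ fun z : ℂ => (Fin.cons z u : Cd (n + 1))) z Complex.I) / 2))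
      rw [h4]
      simp only [ContinuousLinearMap.comp_apply, h5, dzbar]
      ring
    simp_rw [hin]
    rw [integral_const_mul, ih]
    · rw [pow_succ, Function.comp_apply]
      have : (Fin.cons (0:ℂ) (0 : Cd n) : Cd (n + 1)) = 0 := by
        ext i
        refine Fin.cases ?_ (fun i => ?_) i <;> simp
      rw [this]; ring
    · refine hg.comp ?_
      rw [contDiff_pi]
      intro i
      refine Fin.cases ?_ (fun i => ?_) i
      · simpa using contDiff_const
      · simpa using contDiff_apply ℝ ℂ i
    · obtain ⟨R, hR⟩ := hs.isCompact.isBounded.subset_closedBall 0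
      refine HasCompactSupport.of_support_subset_isCompact (isCompact_closedBall (0 : Cd n) R) fun z hz => ?_
      have := hR (subset_tsupport _ hz)
      rw [mem_closedBall_zero_iff] at this ⊢
      refine le_trans ?_ this
      refine (pi_norm_le_iff_of_nonneg (norm_nonneg _)).2 fun i => ?_
      simpa using norm_le_pi_norm (Fin.cons (0:ℂ) z : Cd (n + 1)) i.succ

end CauchyPompeiu

end DivInt
end

noncomputable section
namespace DivInt

/-! ### Coefficient integrals over coordinate planes -/

section CoordinatePlanes

variable {d c : ℕ}

/-- The parametrisation of the coordinate plane `{z_{σ 0} = ⋯ = z_{σ (c-1)} = 0}` for a permutation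
`σ` of the coordinates. -/
def permSlice (σ : Equiv.Perm (Fin d)) (c : ℕ) (w : Cd (d - c)) : Cd d :=
  fun j => slice d c w (σ.symm j)

/-- The last `d - c` coordinates of `ℂ^d`. -/
def tailIdx (d c : ℕ) (k : Fin (d - c)) : Fin d := ⟨c + k, by have := k.isLt; omega⟩

/-- The splitting of the `d` coordinates into the first `c` and the last `d - c`, after a
permutation. -/
def splitEquiv (hc : c ≤ d) (σ : Equiv.Perm (Fin d)) : Fin c ⊕ Fin (d - c) ≃ Fin d :=
  (finSumFinEquiv.trans (finCongr (by omega : c + (d - c) = d))).trans σ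

theorem splitEquiv_inl (hc : c ≤ d) (σ : Equiv.Perm (Fin d)) (i : Fin c) :
    splitEquiv hc σ (Sum.inl i) = σ (Fin.castLE hc i) := rfl

theorem splitEquiv_inr (hc : c ≤ d) (σ : Equiv.Perm (Fin d)) (k : Fin (d - c)) :
    splitEquiv hc σ (Sum.inr k) = σ (tailIdx d c k) := rfl

theorem permSlice_head (hc : c ≤ d) (σ : Equiv.Perm (Fin d)) (w : Cd (d - c)) (i : Fin c) :
    permSlice σ c w (σ (Fin.castLE hc i)) = 0 := by
  simp [permSlice, slice]

theorem permSlice_tail (σ : Equiv.Perm (Fin d)) (w : Cd (d - c)) (k : Fin (d - c)) :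
    permSlice σ c w (σ (tailIdx d c k)) = w k := by
  simp [permSlice, slice, tailIdx]

theorem continuous_slice (d c : ℕ) : Continuous (slice d c) := by
  refine continuous_pi fun j => ?_
  unfold slice
  split_ifs
  · exact continuous_apply _
  · exact continuous_const

theorem contDiff_slice (d c : ℕ) : ContDiff ℝ ∞ (slice d c) := by
  refine contDiff_pi.2 fun j => ?_
  unfold slice
  split_ifs
  · exact contDiff_apply ℝ ℂ _
  · exact contDiff_const

theorem contDiff_permSlice (σ : Equiv.Perm (Fin d)) (c : ℕ) : ContDiff ℝ ∞ (permSlice σ c) := by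
  refine contDiff_pi.2 fun j => ?_
  exact contDiff_pi.1 (contDiff_slice d c) _

theorem hasCompactSupport_comp_permSlice {E : Type*} [Zero E] {g : Cd d → E}
    (hs : HasCompactSupport g) (σ : Equiv.Perm (Fin d)) :
    HasCompactSupport (fun w => g (permSlice σ c w)) := by
  obtain ⟨R, hR⟩ := hs.isCompact.isBounded.subset_closedBall 0
  refine HasCompactSupport.of_support_subset_isCompact
    (isCompact_closedBall (0 : Cd (d - c)) R) fun w hw => ?_
  have := hR (subset_tsupport _ hw)
  rw [mem_closedBall_zero_iff] at this ⊢
  refine le_trans ?_ this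
  refine (pi_norm_le_iff_of_nonneg (norm_nonneg _)).2 fun k => ?_
  rw [← permSlice_tail σ w k]
  exact norm_le_pi_norm (permSlice σ c w) _

/-- The splitting of `ℂ^d` along `splitEquiv`. -/
def splitMeas (hc : c ≤ d) (σ : Equiv.Perm (Fin d)) : Cd c × Cd (d - c) ≃ᵐ Cd d :=
  (MeasurableEquiv.sumPiEquivProdPi (fun _ : Fin c ⊕ Fin (d - c) => ℂ)).symm.trans
    (MeasurableEquiv.piCongrLeft (fun _ : Fin d => ℂ) (splitEquiv hc σ))

theorem measurePreserving_splitMeas (hc : c ≤ d) (σ : Equiv.Perm (Fin d)) :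
    MeasurePreserving (splitMeas hc σ) :=
  (volume_measurePreserving_sumPiEquivProdPi_symm (fun _ : Fin c ⊕ Fin (d - c) => ℂ)).trans
    (volume_measurePreserving_piCongrLeft (fun _ : Fin d => ℂ) (splitEquiv hc σ))

theorem splitMeas_head (hc : c ≤ d) (σ : Equiv.Perm (Fin d)) (p : Cd c × Cd (d - c)) (i : Fin c) :
    splitMeas hc σ p (σ (Fin.castLE hc i)) = p.1 i := by
  rw [← splitEquiv_inl hc]
  exact Equiv.piCongrLeft_apply_apply (fun _ : Fin d => ℂ) _ _ _

theorem splitMeas_tail (hc : c ≤ d) (σ : Equiv.Perm (Fin d)) (p : Cd c × Cd (d - c))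
    (k : Fin (d - c)) : splitMeas hc σ p (σ (tailIdx d c k)) = p.2 k := by
  rw [← splitEquiv_inr hc]
  exact Equiv.piCongrLeft_apply_apply (fun _ : Fin d => ℂ) _ _ _

theorem splitMeas_ext (hc : c ≤ d) (σ : Equiv.Perm (Fin d)) {z z' : Cd d}
    (h1 : ∀ i, z (σ (Fin.castLE hc i)) = z' (σ (Fin.castLE hc i)))
    (h2 : ∀ k, z (σ (tailIdx d c k)) = z' (σ (tailIdx d c k))) : z = z' := by
  funext j
  obtain ⟨x, rfl⟩ := (splitEquiv hc σ).surjective j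
  rcases x with i | k
  · exact h1 i
  · exact h2 k

theorem splitMeas_zero (hc : c ≤ d) (σ : Equiv.Perm (Fin d)) (w : Cd (d - c)) :
    splitMeas hc σ (0, w) = permSlice σ c w :=
  splitMeas_ext hc σ (fun i => by rw [splitMeas_head, permSlice_head]; rfl)
    (fun k => by rw [splitMeas_tail, permSlice_tail])

/-- The integrand over `ℂ^d` which reduces to a coordinate plane by the Cauchy–Pompeiu formula. -/
theorem integrable_head_logKer (hc : c ≤ d) (σ : Equiv.Perm (Fin d)) {p : ℕ}
    (S : Finset (Fin (d - c))) (τ : Fin p → Fin (d - c)) {b : Cd d → ℂ}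
    (hb : Continuous b) (hs : HasCompactSupport b) :
    Integrable (fun z : Cd d => (∏ i : Fin c, (z (σ (Fin.castLE hc i)))⁻¹) *
      logKer S τ (fun k => z (σ (tailIdx d c k))) * b z) := by
  have h := integrable_logKer
    ((Finset.univ.disjSum S).map (splitEquiv hc σ).toEmbedding)
    (fun i => σ (tailIdx d c (τ i))) hb hs
  refine h.congr (ae_of_all _ fun z => ?_)
  simp only [logKer, Finset.prod_map, Finset.prod_disjSum, Equiv.coe_toEmbedding, splitEquiv_inl,
    splitEquiv_inr]
  ring

/-- The Cauchy–Pompeiu formula in the first `c` permuted coordinates, with a kernel in the remaining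
ones. -/
theorem integral_head_logKer (hc : c ≤ d) (σ : Equiv.Perm (Fin d)) {p : ℕ}
    (S : Finset (Fin (d - c))) (τ : Fin p → Fin (d - c)) {g : Cd d → ℂ}
    (hg : ContDiff ℝ ∞ g) (hs : HasCompactSupport g) :
    ∫ z : Cd d, (∏ i : Fin c, (z (σ (Fin.castLE hc i)))⁻¹) *
        logKer S τ (fun k => z (σ (tailIdx d c k))) *
        dbarL ((List.finRange c).map (fun i => σ (Fin.castLE hc i))) g z
      = (-(Real.pi : ℂ)) ^ c * ∫ w, logKer S τ w * g (permSlice σ c w) := by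
  have hD := isWord_dbarL ((List.finRange c).map (fun i => σ (Fin.castLE hc i)))
  have hI := integrable_head_logKer hc σ S τ (hD.contDiff hg).continuous (hD.hasCompactSupport hs)
  have hΦ := measurePreserving_splitMeas hc σ
  rw [← hΦ.integral_comp (splitMeas hc σ).measurableEmbedding, Measure.volume_eq_prod,
    integral_prod_symm]
  swap
  · rw [← Measure.volume_eq_prod]
    exact (hΦ.integrable_comp_emb (splitMeas hc σ).measurableEmbedding).2 hI
  rw [← integral_const_mul]
  refine integral_congr_ae (ae_of_all _ fun w => ?_)
  simp only [splitMeas_head, splitMeas_tail]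
  set ι : Cd c → Cd d := fun u => splitMeas hc σ (u, w) with hι
  have hιd : ∀ u, HasFDerivAt ι (ContinuousLinearMap.pi fun j => Sum.elim
      (fun i => ContinuousLinearMap.proj (R := ℝ) (φ := fun _ : Fin c => ℂ) i) (fun _ => 0)
      ((splitEquiv hc σ).symm j)) u := by
    intro u
    rw [hasFDerivAt_pi']
    intro j
    obtain ⟨x, rfl⟩ := (splitEquiv hc σ).surjective j
    rcases x with i | k
    · have : (fun u => ι u (splitEquiv hc σ (Sum.inl i))) = fun u => u i := by
        funext u; rw [splitEquiv_inl, hι]; exact splitMeas_head hc σ (u, w) i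
      rw [this]
      convert! (ContinuousLinearMap.proj (R := ℝ) (φ := fun _ : Fin c => ℂ) i).hasFDerivAt using 1
      ext; simp
    · have : (fun u => ι u (splitEquiv hc σ (Sum.inr k))) = fun u => w k := by
        funext u; rw [splitEquiv_inr, hι]; exact splitMeas_tail hc σ (u, w) k
      rw [this]
      have h0 := hasFDerivAt_const (𝕜 := ℝ) (w k) u
      convert! h0 using 1
      ext; simp
  have hιs : ContDiff ℝ ∞ ι := by
    rw [contDiff_pi]
    intro j
    obtain ⟨x, rfl⟩ := (splitEquiv hc σ).surjective j
    rcases x with i | k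
    · have : (fun u => ι u (splitEquiv hc σ (Sum.inl i))) = fun u => u i := by
        funext u; rw [splitEquiv_inl, hι]; exact splitMeas_head hc σ (u, w) i
      rw [this]
      exact contDiff_apply ℝ ℂ i
    · have : (fun u => ι u (splitEquiv hc σ (Sum.inr k))) = fun u => w k := by
        funext u; rw [splitEquiv_inr, hι]; exact splitMeas_tail hc σ (u, w) k
      rw [this]
      exact contDiff_const
  have hcomp := dbarL_comp (n := c) hιd (f := fun i => σ (Fin.castLE hc i)) (fun i a => by
    ext j
    obtain ⟨x, rfl⟩ := (splitEquiv hc σ).surjective j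
    rcases x with i' | k
    · rw [← splitEquiv_inl hc]
      simp [Pi.single_apply]
    · rw [← splitEquiv_inl hc]
      simp) hg (List.finRange c)
  have hcs : HasCompactSupport (g ∘ ι) := by
    obtain ⟨R, hR⟩ := hs.isCompact.isBounded.subset_closedBall 0
    refine HasCompactSupport.of_support_subset_isCompact
      (isCompact_closedBall (0 : Cd c) R) fun u hu => ?_
    have := hR (subset_tsupport _ hu)
    rw [mem_closedBall_zero_iff] at this ⊢
    refine le_trans ?_ this
    refine (pi_norm_le_iff_of_nonneg (norm_nonneg _)).2 fun k => ?_
    have h2 : ι u (σ (Fin.castLE hc k)) = u k := splitMeas_head hc σ (u, w) k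
    rw [← h2]
    exact norm_le_pi_norm (ι u) _
  have hCP := integral_prod_inv_mul_dbarL (hg.comp hιs) hcs
  rw [hcomp] at hCP
  rw [← splitMeas_zero hc]
  change _ = _ * (_ * (g ∘ ι) 0)
  rw [mul_left_comm, ← hCP, ← integral_const_mul]
  refine integral_congr_ae (ae_of_all _ fun u => ?_)
  simp only [Function.comp_apply, hι]
  ring

/-- If `p` logarithms occur, at least `m - p` of the `m` branches are free of them, and `c` of these may
be taken as the first coordinates. -/
theorem exists_perm_avoiding {m p : ℕ} (hm : m ≤ d) (hpc : p + c ≤ m) (τ : Fin p → Fin d) :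
    ∃ σ : Equiv.Perm (Fin d), (∀ k : Fin d, (k : ℕ) < c → (σ k : ℕ) < m) ∧
      ∀ k : Fin d, (k : ℕ) < c → ∀ i, σ k ≠ τ i := by
  set A : Finset (Fin d) := Finset.univ.filter (fun j => (j : ℕ) < m) \ Finset.univ.image τ with hA
  have hcard : c ≤ A.card := by
    have h1 : (Finset.univ.filter (fun j : Fin d => (j : ℕ) < m)).card = m := by
      rw [Fin.card_filter_val_lt]; omega
    have h2 : (Finset.univ.image τ).card ≤ p := Finset.card_image_le.trans (by simp)
    have h3 := Finset.le_card_sdiff (Finset.univ.image τ)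
      (Finset.univ.filter (fun j : Fin d => (j : ℕ) < m))
    rw [← hA] at h3
    omega
  obtain ⟨T, hTA, hT⟩ := Finset.exists_subset_card_eq hcard
  have e : {k : Fin d // (k : ℕ) < c} ≃ {x : Fin d // x ∈ T} := Fintype.equivOfCardEq (by
    rw [Fintype.card_coe, hT, Fintype.card_subtype, Fin.card_filter_val_lt]; omega)
  refine ⟨e.extendSubtype, fun k hk => ?_, fun k hk i => ?_⟩
  · have := hTA (e.extendSubtype_mem k hk)
    simp only [hA, Finset.mem_sdiff, Finset.mem_filter, Finset.mem_univ, true_and] at this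
    exact this.1
  · have := hTA (e.extendSubtype_mem k hk)
    simp only [hA, Finset.mem_sdiff, Finset.mem_image, Finset.mem_univ, true_and, not_exists] at this
    exact fun h => this.2 i h.symm

/-- The branches among the last `d - c` permuted coordinates. -/
def tailBranches (σ : Equiv.Perm (Fin d)) (c m : ℕ) : Finset (Fin (d - c)) :=
  Finset.univ.filter fun k => (σ (tailIdx d c k) : ℕ) < m

theorem mono_branches (m : ℕ) (hc : c ≤ d) {σ : Equiv.Perm (Fin d)}
    (hσ : ∀ k : Fin d, (k : ℕ) < c → (σ k : ℕ) < m) (z : Cd d) :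
    mono (fun j : Fin d => if (j : ℕ) < m then 1 else 0) (fun _ => 0) z =
      (∏ i : Fin c, (z (σ (Fin.castLE hc i)))⁻¹) *
        ∏ k ∈ tailBranches σ c m, (z (σ (tailIdx d c k)))⁻¹ := by
  rw [mono, ← (splitEquiv hc σ).prod_comp, Fintype.prod_sum_type, tailBranches, Finset.prod_filter]
  congr 1
  · refine Finset.prod_congr rfl fun i _ => ?_
    rw [splitEquiv_inl, if_pos (hσ _ (by simp))]
    simp
  · refine Finset.prod_congr rfl fun k _ => ?_
    rw [splitEquiv_inr]
    split_ifs <;> simp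

/-- The derivatives along the branches, split into the first `c` permuted coordinates and the others. -/
theorem dbarL_branches {m : ℕ} (hc : c ≤ d) {σ : Equiv.Perm (Fin d)}
    (hσ : ∀ k : Fin d, (k : ℕ) < c → (σ k : ℕ) < m) {g : Cd d → ℂ} (hg : ContDiff ℝ ∞ g) :
    dbarL (branches d m) g = dbarL ((List.finRange c).map (fun i => σ (Fin.castLE hc i)))
      (dbarL (((List.finRange (d - c)).filter (· ∈ tailBranches σ c m)).map
        (fun k => σ (tailIdx d c k))) g) := by
  rw [← dbarL_append]
  refine dbarL_perm ?_ hg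
  rw [List.perm_ext_iff_of_nodup]
  · intro j
    obtain ⟨x, rfl⟩ := (splitEquiv hc σ).surjective j
    have hinj := (splitEquiv hc σ).injective
    rcases x with i | k
    · simp only [branches, List.mem_filter, List.mem_finRange, true_and, List.mem_append,
        List.mem_map, decide_eq_true_eq]
      rw [splitEquiv_inl]
      exact ⟨fun _ => Or.inl ⟨i, rfl⟩, fun _ => hσ _ (by simp)⟩
    · simp only [branches, List.mem_filter, List.mem_finRange, true_and, List.mem_append,
        List.mem_map, decide_eq_true_eq]
      rw [splitEquiv_inr]
      constructor
      · intro h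
        exact Or.inr ⟨k, by simpa [tailBranches] using h, rfl⟩
      · rintro (⟨i, h⟩ | ⟨k', h, h'⟩)
        · rw [← splitEquiv_inl hc, ← splitEquiv_inr hc] at h
          exact absurd (hinj h) (by simp)
        · rw [← h']
          simpa [tailBranches] using h
  · exact (List.nodup_finRange d).filter _
  · refine List.Nodup.append ?_ ?_ ?_
    · refine (List.nodup_finRange c).map fun i i' h => ?_
      rw [← splitEquiv_inl hc, ← splitEquiv_inl hc] at h
      exact Sum.inl.inj ((splitEquiv hc σ).injective h)
    · refine ((List.nodup_finRange _).filter _).map fun i i' h => ?_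
      rw [← splitEquiv_inr hc, ← splitEquiv_inr hc] at h
      exact Sum.inr.inj ((splitEquiv hc σ).injective h)
    · intro j h1 h2
      obtain ⟨i, -, rfl⟩ := List.mem_map.1 h1
      obtain ⟨k, -, h⟩ := List.mem_map.1 h2
      rw [← splitEquiv_inl hc, ← splitEquiv_inr hc] at h
      exact absurd ((splitEquiv hc σ).injective h) (by simp)

/-- A coefficient integral whose kernel has at most `m - c` logarithmic factors is a sum of integrals
over coordinate planes of codimension `c`: each product of logarithms leaves `c` branches free, in
which the Cauchy–Pompeiu formula applies. -/
theorem exists_coefInt_expansion {m p : ℕ} (hm : m ≤ d) (I J K : Fin d → ℕ) (hpc : p + c ≤ m) :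
    ∃ (σ : (Fin p → Fin d) → Equiv.Perm (Fin d)) (τ' : (Fin p → Fin d) → Fin p → Fin (d - c))
      (a : (Fin p → Fin d) → ℂ) (E : (Fin p → Fin d) → (Cd d → ℂ) → Cd d → ℂ),
      (∀ τ, IsWord (E τ)) ∧ (∀ τ (k : Fin d), (k : ℕ) < c → (σ τ k : ℕ) < m) ∧
      ∀ G : Cd d → ℂ, ContDiff ℝ ∞ G → HasCompactSupport G →
        coefInt m I J K p G = ∑ τ, a τ * ∫ w, logKer (tailBranches (σ τ) c m) (τ' τ) w *
          E τ G (permSlice (σ τ) c w) := by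
  have hc : c ≤ d := by omega
  choose σ hσ1 hσ2 using exists_perm_avoiding (c := c) hm hpc
  have hge : ∀ (τ : Fin p → Fin d) i, c ≤ ((σ τ).symm (τ i) : ℕ) := fun τ i => by
    by_contra h
    exact hσ2 τ ((σ τ).symm (τ i)) (by omega) i (by simp)
  set τ' : (Fin p → Fin d) → Fin p → Fin (d - c) := fun τ i =>
    ⟨((σ τ).symm (τ i) : ℕ) - c, by have := hge τ i; have := ((σ τ).symm (τ i)).isLt; omega⟩ with hτ'
  have hτσ : ∀ τ i, σ τ (tailIdx d c (τ' τ i)) = τ i := fun τ i => by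
    have : tailIdx d c (τ' τ i) = (σ τ).symm (τ i) := by
      ext; simp only [tailIdx, hτ']; have := hge τ i; omega
    rw [this]; simp
  set a0 : (Fin p → Fin d) → ℂ := fun τ => (∏ i, (2 * (I (τ i) : ℂ))) / (p.factorial : ℂ) with ha0
  set E : (Fin p → Fin d) → (Cd d → ℂ) → Cd d → ℂ := fun τ G =>
    dbarL (((List.finRange (d - c)).filter (· ∈ tailBranches (σ τ) c m)).map
      (fun k => σ τ (tailIdx d c k))) (dzMulti (fun j => J j - 1) (fun j => K j - 1) G) with hE
  have hEw : ∀ τ, IsWord (E τ) := fun τ => (isWord_dbarL _).comp (isWord_dzMulti _ _)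
  refine ⟨σ, τ', fun τ => a0 τ * (-(Real.pi : ℂ)) ^ c, E, hEw, hσ1, fun G hG hGs => ?_⟩
  have hH := fun τ => (hEw τ).contDiff hG
  have hHs := fun τ => (hEw τ).hasCompactSupport hGs
  have hW := fun τ => isWord_dbarL ((List.finRange c).map (fun i => σ τ (Fin.castLE hc i)))
  have key : ∀ z : Cd d, mono (fun j : Fin d => if (j : ℕ) < m then 1 else 0) (fun _ => 0) z *
      ((logW I z : ℂ) ^ p / (p.factorial : ℂ)) *
      dbarL (branches d m) (dzMulti (fun j => J j - 1) (fun j => K j - 1) G) z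
      = ∑ τ, a0 τ * ((∏ i : Fin c, (z (σ τ (Fin.castLE hc i)))⁻¹) *
        logKer (tailBranches (σ τ) c m) (τ' τ) (fun k => z (σ τ (tailIdx d c k))) *
        dbarL ((List.finRange c).map (fun i => σ τ (Fin.castLE hc i))) (E τ G) z) := by
    intro z
    -- the power of the logarithm is a sum of products of logarithms of the single coordinates `z (τ i)`
    have h1 : (logW I z : ℂ) ^ p = ∑ τ : Fin p → Fin d, ∏ i,
        ((2 * (I (τ i) : ℂ)) * (Real.log ‖z (τ i)‖ : ℂ)) := by
      rw [logW, Complex.ofReal_sum, Finset.sum_pow', Fintype.piFinset_univ]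
      simp
    rw [h1, Finset.sum_div, Finset.mul_sum, Finset.sum_mul]
    refine Finset.sum_congr rfl fun τ _ => ?_
    rw [mono_branches m hc (hσ1 τ), dbarL_branches hc (hσ1 τ) ((isWord_dzMulti _ _).contDiff hG),
      logKer, Finset.prod_mul_distrib]
    simp only [ha0, hτσ, hE]
    ring
  rw [coefInt]
  simp_rw [key]
  rw [integral_finsetSum _ (fun τ _ => (integrable_head_logKer hc (σ τ) _ _
    ((hW τ).contDiff (hH τ)).continuous ((hW τ).hasCompactSupport (hHs τ))).const_mul _)]
  refine Finset.sum_congr rfl fun τ _ => ?_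
  rw [integral_const_mul, integral_head_logKer hc (σ τ) _ _ (hH τ) (hHs τ)]
  ring

/-- The coefficient integral without logarithms is an integral over the intersection of all
branches. -/
theorem coefInt_zero {m : ℕ} (hm : m ≤ d) (I J K : Fin d → ℕ) {G : Cd d → ℂ}
    (hG : ContDiff ℝ ∞ G) (hGs : HasCompactSupport G) :
    coefInt m I J K 0 G = (-(Real.pi : ℂ)) ^ m *
      ∫ w, dzMulti (fun j => J j - 1) (fun j => K j - 1) G (slice d m w) := by
  have hW := isWord_dzMulti (fun j => J j - 1) (fun j => K j - 1)
  have h := integral_head_logKer hm (Equiv.refl (Fin d)) ∅ (Fin.elim0 : Fin 0 → Fin (d - m))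
    (hW.contDiff hG) (hW.hasCompactSupport hGs)
  simp only [logKer, Finset.prod_empty, Finset.univ_eq_empty, one_mul, mul_one] at h
  have h2 : ∀ w, permSlice (Equiv.refl (Fin d)) m w = slice d m w := fun w => rfl
  simp only [h2] at h
  rw [← h, coefInt]
  have hσ : ∀ k : Fin d, (k : ℕ) < m → ((Equiv.refl (Fin d)) k : ℕ) < m := fun k hk => hk
  have hempty : tailBranches (Equiv.refl (Fin d)) m m = ∅ := by
    ext k; simp [tailBranches, tailIdx]
  refine integral_congr_ae (ae_of_all _ fun z => ?_)
  simp only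
  rw [mono_branches m hm hσ, dbarL_branches hm hσ (hW.contDiff hG), hempty]
  simp [dbarL]

end CoordinatePlanes

end DivInt
end

noncomputable section
namespace DivInt

/-! ### Holomorphic functions of several variables -/

section Holomorphic

variable {d : ℕ}

/-- Integrals of a holomorphic function along a continuous family of affine maps, parametrised by a
segment, depend holomorphically on the point. -/
theorem differentiableAt_integral_comp {U : Set (Cd d)} (hU : IsOpen U) {f : Cd d → ℂ}
    (hf : DifferentiableOn ℂ f U) {k : ℝ → ℂ} (hk : Continuous k) {A : ℝ → Cd d →L[ℂ] Cd d}
    (hA : Continuous A) {c : ℝ → Cd d} (hc : Continuous c) {a b : ℝ} {z₀ : Cd d}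
    (hz₀ : ∀ t ∈ Icc a b, A t z₀ + c t ∈ U) :
    DifferentiableAt ℂ (fun z => ∫ t in Ioc a b, k t * f (A t z + c t)) z₀ := by
  have hcont : Continuous fun t => A t z₀ + c t := (hA.clm_apply continuous_const).add hc
  set K₀ : Set (Cd d) := (fun t => A t z₀ + c t) '' Icc a b with hK₀
  have hK₀c : IsCompact K₀ := isCompact_Icc.image hcont
  obtain ⟨δ, hδ, hδU⟩ := hK₀c.exists_cthickening_subset_open hU (by rintro _ ⟨t, ht, rfl⟩; exact hz₀ t ht)
  have hKc : IsCompact (Metric.cthickening δ K₀) := hK₀c.cthickening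
  obtain ⟨M, hM⟩ := hKc.exists_bound_of_continuousOn (hf.continuousOn.mono hδU)
  obtain ⟨N, hN⟩ := isCompact_Icc.exists_bound_of_continuousOn (s := Icc a b) hA.continuousOn
  obtain ⟨B, hB⟩ := isCompact_Icc.exists_bound_of_continuousOn (s := Icc a b) hk.continuousOn
  set N' := max N 0 with hN'
  set δ₁ := δ / (2 * (N' + 1)) with hδ₁
  have hN0 : 0 ≤ N' := le_max_right _ _
  have hδ₁0 : 0 < δ₁ := by positivity
  have hnear : ∀ t ∈ Icc a b, ∀ z ∈ Metric.ball z₀ δ₁, ∀ y ∈ Metric.ball (A t z + c t) (δ / 2),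
      y ∈ Metric.cthickening δ K₀ := by
    intro t ht z hz y hy
    refine Metric.mem_cthickening_of_dist_le y (A t z₀ + c t) δ K₀ ⟨t, ht, rfl⟩ ?_
    have h1 : dist (A t z + c t) (A t z₀ + c t) ≤ δ / 2 := by
      rw [dist_add_right, dist_eq_norm, ← map_sub]
      refine ((A t).le_opNorm _).trans ?_
      have h2 : ‖A t‖ ≤ N' := (hN t ht).trans (le_max_left _ _)
      have h3 : ‖z - z₀‖ ≤ δ₁ := by rw [← dist_eq_norm]; exact (Metric.mem_ball.1 hz).le
      calc ‖A t‖ * ‖z - z₀‖ ≤ (N' + 1) * δ₁ := by gcongr; linarith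
        _ = δ / 2 := by rw [hδ₁]; field_simp
    calc dist y (A t z₀ + c t) ≤ dist y (A t z + c t) + dist (A t z + c t) (A t z₀ + c t) :=
          dist_triangle _ _ _
      _ ≤ δ := by linarith [Metric.mem_ball.1 hy]
  have hmem : ∀ t ∈ Icc a b, ∀ z ∈ Metric.ball z₀ δ₁, A t z + c t ∈ U := fun t ht z hz =>
    hδU (hnear t ht z hz _ (Metric.mem_ball_self (by positivity)))
  have hfd : ∀ t ∈ Icc a b, ∀ z ∈ Metric.ball z₀ δ₁,
      ‖fderiv ℂ f (A t z + c t)‖ ≤ (2 * |M| + 1) / (δ / 2) := by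
    intro t ht z hz
    refine Complex.norm_fderiv_le_div_of_mapsTo_ball
      (hf.mono fun y hy => hδU (hnear t ht z hz y hy)) (fun y hy => ?_) (by positivity)
    rw [Metric.mem_closedBall, dist_eq_norm]
    have h1 := hM y (hnear t ht z hz y hy)
    have h2 := hM _ (hnear t ht z hz _ (Metric.mem_ball_self (by positivity)))
    have h3 := norm_sub_le (f y) (f (A t z + c t))
    have := le_abs_self M
    linarith
  have hder : ∀ t ∈ Icc a b, ∀ z ∈ Metric.ball z₀ δ₁, HasFDerivAt (fun z => k t * f (A t z + c t))
      (k t • (fderiv ℂ f (A t z + c t)).comp (A t)) z := by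
    intro t ht z hz
    have h1 := (hf.differentiableAt (hU.mem_nhds (hmem t ht z hz))).hasFDerivAt
    exact (h1.comp z ((A t).hasFDerivAt.add_const (c t))).const_mul (k t)
  have hcontz : ∀ z ∈ Metric.ball z₀ δ₁, ContinuousOn (fun t => k t * f (A t z + c t)) (Icc a b) := by
    intro z hz
    refine hk.continuousOn.mul (hf.continuousOn.comp ?_ fun t ht => hmem t ht z hz)
    exact ((hA.clm_apply continuous_const).add hc).continuousOn
  have hz₀m : z₀ ∈ Metric.ball z₀ δ₁ := Metric.mem_ball_self hδ₁0
  refine (hasFDerivAt_integral_of_dominated_of_fderiv_le (μ := volume.restrict (Ioc a b))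
    (F' := fun z t => k t • (fderiv ℂ f (A t z + c t)).comp (A t))
    (bound := fun _ => |B| * ((2 * |M| + 1) / (δ / 2) * N'))
    (Metric.ball_mem_nhds z₀ hδ₁0) ?_ ?_ ?_ ?_ ?_ ?_).differentiableAt
  · filter_upwards [Metric.ball_mem_nhds z₀ hδ₁0] with z hz
    exact ((hcontz z hz).mono Ioc_subset_Icc_self).aestronglyMeasurable measurableSet_Ioc
  · exact ((hcontz z₀ hz₀m).integrableOn_compact isCompact_Icc).mono_set Ioc_subset_Icc_self
  · refine Measurable.aestronglyMeasurable ?_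
    have h1 : Measurable fun t => fderiv ℂ f (A t z₀ + c t) :=
      (measurable_fderiv ℂ f).comp hcont.measurable
    have h2 : Measurable fun t => ((fderiv ℂ f (A t z₀ + c t)).comp (A t)) := by
      have := (ContinuousLinearMap.compL ℂ (Cd d) (Cd d) ℂ).continuous₂.measurable
      exact this.comp (h1.prodMk hA.measurable)
    exact hk.measurable.smul h2
  · refine (ae_restrict_iff' measurableSet_Ioc).2 (ae_of_all _ fun t ht z hz => ?_)
    have ht' := Ioc_subset_Icc_self ht
    rw [norm_smul]
    refine mul_le_mul ((hB t ht').trans (le_abs_self B)) ?_ (norm_nonneg _) (abs_nonneg _)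
    refine (ContinuousLinearMap.opNorm_comp_le _ _).trans ?_
    exact mul_le_mul (hfd t ht' z hz) ((hN t ht').trans (le_max_left _ _)) (norm_nonneg _) (by positivity)
  · exact integrable_const _
  · exact (ae_restrict_iff' measurableSet_Ioc).2 (ae_of_all _ fun t ht z hz =>
      hder t (Ioc_subset_Icc_self ht) z hz)

/-- Partial derivatives of a holomorphic function are holomorphic, by Cauchy's formula on a disc in the
direction `v`. -/
theorem differentiableOn_fderiv_apply {U : Set (Cd d)} (hU : IsOpen U) {f : Cd d → ℂ}
    (hf : DifferentiableOn ℂ f U) (v : Cd d) :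
    DifferentiableOn ℂ (fun z => fderiv ℂ f z v) U := by
  intro z₀ hz₀
  refine DifferentiableAt.differentiableWithinAt ?_
  obtain ⟨δ, hδ, hδU⟩ := Metric.isOpen_iff.1 hU z₀ hz₀
  set r : ℝ := δ / (2 * (‖v‖ + 1)) with hr
  have hr0 : 0 < r := by positivity
  have hrv : r * ‖v‖ < δ / 2 := by
    rw [hr, div_mul_eq_mul_div, div_lt_div_iff₀ (by positivity) (by positivity)]
    nlinarith [norm_nonneg v]
  have hin : ∀ z ∈ Metric.ball z₀ (δ / 2), ∀ ζ : ℂ, ‖ζ‖ ≤ r → z + ζ • v ∈ U := by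
    intro z hz ζ hζ
    refine hδU ?_
    rw [Metric.mem_ball, dist_eq_norm]
    have h1 : ‖z - z₀‖ < δ / 2 := by rw [← dist_eq_norm]; exact hz
    calc ‖z + ζ • v - z₀‖ = ‖(z - z₀) + ζ • v‖ := by congr 1; abel
      _ ≤ ‖z - z₀‖ + ‖ζ • v‖ := norm_add_le _ _
      _ ≤ ‖z - z₀‖ + r * ‖v‖ := by rw [norm_smul]; gcongr
      _ < δ := by linarith
  have hmain := differentiableAt_integral_comp hU hf
    (k := fun θ => (2 * Real.pi * Complex.I : ℂ)⁻¹ *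
      (circleMap 0 r θ * Complex.I * ((circleMap 0 r θ - 0) ^ 2)⁻¹))
    (A := fun _ => ContinuousLinearMap.id ℂ (Cd d)) (c := fun θ => circleMap 0 r θ • v)
    (a := 0) (b := 2 * Real.pi) (z₀ := z₀) ?_ continuous_const (by fun_prop) ?_
  · refine hmain.congr_of_eventuallyEq ?_
    filter_upwards [Metric.ball_mem_nhds z₀ (by positivity : 0 < δ / 2)] with z hz
    have hopen : IsOpen {ζ : ℂ | z + ζ • v ∈ U} := hU.preimage (by fun_prop)
    have hder : ∀ ζ : ℂ, z + ζ • v ∈ U →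
        HasDerivAt (fun ζ : ℂ => f (z + ζ • v)) (fderiv ℂ f (z + ζ • v) v) ζ := by
      intro ζ hζ
      have h1 := (hf.differentiableAt (hU.mem_nhds hζ)).hasFDerivAt
      have h2 : HasDerivAt (fun ζ : ℂ => z + ζ • v) v ζ := by
        simpa using ((hasDerivAt_id ζ).smul_const v).const_add z
      exact h1.comp_hasDerivAt ζ h2
    have h := Complex.two_pi_I_inv_smul_circleIntegral_sub_sq_inv_smul_of_differentiable
      (f := fun ζ : ℂ => f (z + ζ • v)) (c := 0) (R := r) (w₀ := 0) hopen (fun ζ hζ => hin z hz ζ (by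
        simpa using hζ)) (fun ζ hζ => (hder ζ hζ).differentiableAt.differentiableWithinAt)
        (Metric.mem_ball_self hr0)
    rw [(hder 0 (by simpa using hin z hz 0 (by simpa using hr0.le))).deriv, zero_smul, add_zero] at h
    rw [← h, circleIntegral, intervalIntegral.integral_of_le (by positivity), smul_eq_mul,
      ← integral_const_mul]
    refine integral_congr_ae (ae_of_all _ fun θ => ?_)
    simp only [deriv_circleMap, smul_eq_mul, ContinuousLinearMap.id_apply, circleMap_zero, sub_zero]
    ring
  · refine continuous_const.mul (((continuous_circleMap 0 r).mul continuous_const).mul ?_)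
    refine Continuous.inv₀ (by fun_prop) fun θ => ?_
    simp [circleMap, hr0.ne']
  · intro θ _
    exact hin z₀ (Metric.mem_ball_self (by positivity)) _ (by simp [circleMap, abs_of_pos hr0])

theorem contDiffOn_nat_of_differentiableOn {U : Set (Cd d)} (hU : IsOpen U) (n : ℕ) :
    ∀ {f : Cd d → ℂ}, DifferentiableOn ℂ f U → ContDiffOn ℂ n f U := by
  induction n with
  | zero => intro f hf; exact contDiffOn_zero.2 hf.continuousOn
  | succ n ih =>
    intro f hf
    push_cast
    rw [contDiffOn_succ_iff_fderiv_of_isOpen hU]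
    refine ⟨hf, by simp, contDiffOn_clm_apply.2 fun v => ih (differentiableOn_fderiv_apply hU hf v)⟩

theorem contDiffOn_of_differentiableOn {U : Set (Cd d)} (hU : IsOpen U) {f : Cd d → ℂ}
    (hf : DifferentiableOn ℂ f U) : ContDiffOn ℂ ∞ f U :=
  contDiffOn_infty.2 fun n => contDiffOn_nat_of_differentiableOn hU n hf

theorem contDiffOn_real_of_differentiableOn {U : Set (Cd d)} (hU : IsOpen U) {f : Cd d → ℂ}
    (hf : DifferentiableOn ℂ f U) : ContDiffOn ℝ ∞ f U :=
  (contDiffOn_of_differentiableOn hU hf).restrict_scalars ℝ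

/-- Division of a holomorphic function which vanishes on `{z_j = 0}` by `z_j`. -/
theorem exists_eq_coord_mul {ε : ℝ} {g : Cd d → ℂ} (hg : DifferentiableOn ℂ g (Metric.ball 0 ε))
    (j : Fin d) (h0 : ∀ z ∈ Metric.ball (0 : Cd d) ε, z j = 0 → g z = 0) :
    ∃ h : Cd d → ℂ, DifferentiableOn ℂ h (Metric.ball 0 ε) ∧
      ∀ z ∈ Metric.ball (0 : Cd d) ε, g z = z j * h z := by
  have hg' := differentiableOn_fderiv_apply Metric.isOpen_ball hg (Pi.single j 1)
  set A : ℝ → Cd d →L[ℂ] Cd d := fun t => ContinuousLinearMap.id ℂ (Cd d) +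
    ((t : ℂ) - 1) • (ContinuousLinearMap.proj (R := ℂ) (φ := fun _ : Fin d => ℂ) j).smulRight
      (Pi.single j (1 : ℂ) : Cd d) with hA
  have hAc : Continuous A := by fun_prop
  have hAj : ∀ t z, A t z j = t * z j := fun t z => by simp [hA]; ring
  have hAi : ∀ t z i, i ≠ j → A t z i = z i := fun t z i hi => by simp [hA, hi]
  have hAz : ∀ t : ℝ, ∀ z, A t z = z + (((t : ℂ) - 1) * z j) • (Pi.single j 1 : Cd d) := fun t z => by
    simp [hA, smul_smul]
  have hAm : ∀ t ∈ Icc (0:ℝ) 1, ∀ z ∈ Metric.ball (0 : Cd d) ε, A t z ∈ Metric.ball (0 : Cd d) ε := by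
    intro t ht z hz
    rw [mem_ball_zero_iff] at hz ⊢
    refine lt_of_le_of_lt ((pi_norm_le_iff_of_nonneg (norm_nonneg z)).2 fun i => ?_) hz
    by_cases hi : i = j
    · subst hi
      rw [hAj, norm_mul, Complex.norm_real, Real.norm_eq_abs, abs_of_nonneg ht.1]
      calc t * ‖z i‖ ≤ 1 * ‖z i‖ := by gcongr; exact ht.2
        _ ≤ ‖z‖ := by rw [one_mul]; exact norm_le_pi_norm z i
    · rw [hAi t z i hi]; exact norm_le_pi_norm z i
  refine ⟨fun z => ∫ t in Ioc (0:ℝ) 1, 1 * fderiv ℂ g (A t z + 0) (Pi.single j 1), fun z hz => ?_,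
    fun z hz => ?_⟩
  · exact (differentiableAt_integral_comp (k := fun _ => 1) (c := fun _ => 0) Metric.isOpen_ball hg'
      continuous_const hAc continuous_const (fun t ht => by simpa using hAm t ht z hz)).differentiableWithinAt
  · simp only [one_mul, add_zero]
    have hder : ∀ t ∈ uIcc (0:ℝ) 1, HasDerivAt (fun t : ℝ => g (A t z))
        (z j * fderiv ℂ g (A t z) (Pi.single j 1)) t := by
      intro t ht
      rw [uIcc_of_le zero_le_one] at ht
      have h1 := (hg.differentiableAt (Metric.isOpen_ball.mem_nhds (hAm t ht z hz))).hasFDerivAt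
      have h2 : HasDerivAt (fun t : ℝ => A t z) (z j • (Pi.single j 1 : Cd d)) t := by
        simp_rw [hAz]
        have h3 : HasDerivAt (fun t : ℝ => ((t : ℂ) - 1) * z j) (z j) t := by
          simpa using ((Complex.ofRealCLM.hasDerivAt (x := t)).sub_const 1).mul_const (z j)
        exact (h3.smul_const (Pi.single j 1 : Cd d)).const_add z
      have := (h1.restrictScalars ℝ).comp_hasDerivAt t h2
      convert! this using 1
      simp
    have h1 : IntervalIntegrable (fun t : ℝ => z j * fderiv ℂ g (A t z) (Pi.single j 1)) volume 0 1 := by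
      refine ContinuousOn.intervalIntegrable ?_
      rw [uIcc_of_le zero_le_one]
      exact continuousOn_const.mul (hg'.continuousOn.comp
        ((hAc.clm_apply continuous_const).continuousOn) fun t ht => hAm t ht z hz)
    have h2 := intervalIntegral.integral_eq_sub_of_hasDerivAt hder h1
    have h3 : A 1 z = z := by rw [hAz]; simp
    have h4 : g (A 0 z) = 0 := h0 _ (hAm 0 ⟨le_rfl, zero_le_one⟩ z hz) (by rw [hAj]; simp)
    rw [h3, h4, sub_zero, intervalIntegral.integral_of_le zero_le_one, integral_const_mul] at h2
    exact h2.symm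

theorem eventually_disc_subset {W : Set (Cd d)} (hW : IsOpen W) {p v : Cd d} {r : ℝ}
    (h : ∀ t : ℂ, ‖t‖ ≤ r → p + t • v ∈ W) :
    ∀ᶠ q in 𝓝 p, ∀ t : ℂ, ‖t‖ ≤ r → q + t • v ∈ W := by
  have : ∀ᶠ q in 𝓝 p, ∀ t ∈ Metric.closedBall (0:ℂ) r, q + t • v ∈ W := by
    refine (isCompact_closedBall (0:ℂ) r).eventually_forall_of_forall_eventually fun t ht => ?_
    exact ContinuousAt.eventually_mem (f := fun q : Cd d × ℂ => q.1 + q.2 • v) (by fun_prop)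
      (hW.mem_nhds (h t (by simpa using ht)))
  simpa using this

/-- A form of Hurwitz's theorem: a value `u p` is not zero if `u` has no zeros on discs through points
arbitrarily close to `p`, and none on the boundary of the disc through `p`. -/
theorem ne_zero_of_nearby_discs {U : Set (Cd d)} (hU : IsOpen U) {u : Cd d → ℂ}
    (hu : DifferentiableOn ℂ u U) {p v : Cd d} {r : ℝ} (hr : 0 < r)
    (hdisc : ∀ t : ℂ, ‖t‖ ≤ r → p + t • v ∈ U)
    (hbd : ∀ t : ℂ, ‖t‖ = r → u (p + t • v) ≠ 0)
    (hnear : ∃ᶠ q in 𝓝 p, ∀ t : ℂ, ‖t‖ ≤ r → u (q + t • v) ≠ 0) : u p ≠ 0 := by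
  intro hp
  have hpU : p ∈ U := by simpa using hdisc 0 (by simpa using hr.le)
  -- a lower bound on the boundary circle, uniform in nearby discs
  obtain ⟨c, hc0, hc⟩ : ∃ c : ℝ, 0 < c ∧ ∀ t ∈ Metric.sphere (0:ℂ) r, c < ‖u (p + t • v)‖ := by
    have hcont : ContinuousOn (fun t : ℂ => ‖u (p + t • v)‖) (Metric.sphere (0:ℂ) r) := by
      refine (hu.continuousOn.comp (by fun_prop) fun t ht => hdisc t ?_).norm
      simpa using (mem_sphere_zero_iff_norm.1 ht).le
    obtain ⟨t₀, ht₀, hmin⟩ := (isCompact_sphere (0:ℂ) r).exists_isMinOn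
      ⟨(r : ℂ), by simp [abs_of_pos hr]⟩ hcont
    have : 0 < ‖u (p + t₀ • v)‖ := norm_pos_iff.2 (hbd t₀ (mem_sphere_zero_iff_norm.1 ht₀))
    exact ⟨‖u (p + t₀ • v)‖ / 2, by positivity, fun t ht => lt_of_lt_of_le (by linarith) (hmin ht)⟩
  have hev := eventually_disc_subset hU hdisc
  have hev2 : ∀ᶠ q in 𝓝 p, ∀ t ∈ Metric.sphere (0:ℂ) r, c < ‖u (q + t • v)‖ := by
    refine (isCompact_sphere (0:ℂ) r).eventually_forall_of_forall_eventually fun t ht => ?_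
    have h1 : ContinuousAt (fun q : Cd d × ℂ => ‖u (q.1 + q.2 • v)‖) (p, t) := by
      refine ContinuousAt.norm (ContinuousAt.comp (g := u) ?_ (by fun_prop))
      exact (hu.differentiableAt (hU.mem_nhds (hdisc t (by
        simpa using (mem_sphere_zero_iff_norm.1 ht).le)))).continuousAt
    exact h1.eventually (lt_mem_nhds (hc t ht))
  have hev3 : ∀ᶠ q in 𝓝 p, ‖u q‖ < c := by
    have h1 : ContinuousAt (fun q => ‖u q‖) p :=
      ((hu.differentiableAt (hU.mem_nhds hpU)).continuousAt).norm
    refine h1.eventually (gt_mem_nhds ?_)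
    simpa [hp] using hc0
  obtain ⟨q, hq, hq1, hq2, hq3⟩ := (hnear.and_eventually (hev.and (hev2.and hev3))).exists
  have hd : DiffContOnCl ℂ (fun t : ℂ => (u (q + t • v))⁻¹) (Metric.ball 0 r) := by
    refine DifferentiableOn.diffContOnCl ?_
    rw [closure_ball _ hr.ne']
    refine DifferentiableOn.inv (hu.comp (by fun_prop) fun t ht => hq1 t (by simpa using ht)) fun t ht => ?_
    exact hq t (by simpa using ht)
  have h := Complex.norm_le_of_forall_mem_frontier_norm_le Metric.isBounded_ball hd (C := c⁻¹)
    (fun t ht => by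
      rw [frontier_ball _ hr.ne'] at ht
      rw [norm_inv]
      exact inv_anti₀ hc0 (hq2 t ht).le) (subset_closure (Metric.mem_ball_self hr))
  simp only [zero_smul, add_zero, norm_inv] at h
  have h0 : 0 < ‖u q‖ := norm_pos_iff.2 (by simpa using hq 0 (by simpa using hr.le))
  have := (inv_le_inv₀ h0 hc0).1 h
  linarith

/-- A disc through `p` in the direction `v` on whose boundary `u` has no zeros. -/
theorem exists_disc_radius {U W : Set (Cd d)} (hU : IsOpen U) (hW : IsOpen W) {u : Cd d → ℂ}
    {p v : Cd d} (hpW : p ∈ W) (hpU : p ∈ U) (hne : ∀ᶠ t : ℂ in 𝓝[≠] 0, u (p + t • v) ≠ 0) :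
    ∃ r : ℝ, 0 < r ∧ (∀ t : ℂ, ‖t‖ ≤ r → p + t • v ∈ U ∩ W) ∧
      ∀ t : ℂ, ‖t‖ = r → u (p + t • v) ≠ 0 := by
  have h1 : ∀ᶠ t : ℂ in 𝓝 0, p + t • v ∈ U ∩ W :=
    ContinuousAt.eventually_mem (f := fun t : ℂ => p + t • v) (by fun_prop)
      ((hU.inter hW).mem_nhds (by simpa using ⟨hpU, hpW⟩))
  obtain ⟨r, hr, h⟩ := Metric.eventually_nhds_iff.1 (h1.and (eventually_nhdsWithin_iff.1 hne))
  refine ⟨r / 2, by positivity, fun t ht => (h ?_).1, fun t ht => (h ?_).2 ?_⟩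
  · rw [dist_zero_right]; linarith
  · rw [dist_zero_right]; linarith
  · rintro rfl
    rw [norm_zero] at ht
    linarith

/-- A holomorphic function on a polydisc whose zeros lie on the coordinate hyperplanes `{z_j = 0}`,
`j ∈ S`, and which vanishes identically on none of them has no zeros: its zero set would be a
hypersurface. -/
theorem ne_zero_of_not_vanishing {ε : ℝ} {u : Cd d → ℂ}
    (hu : DifferentiableOn ℂ u (Metric.ball 0 ε)) (S : Finset (Fin d))
    (hz : ∀ z ∈ Metric.ball (0 : Cd d) ε, (∀ j ∈ S, z j ≠ 0) → u z ≠ 0)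
    (hq : ∀ j ∈ S, ∃ q ∈ Metric.ball (0 : Cd d) ε, q j = 0 ∧ u q ≠ 0) :
    ∀ z ∈ Metric.ball (0 : Cd d) ε, u z ≠ 0 := by
  have hWo : ∀ p : Cd d, IsOpen {z : Cd d | ∀ i ∈ S, p i ≠ 0 → z i ≠ 0} := fun p => by
    have : {z : Cd d | ∀ i ∈ S, p i ≠ 0 → z i ≠ 0} =
        ⋂ i ∈ S, {z : Cd d | p i ≠ 0 → z i ≠ 0} := by ext; simp
    rw [this]
    refine isOpen_biInter_finset fun i _ => ?_
    by_cases h : p i = 0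
    · simp [h]
    · simpa [h] using isOpen_ne_fun (continuous_apply i) continuous_const
  -- points which lie on only one of the hyperplanes
  have h1 : ∀ p ∈ Metric.ball (0 : Cd d) ε, ∀ j ∈ S, p j = 0 → (∀ i ∈ S, i ≠ j → p i ≠ 0) →
      u p ≠ 0 := by
    intro p hp j hjS hpj hpi
    obtain ⟨q, hqB, hqj, hqu⟩ := hq j hjS
    -- on the line from `p` to `q`, which stays in `{z_j = 0}`, the function does not vanish identically;
    -- parallel lines off `{z_j = 0}` meet no zeros at all
    set v := q - p with hv
    have hvj : v j = 0 := by simp [hv, hqj, hpj]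
    set V : Set ℂ := {t | p + t • v ∈ Metric.ball (0 : Cd d) ε} with hV
    have hVo : IsOpen V := Metric.isOpen_ball.preimage (by fun_prop)
    have hVc : IsPreconnected V := by
      refine Convex.isPreconnected ?_
      refine convex_iff_forall_pos.2 fun t ht t' ht' a b ha hb hab => ?_
      have := (convex_ball (0 : Cd d) ε) ht ht' ha.le hb.le hab
      change p + (a • t + b • t') • v ∈ Metric.ball (0 : Cd d) ε
      convert! this using 1
      rw [smul_add, smul_add, add_smul, add_add_add_comm, ← add_smul a b p, hab, one_smul, smul_assoc,
        smul_assoc]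
    have han : AnalyticOnNhd ℂ (fun t : ℂ => u (p + t • v)) V :=
      (hu.comp (f := fun t : ℂ => p + t • v) (by fun_prop) fun t ht => ht).analyticOnNhd hVo
    have hne : ∀ᶠ t : ℂ in 𝓝[≠] 0, u (p + t • v) ≠ 0 := by
      by_contra h
      have h' : ∃ᶠ t : ℂ in 𝓝[≠] 0, u (p + t • v) = 0 := by
        simpa only [Filter.not_eventually, ne_eq, not_not] using h
      have := han.eqOn_zero_of_preconnected_of_frequently_eq_zero hVc
        (by simpa [hV] using hp) h' (x := 1) (by simpa [hV, hv] using hqB)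
      exact hqu (by simpa [hv] using this)
    obtain ⟨r, hr, hr1, hr2⟩ := exists_disc_radius Metric.isOpen_ball (hWo p)
      (fun i _ h => h) hp hne
    refine ne_zero_of_nearby_discs Metric.isOpen_ball hu hr (fun t ht => (hr1 t ht).1) hr2 ?_
    have hev := eventually_disc_subset (Metric.isOpen_ball.inter (hWo p)) hr1
    have hlim : Tendsto (fun s : ℂ => p + s • (Pi.single j 1 : Cd d)) (𝓝[≠] 0) (𝓝 p) := by
      have : ContinuousAt (fun s : ℂ => p + s • (Pi.single j 1 : Cd d)) 0 := by fun_prop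
      have := this.tendsto
      simp only [zero_smul, add_zero] at this
      exact this.mono_left nhdsWithin_le_nhds
    refine hlim.frequently (Eventually.frequently ?_)
    filter_upwards [hlim.eventually hev, self_mem_nhdsWithin] with s hs hs0 t ht
    refine hz _ (hs t ht).1 fun i hi => ?_
    by_cases hij : i = j
    · subst hij; simpa [hpj, hvj] using hs0
    · exact (hs t ht).2 i hi (hpi i hi hij)
  intro p hp
  by_cases hS : ∀ j ∈ S, p j ≠ 0
  · exact hz p hp hS
  -- a line in the diagonal direction through `p` leaves all hyperplanes at once
  set v : Cd d := fun _ => 1 with hv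
  have hne : ∀ᶠ t : ℂ in 𝓝[≠] 0, u (p + t • v) ≠ 0 := by
    have h2 : ∀ᶠ t : ℂ in 𝓝 0, p + t • v ∈ Metric.ball (0 : Cd d) ε ∩
        {z : Cd d | ∀ i ∈ S, p i ≠ 0 → z i ≠ 0} :=
      ContinuousAt.eventually_mem (f := fun t : ℂ => p + t • v) (by fun_prop)
        ((Metric.isOpen_ball.inter (hWo p)).mem_nhds (by simpa using hp))
    filter_upwards [nhdsWithin_le_nhds h2, self_mem_nhdsWithin] with t ht ht0
    refine hz _ ht.1 fun i hi => ?_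
    by_cases hpi : p i = 0
    · simpa [hpi, hv] using ht0
    · exact ht.2 i hi hpi
  obtain ⟨r, hr, hr1, hr2⟩ := exists_disc_radius Metric.isOpen_ball (hWo p)
    (fun i _ h => h) hp hne
  refine ne_zero_of_nearby_discs Metric.isOpen_ball hu hr (fun t ht => (hr1 t ht).1) hr2 ?_
  have hev := eventually_disc_subset (Metric.isOpen_ball.inter (hWo p)) hr1
  -- translation by small multiples of `w` separates the hyperplanes through `p`, so that each point of a
  -- nearby diagonal line lies on at most one of them
  set w : Cd d := fun j => ((j : ℕ) : ℂ) with hw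
  have hlim : Tendsto (fun s : ℂ => p + s • w) (𝓝[≠] 0) (𝓝 p) := by
    have : ContinuousAt (fun s : ℂ => p + s • w) 0 := by fun_prop
    have := this.tendsto
    simp only [zero_smul, add_zero] at this
    exact this.mono_left nhdsWithin_le_nhds
  refine hlim.frequently (Eventually.frequently ?_)
  filter_upwards [hlim.eventually hev, self_mem_nhdsWithin] with s hs hs0 t ht
  by_cases hS' : ∀ j ∈ S, (p + s • w + t • v) j ≠ 0
  · exact hz _ (hs t ht).1 hS'
  push Not at hS'
  obtain ⟨j, hjS, hj⟩ := hS'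
  refine h1 _ (hs t ht).1 j hjS hj fun i hi hij => ?_
  by_cases hpi : p i = 0
  · intro h
    have hpj : p j = 0 := by
      by_contra h3
      exact (hs t ht).2 j hjS h3 hj
    simp only [Pi.add_apply, Pi.smul_apply, hpi, hpj, hw, hv, smul_eq_mul, zero_add, mul_one] at h hj
    have h4 : s * ((i : ℕ) : ℂ) = s * ((j : ℕ) : ℂ) := by linear_combination h - hj
    have h5 := mul_left_cancel₀ hs0 h4
    exact hij (Fin.ext (by exact_mod_cast h5))
  · exact (hs t ht).2 i hi hpi

/-- A holomorphic function on a polydisc whose zeros lie on the coordinate hyperplanes `{z_j = 0}`,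
`j ∈ S`, is a monomial in these coordinates times a function without zeros. -/
theorem exists_monomial_factor {ε : ℝ} (hε : 0 < ε) {g : Cd d → ℂ}
    (hg : DifferentiableOn ℂ g (Metric.ball 0 ε)) (S : Finset (Fin d))
    (hz : ∀ z ∈ Metric.ball (0 : Cd d) ε, (∀ j ∈ S, z j ≠ 0) → g z ≠ 0) :
    ∃ I : Fin d → ℕ, (∀ j ∉ S, I j = 0) ∧ ∃ u : Cd d → ℂ,
      DifferentiableOn ℂ u (Metric.ball 0 ε) ∧ (∀ z ∈ Metric.ball (0 : Cd d) ε, u z ≠ 0) ∧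
      ∀ z ∈ Metric.ball (0 : Cd d) ε, g z = (∏ j, z j ^ I j) * u z := by
  set P : Set (Fin d → ℕ) := {I | (∀ j ∉ S, I j = 0) ∧ ∃ u : Cd d → ℂ,
      DifferentiableOn ℂ u (Metric.ball 0 ε) ∧
      ∀ z ∈ Metric.ball (0 : Cd d) ε, g z = (∏ j, z j ^ I j) * u z} with hP
  have hP0 : (0 : Fin d → ℕ) ∈ P := ⟨fun _ _ => rfl, g, hg, fun z _ => by simp⟩
  -- the exponents are bounded by vanishing orders along lines in general position
  have hbound : ∀ j : Fin d, ∃ N : ℕ, ∀ I ∈ P, I j ≤ N := by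
    intro j
    by_cases hjS : j ∉ S
    · exact ⟨0, fun I hI => (hI.1 j hjS).le⟩
    set q : ℂ → Cd d := fun t => Function.update (fun _ => ((ε / 2 : ℝ) : ℂ)) j t with hq
    have hqd : Differentiable ℂ q := by
      rw [differentiable_pi]
      intro i
      by_cases hij : i = j
      · subst hij; simp [hq]
      · simp [hq, hij]
    have hqB : ∀ t ∈ Metric.ball (0:ℂ) ε, q t ∈ Metric.ball (0 : Cd d) ε := by
      intro t ht
      rw [mem_ball_zero_iff] at ht ⊢
      refine (pi_norm_lt_iff hε).2 fun i => ?_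
      by_cases hij : i = j
      · subst hij; simpa [hq] using ht
      · simp only [hq, Function.update_of_ne hij, Complex.norm_real, Real.norm_eq_abs]
        rw [abs_of_pos (by positivity)]; linarith
    have han : ∀ u : Cd d → ℂ, DifferentiableOn ℂ u (Metric.ball 0 ε) →
        AnalyticAt ℂ (fun t => u (q t)) 0 := fun u hu =>
      (hu.comp hqd.differentiableOn hqB).analyticAt (Metric.ball_mem_nhds 0 hε)
    have hord : analyticOrderAt (fun t => g (q t)) 0 ≠ ⊤ := by
      rw [Ne, analyticOrderAt_eq_top]
      intro h
      have h2 : ∀ᶠ t : ℂ in 𝓝[≠] 0, False := by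
        filter_upwards [nhdsWithin_le_nhds h, nhdsWithin_le_nhds (Metric.ball_mem_nhds (0:ℂ) hε),
          self_mem_nhdsWithin] with t ht htB ht0
        refine hz _ (hqB t htB) (fun i _ => ?_) ht
        by_cases hij : i = j
        · subst hij; simpa [hq] using ht0
        · simp [hq, hij, hε.ne']
      exact h2.exists.elim fun _ h => h
    obtain ⟨N, hN⟩ := ENat.ne_top_iff_exists.1 hord
    refine ⟨N, fun I ⟨_, u, hu, hgu⟩ => ?_⟩
    have h3 : ((I j : ℕ) : ℕ∞) ≤ analyticOrderAt (fun t => g (q t)) 0 := by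
      rw [natCast_le_analyticOrderAt (han g hg)]
      refine ⟨fun t => (∏ i ∈ Finset.univ.erase j, ((ε / 2 : ℝ) : ℂ) ^ I i) * u (q t),
        analyticAt_const.mul (han u hu), ?_⟩
      filter_upwards [Metric.ball_mem_nhds (0:ℂ) hε] with t ht
      rw [hgu _ (hqB t ht), ← Finset.mul_prod_erase Finset.univ _ (Finset.mem_univ j)]
      have : ∏ i ∈ Finset.univ.erase j, q t i ^ I i =
          ∏ i ∈ Finset.univ.erase j, ((ε / 2 : ℝ) : ℂ) ^ I i :=
        Finset.prod_congr rfl fun i hi => by simp [hq, Finset.ne_of_mem_erase hi]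
      rw [this]
      simp [hq]
      ring
    rw [← hN] at h3
    exact_mod_cast h3
  choose N hN using hbound
  have hfin : P.Finite := (Set.finite_Icc (0 : Fin d → ℕ) N).subset
    fun I hI => ⟨fun j => Nat.zero_le _, fun j => hN j I hI⟩
  -- for a maximal exponent the quotient vanishes identically on none of the hyperplanes, since it could be
  -- divided by the coordinate otherwise
  obtain ⟨I, hI, hmax⟩ := Set.exists_max_image P (fun I => ∑ j, I j) hfin ⟨0, hP0⟩
  obtain ⟨hIS, u, hu, hgu⟩ := hI
  refine ⟨I, hIS, u, hu, ?_, hgu⟩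
  refine ne_zero_of_not_vanishing hu S (fun z hzB hzS h0 => ?_) fun j hj => ?_
  · exact hz z hzB hzS (by rw [hgu z hzB, h0, mul_zero])
  · by_contra hcon
    push Not at hcon
    obtain ⟨h, hh, huh⟩ := exists_eq_coord_mul hu j hcon
    have hmem : (I + Pi.single j 1 : Fin d → ℕ) ∈ P := by
      refine ⟨fun i hi => ?_, h, hh, fun z hzB => ?_⟩
      · have : i ≠ j := fun h => hi (h ▸ hj)
        simp [hIS i hi, this]
      · rw [hgu z hzB, huh z hzB]
        simp only [Pi.add_apply, pow_add, Finset.prod_mul_distrib]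
        have : ∏ i, z i ^ (Pi.single j 1 : Fin d → ℕ) i = z j := by
          rw [Finset.prod_eq_single j]
          · simp
          · intro i _ hi; simp [hi]
          · simp
        rw [this]; ring
    have := hmax _ hmem
    simp [Finset.sum_add_distrib] at this

end Holomorphic

end DivInt
end

noncomputable section
namespace DivInt

/-! ### Holomorphic charts -/

set_option linter.unusedSectionVars false

section Charts

variable {d : ℕ} {X : Type*} [TopologicalSpace X] [ChartedSpace (Cd d) X]

theorem mem_contDiffGroupoid_self_iff {𝕜 E : Type*} [NontriviallyNormedField 𝕜]
    [NormedAddCommGroup E] [NormedSpace 𝕜 E] {n : ℕ∞ω} {e : OpenPartialHomeomorph E E} :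
    e ∈ contDiffGroupoid n 𝓘(𝕜, E) ↔ ContDiffOn 𝕜 n e e.source ∧ ContDiffOn 𝕜 n e.symm e.target := by
  rw [contDiffGroupoid, mem_groupoid_of_pregroupoid]
  simp [contDiffPregroupoid]

theorem contDiffGroupoid_complex_le :
    contDiffGroupoid ω 𝓘(ℂ, Cd d) ≤ contDiffGroupoid ∞ 𝓘(ℝ, Cd d) := by
  intro e he
  have h := mem_contDiffGroupoid_self_iff.1 he
  exact mem_contDiffGroupoid_self_iff.2 ⟨(h.1.restrict_scalars ℝ).of_le le_top,
    (h.2.restrict_scalars ℝ).of_le le_top⟩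

instance isManifold_real [IsManifold 𝓘(ℂ, Cd d) ω X] : IsManifold 𝓘(ℝ, Cd d) ∞ X where
  compatible he he' := contDiffGroupoid_complex_le
    ((contDiffGroupoid ω 𝓘(ℂ, Cd d)).compatible he he')

theorem HolChart.real {e : OpenPartialHomeomorph X (Cd d)} (he : HolChart e) :
    e ∈ IsManifold.maximalAtlas 𝓘(ℝ, Cd d) ∞ X :=
  StructureGroupoid.maximalAtlas_mono contDiffGroupoid_complex_le he

theorem HolChart.transHol [IsManifold 𝓘(ℂ, Cd d) ω X] {e : OpenPartialHomeomorph X (Cd d)}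
    (he : HolChart e) {f : OpenPartialHomeomorph (Cd d) (Cd d)}
    (hf : f ∈ contDiffGroupoid ω 𝓘(ℂ, Cd d)) : HolChart (e ≫ₕ f) := by
  refine (mem_maximalAtlas_iff).2 fun e' he' => ?_
  have h := mem_maximalAtlas_iff.1 he e' he'
  constructor
  · rw [OpenPartialHomeomorph.trans_symm_eq_symm_trans_symm, OpenPartialHomeomorph.trans_assoc]
    exact (contDiffGroupoid ω 𝓘(ℂ, Cd d)).trans ((contDiffGroupoid ω 𝓘(ℂ, Cd d)).symm hf) h.1
  · rw [← OpenPartialHomeomorph.trans_assoc]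
    exact (contDiffGroupoid ω 𝓘(ℂ, Cd d)).trans h.2 hf

variable {e e' : OpenPartialHomeomorph X (Cd d)}

theorem HolChart.transition [IsManifold 𝓘(ℂ, Cd d) ω X] (he : HolChart e) (he' : HolChart e') :
    ContDiffOn ℂ ω (e' ∘ e.symm) {w | w ∈ e.target ∧ e.symm w ∈ e'.source} := by
  have h := mem_contDiffGroupoid_self_iff.1
    ((contDiffGroupoid ω 𝓘(ℂ, Cd d)).compatible_of_mem_maximalAtlas he he')
  refine h.1.mono fun w hw => ?_
  simpa [OpenPartialHomeomorph.trans_source] using hw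

theorem isOpen_transition (e e' : OpenPartialHomeomorph X (Cd d)) :
    IsOpen {w | w ∈ e.target ∧ e.symm w ∈ e'.source} :=
  e.symm.isOpen_inter_preimage e'.open_source

theorem HolChart.differentiableAt_transition [IsManifold 𝓘(ℂ, Cd d) ω X] (he : HolChart e)
    (he' : HolChart e') {w : Cd d} (hw : w ∈ e.target) (hw' : e.symm w ∈ e'.source) :
    DifferentiableAt ℂ (e' ∘ e.symm) w :=
  ((he.transition he').differentiableOn (by simp)).differentiableAt
    ((isOpen_transition e e').mem_nhds ⟨hw, hw'⟩)

/-- The affine change of coordinates `z ↦ (z_{σ k} - p_k)_k`. -/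
def affHomeo (σ : Equiv.Perm (Fin d)) (p : Cd d) : Cd d ≃ₜ Cd d where
  toFun z := fun k => z (σ k) - p k
  invFun w := fun j => w (σ.symm j) + p (σ.symm j)
  left_inv z := by ext; simp
  right_inv w := by ext; simp
  continuous_toFun := by fun_prop
  continuous_invFun := by fun_prop

/-- The chart `e`, restricted to the preimage of the open set `V`, with coordinates permuted by `σ`
and translated by `p`. -/
def affChart (e : OpenPartialHomeomorph X (Cd d)) (σ : Equiv.Perm (Fin d)) (p : Cd d) {V : Set (Cd d)}
    (hV : IsOpen V) : OpenPartialHomeomorph X (Cd d) :=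
  e ≫ₕ (OpenPartialHomeomorph.ofSet V hV ≫ₕ (affHomeo σ p).toOpenPartialHomeomorph)

section AffChart

variable (σ : Equiv.Perm (Fin d)) (p : Cd d) {V : Set (Cd d)} (hV : IsOpen V)

theorem affChart_apply (y : X) (k : Fin d) : affChart e σ p hV y k = e y (σ k) - p k := rfl

theorem affChart_source : (affChart e σ p hV).source = {y | y ∈ e.source ∧ e y ∈ V} := by
  ext y; simp [affChart]

theorem affChart_symm_apply (w : Cd d) :
    (affChart e σ p hV).symm w = e.symm (fun j => w (σ.symm j) + p (σ.symm j)) := rfl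

theorem affChart_target : (affChart e σ p hV).target =
    {w | (fun j => w (σ.symm j) + p (σ.symm j)) ∈ e.target ∩ V} := by
  ext w
  simp only [affChart, OpenPartialHomeomorph.trans_target, OpenPartialHomeomorph.trans_symm_eq_symm_trans_symm]
  simp [affHomeo]
  exact and_comm

theorem HolChart.aff [IsManifold 𝓘(ℂ, Cd d) ω X] (he : HolChart e) :
    HolChart (affChart e σ p hV) := by
  refine he.transHol (mem_contDiffGroupoid_self_iff.2 ⟨?_, ?_⟩)
  · refine ContDiff.contDiffOn ?_
    rw [contDiff_pi]
    intro k
    exact (contDiff_apply ℂ ℂ (σ k)).sub contDiff_const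
  · refine ContDiff.contDiffOn ?_
    rw [contDiff_pi]
    intro k
    exact (contDiff_apply ℂ ℂ (σ.symm k)).add contDiff_const

end AffChart

/-! ### Forms in charts and their coefficients -/

theorem inChart_apply_of_eq {k : ℕ} (η : FormField d X k) {w : Cd d} {x : X} (hx : e.symm w = x)
    (v : Fin k → Cd d) : inChart e η w v =
      η x (fun i => (mfderiv 𝓘(ℝ, Cd d) 𝓘(ℝ, Cd d) e.symm w (v i) : Cd d)) := by
  subst hx; rfl

theorem HolChart.mdifferentiableAt_symm (he : HolChart e) {w : Cd d} (hw : w ∈ e.target) :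
    MDifferentiableAt 𝓘(ℝ, Cd d) 𝓘(ℝ, Cd d) e.symm w :=
  (contMDiffAt_symm_of_mem_maximalAtlas he.real hw).mdifferentiableAt (by simp)

theorem HolChart.mdifferentiableAt (he : HolChart e) {x : X} (hx : x ∈ e.source) :
    MDifferentiableAt 𝓘(ℝ, Cd d) 𝓘(ℝ, Cd d) e x :=
  (contMDiffAt_of_mem_maximalAtlas he.real hx).mdifferentiableAt (by simp)

/-- The transformation rule of forms between two holomorphic charts. -/
theorem inChart_transition [IsManifold 𝓘(ℂ, Cd d) ω X] (he : HolChart e) (he' : HolChart e')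
    {k : ℕ} (η : FormField d X k) {w : Cd d} (hw : w ∈ e.target) (hw' : e.symm w ∈ e'.source)
    (v : Fin k → Cd d) :
    inChart e η w v = inChart e' η (e' (e.symm w))
      (fun i => fderiv ℝ (e' ∘ e.symm) w (v i)) := by
  have hx : e'.symm (e' (e.symm w)) = e.symm w := e'.left_inv hw'
  rw [inChart_apply_of_eq η rfl, inChart_apply_of_eq (e := e') η hx]
  congr 1
  funext i
  have hev : e.symm =ᶠ[𝓝 w] e'.symm ∘ (e' ∘ e.symm) := by
    filter_upwards [(isOpen_transition e e').mem_nhds ⟨hw, hw'⟩] with z hz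
    exact (e'.left_inv hz.2).symm
  have hd := (he.differentiableAt_transition he' hw hw').restrictScalars ℝ
  have h1 := mfderiv_comp w (he'.mdifferentiableAt_symm (e'.map_source hw'))
    hd.mdifferentiableAt
  have h2 := hev.mfderiv_eq (I := 𝓘(ℝ, Cd d)) (I' := 𝓘(ℝ, Cd d))
  have h3 := congrArg (fun L : Cd d →L[ℝ] Cd d => L (v i)) (h2.trans h1)
  rw [mfderiv_eq_fderiv] at h3
  exact h3

/-- The embedding of the coordinate plane, as a linear map. -/
def sliceL (d c : ℕ) : Cd (d - c) →L[ℂ] Cd d :=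
  ContinuousLinearMap.pi fun j => if h : c ≤ (j : ℕ) then
    ContinuousLinearMap.proj (⟨(j : ℕ) - c, by have := j.isLt; omega⟩ : Fin (d - c)) else 0

theorem sliceL_apply (d c : ℕ) (w : Cd (d - c)) : sliceL d c w = slice d c w := by
  ext j
  simp only [sliceL, slice, ContinuousLinearMap.coe_pi']
  split_ifs <;> rfl

/-- The projection to the last `d - c` coordinates. -/
def tailL (d c : ℕ) : Cd d →L[ℂ] Cd (d - c) :=
  ContinuousLinearMap.pi fun k => ContinuousLinearMap.proj (tailIdx d c k)

theorem tailL_apply (d c : ℕ) (z : Cd d) (k : Fin (d - c)) : tailL d c z k = z (tailIdx d c k) := rfl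

theorem tailL_slice (d c : ℕ) (w : Cd (d - c)) : tailL d c (slice d c w) = w := by
  ext k; simp [tailL_apply, slice, tailIdx]

theorem slice_tailL (d c : ℕ) {z : Cd d} (hz : ∀ j : Fin d, (j : ℕ) < c → z j = 0) :
    slice d c (tailL d c z) = z := by
  ext j
  unfold slice
  split_ifs with h
  · rw [tailL_apply]; congr 1; ext; simp [tailIdx]; omega
  · exact (hz j (by omega)).symm

theorem slice_eq_zero {d c : ℕ} (w : Cd (d - c)) {j : Fin d} (hj : (j : ℕ) < c) :
    slice d c w j = 0 := by
  simp [slice, hj]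

/-- The oriented real basis of `ℂⁿ`. -/
def realFrame (n : ℕ) : Module.Basis (Fin (2 * n)) ℝ (Cd n) :=
  (Pi.basis (fun _ : Fin n => Complex.basisOneI)).reindex
    ((Equiv.sigmaEquivProd (Fin n) (Fin 2)).trans
      (finProdFinEquiv.trans (finCongr (Nat.mul_comm n 2))))

theorem realFrame_apply (n : ℕ) (k : Fin (2 * n)) : realFrame n k =
    Pi.single ⟨(k : ℕ) / 2, by have := k.isLt; omega⟩ (if (k : ℕ) % 2 = 0 then 1 else Complex.I) := by
  obtain ⟨⟨i, b⟩, rfl⟩ := ((Equiv.sigmaEquivProd (Fin n) (Fin 2)).trans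
      (finProdFinEquiv.trans (finCongr (Nat.mul_comm n 2)))).surjective k
  rw [realFrame, Module.Basis.reindex_apply, Equiv.symm_apply_apply, Pi.basis_apply]
  have h1 : ((((Equiv.sigmaEquivProd (Fin n) (Fin 2)).trans
      (finProdFinEquiv.trans (finCongr (Nat.mul_comm n 2)))) ⟨i, b⟩ : Fin (2 * n)) : ℕ) = b + 2 * i := rfl
  have h2 : ((b : ℕ) + 2 * i) / 2 = i := by have := b.isLt; omega
  have h3 : ((b : ℕ) + 2 * i) % 2 = b := by have := b.isLt; omega
  simp only [h1, h2, h3]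
  fin_cases b <;> simp

theorem sliceFrame_eq (d c : ℕ) (k : Fin (2 * (d - c))) :
    sliceFrame d c k = slice d c (realFrame (d - c) k) := by
  rw [realFrame_apply, sliceFrame]
  ext j
  by_cases hj : c ≤ (j : ℕ)
  · simp only [slice, dif_pos hj, Pi.single_apply, Fin.ext_iff]
    have : ((j : ℕ) = c + k / 2) ↔ ((j : ℕ) - c = k / 2) := by omega
    simp only [this]
  · have : (j : ℕ) ≠ c + k / 2 := by omega
    simp [slice, hj, Fin.ext_iff, this]

theorem alternating_map_comp_frame {n : ℕ} (f : Cd n [⋀^Fin (2 * n)]→ₗ[ℝ] ℂ) (T : Cd n →ₗ[ℝ] Cd n) :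
    f (fun k => T (realFrame n k)) = ((LinearMap.det T : ℝ) : ℂ) * f (realFrame n) := by
  have key : ∀ g : Cd n [⋀^Fin (2 * n)]→ₗ[ℝ] ℝ,
      g (fun k => T (realFrame n k)) = LinearMap.det T * g (realFrame n) := by
    intro g
    have h := (realFrame n).det_comp T (realFrame n)
    rw [(realFrame n).det_self, mul_one] at h
    conv_lhs => rw [g.eq_smul_basis_det (realFrame n)]
    rw [AlternatingMap.smul_apply, show (fun k => T (realFrame n k)) = T ∘ (realFrame n) from rfl, h]
    simp [mul_comm]
  apply Complex.ext
  · simpa using key (Complex.reLm.compAlternatingMap f)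
  · simpa using key (Complex.imLm.compAlternatingMap f)

theorem det_restrictScalars_nonneg {n : ℕ} (T : Cd n →ₗ[ℂ] Cd n) :
    0 ≤ LinearMap.det (T.restrictScalars ℝ) := by
  rw [LinearMap.det_restrictScalars, Algebra.norm_complex_apply]
  exact Complex.normSq_nonneg _

/-! ### Sections of the top exterior power along a coordinate plane -/

theorem sliceCoeff_congr {c : ℕ} {η η' : FormField d X (2 * (d - c))} {w : Cd (d - c)}
    (h : η (e.symm (slice d c w)) = η' (e.symm (slice d c w))) :
    sliceCoeff e c η w = sliceCoeff e c η' w := by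
  simp only [sliceCoeff, inChart, h]

theorem sliceCoeff_zero {c : ℕ} {η : FormField d X (2 * (d - c))} {w : Cd (d - c)}
    (h : η (e.symm (slice d c w)) = 0) : sliceCoeff e c η w = 0 := by
  simp only [sliceCoeff, inChart, h]
  rfl

theorem sliceCoeff_smul {c : ℕ} (a : X → ℂ) (η : FormField d X (2 * (d - c))) (w : Cd (d - c)) :
    sliceCoeff e c (fun x => a x • η x) w =
      a (e.symm (slice d c w)) * sliceCoeff e c η w := rfl

theorem sliceCoeff_sum {c : ℕ} {ι : Type*} (s : Finset ι) (η : ι → FormField d X (2 * (d - c)))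
    (w : Cd (d - c)) :
    sliceCoeff e c (fun x => ∑ i ∈ s, η i x) w = ∑ i ∈ s, sliceCoeff e c (η i) w := by
  classical
  induction s using Finset.induction_on with
  | empty => exact sliceCoeff_zero rfl
  | insert i s hi ih =>
    simp_rw [Finset.sum_insert hi]
    rw [← ih]
    rfl

open Classical in
/-- The form which vanishes outside `U` and has, in the chart `e`, the coefficient `coef` along the
coordinate plane. -/
def mkForm (e : OpenPartialHomeomorph X (Cd d)) (c : ℕ) (U : Set X) (coef : Cd (d - c) → ℂ) :
    FormField d X (2 * (d - c)) := fun x =>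
  if x ∈ U then coef (tailL d c (e x)) •
    (Complex.ofRealCLM.toLinearMap.compAlternatingMap ((realFrame (d - c)).det)).compLinearMap
      ((((tailL d c).restrictScalars ℝ).comp
        (mfderiv 𝓘(ℝ, Cd d) 𝓘(ℝ, Cd d) e x)).toLinearMap)
  else 0

theorem mkForm_of_notMem {c : ℕ} {U : Set X} (coef : Cd (d - c) → ℂ) {x : X} (hx : x ∉ U) :
    mkForm e c U coef x = 0 := by
  rw [mkForm, if_neg hx]

theorem sliceCoeff_mkForm (he : HolChart e) {c : ℕ} {U : Set X} (coef : Cd (d - c) → ℂ)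
    {w : Cd (d - c)} (hw : slice d c w ∈ e.target) (hU : e.symm (slice d c w) ∈ U) :
    sliceCoeff e c (mkForm e c U coef) w = coef w := by
  set x := e.symm (slice d c w) with hx
  have hex : e x = slice d c w := e.right_inv hw
  have hD : ∀ v : Cd d, mfderiv 𝓘(ℝ, Cd d) 𝓘(ℝ, Cd d) e x
      (mfderiv 𝓘(ℝ, Cd d) 𝓘(ℝ, Cd d) e.symm (slice d c w) v : Cd d) = v := by
    intro v
    have h1 := mfderiv_comp (slice d c w) (he.mdifferentiableAt (e.map_target hw))
      (he.mdifferentiableAt_symm hw)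
    have h2 : e ∘ e.symm =ᶠ[𝓝 (slice d c w)] id := by
      filter_upwards [e.open_target.mem_nhds hw] with z hz using e.right_inv hz
    have h3 := h2.mfderiv_eq (I := 𝓘(ℝ, Cd d)) (I' := 𝓘(ℝ, Cd d))
    have h4 := congrArg (fun L : Cd d →L[ℝ] Cd d => L v) (h1.symm.trans h3)
    rw [mfderiv_id] at h4
    exact h4
  rw [sliceCoeff, inChart_apply_of_eq _ rfl, mkForm, if_pos hU, ← hx, hex, tailL_slice]
  rw [AlternatingMap.smul_apply]
  have h5 : ((Complex.ofRealCLM.toLinearMap.compAlternatingMap ((realFrame (d - c)).det)).compLinearMap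
      ((((tailL d c).restrictScalars ℝ).comp
        (mfderiv 𝓘(ℝ, Cd d) 𝓘(ℝ, Cd d) e x)).toLinearMap))
      (fun i => (mfderiv 𝓘(ℝ, Cd d) 𝓘(ℝ, Cd d) e.symm (slice d c w) (sliceFrame d c i) : Cd d)) = 1 := by
    change ((realFrame (d - c)).det (fun i => tailL d c (mfderiv 𝓘(ℝ, Cd d) 𝓘(ℝ, Cd d) e x
      (mfderiv 𝓘(ℝ, Cd d) 𝓘(ℝ, Cd d) e.symm (slice d c w) (sliceFrame d c i) : Cd d))) : ℂ) = 1
    have h6 : (fun i => tailL d c (mfderiv 𝓘(ℝ, Cd d) 𝓘(ℝ, Cd d) e x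
      (mfderiv 𝓘(ℝ, Cd d) 𝓘(ℝ, Cd d) e.symm (slice d c w) (sliceFrame d c i) : Cd d)))
        = realFrame (d - c) := by
      funext i
      rw [hD, sliceFrame_eq, tailL_slice]
    rw [h6, Module.Basis.det_self]
    simp
  rw [h5]
  simp

/-! ### Change of variables between slice charts -/

/-- The transition map between two slice charts, as a map between the coordinate planes. -/
def sliceTrans (e e' : OpenPartialHomeomorph X (Cd d)) (c : ℕ) (w : Cd (d - c)) : Cd (d - c) :=
  tailL d c (e' (e.symm (slice d c w)))

/-- The part of the coordinate plane which corresponds to `A ⊆ X`. -/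
def sliceSet (e : OpenPartialHomeomorph X (Cd d)) (c : ℕ) (A : Set X) : Set (Cd (d - c)) :=
  {w | slice d c w ∈ e.target ∧ e.symm (slice d c w) ∈ A}

variable {S : Set X} {c : ℕ}

theorem IsSliceChart.mem_of_slice (he : IsSliceChart S c e) {w : Cd (d - c)}
    (hw : slice d c w ∈ e.target) : e.symm (slice d c w) ∈ S := by
  refine (he.2.2 _ (e.map_target hw)).2 fun j hj => ?_
  rw [e.right_inv hw, slice_eq_zero w hj]

theorem IsSliceChart.slice_sliceTrans (he : IsSliceChart S c e) (he' : IsSliceChart S c e')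
    {w : Cd (d - c)} (hw : slice d c w ∈ e.target) (hw' : e.symm (slice d c w) ∈ e'.source) :
    slice d c (sliceTrans e e' c w) = e' (e.symm (slice d c w)) :=
  slice_tailL d c fun j hj => (he'.2.2 _ hw').1 (he.mem_of_slice hw) j hj

theorem IsSliceChart.sliceTrans_mem (he : IsSliceChart S c e) (he' : IsSliceChart S c e')
    {A : Set X} (hA' : A ⊆ e'.source) {w : Cd (d - c)} (hw : w ∈ sliceSet e c A) :
    sliceTrans e e' c w ∈ sliceSet e' c A := by
  have h := he.slice_sliceTrans he' hw.1 (hA' hw.2)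
  refine ⟨?_, ?_⟩
  · rw [h]; exact e'.map_source (hA' hw.2)
  · rw [h, e'.left_inv (hA' hw.2)]; exact hw.2

theorem IsSliceChart.sliceTrans_sliceTrans (he : IsSliceChart S c e) (he' : IsSliceChart S c e')
    {A : Set X} (hA' : A ⊆ e'.source) {w : Cd (d - c)} (hw : w ∈ sliceSet e c A) :
    sliceTrans e' e c (sliceTrans e e' c w) = w := by
  have h := he.slice_sliceTrans he' hw.1 (hA' hw.2)
  rw [sliceTrans, h, e'.left_inv (hA' hw.2), e.right_inv hw.1, tailL_slice]

theorem IsSliceChart.image_sliceTrans (he : IsSliceChart S c e) (he' : IsSliceChart S c e')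
    {A : Set X} (hA : A ⊆ e.source) (hA' : A ⊆ e'.source) :
    sliceTrans e e' c '' sliceSet e c A = sliceSet e' c A := by
  apply Subset.antisymm
  · rintro _ ⟨w, hw, rfl⟩
    exact he.sliceTrans_mem he' hA' hw
  · intro w hw
    exact ⟨_, he'.sliceTrans_mem he hA hw, he'.sliceTrans_sliceTrans he hA hw⟩

variable [IsManifold 𝓘(ℂ, Cd d) ω X]

theorem IsSliceChart.hasFDerivAt_sliceTrans (he : IsSliceChart S c e) (he' : IsSliceChart S c e')
    {w : Cd (d - c)} (hw : slice d c w ∈ e.target) (hw' : e.symm (slice d c w) ∈ e'.source) :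
    HasFDerivAt (sliceTrans e e' c) (((tailL d c).comp ((fderiv ℂ (e' ∘ e.symm) (slice d c w)).comp
      (sliceL d c))).restrictScalars ℝ) w := by
  have h1 := (he.1.differentiableAt_transition he'.1 hw hw').hasFDerivAt
  have h2 : HasFDerivAt (slice d c) (sliceL d c) w := by
    have := (sliceL d c).hasFDerivAt (x := w)
    rwa [show (⇑(sliceL d c) : Cd (d - c) → Cd d) = slice d c from
      funext fun w => sliceL_apply d c w] at this
  have h3 := ((tailL d c).hasFDerivAt.comp w (h1.comp w h2)).restrictScalars ℝ
  exact h3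

/-- The transformation rule of the coefficient between two slice charts. The real determinant of a
complex linear map is not negative, so that no sign occurs. -/
theorem IsSliceChart.sliceCoeff_eq (he : IsSliceChart S c e) (he' : IsSliceChart S c e')
    (η : FormField d X (2 * (d - c))) {w : Cd (d - c)} (hw : slice d c w ∈ e.target)
    (hw' : e.symm (slice d c w) ∈ e'.source) :
    sliceCoeff e c η w = |(((tailL d c).comp ((fderiv ℂ (e' ∘ e.symm) (slice d c w)).comp
      (sliceL d c))).restrictScalars ℝ).det| • sliceCoeff e' c η (sliceTrans e e' c w) := by
  set T : Cd (d - c) →L[ℂ] Cd (d - c) := (tailL d c).comp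
    ((fderiv ℂ (e' ∘ e.symm) (slice d c w)).comp (sliceL d c)) with hT
  have hdet : 0 ≤ (T.restrictScalars ℝ).det := det_restrictScalars_nonneg T.toLinearMap
  rw [abs_of_nonneg hdet]
  have hsl := he.slice_sliceTrans he' hw hw'
  have h0 : ∀ v : Cd (d - c), fderiv ℝ (e' ∘ e.symm) (slice d c w) (slice d c v)
      = slice d c (T v) := by
    intro v
    have hd := he.1.differentiableAt_transition he'.1 hw hw'
    rw [hd.fderiv_restrictScalars ℝ]
    have h1 := ((sliceL d c).restrictScalars ℝ).hasFDerivAt.comp w (he.hasFDerivAt_sliceTrans he' hw hw')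
    have h2 : HasFDerivAt (slice d c) (sliceL d c) w := by
      have := (sliceL d c).hasFDerivAt (x := w)
      rwa [show (⇑(sliceL d c) : Cd (d - c) → Cd d) = slice d c from
        funext fun w => sliceL_apply d c w] at this
    have h3 := (hd.hasFDerivAt.comp w h2).restrictScalars ℝ
    have hev : (⇑((sliceL d c).restrictScalars ℝ) ∘ sliceTrans e e' c) =ᶠ[𝓝 w]
        ((e' ∘ e.symm) ∘ slice d c) := by
      have : {w | slice d c w ∈ e.target ∧ e.symm (slice d c w) ∈ e'.source} ∈ 𝓝 w :=
        ((isOpen_transition e e').preimage (continuous_slice d c)).mem_nhds ⟨hw, hw'⟩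
      filter_upwards [this] with z hz
      have := he.slice_sliceTrans he' hz.1 hz.2
      simp only [Function.comp_apply, ← this]
      exact sliceL_apply d c _
    have h4 := (h1.congr_of_eventuallyEq hev.symm).unique h3
    have h5 := congrArg (fun L : Cd (d - c) →L[ℝ] Cd d => L v) h4
    rw [← sliceL_apply d c v, ← sliceL_apply d c (T v)]
    exact h5.symm
  set f : Cd (d - c) [⋀^Fin (2 * (d - c))]→ₗ[ℝ] ℂ :=
    (inChart e' η (e' (e.symm (slice d c w)))).compLinearMap
      ((sliceL d c).restrictScalars ℝ).toLinearMap with hf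
  have h6 := alternating_map_comp_frame f (T.restrictScalars ℝ).toLinearMap
  have h7 : sliceCoeff e c η w = f (fun k => (T.restrictScalars ℝ).toLinearMap (realFrame (d - c) k)) := by
    rw [sliceCoeff, inChart_transition he.1 he'.1 η hw hw', hf, AlternatingMap.compLinearMap_apply]
    congr 1
    funext i
    rw [sliceFrame_eq, h0]
    exact (sliceL_apply d c _).symm
  have h8 : sliceCoeff e' c η (sliceTrans e e' c w) = f (realFrame (d - c)) := by
    rw [sliceCoeff, hsl, hf, AlternatingMap.compLinearMap_apply]
    congr 1
    funext i
    rw [sliceFrame_eq]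
    exact (sliceL_apply d c _).symm
  rw [h7, h8, h6, Complex.real_smul]

theorem IsSliceChart.integral_sliceSet_eq (he : IsSliceChart S c e) (he' : IsSliceChart S c e')
    {A : Set X} (hA : A ⊆ e.source) (hA' : A ⊆ e'.source) (hm : MeasurableSet (sliceSet e c A))
    (η : FormField d X (2 * (d - c))) :
    (IntegrableOn (sliceCoeff e' c η) (sliceSet e' c A) ↔
      IntegrableOn (sliceCoeff e c η) (sliceSet e c A)) ∧
    ∫ w in sliceSet e' c A, sliceCoeff e' c η w = ∫ w in sliceSet e c A, sliceCoeff e c η w := by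
  have hd : ∀ w ∈ sliceSet e c A, HasFDerivWithinAt (sliceTrans e e' c)
      (((tailL d c).comp ((fderiv ℂ (e' ∘ e.symm) (slice d c w)).comp
      (sliceL d c))).restrictScalars ℝ) (sliceSet e c A) w := fun w hw =>
    (he.hasFDerivAt_sliceTrans he' hw.1 (hA' hw.2)).hasFDerivWithinAt
  have hinj : InjOn (sliceTrans e e' c) (sliceSet e c A) := fun w hw w' hw' h => by
    rw [← he.sliceTrans_sliceTrans he' hA' hw, h, he.sliceTrans_sliceTrans he' hA' hw']
  have hcongr := fun w (hw : w ∈ sliceSet e c A) => he.sliceCoeff_eq he' η hw.1 (hA' hw.2)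
  rw [← he.image_sliceTrans he' hA hA']
  constructor
  · rw [integrableOn_image_iff_integrableOn_abs_det_fderiv_smul volume hm hd hinj]
    exact integrableOn_congr_fun (fun w hw => (hcongr w hw).symm) hm
  · rw [integral_image_eq_integral_abs_det_fderiv_smul volume hm hd hinj]
    exact setIntegral_congr_fun hm (fun w hw => (hcongr w hw).symm)

end Charts

end DivInt
end

noncomputable section
namespace DivInt

/-! ### Integrals as sums over charts -/

set_option linter.unusedSectionVars false

section IntegralOver

variable {d : ℕ} {X : Type*} [TopologicalSpace X] [ChartedSpace (Cd d) X]

theorem isOpen_sliceSet (e : OpenPartialHomeomorph X (Cd d)) (c : ℕ) {A : Set X} (hA : IsOpen A) :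
    IsOpen (sliceSet e c A) :=
  (e.symm.isOpen_inter_preimage hA).preimage (continuous_slice d c)

variable {S : Set X} {c : ℕ}

/-- The functional `Λ` on smooth functions is `f ↦ ∫_S P f` for a differential operator `P` with
integrable coefficients, which is a sum of operators in slice charts. -/
def IsIntegralOperator (S : Set X) (c : ℕ) (Λ : (X → ℝ) → ℂ) : Prop :=
  ∃ (n : ℕ) (e : Fin n → OpenPartialHomeomorph X (Cd d))
    (P : Fin n → (X → ℝ) → FormField d X (2 * (d - c))),
    (∀ i, IsLocalDiffOp S c (P i)) ∧ (∀ i, IsSliceChart S c (e i)) ∧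
    ∀ f : X → ℝ, SmoothFn (d := d) f →
      (∀ i, ∀ x ∉ (e i).source, P i f x = 0) ∧
      (∀ i, IntegrableOn (sliceCoeff (e i) c (P i f)) (slice d c ⁻¹' (e i).target)) ∧
      Λ f = ∑ i, ∫ w in slice d c ⁻¹' (e i).target, sliceCoeff (e i) c (P i f) w

theorem IsIntegralOperator.zero : IsIntegralOperator (d := d) S c (fun _ : X → ℝ => 0) :=
  ⟨0, Fin.elim0, Fin.elim0, fun i => i.elim0, fun i => i.elim0, fun _ _ =>
    ⟨fun i => i.elim0, fun i => i.elim0, by simp⟩⟩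

theorem IsIntegralOperator.add {Λ Λ' : (X → ℝ) → ℂ} (h : IsIntegralOperator (d := d) S c Λ)
    (h' : IsIntegralOperator (d := d) S c Λ') : IsIntegralOperator (d := d) S c (fun f => Λ f + Λ' f) := by
  obtain ⟨n, e, P, h1, h2, h3⟩ := h
  obtain ⟨n', e', P', h1', h2', h3'⟩ := h'
  refine ⟨n + n', Fin.append e e', Fin.append P P', fun i => ?_, fun i => ?_, fun f hf =>
    ⟨fun i => ?_, fun i => ?_, ?_⟩⟩
  · refine Fin.addCases (fun i => ?_) (fun i => ?_) i
    · simpa using h1 i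
    · simpa using h1' i
  · refine Fin.addCases (fun i => ?_) (fun i => ?_) i
    · simpa using h2 i
    · simpa using h2' i
  · refine Fin.addCases (fun i => ?_) (fun i => ?_) i
    · simpa using (h3 f hf).1 i
    · simpa using (h3' f hf).1 i
  · refine Fin.addCases (fun i => ?_) (fun i => ?_) i
    · simpa using (h3 f hf).2.1 i
    · simpa using (h3' f hf).2.1 i
  · rw [Fin.sum_univ_add]
    simp only [Fin.append_left, Fin.append_right]
    rw [← (h3 f hf).2.2, ← (h3' f hf).2.2]

theorem IsIntegralOperator.sum {ι : Type*} (s : Finset ι) {Λ : ι → (X → ℝ) → ℂ}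
    (h : ∀ i ∈ s, IsIntegralOperator (d := d) S c (Λ i)) :
    IsIntegralOperator (d := d) S c (fun f => ∑ i ∈ s, Λ i f) := by
  classical
  induction s using Finset.induction_on with
  | empty => simpa using IsIntegralOperator.zero
  | insert i s hi ih =>
    simp_rw [Finset.sum_insert hi]
    exact (h i (Finset.mem_insert_self i s)).add (ih fun j hj => h j (Finset.mem_insert_of_mem hj))

variable [IsManifold 𝓘(ℂ, Cd d) ω X]

/-- The case of `hasIntegralOver_sum` in which the charts are numbered. -/
theorem hasIntegralOver_sum_fin {n : ℕ} {e : Fin n → OpenPartialHomeomorph X (Cd d)}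
    (he : ∀ i, IsSliceChart S c (e i)) (hcov : ∀ x ∈ S, ∃ i, x ∈ (e i).source)
    {θ : Fin n → FormField d X (2 * (d - c))} (hθ : ∀ i, ∀ x ∈ S, x ∉ (e i).source → θ i x = 0)
    {η : FormField d X (2 * (d - c))} (hη : ∀ x ∈ S, η x = ∑ i, θ i x)
    (hint : ∀ i, IntegrableOn (sliceCoeff (e i) c (θ i)) (slice d c ⁻¹' (e i).target)) :
    HasIntegralOver S c η (∑ i, ∫ w in slice d c ⁻¹' (e i).target, sliceCoeff (e i) c (θ i) w) := by
  classical
  -- the weights are the indicator functions of the disjoint sets `A k` of points which lie in the chart `k`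
  -- and in no earlier one
  set B : Fin n → Set X := fun k => ⋃ j ∈ Finset.univ.filter (· < k), (e j).source with hB
  have hBo : ∀ k, IsOpen (B k) := fun k => isOpen_biUnion fun j _ => (e j).open_source
  set A : Fin n → Set X := fun k => (e k).source \ B k with hA
  have hAs : ∀ k, A k ⊆ (e k).source := fun k => sdiff_subset
  have hAdisj : Pairwise (fun k l => Disjoint (A k) (A l)) := by
    have : ∀ k l, k < l → Disjoint (A k) (A l) := fun k l hkl =>
      Set.disjoint_left.2 fun x hx hx' => hx'.2 (by
        simp only [hB, mem_iUnion, Finset.mem_filter, Finset.mem_univ, true_and]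
        exact ⟨k, hkl, hx.1⟩)
    intro k l hkl
    rcases lt_or_gt_of_ne hkl with h | h
    · exact this k l h
    · exact (this l k h).symm
  have hAcov : ∀ x ∈ S, ∃ k, x ∈ A k := by
    intro x hx
    have hne : (Finset.univ.filter fun i => x ∈ (e i).source).Nonempty := by
      obtain ⟨i, hi⟩ := hcov x hx
      exact ⟨i, by simpa using hi⟩
    refine ⟨(Finset.univ.filter fun i => x ∈ (e i).source).min' hne, ?_, ?_⟩
    · simpa using Finset.min'_mem _ hne
    · simp only [hB, mem_iUnion, Finset.mem_filter, Finset.mem_univ, true_and, not_exists]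
      intro j hj hxj
      exact absurd (Finset.min'_le _ j (by simpa using hxj)) (not_le.2 hj)
  have hmeas : ∀ k i l, MeasurableSet (sliceSet (e l) c (A k ∩ (e i).source)) := by
    intro k i l
    have : sliceSet (e l) c (A k ∩ (e i).source) =
        sliceSet (e l) c ((e k).source ∩ (e i).source) \ sliceSet (e l) c (B k) := by
      ext w
      simp only [sliceSet, hA, mem_ofPred_eq, mem_inter_iff, Set.mem_sdiff]
      tauto
    rw [this]
    exact (isOpen_sliceSet _ c ((e k).open_source.inter (e i).open_source)).measurableSet.diff
      (isOpen_sliceSet _ c (hBo k)).measurableSet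
  have hcov' : ∀ k i, (IntegrableOn (sliceCoeff (e i) c (θ i)) (sliceSet (e i) c (A k ∩ (e i).source)) ↔
      IntegrableOn (sliceCoeff (e k) c (θ i)) (sliceSet (e k) c (A k ∩ (e i).source))) ∧
      ∫ w in sliceSet (e i) c (A k ∩ (e i).source), sliceCoeff (e i) c (θ i) w =
        ∫ w in sliceSet (e k) c (A k ∩ (e i).source), sliceCoeff (e k) c (θ i) w := fun k i =>
    (he k).integral_sliceSet_eq (he i) (inter_subset_left.trans (hAs k)) inter_subset_right
      (hmeas k i k) (θ i)
  have hsub : ∀ k i l, sliceSet (e l) c (A k ∩ (e i).source) ⊆ slice d c ⁻¹' (e l).target :=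
    fun k i l w hw => hw.1
  have hintk : ∀ k i, IntegrableOn (sliceCoeff (e k) c (θ i)) (sliceSet (e k) c (A k ∩ (e i).source)) :=
    fun k i => (hcov' k i).1.1 ((hint i).mono_set (hsub k i i))
  have htm : ∀ k, MeasurableSet (slice d c ⁻¹' (e k).target) := fun k =>
    ((e k).open_target.preimage (continuous_slice d c)).measurableSet
  set ρ : Fin n → X → ℝ := fun k => (A k).indicator 1 with hρ
  -- the weighted coefficient of `η` in the chart `k`
  have hfun : ∀ k, ∀ w ∈ slice d c ⁻¹' (e k).target,
      (ρ k ((e k).symm (slice d c w)) : ℂ) * sliceCoeff (e k) c η w =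
      ∑ i, (sliceSet (e k) c (A k ∩ (e i).source)).indicator (sliceCoeff (e k) c (θ i)) w := by
    intro k w hw
    have hwS := (he k).mem_of_slice hw
    have h1 : sliceCoeff (e k) c η w = ∑ i, sliceCoeff (e k) c (θ i) w := by
      rw [← sliceCoeff_sum]
      exact sliceCoeff_congr (hη _ hwS)
    rw [h1, Finset.mul_sum]
    refine Finset.sum_congr rfl fun i _ => ?_
    by_cases hk : (e k).symm (slice d c w) ∈ A k
    · by_cases hi : (e k).symm (slice d c w) ∈ (e i).source
      · rw [indicator_of_mem (show w ∈ sliceSet (e k) c (A k ∩ (e i).source) from ⟨hw, hk, hi⟩)]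
        simp [hρ, hk]
      · rw [sliceCoeff_zero (hθ i _ hwS hi), mul_zero, indicator_of_notMem fun h => hi h.2.2]
    · rw [indicator_of_notMem fun h => hk h.2.1]
      simp [hρ, hk]
  have hintkt : ∀ k i, IntegrableOn ((sliceSet (e k) c (A k ∩ (e i).source)).indicator
      (sliceCoeff (e k) c (θ i))) (slice d c ⁻¹' (e k).target) := fun k i => by
    rw [integrableOn_indicator_iff (hmeas k i k)]
    exact (hintk k i).mono_set inter_subset_left
  refine ⟨n, e, ρ, he, fun i x => indicator_nonneg (fun _ _ => zero_le_one) _, fun i x hx => ?_,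
    fun x hx => ?_, fun k => ?_, ?_⟩
  · exact indicator_of_notMem (fun h => hx (hAs i h)) _
  · obtain ⟨k, hk⟩ := hAcov x hx
    rw [Finset.sum_eq_single k]
    · simp [hρ, hk]
    · intro l _ hl
      exact indicator_of_notMem (fun h => Set.disjoint_left.1 (hAdisj hl) h hk) _
    · simp
  · refine (integrableOn_congr_fun (hfun k) (htm k)).2 ?_
    exact integrable_finsetSum _ fun i _ => hintkt k i
  · have h2 : ∀ k, ∫ w in slice d c ⁻¹' (e k).target,
        (ρ k ((e k).symm (slice d c w)) : ℂ) * sliceCoeff (e k) c η w =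
        ∑ i, ∫ w in sliceSet (e i) c (A k ∩ (e i).source), sliceCoeff (e i) c (θ i) w := by
      intro k
      rw [setIntegral_congr_fun (htm k) (hfun k), integral_finsetSum _ fun i _ => hintkt k i]
      refine Finset.sum_congr rfl fun i _ => ?_
      rw [setIntegral_indicator (hmeas k i k), inter_eq_self_of_subset_right (hsub k i k), (hcov' k i).2]
    simp_rw [h2]
    rw [Finset.sum_comm]
    refine Finset.sum_congr rfl fun i _ => ?_
    have h3 : slice d c ⁻¹' (e i).target = ⋃ k, sliceSet (e i) c (A k ∩ (e i).source) := by
      ext w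
      simp only [mem_iUnion]
      constructor
      · intro hw
        obtain ⟨k, hk⟩ := hAcov _ ((he i).mem_of_slice hw)
        exact ⟨k, hw, hk, (e i).map_target hw⟩
      · rintro ⟨k, hk⟩
        exact hk.1
    rw [h3, integral_iUnion_fintype]
    · exact fun k => hmeas k i i
    · exact fun k l hkl => Set.disjoint_left.2 fun w hw hw' =>
        Set.disjoint_left.1 (hAdisj hkl) hw.2.1 hw'.2.1
    · exact fun k => (hint i).mono_set (hsub k i i)

/-- Integrals over a submanifold may be computed from a decomposition of the form into pieces which
live in slice charts. -/
theorem hasIntegralOver_sum {ι : Type*} [Fintype ι] {e : ι → OpenPartialHomeomorph X (Cd d)}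
    (he : ∀ i, IsSliceChart S c (e i)) (hcov : ∀ x ∈ S, ∃ i, x ∈ (e i).source)
    {θ : ι → FormField d X (2 * (d - c))} (hθ : ∀ i, ∀ x ∈ S, x ∉ (e i).source → θ i x = 0)
    {η : FormField d X (2 * (d - c))} (hη : ∀ x ∈ S, η x = ∑ i, θ i x)
    (hint : ∀ i, IntegrableOn (sliceCoeff (e i) c (θ i)) (slice d c ⁻¹' (e i).target)) :
    HasIntegralOver S c η (∑ i, ∫ w in slice d c ⁻¹' (e i).target, sliceCoeff (e i) c (θ i) w) := by
  set f := (Fintype.equivFin ι).symm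
  rw [← f.sum_comp]
  refine hasIntegralOver_sum_fin (e := fun i => e (f i)) (θ := fun i => θ (f i)) (fun i => he _)
    (fun x hx => ?_) (fun i => hθ _) (fun x hx => ?_) (fun i => hint _)
  · obtain ⟨i, hi⟩ := hcov x hx
    exact ⟨f.symm i, by simpa using hi⟩
  · rw [hη x hx, f.sum_comp (fun i => θ i x)]

/-- An integral operator comes from one differential operator on all of `S`. The second family of charts
serves to cover `S`. -/
theorem IsIntegralOperator.exists_diffOp {Λ : (X → ℝ) → ℂ} (h : IsIntegralOperator (d := d) S c Λ)
    {κ : Type*} [Finite κ] {e' : κ → OpenPartialHomeomorph X (Cd d)}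
    (he' : ∀ i, IsSliceChart S c (e' i)) (hcov : ∀ x ∈ S, ∃ i, x ∈ (e' i).source) :
    ∃ Q : (X → ℝ) → FormField d X (2 * (d - c)), IsDiffOp S c Q ∧
      ∀ f : X → ℝ, SmoothFn (d := d) f → HasIntegralOver S c (Q f) (Λ f) := by
  obtain ⟨n, e, P, h1, h2, h3⟩ := h
  have := Fintype.ofFinite κ
  refine ⟨fun f x => ∑ i, P i f x, ⟨n, P, h1, fun f _ x _ => rfl⟩, fun f hf => ?_⟩
  obtain ⟨h4, h5, h6⟩ := h3 f hf
  have := hasIntegralOver_sum (S := S) (c := c) (e := Sum.elim e e')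
    (θ := Sum.elim (fun i => P i f) (fun _ => 0)) (η := fun x => ∑ i, P i f x) ?_ ?_ ?_ ?_ ?_
  · rw [h6]
    convert! this using 1
    rw [Fintype.sum_sum_type]
    simp only [Sum.elim_inl, Sum.elim_inr]
    rw [left_eq_add]
    refine Finset.sum_eq_zero fun i _ => ?_
    rw [integral_congr_ae (ae_of_all _ fun w => sliceCoeff_zero (η := 0) rfl)]
    simp
  · rintro (i | i)
    exacts [h2 i, he' i]
  · intro x hx
    obtain ⟨i, hi⟩ := hcov x hx
    exact ⟨Sum.inr i, hi⟩
  · rintro (i | i) x - hx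
    exacts [h4 i x hx, rfl]
  · intro x _
    rw [Fintype.sum_sum_type]
    simp
  · rintro (i | i)
    · exact h5 i
    · refine (integrableOn_zero (ε' := ℂ)).congr (ae_of_all _ fun w => ?_)
      exact (sliceCoeff_zero (η := 0) rfl).symm

end IntegralOver

end DivInt
end

noncomputable section
namespace DivInt

/-! ### The stratification in normal crossings charts -/

set_option linter.unusedSectionVars false

section Stratification

variable {d : ℕ} {X : Type*} [TopologicalSpace X] [ChartedSpace (Cd d) X]

/-- The branches `{z_j = 0}`, `j < m`, through the point `z`. -/
def vanSet (m : ℕ) (z : Cd d) : Finset (Fin d) :=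
  Finset.univ.filter fun j => (j : ℕ) < m ∧ z j = 0

theorem mem_vanSet {m : ℕ} {z : Cd d} {j : Fin d} : j ∈ vanSet m z ↔ (j : ℕ) < m ∧ z j = 0 := by
  simp [vanSet]

/-- The points which lie on no other branches than the first `c` ones in the order given by `σ`. -/
def offSet (σ : Equiv.Perm (Fin d)) (c m : ℕ) : Set (Cd d) :=
  {z | ∀ k : Fin d, c ≤ (k : ℕ) → (σ k : ℕ) < m → z (σ k) ≠ 0}

theorem isOpen_offSet (σ : Equiv.Perm (Fin d)) (c m : ℕ) : IsOpen (offSet σ c m) := by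
  have : offSet σ c m = ⋂ k : Fin d, {z : Cd d | c ≤ (k : ℕ) → (σ k : ℕ) < m → z (σ k) ≠ 0} := by
    ext; simp [offSet]
  rw [this]
  refine isOpen_iInter_of_finite fun k => ?_
  by_cases h : c ≤ (k : ℕ) ∧ (σ k : ℕ) < m
  · simpa [h.1, h.2] using isOpen_ne_fun (continuous_apply (σ k)) continuous_const
  · have : {z : Cd d | c ≤ (k : ℕ) → (σ k : ℕ) < m → z (σ k) ≠ 0} = univ := by
      ext z; simp only [mem_ofPred_eq, mem_univ, iff_true]; intro h1 h2; exact absurd ⟨h1, h2⟩ h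
    rw [this]
    exact isOpen_univ

/-- Off the other branches at most `c` branches pass through a point, and `c` of them do on the
coordinate plane only. -/
theorem vanSet_of_mem_offSet {σ : Equiv.Perm (Fin d)} {c m : ℕ} (hc : c ≤ d)
    (hσ : ∀ k : Fin d, (k : ℕ) < c → (σ k : ℕ) < m) {z : Cd d} (hz : z ∈ offSet σ c m) :
    (vanSet m z).card ≤ c ∧
      (c ≤ (vanSet m z).card ↔ ∀ k : Fin d, (k : ℕ) < c → z (σ k) = 0) := by
  set T : Finset (Fin d) := (Finset.univ.filter fun k : Fin d => (k : ℕ) < c).map σ.toEmbedding with hT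
  have hTc : T.card = c := by rw [hT, Finset.card_map, Fin.card_filter_val_lt]; omega
  have hsub : vanSet m z ⊆ T := by
    intro j hj
    obtain ⟨h1, h2⟩ := mem_vanSet.1 hj
    simp only [hT, Finset.mem_map, Finset.mem_filter, Finset.mem_univ, true_and]
    refine ⟨σ.symm j, ?_, by simp⟩
    by_contra h
    exact hz (σ.symm j) (by omega) (by simpa using h1) (by simpa using h2)
  refine ⟨hTc ▸ Finset.card_le_card hsub, fun h k hk => ?_, fun h => ?_⟩
  · have heq := Finset.eq_of_subset_of_card_le hsub (by omega)
    have : σ k ∈ T := by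
      simp only [hT, Finset.mem_map, Finset.mem_filter, Finset.mem_univ, true_and]
      exact ⟨k, hk, rfl⟩
    rw [← heq] at this
    exact (mem_vanSet.1 this).2
  · rw [← hTc]
    refine Finset.card_le_card fun j hj => ?_
    simp only [hT, Finset.mem_map, Finset.mem_filter, Finset.mem_univ, true_and] at hj
    obtain ⟨k, hk, rfl⟩ := hj
    exact mem_vanSet.2 ⟨hσ k hk, h k hk⟩

theorem exists_perm_of_finset (T : Finset (Fin d)) :
    ∃ σ : Equiv.Perm (Fin d), ∀ k : Fin d, (k : ℕ) < T.card ↔ σ k ∈ T := by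
  have hT : T.card ≤ d := by simpa using T.card_le_univ
  have e : {k : Fin d // (k : ℕ) < T.card} ≃ {x : Fin d // x ∈ T} := Fintype.equivOfCardEq (by
    rw [Fintype.card_coe, Fintype.card_subtype, Fin.card_filter_val_lt]; omega)
  exact ⟨e.extendSubtype, fun k => ⟨fun hk => e.extendSubtype_mem k hk, fun hk => by
    by_contra h
    exact e.extendSubtype_not_mem k h hk⟩⟩

theorem mem_offSet_of_vanSet {m : ℕ} {z : Cd d} {σ : Equiv.Perm (Fin d)}
    (hσ : ∀ k : Fin d, (k : ℕ) < (vanSet m z).card ↔ σ k ∈ vanSet m z) :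
    z ∈ offSet σ (vanSet m z).card m := by
  intro k hk hkm h0
  have := (hσ k).2 (mem_vanSet.2 ⟨hkm, h0⟩)
  omega

variable {e : OpenPartialHomeomorph X (Cd d)} {D : Set X} {m : ℕ}

/-- The chart `e`, restricted to the points which lie on no other branches than the first `c` ones
in the order given by `σ`, which become the first `c` coordinates. -/
def permChart (e : OpenPartialHomeomorph X (Cd d)) (σ : Equiv.Perm (Fin d)) (c m : ℕ) :
    OpenPartialHomeomorph X (Cd d) :=
  affChart e σ 0 (isOpen_offSet σ c m)

theorem permChart_apply (σ : Equiv.Perm (Fin d)) (c : ℕ) (y : X) (k : Fin d) :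
    permChart e σ c m y k = e y (σ k) := by
  simp [permChart, affChart_apply]

theorem mem_permChart_source {σ : Equiv.Perm (Fin d)} {c : ℕ} {y : X} :
    y ∈ (permChart e σ c m).source ↔ y ∈ e.source ∧ e y ∈ offSet σ c m := by
  rw [permChart, affChart_source]; rfl

theorem permChart_symm_slice (σ : Equiv.Perm (Fin d)) (c : ℕ) (w : Cd (d - c)) :
    (permChart e σ c m).symm (slice d c w) = e.symm (permSlice σ c w) := by
  rw [permChart, affChart_symm_apply]
  congr 1
  funext j
  simp [permSlice]

theorem slice_mem_permChart_target {σ : Equiv.Perm (Fin d)} {c : ℕ} {w : Cd (d - c)} :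
    slice d c w ∈ (permChart e σ c m).target ↔
      permSlice σ c w ∈ e.target ∧ permSlice σ c w ∈ offSet σ c m := by
  rw [permChart, affChart_target]
  have : (fun j => slice d c w (σ.symm j) + (0 : Cd d) (σ.symm j)) = permSlice σ c w := by
    funext j; simp [permSlice]
  rw [mem_ofPred_eq, this]
  rfl

variable [IsManifold 𝓘(ℂ, Cd d) ω X]

theorem HolChart.perm (he : HolChart e) (σ : Equiv.Perm (Fin d)) (c : ℕ) :
    HolChart (permChart e σ c m) := he.aff σ 0 _

/-- The coordinates of a chart have non-zero differentials in any other chart. -/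
theorem fderiv_transition_coord_ne_zero {e' : OpenPartialHomeomorph X (Cd d)} (he : HolChart e)
    (he' : HolChart e') {y : X} (hy : y ∈ e.source) (hy' : y ∈ e'.source) (i : Fin d) :
    fderiv ℂ (fun w => e' (e.symm w) i) (e y) ≠ 0 := by
  intro h0
  have h1 : DifferentiableAt ℂ (e' ∘ e.symm) (e y) :=
    he.differentiableAt_transition he' (e.map_source hy) (by rwa [e.left_inv hy])
  have h2 : DifferentiableAt ℂ (e ∘ e'.symm) (e' y) :=
    he'.differentiableAt_transition he (e'.map_source hy') (by rwa [e'.left_inv hy'])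
  have hy2 : (e ∘ e'.symm) (e' y) = e y := by simp [e'.left_inv hy']
  have h3 : DifferentiableAt ℂ (fun w => e' (e.symm w) i) (e y) :=
    (differentiableAt_pi.1 h1) i
  have h4 : HasFDerivAt (fun z => e' (e.symm ((e ∘ e'.symm) z)) i)
      ((fderiv ℂ (fun w => e' (e.symm w) i) (e y)).comp (fderiv ℂ (e ∘ e'.symm) (e' y))) (e' y) := by
    have h5 := h3.hasFDerivAt
    rw [← hy2] at h5
    have := h5.comp (e' y) h2.hasFDerivAt
    rw [hy2] at this
    exact this
  have h6 : (fun z => e' (e.symm ((e ∘ e'.symm) z)) i) =ᶠ[𝓝 (e' y)] fun z => z i := by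
    filter_upwards [(isOpen_transition e' e).mem_nhds
      ⟨e'.map_source hy', by rwa [e'.left_inv hy']⟩] with z hz
    simp only [Function.comp_apply]
    rw [e.left_inv hz.2, e'.right_inv hz.1]
  have h7 := (h4.congr_of_eventuallyEq h6.symm).unique
    (ContinuousLinearMap.proj (R := ℂ) (φ := fun _ : Fin d => ℂ) i).hasFDerivAt
  rw [h0] at h7
  have := congrArg (fun L : Cd d →L[ℂ] ℂ => L (Pi.single i 1)) h7
  simp at this

theorem isSliceChart_permChart_of {S : Set X} (he : HolChart e) {σ : Equiv.Perm (Fin d)} {c : ℕ}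
    (hc : c ≤ d) (hS : ∀ y ∈ e.source, e y ∈ offSet σ c m →
      (y ∈ S ↔ ∀ k : Fin d, (k : ℕ) < c → e y (σ k) = 0)) :
    IsSliceChart S c (permChart e σ c m) := by
  refine ⟨he.perm σ c, hc, fun y hy => ?_⟩
  obtain ⟨h1, h2⟩ := mem_permChart_source.1 hy
  simp only [permChart_apply]
  exact hS y h1 h2

/-- In a normal crossings chart the stratum of index `k` consists of the points which lie on at least
`k` branches. -/
theorem mem_stratum_iff (he : HolChart e)
    (hD : ∀ y ∈ e.source, y ∈ D ↔ ∃ j : Fin d, (j : ℕ) < m ∧ e y j = 0) (k : ℕ) :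
    ∀ y ∈ e.source, y ∈ stratum (d := d) D k ↔ k ≤ (vanSet m (e y)).card := by
  induction k using stratum.induct with
  | case1 => intro y _; simp [stratum]
  | case2 =>
    intro y hy
    rw [stratum, hD y hy, Nat.one_le_iff_ne_zero, Ne, Finset.card_eq_zero,
      Finset.eq_empty_iff_forall_notMem]
    push Not
    simp [mem_vanSet]
  | case3 k ih =>
    intro y hy
    rw [stratum, mem_ofPred_eq, ih y hy]
    constructor
    · rintro ⟨h1, h2⟩
      by_contra h3
      have hcard : (vanSet m (e y)).card = k + 1 := by omega
      obtain ⟨σ, hσ⟩ := exists_perm_of_finset (vanSet m (e y))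
      have hoff := mem_offSet_of_vanSet hσ
      rw [hcard] at hoff
      have hkd : k + 1 ≤ d := by
        rw [← hcard]; simpa using (vanSet m (e y)).card_le_univ
      refine h2 ⟨permChart e σ (k + 1) m, ?_, mem_permChart_source.2 ⟨hy, hoff⟩⟩
      refine isSliceChart_permChart_of he hkd fun z hz hzo => ?_
      rw [ih z hz]
      refine (vanSet_of_mem_offSet hkd (fun j hj => ?_) hzo).2
      exact (mem_vanSet.1 ((hσ j).1 (by omega))).1
    · intro h
      refine ⟨by omega, ?_⟩
      rintro ⟨e', ⟨he', hkd, hS⟩, hy'⟩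
      -- at a point on more than `k + 1` branches the stratum `k + 1` contains the intersections of any `k + 1`
      -- of them, whose tangent spaces span everything; a function which vanishes on the stratum then has
      -- no differential there, in contrast to a coordinate of a slice chart
      set i₀ : Fin d := ⟨0, by omega⟩
      refine fderiv_transition_coord_ne_zero he he' hy hy' i₀ ?_
      have hdiff : DifferentiableAt ℂ (fun w => e' (e.symm w) i₀) (e y) :=
        (differentiableAt_pi.1 (he.differentiableAt_transition he' (e.map_source hy)
          (by rwa [e.left_inv hy]))) i₀
      have hzero : ∀ j : Fin d, fderiv ℂ (fun w => e' (e.symm w) i₀) (e y) (Pi.single j 1) = 0 := by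
        intro j
        have hline : HasDerivAt (fun t : ℂ => e y + t • (Pi.single j 1 : Cd d)) (Pi.single j 1) 0 := by
          simpa using ((hasDerivAt_id (0:ℂ)).smul_const (Pi.single j 1 : Cd d)).const_add (e y)
        have h1 := hdiff.hasFDerivAt
        rw [show e y = e y + (0:ℂ) • (Pi.single j 1 : Cd d) by simp] at h1
        have h2 := h1.comp_hasDerivAt (0:ℂ) hline
        have hev : ∀ᶠ t : ℂ in 𝓝 0, e y + t • (Pi.single j 1 : Cd d) ∈
            {w | w ∈ e.target ∧ e.symm w ∈ e'.source} := by
          refine hline.continuousAt.eventually_mem ((isOpen_transition e e').mem_nhds ?_)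
          simp only [zero_smul, add_zero]
          exact ⟨e.map_source hy, by rwa [e.left_inv hy]⟩
        have h3 : ((fun w => e' (e.symm w) i₀) ∘ fun t : ℂ => e y + t • (Pi.single j 1 : Cd d))
            =ᶠ[𝓝 0] fun _ => 0 := by
          filter_upwards [hev] with t ht
          have hcount : k + 1 ≤ (vanSet m (e (e.symm (e y + t • (Pi.single j 1 : Cd d))))).card := by
            rw [e.right_inv ht.1]
            have hsub : (vanSet m (e y)).erase j ⊆ vanSet m (e y + t • (Pi.single j 1 : Cd d)) := by
              intro i hi
              obtain ⟨hij, hi⟩ := Finset.mem_erase.1 hi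
              obtain ⟨h1, h2⟩ := mem_vanSet.1 hi
              exact mem_vanSet.2 ⟨h1, by simp [h2, hij]⟩
            have h5 := Finset.card_le_card hsub
            have h6 := Finset.pred_card_le_card_erase (s := vanSet m (e y)) (a := j)
            omega
          exact (hS _ ht.2).1 ((ih _ (e.map_target ht.1)).2 hcount) i₀ (by simp [i₀])
        have h4 := (h2.congr_of_eventuallyEq h3.symm).unique (hasDerivAt_const (0:ℂ) (0:ℂ))
        simpa using h4
      ext v
      rw [show v = ∑ j, v j • (Pi.single j (1:ℂ) : Cd d) by
        ext i; simp [Finset.sum_apply, Pi.single_apply], map_sum]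
      simp [hzero]

/-- Coordinates centred at a given point, defined on a polydisc inside a given neighbourhood, in which
`D` is `{z₁ ⋯ z_m = 0}`. -/
theorem exists_centered_chart (hD : IsNormalCrossing (d := d) D) (x : X) {N : Set X} (hN : N ∈ 𝓝 x) :
    ∃ (e : OpenPartialHomeomorph X (Cd d)) (m : ℕ) (ε : ℝ), HolChart e ∧ x ∈ e.source ∧ e x = 0 ∧
      0 < ε ∧ e.target = Metric.ball 0 ε ∧ e.source ⊆ N ∧ m ≤ d ∧
      ∀ y ∈ e.source, y ∈ D ↔ ∃ j : Fin d, (j : ℕ) < m ∧ e y j = 0 := by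
  obtain ⟨e₀, he₀, hx₀, m₀, hm₀⟩ := hD x
  obtain ⟨σ, hσ⟩ := exists_perm_of_finset (vanSet m₀ (e₀ x))
  set m := (vanSet m₀ (e₀ x)).card with hm
  have hoff : e₀ x ∈ offSet σ m m₀ := mem_offSet_of_vanSet hσ
  set e₁ := affChart e₀ σ (fun k => e₀ x (σ k)) (isOpen_offSet σ m m₀) with he₁
  have hx₁ : x ∈ e₁.source := by rw [he₁, affChart_source]; exact ⟨hx₀, hoff⟩
  have he₁x : e₁ x = 0 := by ext k; simp [he₁, affChart_apply]
  have hnb : {w | w ∈ e₁.target ∧ e₁.symm w ∈ interior N} ∈ 𝓝 (0 : Cd d) := by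
    refine (e₁.symm.isOpen_inter_preimage isOpen_interior).mem_nhds ?_
    rw [← he₁x]
    exact ⟨e₁.map_source hx₁, by
      rw [mem_preimage, e₁.left_inv hx₁]; exact mem_interior_iff_mem_nhds.2 hN⟩
  obtain ⟨ε, hε, hball⟩ := Metric.mem_nhds_iff.1 hnb
  set e₂ := affChart e₁ (Equiv.refl _) 0 (Metric.isOpen_ball (x := (0 : Cd d)) (ε := ε)) with he₂
  have happ : ∀ y, e₂ y = e₁ y := fun y => by ext k; simp [he₂, affChart_apply]
  have hsrc : ∀ y, y ∈ e₂.source ↔ y ∈ e₁.source ∧ e₁ y ∈ Metric.ball (0 : Cd d) ε := fun y => by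
    rw [he₂, affChart_source]; rfl
  refine ⟨e₂, m, ε, (he₀.aff σ _ _).aff _ _ _, (hsrc x).2 ⟨hx₁, by rw [he₁x]; simpa using hε⟩,
    by rw [happ, he₁x], hε, ?_, ?_, ?_, ?_⟩
  · rw [he₂, affChart_target]
    ext w
    simp only [Equiv.refl_symm, Equiv.refl_apply, Pi.zero_apply, add_zero, mem_ofPred_eq]
    exact ⟨fun h => h.2, fun h => ⟨(hball h).1, h⟩⟩
  · intro y hy
    obtain ⟨h1, h2⟩ := (hsrc y).1 hy
    have := interior_subset (hball h2).2
    rwa [e₁.left_inv h1] at this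
  · rw [hm]; simpa using (vanSet m₀ (e₀ x)).card_le_univ
  · intro y hy
    obtain ⟨h1, -⟩ := (hsrc y).1 hy
    rw [he₁, affChart_source] at h1
    rw [hm₀ y h1.1]
    simp only [happ, he₁, affChart_apply]
    constructor
    · rintro ⟨j, hj, h0⟩
      have hlt : ((σ.symm j : Fin d) : ℕ) < m := by
        by_contra h
        exact h1.2 (σ.symm j) (by omega) (by simpa using hj) (by simpa using h0)
      refine ⟨σ.symm j, hlt, ?_⟩
      have h3 := (hσ _).1 hlt
      rw [mem_vanSet] at h3
      rw [h3.2, Equiv.apply_symm_apply, h0, sub_zero]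
    · rintro ⟨k, hk, h0⟩
      have h3 := (hσ k).1 hk
      rw [mem_vanSet] at h3
      exact ⟨σ k, h3.1, by rwa [h3.2, sub_zero] at h0⟩

end Stratification

end DivInt
end

noncomputable section
namespace DivInt

/-! ### Holomorphic sections of a line bundle in coordinates -/

set_option linter.unusedSectionVars false

section Sections

variable {d : ℕ} {X : Type*} [TopologicalSpace X] [ChartedSpace (Cd d) X]
  [IsManifold 𝓘(ℂ, Cd d) ω X] {L : X → Type*} [TopologicalSpace (TotalSpace ℂ L)]
  [∀ x, AddCommGroup (L x)] [∀ x, Module ℂ (L x)] [∀ x, TopologicalSpace (L x)]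
  [FiberBundle ℂ L] [VectorBundle ℂ ℂ L] [ContMDiffVectorBundle ω ℂ L 𝓘(ℂ, Cd d)]
  {e : OpenPartialHomeomorph X (Cd d)}

theorem HolChart.differentiableOn_comp_symm {E : Type*} [NormedAddCommGroup E] [NormedSpace ℂ E]
    (he : HolChart e) {f : X → E} {B : Set X} (hf : ContMDiffOn 𝓘(ℂ, Cd d) 𝓘(ℂ, E) ω f B) :
    DifferentiableOn ℂ (f ∘ e.symm) {w | w ∈ e.target ∧ e.symm w ∈ B} := by
  have h1 : ContMDiffOn 𝓘(ℂ, Cd d) 𝓘(ℂ, Cd d) ω e.symm {w | w ∈ e.target ∧ e.symm w ∈ B} :=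
    (contMDiffOn_symm_of_mem_maximalAtlas he).mono fun w hw => hw.1
  exact (contMDiffOn_iff_contDiffOn.1 (hf.comp h1 fun w hw => hw.2)).differentiableOn (by simp)

theorem HolChart.contDiffOn_comp_symm {f : X → ℝ} {B : Set X} (he : HolChart e)
    (hf : ContMDiffOn 𝓘(ℝ, Cd d) 𝓘(ℝ, ℝ) ∞ f B) :
    ContDiffOn ℝ ∞ (f ∘ e.symm) {w | w ∈ e.target ∧ e.symm w ∈ B} := by
  have h1 : ContMDiffOn 𝓘(ℝ, Cd d) 𝓘(ℝ, Cd d) ∞ e.symm {w | w ∈ e.target ∧ e.symm w ∈ B} :=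
    (contMDiffOn_symm_of_mem_maximalAtlas he.real).mono fun w hw => hw.1
  exact contMDiffOn_iff_contDiffOn.1 (hf.comp h1 fun w hw => hw.2)

theorem trivializationAt_snd_eq_zero_iff {x y : X} (hy : y ∈ (trivializationAt ℂ L x).baseSet)
    (v : L y) : (trivializationAt ℂ L x ⟨y, v⟩).2 = 0 ↔ v = 0 := by
  have h := (trivializationAt ℂ L x).continuousLinearEquivAt_apply' (R := ℂ) ⟨y, v⟩
    ((trivializationAt ℂ L x).mem_source.2 hy)
  rw [← h]
  exact EmbeddingLike.map_eq_zero_iff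

/-- The change of frame between two local trivialisations. -/
def frameChange (L : X → Type*) [TopologicalSpace (TotalSpace ℂ L)]
    [∀ x, AddCommGroup (L x)] [∀ x, Module ℂ (L x)] [∀ x, TopologicalSpace (L x)]
    [FiberBundle ℂ L] [VectorBundle ℂ ℂ L] (x x' y : X) : ℂ :=
  (trivializationAt ℂ L x).coordChangeL ℂ (trivializationAt ℂ L x') y 1

theorem frameChange_ne_zero (x x' y : X) : frameChange L x x' y ≠ 0 := by
  intro h
  rw [frameChange] at h
  exact one_ne_zero ((EmbeddingLike.map_eq_zero_iff
    (f := (trivializationAt ℂ L x).coordChangeL ℂ (trivializationAt ℂ L x') y)).1 h)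

theorem trivializationAt_snd_eq {x x' y : X} (hy : y ∈ (trivializationAt ℂ L x).baseSet)
    (hy' : y ∈ (trivializationAt ℂ L x').baseSet) (v : L y) :
    (trivializationAt ℂ L x' ⟨y, v⟩).2 =
      (trivializationAt ℂ L x ⟨y, v⟩).2 * frameChange L x x' y := by
  have h2 : (trivializationAt ℂ L x).symm y (trivializationAt ℂ L x ⟨y, v⟩).2 = v := by
    have := (trivializationAt ℂ L x).symm_apply_apply_mk hy v
    exact this
  have h1 := (trivializationAt ℂ L x).coordChangeL_apply (R := ℂ) (trivializationAt ℂ L x') ⟨hy, hy'⟩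
    (trivializationAt ℂ L x ⟨y, v⟩).2
  rw [h2] at h1
  rw [← h1, frameChange, ← smul_eq_mul, ← map_smul, smul_eq_mul, mul_one]

theorem contMDiffOn_frameChange (x x' : X) :
    ContMDiffOn 𝓘(ℂ, Cd d) 𝓘(ℂ, ℂ) ω (frameChange L x x')
      ((trivializationAt ℂ L x).baseSet ∩ (trivializationAt ℂ L x').baseSet) := by
  have h := contMDiffOn_coordChangeL (IB := 𝓘(ℂ, Cd d)) (n := ω) (trivializationAt ℂ L x)
    (trivializationAt ℂ L x')
  exact h.clm_apply (contMDiffOn_const (c := (1:ℂ)))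

variable {s : ∀ x : X, L x} {D : Set X}

/-- In a polydisc in which its zero set is `{z₁ ⋯ z_m = 0}`, the section is `z^I u`, where `u` has no
zeros and precisely the first `m` exponents are positive. -/
theorem exists_section_factor
    (hs : ContMDiff 𝓘(ℂ, Cd d) (𝓘(ℂ, Cd d).prod 𝓘(ℂ, ℂ)) ω
      (fun x => (⟨x, s x⟩ : TotalSpace ℂ L)))
    (hDs : ∀ x, x ∈ D ↔ s x = 0) {x : X} (he : HolChart e)
    (hB : e.source ⊆ (trivializationAt ℂ L x).baseSet) {ε : ℝ} (hε : 0 < ε)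
    (hball : e.target = Metric.ball 0 ε) {m : ℕ}
    (hD : ∀ y ∈ e.source, y ∈ D ↔ ∃ j : Fin d, (j : ℕ) < m ∧ e y j = 0) :
    ∃ I : Fin d → ℕ, (∀ j : Fin d, (j : ℕ) < m → 1 ≤ I j) ∧ (∀ j : Fin d, m ≤ (j : ℕ) → I j = 0) ∧
      ∃ u : Cd d → ℂ, DifferentiableOn ℂ u e.target ∧ (∀ z ∈ e.target, u z ≠ 0) ∧
        ∀ z ∈ e.target, (trivializationAt ℂ L x ⟨e.symm z, s (e.symm z)⟩).2 =
          (∏ j, z j ^ I j) * u z := by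
  have hg : DifferentiableOn ℂ (fun z => (trivializationAt ℂ L x ⟨e.symm z, s (e.symm z)⟩).2)
      (Metric.ball 0 ε) := by
    have h1 := ((trivializationAt ℂ L x).contMDiffOn_section_baseSet_iff
      (IB := 𝓘(ℂ, Cd d)) (n := ω) (s := s)).1 hs.contMDiffOn
    have h2 := he.differentiableOn_comp_symm h1
    refine h2.mono fun w hw => ?_
    rw [← hball] at hw
    exact ⟨hw, hB (e.map_target hw)⟩
  have hzero : ∀ z ∈ Metric.ball (0 : Cd d) ε,
      (trivializationAt ℂ L x ⟨e.symm z, s (e.symm z)⟩).2 = 0 ↔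
        ∃ j : Fin d, (j : ℕ) < m ∧ z j = 0 := by
    intro z hz
    rw [← hball] at hz
    rw [trivializationAt_snd_eq_zero_iff (hB (e.map_target hz)), ← hDs, hD _ (e.map_target hz),
      e.right_inv hz]
  obtain ⟨I, hI, u, hu, hu0, hfac⟩ := exists_monomial_factor hε hg
    (Finset.univ.filter fun j : Fin d => (j : ℕ) < m) (by
      intro z hz hne h0
      obtain ⟨j, hj, hj0⟩ := (hzero z hz).1 h0
      exact hne j (by simpa using hj) hj0)
  refine ⟨I, fun j hj => ?_, fun j hj => hI j (by simpa using hj), u, hball ▸ hu, hball ▸ hu0,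
    hball ▸ hfac⟩
  by_contra hlt
  set z : Cd d := fun i => if i = j then 0 else ((ε / 2 : ℝ) : ℂ) with hz
  have hzb : z ∈ Metric.ball (0 : Cd d) ε := by
    rw [mem_ball_zero_iff]
    refine lt_of_le_of_lt ((pi_norm_le_iff_of_nonneg (by positivity : (0:ℝ) ≤ ε / 2)).2 fun i => ?_)
      (half_lt_self hε)
    simp only [hz]
    split_ifs
    · simp; positivity
    · rw [Complex.norm_real, Real.norm_of_nonneg (by positivity)]
  have h0 := (hzero z hzb).2 ⟨j, hj, by simp [hz]⟩
  rw [hfac z hzb] at h0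
  rcases mul_eq_zero.1 h0 with h | h
  · obtain ⟨i, -, hi⟩ := Finset.prod_eq_zero_iff.1 h
    have hne : I i ≠ 0 := by intro h'; simp [h'] at hi
    have hzi := pow_eq_zero_iff hne |>.1 hi
    have hij : i ≠ j := by rintro rfl; omega
    simp only [hz, if_neg hij, Complex.ofReal_eq_zero] at hzi
    linarith
  · exact hu0 z hzb h

/-- The product of the exponents is an order product in the sense of the residue, at each point of all
`m` branches: translated coordinates are centred at this point, and the frame may be changed. -/
theorem isOrderProduct_of_factor {x : X} (he : HolChart e)
    (hB : e.source ⊆ (trivializationAt ℂ L x).baseSet) {m : ℕ} {I : Fin d → ℕ}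
    (hI : ∀ j : Fin d, (j : ℕ) < m → 1 ≤ I j) (hI0 : ∀ j : Fin d, m ≤ (j : ℕ) → I j = 0) {u : Cd d → ℂ}
    (hu : DifferentiableOn ℂ u e.target) (hu0 : ∀ z ∈ e.target, u z ≠ 0)
    (hfac : ∀ z ∈ e.target, (trivializationAt ℂ L x ⟨e.symm z, s (e.symm z)⟩).2 =
          (∏ j, z j ^ I j) * u z) {y : X} (hy : y ∈ e.source)
    (hy0 : ∀ j : Fin d, (j : ℕ) < m → e y j = 0) :
    IsOrderProduct (d := d) s y (∏ j ∈ Finset.univ.filter (fun j : Fin d => (j : ℕ) < m), I j) := by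
  set B := (trivializationAt ℂ L y).baseSet with hBdef
  have hBo : IsOpen B := (trivializationAt ℂ L y).open_baseSet
  have hV : IsOpen {w | w ∈ e.target ∧ e.symm w ∈ B} := e.symm.isOpen_inter_preimage hBo
  have hsrc : ∀ y', y' ∈ (affChart e (Equiv.refl _) (e y) hV).source → y' ∈ e.source ∧ y' ∈ B := by
    intro y' hy'
    rw [affChart_source] at hy'
    refine ⟨hy'.1, ?_⟩
    have := hy'.2.2
    rwa [e.left_inv hy'.1] at this
  have htgt : ∀ w, w ∈ (affChart e (Equiv.refl _) (e y) hV).target →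
      (w + e y) ∈ {w | w ∈ e.target ∧ e.symm w ∈ B} := by
    intro w hw
    rw [affChart_target] at hw
    exact hw.2
  refine ⟨affChart e (Equiv.refl _) (e y) hV, he.aff _ _ _, ?_, ?_, fun y' hy' => (hsrc y' hy').2,
    I, fun w => u (w + e y) * frameChange L x y (e.symm (w + e y)), ?_, ?_, ?_, ?_⟩
  · rw [affChart_source]
    exact ⟨hy, e.map_source hy, by
      rw [e.left_inv hy]; exact FiberBundle.mem_baseSet_trivializationAt' y⟩
  · ext k; simp [affChart_apply]
  · have h1 := he.differentiableOn_comp_symm (contMDiffOn_frameChange (L := L) x y)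
    have hadd : DifferentiableOn ℂ (fun w : Cd d => w + e y)
        (affChart e (Equiv.refl _) (e y) hV).target := by fun_prop
    refine DifferentiableOn.mul (hu.comp hadd fun w hw => (htgt w hw).1)
      (h1.comp hadd fun w hw => ?_)
    exact ⟨(htgt w hw).1, hB (e.map_target (htgt w hw).1), (htgt w hw).2⟩
  · exact fun w hw => mul_ne_zero (hu0 _ (htgt w hw).1) (frameChange_ne_zero _ _ _)
  · intro y' hy'
    obtain ⟨h1, h2⟩ := hsrc y' hy'
    have h3 : affChart e (Equiv.refl _) (e y) hV y' + e y = e y' := by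
      ext k; simp [affChart_apply]
    beta_reduce
    rw [h3, e.left_inv h1, trivializationAt_snd_eq (hB h1) h2]
    have h4 := hfac (e y') (e.map_source h1)
    rw [e.left_inv h1] at h4
    rw [h4, mul_assoc]
    congr 1
    refine Finset.prod_congr rfl fun j _ => ?_
    by_cases hj : (j : ℕ) < m
    · simp [affChart_apply, hy0 j hj]
    · simp [hI0 j (by omega)]
  · refine Finset.prod_congr (Finset.filter_congr fun j _ => ?_) fun _ _ => rfl
    constructor
    · intro h; have := hI j h; omega
    · intro h; by_contra h'; exact h (hI0 j (by omega))

/-- The length of a section `z^I u` in terms of the metric of the local frame. -/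
theorem nrm_eq_of_factor (h₀ : LineMetric d L) {x y : X}
    (hy : y ∈ (trivializationAt ℂ L x).baseSet) (v : L y) :
    h₀.nrm y v = ‖(trivializationAt ℂ L x ⟨y, v⟩).2‖ *
      h₀.nrm y ((trivializationAt ℂ L x).symm y (1 : ℂ)) := by
  have h2 : (trivializationAt ℂ L x).symm y (trivializationAt ℂ L x ⟨y, v⟩).2 = v :=
    (trivializationAt ℂ L x).symm_apply_apply_mk hy v
  rw [← h₀.nrm_smul]
  congr 1
  rw [← (trivializationAt ℂ L x).symmL_apply (R := ℂ) hy, ← map_smul,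
    (trivializationAt ℂ L x).symmL_apply (R := ℂ) hy, smul_eq_mul, mul_one, h2]

theorem nrm_frame_pos (h₀ : LineMetric d L) {x y : X}
    (hy : y ∈ (trivializationAt ℂ L x).baseSet) :
    0 < h₀.nrm y ((trivializationAt ℂ L x).symm y (1 : ℂ)) := by
  refine h₀.nrm_pos _ _ fun h => ?_
  have h1 := (trivializationAt ℂ L x).apply_mk_symm hy (1 : ℂ)
  rw [h] at h1
  have h2 := (trivializationAt_snd_eq_zero_iff hy (0 : L y)).2 rfl
  rw [h1] at h2
  exact one_ne_zero h2

/-- The length of the section `z^I u` is `|z^I|` times a positive smooth function. -/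
theorem exists_log_metric (h₀ : LineMetric d L) {x : X} (he : HolChart e)
    (hB : e.source ⊆ (trivializationAt ℂ L x).baseSet) {I : Fin d → ℕ} {u : Cd d → ℂ}
    (hu : DifferentiableOn ℂ u e.target) (hu0 : ∀ z ∈ e.target, u z ≠ 0)
    (hfac : ∀ z ∈ e.target, (trivializationAt ℂ L x ⟨e.symm z, s (e.symm z)⟩).2 =
          (∏ j, z j ^ I j) * u z) :
    ∃ a : Cd d → ℝ, ContDiffOn ℝ ∞ a e.target ∧ ∀ z ∈ e.target,
      h₀.nrm (e.symm z) (s (e.symm z)) = (∏ j, ‖z j‖ ^ I j) * Real.exp (a z / 2) := by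
  set b : Cd d → ℝ := fun z => h₀.nrm (e.symm z) ((trivializationAt ℂ L x).symm (e.symm z) (1 : ℂ))
    with hb
  have hbs : ContDiffOn ℝ ∞ b e.target :=
    (he.contDiffOn_comp_symm (h₀.smooth x)).mono fun w hw => ⟨hw, hB (e.map_target hw)⟩
  have hb0 : ∀ z ∈ e.target, 0 < b z := fun z hz => nrm_frame_pos h₀ (hB (e.map_target hz))
  have hus : ContDiffOn ℝ ∞ u e.target := contDiffOn_real_of_differentiableOn e.open_target hu
  refine ⟨fun z => 2 * Real.log (‖u z‖ * b z), ?_, fun z hz => ?_⟩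
  · refine contDiffOn_const.mul (ContDiffOn.log ?_ fun z hz => ?_)
    · exact (hus.norm ℂ hu0).mul hbs
    · exact (mul_pos (norm_pos_iff.2 (hu0 z hz)) (hb0 z hz)).ne'
  · rw [nrm_eq_of_factor h₀ (hB (e.map_target hz)), hfac z hz, norm_mul, norm_prod, mul_assoc]
    have hpos : 0 < ‖u z‖ * b z := mul_pos (norm_pos_iff.2 (hu0 z hz)) (hb0 z hz)
    rw [show (2 * Real.log (‖u z‖ * b z)) / 2 = Real.log (‖u z‖ * b z) by ring, Real.exp_log hpos]
    simp [norm_pow, hb]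

end Sections

end DivInt
end

noncomputable section
namespace DivInt

/-! ### Semi-meromorphic forms in coordinates -/

set_option linter.unusedSectionVars false

section SemiMeromorphic

variable {d : ℕ} {X : Type*} [TopologicalSpace X] [ChartedSpace (Cd d) X]
  {e : OpenPartialHomeomorph X (Cd d)}

theorem contDiffOn_alternating_apply {E F : Type*} [NormedAddCommGroup E] [NormedSpace ℝ E]
    [NormedAddCommGroup F] [NormedSpace ℝ F] [FiniteDimensional ℝ F] {k : ℕ}
    {a : E → F [⋀^Fin k]→L[ℝ] ℂ} {v : Fin k → E → F} {s : Set E} (ha : ContDiffOn ℝ ∞ a s)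
    (hv : ∀ i, ContDiffOn ℝ ∞ (v i) s) : ContDiffOn ℝ ∞ (fun w => a w (fun i => v i w)) s := by
  classical
  set b := Module.finBasis ℝ F
  have hexp : ∀ w, a w (fun i => v i w) = ∑ r : Fin k → Fin (Module.finrank ℝ F),
      (∏ i, b.repr (v i w) (r i)) • a w (fun i => b (r i)) := by
    intro w
    have h1 := (a w).toMultilinearMap.map_sum
      (g := fun i (j : Fin (Module.finrank ℝ F)) => b.repr (v i w) j • b j)
    have h2 : (fun i => ∑ j, b.repr (v i w) j • b j) = fun i => v i w := by
      funext i; exact b.sum_repr _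
    rw [h2] at h1
    refine h1.trans (Finset.sum_congr rfl fun r _ => ?_)
    exact (a w).toMultilinearMap.map_smul_univ _ _
  simp_rw [hexp]
  refine ContDiffOn.sum fun r _ => ContDiffOn.fun_smul ?_ ?_
  · refine contDiffOn_prod fun i _ => ?_
    exact ((LinearMap.toContinuousLinearMap (b.coord (r i))).contDiff.comp_contDiffOn (hv i))
  · have h3 : ContDiffOn ℝ ∞ (fun w => (a w).toContinuousMultilinearMap) s :=
      (ContinuousAlternatingMap.toContinuousMultilinearMapCLM (𝕜 := ℝ) (E := F)
        (F := ℂ) (ι := Fin k) ℝ).contDiff.comp_contDiffOn ha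
    exact (ContinuousMultilinearMap.apply ℝ (fun _ : Fin k => F) ℂ
      (fun i => b (r i))).contDiff.comp_contDiffOn h3

theorem domCoprod_mul_apply {M : Type*} [AddCommGroup M] [Module ℝ M] {k l : ℕ}
    (a : M [⋀^Fin k]→ₗ[ℝ] ℂ) (b : M [⋀^Fin l]→ₗ[ℝ] ℂ) (v : Fin k ⊕ Fin l → M) :
    (LinearMap.mul' ℝ ℂ).compAlternatingMap (a.domCoprod b) v =
      ((k.factorial * l.factorial : ℕ) : ℂ)⁻¹ * ∑ σ : Equiv.Perm (Fin k ⊕ Fin l),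
        ((Equiv.Perm.sign σ : ℤ) : ℂ) *
          (a (fun i => v (σ (Sum.inl i))) * b (fun j => v (σ (Sum.inr j)))) := by
  have h := congrArg (fun T => (LinearMap.mul' ℝ ℂ) (T v))
    (MultilinearMap.domCoprod_alternization_eq a b)
  simp only [AlternatingMap.smul_apply, MultilinearMap.alternatization_apply, map_sum,
    Fintype.card_fin, map_nsmul] at h
  rw [eq_inv_mul_iff_mul_eq₀ (by exact_mod_cast
    (mul_pos k.factorial_pos l.factorial_pos).ne')]
  rw [nsmul_eq_mul] at h
  refine Eq.trans ?_ (h.symm.trans (Finset.sum_congr rfl fun σ _ => ?_))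
  · rfl
  · rw [← zsmul_eq_mul, ← Units.smul_def, map_zsmul_unit]
    congr 1

theorem inChart_conjForm {l : ℕ} (β : FormField d X l) (w : Cd d) (v : Fin l → Cd d) :
    inChart e (conjForm β) w v = starRingEnd ℂ (inChart e β w v) := rfl

theorem inChart_wedgeTop {k l : ℕ} (hkl : k + l = 2 * d) (α : FormField d X k)
    (β : FormField d X l) (w : Cd d) (v : Fin (2 * d) → Cd d) :
    inChart e (wedgeTop hkl α β) w v =
      ((k.factorial * l.factorial : ℕ) : ℂ)⁻¹ * ∑ σ : Equiv.Perm (Fin k ⊕ Fin l),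
        ((Equiv.Perm.sign σ : ℤ) : ℂ) *
          (inChart e α w (fun i => v (finSumFinEquiv.trans (finCongr hkl) (σ (Sum.inl i)))) *
            inChart e β w (fun j => v (finSumFinEquiv.trans (finCongr hkl) (σ (Sum.inr j))))) :=
  domCoprod_mul_apply (α (e.symm w)) (β (e.symm w)) fun i =>
    (mfderiv 𝓘(ℝ, Cd d) 𝓘(ℝ, Cd d) e.symm w (v (finSumFinEquiv.trans (finCongr hkl) i)) : Cd d)

variable [IsManifold 𝓘(ℂ, Cd d) ω X] {D : Set X}

/-- Near every point a semi-meromorphic form has, in coordinates in which `D` is `{z₁ ⋯ z_m = 0}`,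
coefficients of the form `b / z^A` with `b` smooth. -/
theorem IsSemiMeromorphic.exists_coeff {k : ℕ} {α : FormField d X k} (hα : IsSemiMeromorphic D α)
    (x : X) : ∃ N ∈ 𝓝 x, ∀ (e : OpenPartialHomeomorph X (Cd d)) (m : ℕ) (ε : ℝ), HolChart e →
      0 < ε → e.target = Metric.ball 0 ε → e.source ⊆ N →
      (∀ y ∈ e.source, y ∈ D ↔ ∃ j : Fin d, (j : ℕ) < m ∧ e y j = 0) →
      ∃ A : Fin d → ℕ, (∀ j : Fin d, m ≤ (j : ℕ) → A j = 0) ∧ ∀ v : Fin k → Cd d,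
        ∃ b : Cd d → ℂ, ContDiffOn ℝ ∞ b e.target ∧
          ∀ w ∈ e.target, e.symm w ∉ D → inChart e α w v = b w / ∏ j, w j ^ A j := by
  obtain ⟨e', he', hx', f, a, hf, hf0, ha, hαe⟩ := hα x
  refine ⟨e'.source, e'.open_source.mem_nhds hx', fun e m ε he hε hball hsub hD => ?_⟩
  have hsrc : ∀ w ∈ e.target, e.symm w ∈ e'.source := fun w hw => hsub (e.map_target hw)
  have hΦ : ContDiffOn ℂ ω (e' ∘ e.symm) e.target :=
    (he.transition he').mono fun w hw => ⟨hw, hsrc w hw⟩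
  have hmaps : MapsTo (e' ∘ e.symm) e.target e'.target := fun w hw => e'.map_source (hsrc w hw)
  have hfΦ : DifferentiableOn ℂ (f ∘ (e' ∘ e.symm)) (Metric.ball 0 ε) :=
    hball ▸ hf.comp (hΦ.differentiableOn (by simp)) hmaps
  obtain ⟨A, hA, u, hu, hu0, hfac⟩ := exists_monomial_factor hε hfΦ
    (Finset.univ.filter fun j : Fin d => (j : ℕ) < m) (by
      intro z hz hne h0
      rw [← hball] at hz
      have h1 := hf0 _ (hmaps hz) h0
      rw [Function.comp_apply, e'.left_inv (hsrc z hz), hD _ (e.map_target hz)] at h1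
      obtain ⟨j, hj, hj0⟩ := h1
      rw [e.right_inv hz] at hj0
      exact hne j (by simpa using hj) hj0)
  rw [← hball] at hu hu0 hfac
  refine ⟨A, fun j hj => hA j (by simpa using hj), fun v => ?_⟩
  have hΦr : ContDiffOn ℝ ∞ (e' ∘ e.symm) e.target := (hΦ.restrict_scalars ℝ).of_le le_top
  refine ⟨fun w => a (e' (e.symm w)) (fun i => fderiv ℝ (e' ∘ e.symm) w (v i)) * (u w)⁻¹, ?_, ?_⟩
  · refine ContDiffOn.mul ?_ ((contDiffOn_real_of_differentiableOn e.open_target hu).inv hu0)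
    refine contDiffOn_alternating_apply (ha.comp hΦr hmaps) fun i => ?_
    exact (hΦr.fderiv_of_isOpen e.open_target (by simp)).clm_apply contDiffOn_const
  · intro w hw hwD
    have h1 : e'.symm (e' (e.symm w)) ∉ D := by rwa [e'.left_inv (hsrc w hw)]
    rw [inChart_transition he he' α hw (hsrc w hw), hαe (e' (e.symm w)) (hmaps hw) h1]
    have h2 := hfac w hw
    simp only [Function.comp_apply] at h2
    beta_reduce
    rw [h2, ← div_eq_mul_inv, div_div, mul_comm (u w)]

/-- Near every point `α ∧ β̄` has the coefficient `G / (z^J z̄^K)` with smooth `G`, in coordinates in which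
`D` is `{z₁ ⋯ z_m = 0}`. The exponents may be enlarged to be positive along each branch. -/
theorem exists_wedge_coeff {k l : ℕ} (hkl : k + l = 2 * d) {α : FormField d X k}
    {β : FormField d X l} (hα : IsSemiMeromorphic D α) (hβ : IsSemiMeromorphic D β) (x : X) :
    ∃ N ∈ 𝓝 x, ∀ (e : OpenPartialHomeomorph X (Cd d)) (m : ℕ) (ε : ℝ), HolChart e →
      0 < ε → e.target = Metric.ball 0 ε → e.source ⊆ N →
      (∀ y ∈ e.source, y ∈ D ↔ ∃ j : Fin d, (j : ℕ) < m ∧ e y j = 0) →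
      ∃ (J K : Fin d → ℕ) (G : Cd d → ℂ), (∀ j : Fin d, (j : ℕ) < m → 1 ≤ J j ∧ 1 ≤ K j) ∧
        (∀ j : Fin d, m ≤ (j : ℕ) → J j = 0 ∧ K j = 0) ∧ ContDiffOn ℝ ∞ G e.target ∧
        ∀ w ∈ e.target, e.symm w ∉ D → sliceCoeff e 0 (wedgeTop hkl α (conjForm β)) w =
          G w / ∏ j, (w j ^ J j * (starRingEnd ℂ (w j)) ^ K j) := by
  obtain ⟨N₁, hN₁, h₁⟩ := hα.exists_coeff x
  obtain ⟨N₂, hN₂, h₂⟩ := hβ.exists_coeff x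
  refine ⟨N₁ ∩ N₂, inter_mem hN₁ hN₂, fun e m ε he hε hball hsub hD => ?_⟩
  obtain ⟨A, hA, hb⟩ := h₁ e m ε he hε hball (hsub.trans inter_subset_left) hD
  obtain ⟨B, hB, hc⟩ := h₂ e m ε he hε hball (hsub.trans inter_subset_right) hD
  choose b hbs hbe using hb
  choose c hcs hce using hc
  set fr : Fin (2 * d) → Cd d := sliceFrame d 0
  set q : Fin k ⊕ Fin l → Fin (2 * d) := ⇑(finSumFinEquiv.trans (finCongr hkl))
  set S : Finset (Fin d) := Finset.univ.filter fun j : Fin d => (j : ℕ) < m with hS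
  set G₀ : Cd d → ℂ := fun w => ((k.factorial * l.factorial : ℕ) : ℂ)⁻¹ *
    ∑ σ : Equiv.Perm (Fin k ⊕ Fin l), ((Equiv.Perm.sign σ : ℤ) : ℂ) *
      (b (fun i => fr (q (σ (Sum.inl i)))) w *
        starRingEnd ℂ (c (fun i => fr (q (σ (Sum.inr i)))) w)) with hG₀
  refine ⟨fun j => if (j : ℕ) < m then A j + 1 else 0, fun j => if (j : ℕ) < m then B j + 1 else 0,
    fun w => G₀ w * ∏ j ∈ S, (w j * starRingEnd ℂ (w j)), fun j hj => by simp [hj],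
    fun j hj => by simp [hj.not_gt], ?_, ?_⟩
  · refine ContDiffOn.mul (contDiffOn_const.mul (ContDiffOn.sum fun σ _ =>
      contDiffOn_const.mul ((hbs _).mul ?_))) (ContDiff.contDiffOn (contDiff_prod fun j _ => ?_))
    · exact Complex.conjCLE.contDiff.comp_contDiffOn (hcs _)
    · exact (contDiff_apply ℝ ℂ j).mul (Complex.conjCLE.contDiff.comp (contDiff_apply ℝ ℂ j))
  · intro w hw hwD
    have hw0 : ∀ j : Fin d, (j : ℕ) < m → w j ≠ 0 := by
      intro j hj h0
      refine hwD ((hD _ (e.map_target hw)).2 ⟨j, hj, ?_⟩)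
      rwa [e.right_inv hw]
    have hsl : slice d 0 w = w := by funext j; simp [slice]
    have hP : ∏ j, (w j ^ (if (j : ℕ) < m then A j + 1 else 0) *
        (starRingEnd ℂ (w j)) ^ (if (j : ℕ) < m then B j + 1 else 0)) =
        ((∏ j, w j ^ A j) * ∏ j, (starRingEnd ℂ (w j)) ^ B j) *
          ∏ j ∈ S, (w j * starRingEnd ℂ (w j)) := by
      rw [hS, Finset.prod_filter, ← Finset.prod_mul_distrib, ← Finset.prod_mul_distrib]
      refine Finset.prod_congr rfl fun j _ => ?_
      by_cases hj : (j : ℕ) < m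
      · simp only [hj, if_true]; ring
      · simp [hj, hA j (by omega), hB j (by omega)]
    have hSne : ∏ j ∈ S, (w j * starRingEnd ℂ (w j)) ≠ 0 := by
      refine Finset.prod_ne_zero_iff.2 fun j hj => ?_
      have := hw0 j (by simpa [hS] using hj)
      simpa using this
    rw [hP, mul_div_mul_right _ _ hSne]
    have h3 : sliceCoeff e 0 (wedgeTop hkl α (conjForm β)) w =
        inChart e (wedgeTop hkl α (conjForm β)) w fr := by
      rw [sliceCoeff, hsl]
    rw [h3, inChart_wedgeTop, hG₀, mul_div_assoc, Finset.sum_div]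
    congr 1
    refine Finset.sum_congr rfl fun σ _ => ?_
    rw [inChart_conjForm, hbe _ w hw hwD, hce _ w hw hwD, map_div₀, map_prod, mul_div_assoc,
      div_mul_div_comm]
    simp only [map_pow]
    rfl

end SemiMeromorphic

end DivInt
end

noncomputable section
namespace DivInt

/-! ### The product of the vanishing orders is well defined -/

set_option linter.unusedSectionVars false

section OrderProduct

variable {d : ℕ}

/-- Comparison of the exponents of two monomials, by restriction to a line in general position on which
the coordinate `z_j` tends to `0`. -/
theorem exponent_le_of_monomial_eq {ε : ℝ} (hε : 0 < ε) {A B : Fin d → ℕ} {f g : Cd d → ℂ}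
    (hf : ContinuousOn f (Metric.ball 0 ε)) (hg : ContinuousOn g (Metric.ball 0 ε))
    (hf0 : ∀ z ∈ Metric.ball (0 : Cd d) ε, f z ≠ 0)
    (h : ∀ z ∈ Metric.ball (0 : Cd d) ε, (∏ j, z j ^ A j) * f z = (∏ j, z j ^ B j) * g z)
    (j : Fin d) : B j ≤ A j := by
  by_contra hlt
  push Not at hlt
  -- the points with all coordinates but the `j`-th equal to `ε / 2`
  set c : ℂ → Cd d := fun t => Function.update (fun _ => ((ε / 2 : ℝ) : ℂ)) j t with hc
  have hcc : Continuous c := continuous_const.update j continuous_id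
  have hcj : ∀ t, c t j = t := fun t => by simp [hc]
  have hci : ∀ t i, i ≠ j → c t i = ((ε / 2 : ℝ) : ℂ) := fun t i hi => by simp [hc, hi]
  have hcb : ∀ t : ℂ, ‖t‖ ≤ ε / 2 → c t ∈ Metric.ball (0 : Cd d) ε := by
    intro t ht
    rw [mem_ball_zero_iff]
    refine lt_of_le_of_lt ((pi_norm_le_iff_of_nonneg (by positivity : (0:ℝ) ≤ ε / 2)).2 fun i => ?_)
      (half_lt_self hε)
    by_cases hi : i = j
    · subst hi; rwa [hcj]
    · rw [hci t i hi, Complex.norm_real, Real.norm_of_nonneg (by positivity)]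
  set C : (Fin d → ℕ) → ℂ := fun E => ∏ i ∈ Finset.univ.erase j, ((ε / 2 : ℝ) : ℂ) ^ E i with hC
  have hprod : ∀ (E : Fin d → ℕ) t, ∏ i, c t i ^ E i = t ^ E j * C E := by
    intro E t
    rw [← Finset.mul_prod_erase Finset.univ _ (Finset.mem_univ j), hcj]
    congr 1
    refine Finset.prod_congr rfl fun i hi => ?_
    rw [hci t i (Finset.ne_of_mem_erase hi)]
  have hC0 : C A ≠ 0 := Finset.prod_ne_zero_iff.2 fun i _ =>
    pow_ne_zero _ (by exact_mod_cast (half_pos hε).ne')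
  have hev : ∀ᶠ t : ℂ in 𝓝[≠] 0, C A * f (c t) = t ^ (B j - A j) * (C B * g (c t)) := by
    have h1 : ∀ᶠ t : ℂ in 𝓝[≠] 0, ‖t‖ ≤ ε / 2 :=
      nhdsWithin_le_nhds ((continuous_norm.tendsto' (0:ℂ) 0 norm_zero).eventually_le_const (half_pos hε))
    filter_upwards [h1, self_mem_nhdsWithin] with t ht ht0
    have h2 := h (c t) (hcb t ht)
    rw [hprod, hprod] at h2
    have h3 : t ^ B j = t ^ A j * t ^ (B j - A j) := by rw [← pow_add]; congr 1; omega
    rw [h3] at h2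
    exact mul_left_cancel₀ (pow_ne_zero (A j) ht0) (by linear_combination h2)
  have hc0 : c 0 ∈ Metric.ball (0 : Cd d) ε := hcb 0 (by simp; positivity)
  have hfc : ContinuousAt (fun t => f (c t)) 0 :=
    (hf.continuousAt (Metric.isOpen_ball.mem_nhds hc0)).comp hcc.continuousAt
  have hgc : ContinuousAt (fun t => g (c t)) 0 :=
    (hg.continuousAt (Metric.isOpen_ball.mem_nhds hc0)).comp hcc.continuousAt
  have hl1 : Tendsto (fun t => C A * f (c t)) (𝓝[≠] 0) (𝓝 (C A * f (c 0))) :=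
    (hfc.const_mul (C A)).mono_left nhdsWithin_le_nhds
  have hl2 : Tendsto (fun t : ℂ => t ^ (B j - A j) * (C B * g (c t))) (𝓝[≠] 0)
      (𝓝 ((0:ℂ) ^ (B j - A j) * (C B * g (c 0)))) :=
    (((continuous_pow (B j - A j)).continuousAt).mul (hgc.const_mul (C B))).mono_left
      nhdsWithin_le_nhds
  have := tendsto_nhds_unique (hl1.congr' hev) hl2
  rw [zero_pow (by omega), zero_mul] at this
  exact (mul_ne_zero hC0 (hf0 _ hc0)) this

theorem exponent_eq_of_monomial_eq {ε : ℝ} (hε : 0 < ε) {A B : Fin d → ℕ} {f g : Cd d → ℂ}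
    (hf : ContinuousOn f (Metric.ball 0 ε)) (hg : ContinuousOn g (Metric.ball 0 ε))
    (hf0 : ∀ z ∈ Metric.ball (0 : Cd d) ε, f z ≠ 0) (hg0 : ∀ z ∈ Metric.ball (0 : Cd d) ε, g z ≠ 0)
    (h : ∀ z ∈ Metric.ball (0 : Cd d) ε, (∏ j, z j ^ A j) * f z = (∏ j, z j ^ B j) * g z) :
    A = B :=
  funext fun j => le_antisymm
    (exponent_le_of_monomial_eq hε hg hf hg0 (fun z hz => (h z hz).symm) j)
    (exponent_le_of_monomial_eq hε hf hg hf0 h j)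

/-- A holomorphic function with zeros only on some coordinate hyperplanes, which vanishes to first
order at the origin, is a coordinate up to a factor without zeros. -/
theorem exists_coord_factor {ε : ℝ} (hε : 0 < ε) {g : Cd d → ℂ}
    (hg : DifferentiableOn ℂ g (Metric.ball 0 ε)) (S : Finset (Fin d))
    (hz : ∀ z ∈ Metric.ball (0 : Cd d) ε, (∀ j ∈ S, z j ≠ 0) → g z ≠ 0)
    (hg0 : g 0 = 0) (hdg : fderiv ℂ g 0 ≠ 0) :
    ∃ j ∈ S, ∃ v : Cd d → ℂ, DifferentiableOn ℂ v (Metric.ball 0 ε) ∧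
      (∀ z ∈ Metric.ball (0 : Cd d) ε, v z ≠ 0) ∧
      ∀ z ∈ Metric.ball (0 : Cd d) ε, g z = z j * v z := by
  obtain ⟨A, hA, v, hv, hv0, hfac⟩ := exists_monomial_factor hε hg S hz
  have h0 : (0 : Cd d) ∈ Metric.ball (0 : Cd d) ε := by simpa using hε
  have hex : ∃ j, A j ≠ 0 := by
    by_contra h
    push Not at h
    have := hfac 0 h0
    simp only [h, pow_zero, Finset.prod_const_one, one_mul, hg0] at this
    exact hv0 0 h0 this.symm
  obtain ⟨j, hj⟩ := hex
  have hjS : j ∈ S := by by_contra h; exact hj (hA j h)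
  set A' : Fin d → ℕ := Function.update A j (A j - 1) with hA'
  have hsplit : ∀ z : Cd d, ∏ i, z i ^ A i = z j * ∏ i, z i ^ A' i := by
    intro z
    rw [← Finset.mul_prod_erase Finset.univ _ (Finset.mem_univ j),
      ← Finset.mul_prod_erase Finset.univ (fun i => z i ^ A' i) (Finset.mem_univ j), ← mul_assoc]
    congr 1
    · rw [hA', Function.update_self, ← pow_succ']; congr 1; omega
    · refine Finset.prod_congr rfl fun i hi => ?_
      rw [hA', Function.update_of_ne (Finset.ne_of_mem_erase hi)]
  by_cases hA0 : ∀ i, A' i = 0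
  · refine ⟨j, hjS, v, hv, hv0, fun z hz => ?_⟩
    rw [hfac z hz, hsplit]
    simp [hA0]
  · push Not at hA0
    obtain ⟨i, hi⟩ := hA0
    refine absurd ?_ hdg
    have h1 : g =ᶠ[𝓝 0] fun z => z j * ((∏ i, z i ^ A' i) * v z) := by
      filter_upwards [Metric.ball_mem_nhds (0 : Cd d) hε] with z hz
      rw [hfac z hz, hsplit, mul_assoc]
    have hd1 : HasFDerivAt (fun z : Cd d => z j)
        (ContinuousLinearMap.proj (R := ℂ) (φ := fun _ : Fin d => ℂ) j) 0 :=
      (ContinuousLinearMap.proj (R := ℂ) (φ := fun _ : Fin d => ℂ) j).hasFDerivAt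
    have hd2 : DifferentiableAt ℂ (fun z : Cd d => (∏ i, z i ^ A' i) * v z) 0 := by
      refine DifferentiableAt.mul ?_ (hv.differentiableAt (Metric.ball_mem_nhds _ hε))
      fun_prop
    have h2 := (hd1.mul hd2.hasFDerivAt).congr_of_eventuallyEq h1
    rw [h2.fderiv]
    have h3 : ∏ i, (0 : Cd d) i ^ A' i = 0 :=
      Finset.prod_eq_zero (Finset.mem_univ i) (by simp [hi])
    rw [h3, zero_mul]
    ext
    simp

variable {X : Type*} [TopologicalSpace X] [ChartedSpace (Cd d) X]
  [IsManifold 𝓘(ℂ, Cd d) ω X] {L : X → Type*} [TopologicalSpace (TotalSpace ℂ L)]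
  [∀ x, AddCommGroup (L x)] [∀ x, Module ℂ (L x)] [∀ x, TopologicalSpace (L x)]
  [FiberBundle ℂ L] [VectorBundle ℂ ℂ L] [ContMDiffVectorBundle ω ℂ L 𝓘(ℂ, Cd d)]
  {s : ∀ x : X, L x} {D : Set X}

/-- In the chart `e`, where `D` is `{z₁ ⋯ z_m = 0}`, the section is `z^I u` in the frame which belongs
to the point `x`; the exponents `I_j` are positive for `j < m` and vanish for the other `j`. -/
def IsFactored (s : ∀ x : X, L x) (D : Set X) (e : OpenPartialHomeomorph X (Cd d)) (m : ℕ)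
    (I : Fin d → ℕ) (x : X) : Prop :=
  HolChart e ∧ e.source ⊆ (trivializationAt ℂ L x).baseSet ∧
    (∀ y ∈ e.source, y ∈ D ↔ ∃ j : Fin d, (j : ℕ) < m ∧ e y j = 0) ∧
    (∀ j : Fin d, (j : ℕ) < m → 1 ≤ I j) ∧ (∀ j : Fin d, m ≤ (j : ℕ) → I j = 0) ∧
    ∃ u : Cd d → ℂ, DifferentiableOn ℂ u e.target ∧ (∀ z ∈ e.target, u z ≠ 0) ∧
      ∀ z ∈ e.target, (trivializationAt ℂ L x ⟨e.symm z, s (e.symm z)⟩).2 =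
        (∏ j, z j ^ I j) * u z

/-- The transition to a polydisc centred at a point of all `m` branches permutes the branches, and
therefore the exponents. -/
theorem IsFactored.prod_eq_of_centered {e e' : OpenPartialHomeomorph X (Cd d)} {m : ℕ}
    {I I' : Fin d → ℕ} {x x' y : X} (h : IsFactored s D e m I x) (h' : IsFactored s D e' m I' x')
    {ε : ℝ} (hε : 0 < ε) (hball : e'.target = Metric.ball 0 ε) (hsub : e'.source ⊆ e.source)
    (hy' : y ∈ e'.source) (hy0' : e' y = 0) (hy0 : ∀ j : Fin d, (j : ℕ) < m → e y j = 0) :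
    ∏ j ∈ Finset.univ.filter (fun j : Fin d => (j : ℕ) < m), I j =
      ∏ j ∈ Finset.univ.filter (fun j : Fin d => (j : ℕ) < m), I' j := by
  classical
  obtain ⟨he, hB, hDe, hI1, hI0, u, hu, hu0, hfac⟩ := h
  obtain ⟨he', hB', hDe', hI1', hI0', u', hu', hu0', hfac'⟩ := h'
  set S := Finset.univ.filter (fun j : Fin d => (j : ℕ) < m) with hS
  have hmemS : ∀ j : Fin d, j ∈ S ↔ (j : ℕ) < m := fun j => by simp [hS]
  set T : Cd d → Cd d := e ∘ e'.symm with hT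
  have hsrc : ∀ z ∈ Metric.ball (0 : Cd d) ε, e'.symm z ∈ e.source := fun z hz =>
    hsub (e'.map_target (hball ▸ hz))
  have hTd : DifferentiableOn ℂ T (Metric.ball 0 ε) := fun z hz =>
    (he'.differentiableAt_transition he (hball ▸ hz) (hsrc z hz)).differentiableWithinAt
  have hTt : MapsTo T (Metric.ball 0 ε) e.target := fun z hz => e.map_source (hsrc z hz)
  have hTs : ∀ z ∈ Metric.ball (0 : Cd d) ε, e.symm (T z) = e'.symm z := fun z hz =>
    e.left_inv (hsrc z hz)
  -- each coordinate of `e` which defines a branch is a unit times a coordinate of `e'`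
  have hcoord : ∀ k : Fin d, ∃ j : Fin d, (k : ℕ) < m → j ∈ S ∧ ∃ v : Cd d → ℂ,
      DifferentiableOn ℂ v (Metric.ball 0 ε) ∧ (∀ z ∈ Metric.ball (0 : Cd d) ε, v z ≠ 0) ∧
      ∀ z ∈ Metric.ball (0 : Cd d) ε, T z k = z j * v z := by
    intro k
    by_cases hk : (k : ℕ) < m
    · have hy0s : e'.symm 0 = y := by rw [← hy0', e'.left_inv hy']
      obtain ⟨j, hj, hv⟩ := exists_coord_factor hε (g := fun z => T z k)
        (differentiableOn_pi.1 hTd k) S (by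
          intro z hz hne h0
          have h1 : e'.symm z ∈ D := (hDe _ (hsrc z hz)).2 ⟨k, hk, h0⟩
          obtain ⟨j, hj, hj0⟩ := (hDe' _ (e'.map_target (hball ▸ hz))).1 h1
          rw [e'.right_inv (hball ▸ hz)] at hj0
          exact hne j ((hmemS j).2 hj) hj0)
        (by simp only [hT, Function.comp_apply, hy0s]; exact hy0 k hk)
        (by
          have := fderiv_transition_coord_ne_zero he' he hy' (hsub hy') k
          rwa [hy0'] at this)
      exact ⟨j, fun _ => ⟨hj, hv⟩⟩
    · exact ⟨k, fun h => absurd h hk⟩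
  choose τ hτ using hcoord
  have hτv : ∀ k : Fin d, ∃ v : Cd d → ℂ, (k : ℕ) < m →
      DifferentiableOn ℂ v (Metric.ball 0 ε) ∧ (∀ z ∈ Metric.ball (0 : Cd d) ε, v z ≠ 0) ∧
      ∀ z ∈ Metric.ball (0 : Cd d) ε, T z k = z (τ k) * v z := by
    intro k
    by_cases hk : (k : ℕ) < m
    · obtain ⟨-, v, hv⟩ := hτ k hk
      exact ⟨v, fun _ => hv⟩
    · exact ⟨0, fun h => absurd h hk⟩
  choose v hv using hτv
  set A : Fin d → ℕ := fun j => ∑ k ∈ S with τ k = j, I k with hA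
  have hprodT : ∀ z ∈ Metric.ball (0 : Cd d) ε, ∏ k, T z k ^ I k =
      (∏ j, z j ^ A j) * ∏ k ∈ S, v k z ^ I k := by
    intro z hz
    have h1 : ∏ k, T z k ^ I k = ∏ k ∈ S, T z k ^ I k := by
      refine (Finset.prod_subset (Finset.subset_univ S) fun k _ hk => ?_).symm
      rw [hI0 k (by rw [hmemS] at hk; omega), pow_zero]
    rw [h1]
    have h2 : ∏ j, z j ^ A j = ∏ k ∈ S, z (τ k) ^ I k := by
      rw [← Finset.prod_fiberwise S τ]
      refine Finset.prod_congr rfl fun j _ => ?_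
      rw [hA, ← Finset.prod_pow_eq_pow_sum]
      refine Finset.prod_congr rfl fun k hk => ?_
      rw [(Finset.mem_filter.1 hk).2]
    rw [h2, ← Finset.prod_mul_distrib]
    refine Finset.prod_congr rfl fun k hk => ?_
    rw [(hv k ((hmemS k).1 hk)).2.2 z hz, mul_pow]
  have hfr : ∀ z ∈ Metric.ball (0 : Cd d) ε, (∏ j, z j ^ A j) *
      ((∏ k ∈ S, v k z ^ I k) * u (T z) * frameChange L x x' (e'.symm z)) =
        (∏ j, z j ^ I' j) * u' z := by
    intro z hz
    rw [← hfac' z (hball ▸ hz), trivializationAt_snd_eq (hB (hsrc z hz))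
      (hB' (e'.map_target (hball ▸ hz)))]
    have h1 := hfac (T z) (hTt hz)
    rw [hTs z hz, hprodT z hz] at h1
    rw [h1]
    ring
  have hAI : A = I' := by
    refine exponent_eq_of_monomial_eq hε ?_ (hball ▸ hu'.continuousOn) ?_ (hball ▸ hu0') hfr
    · refine ContinuousOn.mul (ContinuousOn.mul ?_ ?_) ?_
      · exact continuousOn_finsetProd _ fun k hk =>
          ((hv k ((hmemS k).1 hk)).1.continuousOn.pow _)
      · exact hu.continuousOn.comp hTd.continuousOn hTt
      · exact (he'.differentiableOn_comp_symm (contMDiffOn_frameChange (L := L) x x')).continuousOn.mono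
          fun z hz => ⟨hball ▸ hz, hB (hsrc z hz), hB' (e'.map_target (hball ▸ hz))⟩
    · intro z hz
      refine mul_ne_zero (mul_ne_zero ?_ (hu0 _ (hTt hz))) (frameChange_ne_zero _ _ _)
      exact Finset.prod_ne_zero_iff.2 fun k hk =>
        pow_ne_zero _ ((hv k ((hmemS k).1 hk)).2.1 z hz)
  have hmaps : ∀ k ∈ S, τ k ∈ S := fun k hk => (hτ k ((hmemS k).1 hk)).1
  -- each branch occurs since its exponent is positive, so `τ` permutes the branches
  have hsurj : SurjOn τ S S := by
    intro j hj
    have h1 : 1 ≤ A j := hAI ▸ hI1' j ((hmemS j).1 hj)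
    have h2 : (S.filter fun k => τ k = j).Nonempty := by
      rw [Finset.nonempty_iff_ne_empty]
      intro h
      simp only [hA] at h1
      rw [h] at h1
      simp at h1
    obtain ⟨k, hk⟩ := h2
    exact ⟨k, (Finset.mem_filter.1 hk).1, (Finset.mem_filter.1 hk).2⟩
  have hinj : InjOn τ S := Finset.injOn_of_surjOn_of_card_le τ hmaps hsurj le_rfl
  refine Finset.prod_nbij τ hmaps hinj hsurj fun k hk => ?_
  rw [← hAI, hA]
  have : S.filter (fun k' => τ k' = τ k) = {k} := by
    ext k'
    simp only [Finset.mem_filter, Finset.mem_singleton]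
    exact ⟨fun h => hinj h.1 hk h.2, fun h => by subst h; exact ⟨hk, rfl⟩⟩
  simp only [this, Finset.sum_singleton]

/-- The product of the exponents at a point of all `m` branches does not depend on the coordinates: both
factorisations are compared with one in a polydisc centred at the point. -/
theorem IsFactored.prod_eq
    (hs : ContMDiff 𝓘(ℂ, Cd d) (𝓘(ℂ, Cd d).prod 𝓘(ℂ, ℂ)) ω
      (fun x => (⟨x, s x⟩ : TotalSpace ℂ L)))
    (hDs : ∀ x, x ∈ D ↔ s x = 0) (hD : IsNormalCrossing (d := d) D)
    {e e' : OpenPartialHomeomorph X (Cd d)} {m : ℕ} (hm : m ≤ d)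
    {I I' : Fin d → ℕ} {x x' y : X} (h : IsFactored s D e m I x) (h' : IsFactored s D e' m I' x')
    (hy : y ∈ e.source) (hy' : y ∈ e'.source) (hy0 : ∀ j : Fin d, (j : ℕ) < m → e y j = 0)
    (hy0' : ∀ j : Fin d, (j : ℕ) < m → e' y j = 0) :
    ∏ j ∈ Finset.univ.filter (fun j : Fin d => (j : ℕ) < m), I j =
      ∏ j ∈ Finset.univ.filter (fun j : Fin d => (j : ℕ) < m), I' j := by
  have hbase : (trivializationAt ℂ L y).baseSet ∈ 𝓝 y :=
    (trivializationAt ℂ L y).open_baseSet.mem_nhds (FiberBundle.mem_baseSet_trivializationAt' y)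
  obtain ⟨e₁, m₁, ε, he₁, hy₁, hy₁0, hε, hball, hsub, hm₁, hD₁⟩ := exists_centered_chart hD y
    (inter_mem (inter_mem (e.open_source.mem_nhds hy) (e'.open_source.mem_nhds hy')) hbase)
  have hcard : ∀ {f : OpenPartialHomeomorph X (Cd d)} {n : ℕ}, n ≤ d →
      (∀ j : Fin d, (j : ℕ) < n → f y j = 0) → (vanSet n (f y)).card = n := by
    intro f n hn h0
    have : vanSet n (f y) = Finset.univ.filter fun j : Fin d => (j : ℕ) < n := by
      ext j; simp only [mem_vanSet, Finset.mem_filter, Finset.mem_univ, true_and]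
      exact ⟨fun h => h.1, fun h => ⟨h, h0 j h⟩⟩
    rw [this, Fin.card_filter_val_lt]; omega
  -- the number of branches through `y` is determined by the strata
  have hmm : m₁ = m := by
    have h1 := fun k => mem_stratum_iff h.1 h.2.2.1 k y hy
    have h2 := fun k => mem_stratum_iff he₁ hD₁ k y hy₁
    rw [hcard hm hy0] at h1
    rw [hcard hm₁ fun j _ => by rw [hy₁0]; rfl] at h2
    exact le_antisymm ((h1 m₁).1 ((h2 m₁).2 le_rfl)) ((h2 m).1 ((h1 m).2 le_rfl))
  subst hmm
  obtain ⟨I₁, hI₁, hI₁0, hu⟩ := exists_section_factor hs hDs he₁ (hsub.trans inter_subset_right)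
    hε hball hD₁
  have hF₁ : IsFactored s D e₁ m₁ I₁ y :=
    ⟨he₁, hsub.trans inter_subset_right, hD₁, hI₁, hI₁0, hu⟩
  rw [h.prod_eq_of_centered hF₁ hε hball (hsub.trans fun _ h => h.1.1) hy₁ hy₁0 hy0,
    h'.prod_eq_of_centered hF₁ hε hball (hsub.trans fun _ h => h.1.2) hy₁ hy₁0 hy0']

end OrderProduct

end DivInt
end

noncomputable section
namespace DivInt

/-! ### Local integrals as integrals of differential operators -/

set_option linter.unusedSectionVars false

section Operators

variable {d : ℕ}

theorem contDiff_smul_of_tsupport_subset {E F : Type*} [NormedAddCommGroup E] [NormedSpace ℝ E]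
    [NormedAddCommGroup F] [NormedSpace ℝ F] {χ : E → ℝ} {f : E → F} {U : Set E} (hU : IsOpen U)
    (hχ : ContDiff ℝ ∞ χ) (hf : ContDiffOn ℝ ∞ f U) (hs : tsupport χ ⊆ U) :
    ContDiff ℝ ∞ (fun z => χ z • f z) := by
  rw [contDiff_iff_contDiffAt]
  intro z
  by_cases hz : z ∈ U
  · exact hχ.contDiffAt.fun_smul (hf.contDiffAt (hU.mem_nhds hz))
  · have h0 : (fun z => χ z • f z) =ᶠ[𝓝 z] fun _ => 0 := by
      filter_upwards [(isClosed_tsupport χ).isOpen_compl.mem_nhds fun h => hz (hs h)] with y hy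
      rw [image_eq_zero_of_notMem_tsupport hy, zero_smul]
    exact contDiffAt_const.congr_of_eventuallyEq h0

theorem contDiff_mul_of_tsupport_subset {g f : Cd d → ℂ} {U : Set (Cd d)} (hU : IsOpen U)
    (hg : ContDiff ℝ ∞ g) (hf : ContDiffOn ℝ ∞ f U) (hs : tsupport g ⊆ U) :
    ContDiff ℝ ∞ (fun z => g z * f z) := by
  rw [contDiff_iff_contDiffAt]
  intro z
  by_cases hz : z ∈ U
  · exact hg.contDiffAt.mul (hf.contDiffAt (hU.mem_nhds hz))
  · have h0 : (fun z => g z * f z) =ᶠ[𝓝 z] fun _ => 0 := by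
      filter_upwards [(isClosed_tsupport g).isOpen_compl.mem_nhds fun h => hz (hs h)] with y hy
      rw [image_eq_zero_of_notMem_tsupport hy, zero_mul]
    exact contDiffAt_const.congr_of_eventuallyEq h0

theorem exists_cutoff {K U : Set (Cd d)} (hK : IsCompact K) (hU : IsOpen U) (hKU : K ⊆ U) :
    ∃ χ : Cd d → ℝ, ContDiff ℝ ∞ χ ∧ tsupport χ ⊆ U ∧ ∀ᶠ z in 𝓝ˢ K, χ z = 1 := by
  obtain ⟨V, hVo, hKV, hVU, -⟩ := exists_open_between_and_isCompact_closure hK hU hKU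
  obtain ⟨f, h1, h0, -⟩ := exists_contMDiffMap_one_nhds_of_subset_interior (n := ⊤)
    𝓘(ℝ, Cd d) (s := K) (t := V) hK.isClosed (by rwa [hVo.interior_eq])
  refine ⟨f, f.contMDiff.contDiff, (closure_mono fun z hz => ?_).trans hVU, h1⟩
  by_contra h
  exact hz (h0 z h)

/-- A smooth function on a neighbourhood of a compact set agrees near this set with a function
which is smooth everywhere. -/
theorem exists_contDiff_eventuallyEq {K U : Set (Cd d)} (hK : IsCompact K) (hU : IsOpen U)
    (hKU : K ⊆ U) {f : Cd d → ℝ} (hf : ContDiffOn ℝ ∞ f U) :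
    ∃ f' : Cd d → ℝ, ContDiff ℝ ∞ f' ∧ ∀ z ∈ K, f' =ᶠ[𝓝 z] f := by
  obtain ⟨χ, hχ, hχU, h1⟩ := exists_cutoff hK hU hKU
  refine ⟨fun z => χ z • f z, contDiff_smul_of_tsupport_subset hU hχ hf hχU, fun z hz => ?_⟩
  filter_upwards [eventually_nhdsSet_iff_forall.1 h1 z hz] with y hy
  rw [hy, one_smul]

variable {X : Type*} [TopologicalSpace X] [ChartedSpace (Cd d) X] [IsManifold 𝓘(ℂ, Cd d) ω X]
  {e : OpenPartialHomeomorph X (Cd d)} {S : Set X} {c m : ℕ}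

theorem SmoothFn.contDiffOn_symm (he : HolChart e) {f : X → ℝ} (hf : SmoothFn (d := d) f) :
    ContDiffOn ℝ ∞ (f ∘ e.symm) e.target :=
  (he.contDiffOn_comp_symm (hf.contMDiffOn (s := univ))).mono fun _ hw => ⟨hw, mem_univ _⟩

theorem contDiff_mul_comp_symm (he : HolChart e) {g : Cd d → ℂ} (hg : ContDiff ℝ ∞ g)
    (hgt : tsupport g ⊆ e.target) {f : X → ℝ} (hf : SmoothFn (d := d) f) :
    ContDiff ℝ ∞ (fun z => g z * (f (e.symm z) : ℂ)) :=
  contDiff_mul_of_tsupport_subset e.open_target hg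
    (Complex.ofRealCLM.contDiff.comp_contDiffOn (SmoothFn.contDiffOn_symm he hf)) hgt

theorem IsIntegralOperator.congr {Λ Λ' : (X → ℝ) → ℂ} (h : IsIntegralOperator (d := d) S c Λ)
    (heq : ∀ f, SmoothFn (d := d) f → Λ' f = Λ f) : IsIntegralOperator (d := d) S c Λ' := by
  obtain ⟨n, e, P, h1, h2, h3⟩ := h
  exact ⟨n, e, P, h1, h2, fun f hf => ⟨(h3 f hf).1, (h3 f hf).2.1, (heq f hf).trans (h3 f hf).2.2⟩⟩

/-- The permutation of the coordinates. -/
def permL (σ : Equiv.Perm (Fin d)) : Cd d →L[ℝ] Cd d :=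
  ContinuousLinearMap.pi fun j => ContinuousLinearMap.proj (σ.symm j)

theorem permL_apply (σ : Equiv.Perm (Fin d)) (u : Cd d) (j : Fin d) :
    permL σ u j = u (σ.symm j) := rfl

theorem sliceCoeff_permChart (σ : Equiv.Perm (Fin d)) (η : FormField d X (2 * (d - c)))
    (w : Cd (d - c)) : sliceCoeff (affChart e σ 0 isOpen_univ) c η w =
      sliceCoeff (permChart e σ c m) c η w := rfl

theorem offSet_of_logKer_ne_zero {p : ℕ} {σ : Equiv.Perm (Fin d)} {τ' : Fin p → Fin (d - c)}
    {w : Cd (d - c)} (h : logKer (tailBranches σ c m) τ' w ≠ 0) : permSlice σ c w ∈ offSet σ c m := by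
  intro k hk hkm h0
  have h1 : tailIdx d c ⟨(k : ℕ) - c, by have := k.isLt; omega⟩ = k := by
    ext; simp only [tailIdx]; omega
  have h2 : (⟨(k : ℕ) - c, by have := k.isLt; omega⟩ : Fin (d - c)) ∈ tailBranches σ c m := by
    simp only [tailBranches, Finset.mem_filter, Finset.mem_univ, true_and, h1, hkm]
  have h3 := Finset.prod_ne_zero_iff.1 (left_ne_zero_of_mul h) _ h2
  refine h3 ?_
  have h4 : permSlice σ c w (σ k) = w ⟨(k : ℕ) - c, by have := k.isLt; omega⟩ := by
    simp [permSlice, slice, hk]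
  rw [← h4, h0, inv_zero]

/-- Integrals with a kernel made of logarithms and of the simple poles along the branches which do
not contain the coordinate plane: the kernel is integrable on the plane and vanishes (by convention,
in `0⁻¹ = 0`) on the other branches, outside of which the plane is all of `S`. -/
theorem isIntegralOperator_logKer (he : HolChart e) {p : ℕ} {σ : Equiv.Perm (Fin d)} (hc : c ≤ d)
    (hS : ∀ y ∈ e.source, e y ∈ offSet σ c m →
      (y ∈ S ↔ ∀ k : Fin d, (k : ℕ) < c → e y (σ k) = 0))
    {E : (Cd d → ℂ) → Cd d → ℂ} (hE : IsWord E) {g : Cd d → ℂ} (hg : ContDiff ℝ ∞ g)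
    (hgs : HasCompactSupport g) (hgt : tsupport g ⊆ e.target) (τ' : Fin p → Fin (d - c)) (a : ℂ) :
    IsIntegralOperator (d := d) S c (fun f : X → ℝ => a *
      ∫ w, logKer (tailBranches σ c m) τ' w *
        E (fun z => g z * (f (e.symm z) : ℂ)) (permSlice σ c w)) := by
  classical
  obtain ⟨ι, _, ord, v, b, hb, hbs, hEb⟩ := hE.diff_expansion hg
  have hbc : ∀ i, HasCompactSupport (b i) := fun i =>
    hgs.of_isClosed_subset (isClosed_tsupport _) (hbs i)
  set ker' := logKer (tailBranches σ c m) τ' with hker'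
  set coef : (X → ℝ) → Cd (d - c) → ℂ := fun f w =>
    a * (ker' w * E (fun z => g z * (f (e.symm z) : ℂ)) (permSlice σ c w)) with hcoef
  set U := (permChart e σ c m).source with hU
  set inv : Cd d → Cd d := fun u k => u (σ k) with hinv
  -- the coefficients of the operator of order `n`, with coordinates permuted back by `inv`
  set A : ∀ n : ℕ, Cd (d - c) → ((Cd d [×n]→L[ℝ] ℝ) →ₗ[ℝ] ℂ) := fun n w =>
    ∑ i with ord i = n, (a * (ker' w * b i (permSlice σ c w))) •
      (Complex.ofRealCLM.toLinearMap.comp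
        (ContinuousMultilinearMap.apply ℝ (fun _ : Fin n => Cd d) ℝ
          (fun k => inv (v i k))).toLinearMap) with hA
  have hAapp : ∀ n w t, A n w t = ∑ i with ord i = n,
      a * (ker' w * b i (permSlice σ c w)) * ((t fun k => inv (v i k) : ℝ) : ℂ) := by
    intro n w t
    simp only [hA, LinearMap.sum_apply]
    rfl
  have hslice : ∀ w : Cd (d - c), permL σ (slice d c w) = permSlice σ c w := fun w => by
    ext j; rw [permL_apply]; rfl
  have hpt : ∀ w, logKer (tailBranches σ c m) τ' w ≠ 0 → permSlice σ c w ∈ e.target →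
      slice d c w ∈ (permChart e σ c m).target := fun w h1 h2 =>
    slice_mem_permChart_target.2 ⟨h2, offSet_of_logKer_ne_zero h1⟩
  have hGs : ∀ f : X → ℝ, tsupport (fun z => g z * (f (e.symm z) : ℂ)) ⊆ tsupport g :=
    fun f => tsupport_mul_subset_left
  have hcoef0 : ∀ f w, slice d c w ∉ (permChart e σ c m).target → coef f w = 0 := by
    intro f w hw
    by_contra h
    have h1 := right_ne_zero_of_mul h
    refine hw (hpt w (left_ne_zero_of_mul h1) (hgt (hGs f (hE.tsupport_subset _ ?_))))
    exact subset_tsupport _ (right_ne_zero_of_mul h1)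
  have hsc : ∀ f w, slice d c w ∈ (permChart e σ c m).target →
      sliceCoeff (permChart e σ c m) c (mkForm (permChart e σ c m) c U (coef f)) w = coef f w :=
    fun f w hw => sliceCoeff_mkForm (he.perm σ c) _ hw ((permChart e σ c m).map_target hw)
  have hmeas : MeasurableSet (slice d c ⁻¹' (permChart e σ c m).target) :=
    ((permChart e σ c m).open_target.preimage (continuous_slice d c)).measurableSet
  have hcoefint : ∀ f, SmoothFn (d := d) f → Integrable (coef f) := by
    intro f hf
    have hGd := hE.contDiff (contDiff_mul_comp_symm he hg hgt hf)
    have hGc : HasCompactSupport (E (fun z => g z * (f (e.symm z) : ℂ))) :=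
      hE.hasCompactSupport (hgs.of_isClosed_subset (isClosed_tsupport _) (hGs f))
    exact (integrable_logKer _ _ (hGd.continuous.comp (contDiff_permSlice σ c).continuous)
      (hasCompactSupport_comp_permSlice hGc σ)).const_mul a
  refine ⟨1, fun _ => permChart e σ c m, fun _ f => mkForm (permChart e σ c m) c U (coef f),
    fun _ => ?_, fun _ => isSliceChart_permChart_of he hc hS, fun f hf => ⟨fun _ x hx => ?_,
    fun _ => ?_, ?_⟩⟩
  · refine ⟨affChart e σ 0 isOpen_univ, U, e.symm '' tsupport g, Finset.univ.sup ord, A,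
      he.aff _ _ _, hc, (permChart e σ c m).open_source, ?_, ?_, ?_, ?_, ?_, ?_, ?_⟩
    · intro y hy
      rw [affChart_source]
      exact ⟨(mem_permChart_source.1 hy).1, mem_univ _⟩
    · intro y hy
      obtain ⟨h1, h2⟩ := mem_permChart_source.1 hy
      simp only [affChart_apply, Pi.zero_apply, sub_zero]
      exact hS y h1 h2
    · exact hgs.isCompact.image_of_continuousOn (e.continuousOn_symm.mono hgt)
    · rintro y ⟨z, hz, rfl⟩
      rw [affChart_source]
      exact ⟨e.map_target (hgt hz), mem_univ _⟩
    · intro n t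
      simp only [hAapp]
      refine integrable_finsetSum _ fun i _ => ((integrable_logKer _ _
        ((hb i).continuous.comp (contDiff_permSlice σ c).continuous)
        (hasCompactSupport_comp_permSlice (hbc i) σ)).const_mul a).mul_const _
    · intro n w hw
      refine Finset.sum_eq_zero fun i _ => ?_
      suffices h : a * (ker' w * b i (permSlice σ c w)) = 0 by rw [h, zero_smul]
      by_contra h
      have h1 := right_ne_zero_of_mul h
      have h2 : permSlice σ c w ∈ tsupport g :=
        hbs i (subset_tsupport _ (right_ne_zero_of_mul h1))
      have h3 := hpt w (left_ne_zero_of_mul h1) (hgt h2)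
      refine hw ⟨?_, ?_, ?_⟩
      · rw [affChart_target]
        have := (slice_mem_permChart_target.1 h3).1
        refine ⟨?_, mem_univ _⟩
        convert! this using 1
        funext j; simp [permSlice]
      · exact (permChart e σ c m).map_target h3
      · exact ⟨permSlice σ c w, h2, (permChart_symm_slice (m := m) σ c w).symm⟩
    · intro f hf
      refine ⟨fun x hx => mkForm_of_notMem _ hx, fun w hwe hwU => ?_⟩
      have hperm : (fun j => slice d c w (σ.symm j) + (0 : Cd d) (σ.symm j)) = permSlice σ c w := by
        funext j; simp [permSlice]
      have hwt : slice d c w ∈ (permChart e σ c m).target := by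
        have h1 : (permChart e σ c m).symm (slice d c w) ∈ U := hwU
        rw [permChart_symm_slice] at h1
        rw [affChart_target, mem_ofPred_eq, hperm] at hwe
        have h2 := (mem_permChart_source.1 h1).2
        rw [e.right_inv hwe.1] at h2
        exact slice_mem_permChart_target.2 ⟨hwe.1, h2⟩
      rw [sliceCoeff_permChart (m := m), hsc f w hwt]
      -- `f ∘ e⁻¹` is smooth in the chart only and has to be extended
      obtain ⟨f', hf', hff'⟩ := exists_contDiff_eventuallyEq hgs.isCompact e.open_target hgt
        (SmoothFn.contDiffOn_symm he hf)
      have hgf : (fun z => g z * (f (e.symm z) : ℂ)) = fun z => g z * (f' z : ℂ) := by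
        funext z
        by_cases hz : z ∈ tsupport g
        · rw [(hff' z hz).eq_of_nhds]; rfl
        · rw [image_eq_zero_of_notMem_tsupport hz, zero_mul, zero_mul]
      simp only [hcoef, hgf]
      rw [hEb f' hf']
      have hterm : ∀ i, b i (permSlice σ c w) *
          ((iteratedFDeriv ℝ (ord i) f' (permSlice σ c w) (fun k => v i k) : ℝ) : ℂ) =
          b i (permSlice σ c w) * ((iteratedFDeriv ℝ (ord i)
            (f ∘ (affChart e σ 0 isOpen_univ).symm) (slice d c w)
            (fun k => inv (v i k)) : ℝ) : ℂ) := by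
        intro i
        by_cases hz : permSlice σ c w ∈ tsupport g
        · congr 2
          have h1 : f ∘ (affChart e σ 0 isOpen_univ).symm =ᶠ[𝓝 (slice d c w)] f' ∘ permL σ := by
            have h2 := hff' _ hz
            rw [← hslice] at h2
            have h3 := (permL σ).continuous.continuousAt.eventually h2
            filter_upwards [h3] with u hu
            rw [Function.comp_apply (f := f'), hu, Function.comp_apply, Function.comp_apply,
              affChart_symm_apply]
            congr 2
            funext j
            simp [permL_apply]
          rw [(h1.iteratedFDeriv ℝ (ord i)).eq_of_nhds,
            ContinuousLinearMap.iteratedFDeriv_comp_right (permL σ) hf' _ (i := ord i)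
              (by exact_mod_cast le_top), hslice]
          rw [ContinuousMultilinearMap.compContinuousLinearMap_apply]
          congr 1
          funext k
          ext j
          simp [permL_apply, hinv]
        · rw [image_eq_zero_of_notMem_tsupport fun h => hz (hbs i h), zero_mul, zero_mul]
      simp only [hAapp, hterm]
      rw [← Finset.sum_fiberwise_of_maps_to (g := ord)
        (fun i _ => Finset.mem_range.2 (Nat.lt_succ_of_le (Finset.le_sup (f := ord) (Finset.mem_univ i)))), Finset.mul_sum, Finset.mul_sum]
      refine Finset.sum_congr rfl fun n _ => ?_
      rw [Finset.mul_sum, Finset.mul_sum]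
      refine Finset.sum_congr rfl fun i hi => ?_
      obtain rfl := (Finset.mem_filter.1 hi).2
      ring
  · exact mkForm_of_notMem _ hx
  · exact (hcoefint f hf).integrableOn.congr_fun (fun w hw => (hsc f w hw).symm) hmeas
  · rw [Finset.univ_unique, Finset.sum_singleton]
    beta_reduce
    rw [← integral_const_mul,
      setIntegral_congr_fun hmeas fun w hw => hsc f w hw]
    exact (setIntegral_eq_integral_of_forall_compl_eq_zero fun w hw => hcoef0 f w hw).symm

/-- The coefficients of the local expansions, as functionals of a smooth function `f` on `X`, are
integrals of differential operators over `S`, if there are no more logarithms than branches which do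
not contain `S`. -/
theorem isIntegralOperator_coefInt (he : HolChart e) (hm : m ≤ d) (I J K : Fin d → ℕ) {p : ℕ}
    (hpc : p + c ≤ m)
    (hS : ∀ σ : Equiv.Perm (Fin d), (∀ k : Fin d, (k : ℕ) < c → (σ k : ℕ) < m) →
      ∀ y ∈ e.source, e y ∈ offSet σ c m → (y ∈ S ↔ ∀ k : Fin d, (k : ℕ) < c → e y (σ k) = 0))
    {g : Cd d → ℂ} (hg : ContDiff ℝ ∞ g) (hgs : HasCompactSupport g) (hgt : tsupport g ⊆ e.target)
    (b : ℂ) :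
    IsIntegralOperator (d := d) S c (fun f : X → ℝ => b *
      coefInt m I J K p (fun z => g z * (f (e.symm z) : ℂ))) := by
  obtain ⟨σ, τ', a, E, hE, hσ, hexp⟩ := exists_coefInt_expansion hm I J K hpc
  refine IsIntegralOperator.congr (IsIntegralOperator.sum Finset.univ fun τ _ =>
    isIntegralOperator_logKer (c := c) (m := m) he (by omega) (hS (σ τ) (hσ τ)) (hE τ) hg hgs hgt
      (τ' τ) (b * a τ)) fun f hf => ?_
  rw [hexp _ (contDiff_mul_comp_symm he hg hgt hf)
    (hgs.of_isClosed_subset (isClosed_tsupport _) tsupport_mul_subset_left), Finset.mul_sum]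
  simp only [mul_assoc]

theorem mem_stratum_diff_iff {D : Set X} (he : HolChart e)
    (hD : ∀ y ∈ e.source, y ∈ D ↔ ∃ j : Fin d, (j : ℕ) < m ∧ e y j = 0) (hc : c ≤ d)
    {σ : Equiv.Perm (Fin d)} (hσ : ∀ k : Fin d, (k : ℕ) < c → (σ k : ℕ) < m) :
    ∀ y ∈ e.source, e y ∈ offSet σ c m → (y ∈ stratum (d := d) D c \ stratum (d := d) D (c + 1) ↔
      ∀ k : Fin d, (k : ℕ) < c → e y (σ k) = 0) := by
  intro y hy hoff
  obtain ⟨h1, h2⟩ := vanSet_of_mem_offSet hc hσ hoff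
  rw [Set.mem_sdiff, mem_stratum_iff he hD c y hy, mem_stratum_iff he hD (c + 1) y hy, ← h2]
  omega

end Operators

end DivInt
end

noncomputable section
namespace DivInt

/-! ### Local expressions of the section, the metric and the form -/

set_option linter.unusedSectionVars false

section LocalData

variable {d : ℕ} {X : Type*} [TopologicalSpace X] [ChartedSpace (Cd d) X]
  [IsManifold 𝓘(ℂ, Cd d) ω X] {L : X → Type*} [TopologicalSpace (TotalSpace ℂ L)]
  [∀ x, AddCommGroup (L x)] [∀ x, Module ℂ (L x)] [∀ x, TopologicalSpace (L x)]
  [FiberBundle ℂ L] [VectorBundle ℂ ℂ L] [ContMDiffVectorBundle ω ℂ L 𝓘(ℂ, Cd d)]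

/-- The data of the integral in one chart: there `D` is `{z₁ ⋯ z_m = 0}`, the length of `s` is
`|z^I| e^{a/2}` and the coefficient of the form `Ω` is `G / (z^J z̄^K)`, with smooth `a` and `G`. -/
structure IsLocalDatum (h₀ : LineMetric d L) (s : ∀ x : X, L x) (D : Set X)
    (Ω : FormField d X (2 * d)) (e : OpenPartialHomeomorph X (Cd d)) (m : ℕ)
    (I J K : Fin d → ℕ) (a : Cd d → ℝ) (G : Cd d → ℂ) : Prop where
  chart : HolChart e
  mem_iff : ∀ y ∈ e.source, y ∈ D ↔ ∃ j : Fin d, (j : ℕ) < m ∧ e y j = 0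
  exponents : IsExponents m I J K
  center : ∃ y ∈ e.source, ∀ j : Fin d, (j : ℕ) < m → e y j = 0
  factored : ∃ x, IsFactored s D e m I x
  smooth_log : ContDiffOn ℝ ∞ a e.target
  smooth_coeff : ContDiffOn ℝ ∞ G e.target
  nrm_eq : ∀ z ∈ e.target,
    h₀.nrm (e.symm z) (s (e.symm z)) = (∏ j, ‖z j‖ ^ I j) * Real.exp (a z / 2)
  coeff_eq : ∀ w ∈ e.target, e.symm w ∉ D →
    sliceCoeff e 0 Ω w = G w / ∏ j, (w j ^ J j * (starRingEnd ℂ (w j)) ^ K j)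

variable {h₀ : LineMetric d L} {s : ∀ x : X, L x} {D : Set X}

/-- Every point has a coordinate polydisc with simultaneous normal forms of `D`, the section, its length
and the form `α ∧ β̄`. -/
theorem exists_localDatum
    (hs : ContMDiff 𝓘(ℂ, Cd d) (𝓘(ℂ, Cd d).prod 𝓘(ℂ, ℂ)) ω
      (fun x => (⟨x, s x⟩ : TotalSpace ℂ L)))
    (hDs : ∀ x, x ∈ D ↔ s x = 0) (hD : IsNormalCrossing (d := d) D) {k l : ℕ} (hkl : k + l = 2 * d)
    {α : FormField d X k} {β : FormField d X l} (hα : IsSemiMeromorphic D α)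
    (hβ : IsSemiMeromorphic D β) (h₀ : LineMetric d L) (x : X) :
    ∃ (e : OpenPartialHomeomorph X (Cd d)) (m : ℕ) (I J K : Fin d → ℕ) (a : Cd d → ℝ)
      (G : Cd d → ℂ), x ∈ e.source ∧
      IsLocalDatum h₀ s D (wedgeTop hkl α (conjForm β)) e m I J K a G := by
  obtain ⟨N, hN, hwedge⟩ := exists_wedge_coeff hkl hα hβ x
  have hbase : (trivializationAt ℂ L x).baseSet ∈ 𝓝 x :=
    (trivializationAt ℂ L x).open_baseSet.mem_nhds (FiberBundle.mem_baseSet_trivializationAt' x)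
  obtain ⟨e, m, ε, he, hx, hx0, hε, hball, hsub, hm, hDe⟩ :=
    exists_centered_chart hD x (inter_mem hN hbase)
  have hB := hsub.trans inter_subset_right
  obtain ⟨I, hI, hI0, u, hu, hu0, hfac⟩ := exists_section_factor hs hDs he hB hε hball hDe
  obtain ⟨J, K, G, hJK, hJK0, hG, hGe⟩ := hwedge e m ε he hε hball (hsub.trans inter_subset_left) hDe
  obtain ⟨a, ha, hae⟩ := exists_log_metric h₀ he hB hu hu0 hfac
  exact ⟨e, m, I, J, K, a, G, hx, he, hDe,
    ⟨hm, fun j hj => ⟨hI j hj, hJK j hj⟩, fun j hj => ⟨hI0 j hj, hJK0 j hj⟩⟩,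
    ⟨x, hx, fun j _ => by rw [hx0]; rfl⟩, ⟨x, he, hB, hDe, hI, hI0, u, hu, hu0, hfac⟩, ha, hG, hae, hGe⟩

theorem IsFactored.isOrderProduct {e : OpenPartialHomeomorph X (Cd d)} {m : ℕ} {I : Fin d → ℕ}
    {x y : X} (h : IsFactored s D e m I x) (hy : y ∈ e.source)
    (hy0 : ∀ j : Fin d, (j : ℕ) < m → e y j = 0) :
    IsOrderProduct (d := d) s y (∏ j ∈ Finset.univ.filter (fun j : Fin d => (j : ℕ) < m), I j) := by
  obtain ⟨he, hB, -, hI, hI0, u, hu, hu0, hfac⟩ := h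
  exact isOrderProduct_of_factor he hB hI hI0 hu hu0 hfac hy hy0

theorem LineMetric.smoothFn_of_eq (h h₀ : LineMetric d L) {φ : X → ℝ}
    (hφ : ∀ x v, h.nrm x v = h₀.nrm x v * Real.exp (-φ x)) : SmoothFn (d := d) φ := by
  intro x
  have hx := FiberBundle.mem_baseSet_trivializationAt' (F := ℂ) (E := L) x
  have hnb := (trivializationAt ℂ L x).open_baseSet.mem_nhds hx
  have h1 : ContMDiffAt 𝓘(ℝ, Cd d) 𝓘(ℝ, ℝ) ∞
      (fun y => Real.log (h₀.nrm y ((trivializationAt ℂ L x).symm y (1 : ℂ)))) x :=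
    (Real.contDiffAt_log.2 (nrm_frame_pos h₀ hx).ne').contMDiffAt.comp x ((h₀.smooth x).contMDiffAt hnb)
  have h2 : ContMDiffAt 𝓘(ℝ, Cd d) 𝓘(ℝ, ℝ) ∞
      (fun y => Real.log (h.nrm y ((trivializationAt ℂ L x).symm y (1 : ℂ)))) x :=
    (Real.contDiffAt_log.2 (nrm_frame_pos h hx).ne').contMDiffAt.comp x ((h.smooth x).contMDiffAt hnb)
  refine (h1.sub h2).congr_of_eventuallyEq ?_
  filter_upwards [hnb] with y hy
  rw [hφ, Real.log_mul (nrm_frame_pos h₀ hy).ne' (Real.exp_pos _).ne', Real.log_exp]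
  ring

theorem card_vanSet_le (m : ℕ) (z : Cd d) : (vanSet m z).card ≤ m := by
  have h : vanSet m z ⊆ Finset.univ.filter fun j : Fin d => (j : ℕ) < m := fun j hj => by
    simpa using (mem_vanSet.1 hj).1
  refine (Finset.card_le_card h).trans ?_
  rw [Fin.card_filter_val_lt]
  exact min_le_right _ _

theorem le_card_vanSet_iff {m : ℕ} (hm : m ≤ d) (z : Cd d) :
    m ≤ (vanSet m z).card ↔ ∀ j : Fin d, (j : ℕ) < m → z j = 0 := by
  have h : vanSet m z ⊆ Finset.univ.filter fun j : Fin d => (j : ℕ) < m := fun j hj => by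
    simpa using (mem_vanSet.1 hj).1
  have hc : (Finset.univ.filter fun j : Fin d => (j : ℕ) < m).card = m := by
    rw [Fin.card_filter_val_lt]; omega
  constructor
  · intro hle j hj
    have := Finset.eq_of_subset_of_card_le h (by omega)
    have hj' : j ∈ vanSet m z := by rw [this]; simpa using hj
    exact (mem_vanSet.1 hj').2
  · intro h0
    refine hc.ge.trans ?_
    exact Finset.card_le_card fun j hj => mem_vanSet.2 ⟨by simpa using hj, h0 j (by simpa using hj)⟩

/-- The centre of a chart with `m` branches lies in the stratum `m`. -/
theorem IsLocalDatum.card_le {Ω : FormField d X (2 * d)} {e : OpenPartialHomeomorph X (Cd d)} {m : ℕ}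
    {I J K : Fin d → ℕ} {a : Cd d → ℝ} {G : Cd d → ℂ} (hd : IsLocalDatum h₀ s D Ω e m I J K a G)
    {κ : ℕ} (hκ : IsGreatest {r : ℕ | (stratum (d := d) D r).Nonempty} κ) : m ≤ κ := by
  obtain ⟨y, hy, hy0⟩ := hd.center
  refine hκ.2 ⟨y, (mem_stratum_iff hd.chart hd.mem_iff m y hy).2
    ((le_card_vanSet_iff hd.exponents.le _).2 hy0)⟩

/-- A function with support in the domain of a chart, in this chart and extended by zero. -/
theorem exists_localized [T2Space X] [CompactSpace X] {e : OpenPartialHomeomorph X (Cd d)}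
    (he : HolChart e) {ρ : X → ℝ} (hρ : SmoothFn (d := d) ρ) (hρe : tsupport ρ ⊆ e.source) :
    ∃ r : Cd d → ℝ, ContDiff ℝ ∞ r ∧ HasCompactSupport r ∧ tsupport r ⊆ e.target ∧
      ∀ z ∈ e.target, r z = ρ (e.symm z) := by
  have hK : IsCompact (e '' tsupport ρ) :=
    (isClosed_tsupport ρ).isCompact.image_of_continuousOn (e.continuousOn.mono hρe)
  have hsupp : Function.support (e.target.indicator (ρ ∘ e.symm)) ⊆ e '' tsupport ρ := by
    intro z hz
    rw [Function.mem_support] at hz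
    have hzt : z ∈ e.target := mem_of_indicator_ne_zero hz
    rw [indicator_of_mem hzt] at hz
    exact ⟨e.symm z, subset_tsupport _ hz, e.right_inv hzt⟩
  have hts : tsupport (e.target.indicator (ρ ∘ e.symm)) ⊆ e '' tsupport ρ :=
    closure_minimal hsupp hK.isClosed
  have hts' : tsupport (e.target.indicator (ρ ∘ e.symm)) ⊆ e.target := hts.trans (by
    rintro z ⟨y, hy, rfl⟩; exact e.map_source (hρe hy))
  refine ⟨e.target.indicator (ρ ∘ e.symm), ?_, hK.of_isClosed_subset (isClosed_tsupport _) hts, hts',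
    fun z hz => indicator_of_mem hz _⟩
  rw [contDiff_iff_contDiffAt]
  intro z
  by_cases hz : z ∈ e.target
  · refine ((SmoothFn.contDiffOn_symm he hρ).contDiffAt (e.open_target.mem_nhds hz)).congr_of_eventuallyEq ?_
    filter_upwards [e.open_target.mem_nhds hz] with w hw using indicator_of_mem hw _
  · refine contDiffAt_const (c := (0:ℝ)) |>.congr_of_eventuallyEq ?_
    filter_upwards [(isClosed_tsupport _).isOpen_compl.mem_nhds fun h => hz (hts' h)] with w hw
    exact image_eq_zero_of_notMem_tsupport hw

end LocalData

end DivInt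
end

noncomputable section
namespace DivInt

/-! ### The Laurent expansion of a local integral -/

set_option linter.unusedSectionVars false

section LocalExpansion

variable {d : ℕ}

/-- Additivity of the coefficient integrals, whose integrands are integrable by
`exists_coefInt_expansion` for `c = 0`. -/
theorem coefInt_sum {m p : ℕ} (hm : m ≤ d) (I J K : Fin d → ℕ) (hp : p ≤ m) {ι : Type*}
    (s : Finset ι) (k : ι → ℂ) {G : ι → Cd d → ℂ} (hG : ∀ i ∈ s, ContDiff ℝ ∞ (G i))
    (hGs : ∀ i ∈ s, HasCompactSupport (G i)) :
    coefInt m I J K p (fun z => ∑ i ∈ s, k i * G i z) = ∑ i ∈ s, k i * coefInt m I J K p (G i) := by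
  obtain ⟨σ, τ', a, E, hE, -, hexp⟩ := exists_coefInt_expansion (c := 0) hm I J K (p := p) (by omega)
  have hsum : ContDiff ℝ ∞ (fun z => ∑ i ∈ s, k i * G i z) :=
    ContDiff.sum fun i hi => contDiff_const.mul (hG i hi)
  have hsums : HasCompactSupport (fun z => ∑ i ∈ s, k i * G i z) := by
    classical
    clear hsum
    induction s using Finset.induction_on with
    | empty => exact (HasCompactSupport.zero : HasCompactSupport (0 : Cd d → ℂ))
    | insert i s hi ih =>
      simp_rw [Finset.sum_insert hi]
      exact ((hGs i (Finset.mem_insert_self i s)).mul_left).add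
        (ih (fun j hj => hG j (Finset.mem_insert_of_mem hj))
          fun j hj => hGs j (Finset.mem_insert_of_mem hj))
  rw [hexp _ hsum hsums]
  have h1 : ∀ i ∈ s, k i * coefInt m I J K p (G i) = ∑ τ, k i * (a τ * ∫ w,
      logKer (tailBranches (σ τ) 0 m) (τ' τ) w * E τ (G i) (permSlice (σ τ) 0 w)) := fun i hi => by
    rw [hexp _ (hG i hi) (hGs i hi), Finset.mul_sum]
  rw [Finset.sum_congr rfl h1, Finset.sum_comm]
  refine Finset.sum_congr rfl fun τ _ => ?_
  rw [(hE τ).sum s (f := fun i z => k i * G i z) fun i hi => contDiff_const.mul (hG i hi)]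
  simp_rw [Finset.mul_sum]
  rw [integral_finsetSum, Finset.mul_sum]
  · refine Finset.sum_congr rfl fun i hi => ?_
    rw [(hE τ).const_mul (k i) (hG i hi)]
    simp_rw [mul_left_comm _ (k i), integral_const_mul]
    ring
  · intro i hi
    rw [(hE τ).const_mul (k i) (hG i hi)]
    simp_rw [mul_left_comm _ (k i)]
    exact (integrable_logKer _ _ (((hE τ).contDiff (hG i hi)).continuous.comp
      (contDiff_permSlice _ _).continuous) (hasCompactSupport_comp_permSlice
        ((hE τ).hasCompactSupport (hGs i hi)) _)).const_mul _

/-- The Laurent expansion of `t^{-m} H(t)` up to the constant term. It may be written with a larger number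
`κ` of polar terms. -/
theorem isBigO_laurent {m κ : ℕ} (hmκ : m ≤ κ) {F H : ℂ → ℂ} {c : ℕ → ℂ}
    (hF : F =ᶠ[𝓝[≠] 0] fun t => t ^ (-(m : ℤ)) * H t) (hH : HasTaylor H c) :
    (fun z : ℂ => F z - ∑ r ∈ Finset.range (κ + 1), (if r ≤ m then c (m - r) else 0) * z ^ (-(r : ℤ)))
      =O[𝓝[≠] 0] fun z : ℂ => z := by
  have h1 := (hH.isBigO (m + 1)).mono (nhdsWithin_le_nhds (s := {0}ᶜ))
  have h2 := (Asymptotics.isBigO_refl (fun z : ℂ => z ^ (-(m : ℤ))) (𝓝[≠] 0)).mul h1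
  refine h2.congr' ?_ ?_
  · filter_upwards [hF, self_mem_nhdsWithin] with z hz hz0
    rw [hz, mul_sub, Finset.mul_sum]
    congr 1
    have h3 : ∑ r ∈ Finset.range (κ + 1), (if r ≤ m then c (m - r) else 0) * z ^ (-(r : ℤ)) =
        ∑ r ∈ Finset.range (m + 1), c (m - r) * z ^ (-(r : ℤ)) := by
      symm
      refine (Finset.sum_congr rfl fun r hr => ?_).trans
        (Finset.sum_subset (Finset.range_subset_range.2 (by omega)) fun r _ hr => ?_)
      · rw [if_pos (by simpa [Nat.lt_succ_iff] using hr)]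
      · rw [if_neg (by simpa [Nat.lt_succ_iff] using hr), zero_mul]
    rw [h3, ← Finset.sum_range_reflect]
    refine Finset.sum_congr rfl fun n hn => ?_
    have hn' : n ≤ m := by simpa [Nat.lt_succ_iff] using hn
    have h4 : z ^ (-(n : ℤ)) = z ^ (-(m : ℤ)) * z ^ (m - n) := by
      rw [← zpow_natCast, ← zpow_add₀ hz0, Nat.cast_sub hn']
      congr 1
      ring
    rw [h4, show m + 1 - 1 - n = m - n by omega]
    ring
  · filter_upwards [self_mem_nhdsWithin] with z hz0
    rw [pow_succ, ← mul_assoc, ← zpow_natCast, ← zpow_add₀ hz0]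
    simp

theorem cpow_monomial_mul_exp (I : Fin d → ℕ) {z : Cd d} (hz : ∀ j, z j ≠ 0) (w : ℝ) (t : ℂ) :
    (((∏ j, ‖z j‖ ^ I j) * Real.exp (w / 2) : ℝ) : ℂ) ^ (2 * t) =
      Complex.exp (t * (logW I z : ℝ)) * Complex.exp (t * (w : ℝ)) := by
  have h1 : (∏ j, ‖z j‖ ^ I j) * Real.exp (w / 2) = Real.exp (logW I z / 2 + w / 2) := by
    rw [Real.exp_add]
    congr 1
    rw [logW, Finset.sum_div, Real.exp_sum]
    refine Finset.prod_congr rfl fun j _ => ?_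
    rw [show 2 * (I j : ℝ) * Real.log ‖z j‖ / 2 = I j * Real.log ‖z j‖ by ring, Real.exp_nat_mul,
      Real.exp_log (norm_pos_iff.2 (hz j))]
  rw [h1, Complex.cpow_def_of_ne_zero (by exact_mod_cast (Real.exp_pos _).ne'),
    ← Complex.ofReal_log (Real.exp_pos _).le, Real.log_exp, ← Complex.exp_add]
  congr 1
  push_cast
  ring

theorem mono_natCast (J K : Fin d → ℕ) (z : Cd d) :
    mono (fun j => (J j : ℤ)) (fun j => (K j : ℤ)) z =
      (∏ j, (z j ^ J j * (starRingEnd ℂ (z j)) ^ K j))⁻¹ := by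
  rw [mono, ← Finset.prod_inv_distrib]
  refine Finset.prod_congr rfl fun j _ => ?_
  rw [zpow_neg, zpow_neg, zpow_natCast, zpow_natCast, mul_inv]

theorem pow_div_factorial_sub (a f : ℂ) (q : ℕ) : (a - 2 * f) ^ q / (q.factorial : ℂ) =
    ∑ j ∈ Finset.range (q + 1),
      (-2) ^ j / (((q - j).factorial * j.factorial : ℕ) : ℂ) * (a ^ (q - j) * f ^ j) := by
  rw [show a - 2 * f = (-2 * f) + a by ring, add_pow, Finset.sum_div]
  refine Finset.sum_congr rfl fun j hj => ?_
  have hj' : j ≤ q := by simpa [Nat.lt_succ_iff] using hj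
  have h1 : ((q.factorial : ℕ) : ℂ) = (q.choose j : ℂ) * (((q - j).factorial * j.factorial : ℕ) : ℂ) := by
    rw [← Nat.choose_mul_factorial_mul_factorial hj']; push_cast; ring
  have h2 : (((q - j).factorial * j.factorial : ℕ) : ℂ) ≠ 0 := by
    exact_mod_cast (mul_pos (Nat.factorial_pos _) (Nat.factorial_pos _)).ne'
  have h3 : (q.choose j : ℂ) ≠ 0 := by exact_mod_cast (Nat.choose_pos hj').ne'
  rw [h1, mul_pow]
  field_simp

variable {X : Type*} [TopologicalSpace X] [ChartedSpace (Cd d) X]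
  [IsManifold 𝓘(ℂ, Cd d) ω X] {L : X → Type*} [TopologicalSpace (TotalSpace ℂ L)]
  [∀ x, AddCommGroup (L x)] [∀ x, Module ℂ (L x)] [∀ x, TopologicalSpace (L x)]
  [FiberBundle ℂ L] [VectorBundle ℂ ℂ L] [ContMDiffVectorBundle ω ℂ L 𝓘(ℂ, Cd d)]
  {h₀ : LineMetric d L} {s : ∀ x : X, L x} {D : Set X} {Ω : FormField d X (2 * d)}
  {e : OpenPartialHomeomorph X (Cd d)} {m : ℕ} {I J K : Fin d → ℕ} {a : Cd d → ℝ} {G : Cd d → ℂ}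

/-- The coefficient of `λ^{-r}` in the expansion of a local integral, the part of degree `j` in the
weight, as a functional of the `j`-th power of the weight. -/
def localCoeff (m : ℕ) (I J K : Fin d → ℕ) (γ : ℕ → ℂ) (g : Cd d → ℂ) (a : Cd d → ℝ)
    (e : OpenPartialHomeomorph X (Cd d)) (r j : ℕ) (f : X → ℝ) : ℂ :=
  if r ≤ m then ∑ x ∈ Finset.HasAntidiagonal.antidiagonal (m - r), ∑ y ∈ Finset.HasAntidiagonal.antidiagonal x.2,
    if j ≤ y.2 then (γ x.1 * ((-2) ^ j / (((y.2 - j).factorial * j.factorial : ℕ) : ℂ))) *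
      coefInt m I J K y.1 (fun z => (g z * (a z : ℂ) ^ (y.2 - j)) * (f (e.symm z) : ℂ)) else 0
  else 0

/-- In the coefficient of `λ^{-r}` at most `m - r` logarithms occur, so that it is an integral over the
intersections of `r` branches. -/
theorem isIntegralOperator_localCoeff (he : HolChart e) (hm : m ≤ d) {S : Set X} {c : ℕ}
    (γ : ℕ → ℂ) {g : Cd d → ℂ} (hg : ContDiff ℝ ∞ g) (hgs : HasCompactSupport g)
    (hgt : tsupport g ⊆ e.target) (ha : ContDiff ℝ ∞ a) {r : ℕ} (hcr : c ≤ r) (j : ℕ)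
    (hS : c ≤ m → ∀ σ : Equiv.Perm (Fin d), (∀ k : Fin d, (k : ℕ) < c → (σ k : ℕ) < m) →
      ∀ y ∈ e.source, e y ∈ offSet σ c m → (y ∈ S ↔ ∀ k : Fin d, (k : ℕ) < c → e y (σ k) = 0)) :
    IsIntegralOperator (d := d) S c (localCoeff m I J K γ g a e r j) := by
  unfold localCoeff
  by_cases hr : r ≤ m
  · simp only [if_pos hr]
    refine IsIntegralOperator.sum _ fun x hx => IsIntegralOperator.sum _ fun y hy => ?_
    have h1 := Finset.HasAntidiagonal.mem_antidiagonal.1 hx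
    have h2 := Finset.HasAntidiagonal.mem_antidiagonal.1 hy
    by_cases hj : j ≤ y.2
    · simp only [if_pos hj]
      refine isIntegralOperator_coefInt he hm I J K (by omega) (hS (by omega)) ?_ hgs.mul_right
        (tsupport_mul_subset_left.trans hgt) _
      exact hg.mul ((Complex.ofRealCLM.contDiff.comp ha).pow _)
    · simp only [if_neg hj]
      exact IsIntegralOperator.zero
  · simp only [if_neg hr]
    exact IsIntegralOperator.zero

theorem localCoeff_eq_zero (γ : ℕ → ℂ) (g : Cd d → ℂ) {r j : ℕ} (h : m < r + j) (f : X → ℝ) :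
    localCoeff m I J K γ g a e r j f = 0 := by
  unfold localCoeff
  split_ifs with hr
  · refine Finset.sum_eq_zero fun x hx => Finset.sum_eq_zero fun y hy => if_neg ?_
    have h1 := Finset.HasAntidiagonal.mem_antidiagonal.1 hx
    have h2 := Finset.HasAntidiagonal.mem_antidiagonal.1 hy
    omega
  · rfl

/-- In the top degree `r + j = m` neither logarithms nor the metric contribute. -/
theorem localCoeff_top (γ : ℕ → ℂ) (g : Cd d → ℂ) {r j : ℕ} (h : r + j = m) (f : X → ℝ) :
    localCoeff m I J K γ g a e r j f = γ 0 * ((-2) ^ j / (j.factorial : ℂ)) *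
      coefInt m I J K 0 (fun z => g z * (f (e.symm z) : ℂ)) := by
  unfold localCoeff
  rw [if_pos (by omega), Finset.sum_eq_single_of_mem ((0, j) : ℕ × ℕ)
    (Finset.HasAntidiagonal.mem_antidiagonal.2 (by simp; omega)),
    Finset.sum_eq_single_of_mem ((0, j) : ℕ × ℕ)
    (Finset.HasAntidiagonal.mem_antidiagonal.2 (by simp)), if_pos le_rfl]
  · simp
  · rintro ⟨p, q⟩ hy hne
    have h2 := Finset.HasAntidiagonal.mem_antidiagonal.1 hy
    refine if_neg fun hjq => hne ?_
    simp only [Prod.mk.injEq] at h2 ⊢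
    omega
  · rintro ⟨p, q⟩ hx hne
    have h1 := Finset.HasAntidiagonal.mem_antidiagonal.1 hx
    refine Finset.sum_eq_zero fun y hy => if_neg fun hjq => hne ?_
    have h2 := Finset.HasAntidiagonal.mem_antidiagonal.1 hy
    simp only [Prod.mk.injEq] at h1 h2 ⊢
    omega

/-- The coefficients of the local expansion, for the weight `a - 2φ`, are polynomials in `φ`. -/
theorem sum_localCoeff (hm : m ≤ d) (γ : ℕ → ℂ) {g : Cd d → ℂ} (hg : ContDiff ℝ ∞ g)
    (hgs : HasCompactSupport g) (ha : ContDiff ℝ ∞ a) {φ : X → ℝ} {φ' : Cd d → ℝ}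
    (hφ' : ContDiff ℝ ∞ φ') (hφ : ∀ z, g z ≠ 0 → φ' z = φ (e.symm z)) {r κ : ℕ} (hr : r ≤ κ)
    (hmκ : m ≤ κ) :
    ∑ j ∈ Finset.range (κ - r + 1), localCoeff m I J K γ g a e r j (fun x => φ x ^ j) =
      if r ≤ m then ∑ x ∈ Finset.HasAntidiagonal.antidiagonal (m - r), γ x.1 *
        ∑ y ∈ Finset.HasAntidiagonal.antidiagonal x.2, coefInt m I J K y.1
          (fun z => g z * ((((a z - 2 * φ' z : ℝ)) : ℂ) ^ y.2 / (y.2.factorial : ℂ))) else 0 := by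
  unfold localCoeff
  split_ifs with hrm
  swap
  · simp
  rw [Finset.sum_comm]
  refine Finset.sum_congr rfl fun x hx => ?_
  rw [Finset.sum_comm, Finset.mul_sum]
  refine Finset.sum_congr rfl fun y hy => ?_
  have h1 := Finset.HasAntidiagonal.mem_antidiagonal.1 hx
  have h2 := Finset.HasAntidiagonal.mem_antidiagonal.1 hy
  have h3 : (fun z => g z * ((((a z - 2 * φ' z : ℝ)) : ℂ) ^ y.2 / (y.2.factorial : ℂ))) =
      fun z => ∑ j ∈ Finset.range (y.2 + 1),
        (-2) ^ j / (((y.2 - j).factorial * j.factorial : ℕ) : ℂ) *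
          ((g z * (a z : ℂ) ^ (y.2 - j)) * (φ' z : ℂ) ^ j) := by
    funext z
    push_cast
    rw [pow_div_factorial_sub, Finset.mul_sum]
    refine Finset.sum_congr rfl fun j _ => ?_
    push_cast
    ring
  have hsm : ∀ j, ContDiff ℝ ∞ (fun z => (g z * (a z : ℂ) ^ (y.2 - j)) * (φ' z : ℂ) ^ j) := fun j =>
    (hg.mul ((Complex.ofRealCLM.contDiff.comp ha).pow _)).mul
      ((Complex.ofRealCLM.contDiff.comp hφ').pow _)
  rw [h3, coefInt_sum hm I J K (by omega) _ _ (fun j _ => hsm j)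
    (fun j _ => hgs.mul_right.mul_right), Finset.mul_sum]
  symm
  refine (Finset.sum_congr rfl fun j hj => ?_).trans
    (Finset.sum_subset (Finset.range_subset_range.2 (by omega)) fun j _ hj => ?_)
  · rw [if_pos (by simpa [Nat.lt_succ_iff] using hj), ← mul_assoc]
    congr 2
    funext z
    by_cases hz : g z = 0
    · simp [hz]
    · rw [hφ z hz]; push_cast; rfl
  · rw [if_neg (by simpa [Nat.lt_succ_iff] using hj)]

end LocalExpansion

end DivInt
end

noncomputable section
namespace DivInt

/-! ### The contribution of one chart -/

set_option linter.unusedSectionVars false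

section ChartContribution

variable {d : ℕ} {X : Type*} [TopologicalSpace X] [ChartedSpace (Cd d) X]
  [IsManifold 𝓘(ℂ, Cd d) ω X] {L : X → Type*} [TopologicalSpace (TotalSpace ℂ L)]
  [∀ x, AddCommGroup (L x)] [∀ x, Module ℂ (L x)] [∀ x, TopologicalSpace (L x)]
  [FiberBundle ℂ L] [VectorBundle ℂ ℂ L] [ContMDiffVectorBundle ω ℂ L 𝓘(ℂ, Cd d)]
  {h₀ : LineMetric d L} {s : ∀ x : X, L x} {D : Set X} {Ω : FormField d X (2 * d)}
  {e : OpenPartialHomeomorph X (Cd d)} {m : ℕ} {I J K : Fin d → ℕ} {a : Cd d → ℝ} {G : Cd d → ℂ}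

theorem slice_zero_eq (d : ℕ) (w : Cd d) : slice d 0 w = w := by
  funext j; simp [slice]

/-- Off the coordinate hyperplanes the integrand is the kernel times a smooth function. -/
theorem IsLocalDatum.sliceCoeff_eq_ker (hd : IsLocalDatum h₀ s D Ω e m I J K a G) {h : LineMetric d L}
    {φ : X → ℝ} (hφ : ∀ x v, h.nrm x v = h₀.nrm x v * Real.exp (-φ x)) (ρ : X → ℝ) (t : ℂ)
    {w : Cd d} (hw : w ∈ e.target) (hw0 : ∀ j, w j ≠ 0) :
    sliceCoeff e 0 (fun x => ((ρ x : ℂ) * (h.nrm x (s x) : ℂ) ^ (2 * t)) • Ω x) w =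
      ker I (fun j => (J j : ℤ)) (fun j => (K j : ℤ)) t w *
        ((ρ (e.symm w) : ℂ) * G w * Complex.exp (t * (a w - 2 * φ (e.symm w) : ℝ))) := by
  have hwD : e.symm w ∉ D := by
    rw [hd.mem_iff _ (e.map_target hw), e.right_inv hw]
    rintro ⟨j, -, hj⟩
    exact hw0 j hj
  have h1 := sliceCoeff_smul (e := e) (c := 0)
    (fun x => (ρ x : ℂ) * (h.nrm x (s x) : ℂ) ^ (2 * t)) Ω w
  rw [slice_zero_eq] at h1
  refine h1.trans ?_
  rw [hd.coeff_eq w hw hwD, hφ, hd.nrm_eq w hw, mul_assoc (∏ j, ‖w j‖ ^ I j), ← Real.exp_add,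
    show a w / 2 + -φ (e.symm w) = (a w - 2 * φ (e.symm w)) / 2 by ring,
    cpow_monomial_mul_exp I hw0, ker_eq t hw0, mono_natCast]
  ring

/-- Off the other branches, the open stratum of index `r` is a coordinate plane. -/
theorem IsLocalDatum.mem_stratum_iff_offSet (hd : IsLocalDatum h₀ s D Ω e m I J K a G) {r : ℕ}
    (hr : r ≤ m) (σ : Equiv.Perm (Fin d)) (hσ : ∀ k : Fin d, (k : ℕ) < r → (σ k : ℕ) < m) :
    ∀ y ∈ e.source, e y ∈ offSet σ r m →
      (y ∈ stratum (d := d) D r \ stratum (d := d) D (r + 1) ↔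
        ∀ k : Fin d, (k : ℕ) < r → e y (σ k) = 0) :=
  mem_stratum_diff_iff hd.chart hd.mem_iff (hr.trans hd.exponents.le) hσ

/-- The expansion of the part of the integral which is cut out by `ρ`. Its coefficients are integrals of
differential operators in `φ`, both over `X` and over the strata; those of the top degree in `φ` are
integrals over the deepest stratum of the chart. -/
theorem IsLocalDatum.exists_expansion (hd : IsLocalDatum h₀ s D Ω e m I J K a G) {ρ : X → ℝ}
    {r₀ : Cd d → ℝ} (hr₀ : ContDiff ℝ ∞ r₀) (hr₀s : HasCompactSupport r₀)
    (hr₀t : tsupport r₀ ⊆ e.target) (hr₀e : ∀ z ∈ e.target, r₀ z = ρ (e.symm z)) :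
    ∃ (Λ : ℕ → ℕ → (X → ℝ) → ℂ) (R : ℝ),
      (∀ r j, IsIntegralOperator (d := d) (univ : Set X) 0 (Λ r j)) ∧
      (∀ r j, IsIntegralOperator (d := d) (stratum (d := d) D r \ stratum (d := d) D (r + 1)) r (Λ r j)) ∧
      (∀ r j, m < r + j → ∀ f, Λ r j f = 0) ∧
      (∀ r j, r + j = m → ∀ f, SmoothFn (d := d) f → Λ r j f = (-2) ^ j / (j.factorial : ℂ) *
        ((Real.pi : ℂ) ^ m / ((∏ j ∈ Finset.univ.filter (fun j : Fin d => (j : ℕ) < m), (I j : ℂ)) *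
          ∏ j, (((J j - 1).factorial * (K j - 1).factorial : ℕ) : ℂ))) *
        ∫ w, dzMulti (fun j => J j - 1) (fun j => K j - 1)
          (fun z => (r₀ z • G z) * (f (e.symm z) : ℂ)) (slice d m w)) ∧
      ∀ (h : LineMetric d L) (φ : X → ℝ), SmoothFn (d := d) φ →
        (∀ x v, h.nrm x v = h₀.nrm x v * Real.exp (-φ x)) →
        ∃ F : ℂ → ℂ, Meromorphic F ∧
          (∀ t : ℂ, R < t.re → IntegrableOn
              (sliceCoeff e 0 (fun x => ((ρ x : ℂ) * (h.nrm x (s x) : ℂ) ^ (2 * t)) • Ω x))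
              (slice d 0 ⁻¹' e.target) ∧
            F t = ∫ w in slice d 0 ⁻¹' e.target,
              sliceCoeff e 0 (fun x => ((ρ x : ℂ) * (h.nrm x (s x) : ℂ) ^ (2 * t)) • Ω x) w) ∧
          ∀ κ, m ≤ κ → (fun z : ℂ => F z - ∑ r ∈ Finset.range (κ + 1),
            (∑ j ∈ Finset.range (κ - r + 1), Λ r j (fun x => φ x ^ j)) * z ^ (-(r : ℤ)))
              =O[𝓝[≠] 0] fun z : ℂ => z := by
  obtain ⟨γ, R, hγ, hAdm, hexp⟩ := exists_local_expansion hd.exponents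
  have hm := hd.exponents.le
  obtain ⟨a', ha', haa'⟩ := exists_contDiff_eventuallyEq hr₀s.isCompact e.open_target hr₀t hd.smooth_log
  set g : Cd d → ℂ := fun z => r₀ z • G z with hg
  have hgsm : ContDiff ℝ ∞ g := contDiff_smul_of_tsupport_subset e.open_target hr₀ hd.smooth_coeff hr₀t
  have hgsub : tsupport g ⊆ tsupport r₀ := closure_mono fun z hz => by
    intro h0
    exact hz (by simp only [hg, h0, zero_smul])
  have hgs : HasCompactSupport g := hr₀s.of_isClosed_subset (isClosed_tsupport _) hgsub
  have hgt := hgsub.trans hr₀t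
  have hgmem : ∀ z, g z ≠ 0 → z ∈ tsupport r₀ := fun z hz => hgsub (subset_tsupport _ hz)
  refine ⟨localCoeff m I J K γ g a' e, R, fun r j => ?_, fun r j => ?_, fun r j h f =>
    localCoeff_eq_zero γ g h f, fun r j h f hf => ?_, fun h φ hφs hφ => ?_⟩
  · refine isIntegralOperator_localCoeff hd.chart hm γ hgsm hgs hgt ha' (Nat.zero_le r) j ?_
    intro _ σ _ y _ _
    simp
  · exact isIntegralOperator_localCoeff hd.chart hm γ hgsm hgs hgt ha' le_rfl j
      hd.mem_stratum_iff_offSet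
  · rw [localCoeff_top γ g h f, coefInt_zero hm I J K (contDiff_mul_comp_symm hd.chart hgsm hgt hf)
      (hgs.of_isClosed_subset (isClosed_tsupport _) tsupport_mul_subset_left)]
    -- the sign `(-1)^m` of the `m` integrations by parts cancels that of the Cauchy–Pompeiu formula
    have hB : ∀ A B : ℂ, γ 0 * ((-1) ^ m * A * B) = 1 →
        γ 0 * (-(Real.pi : ℂ)) ^ m = (Real.pi : ℂ) ^ m / (A * B) := by
      intro A B hAB
      have hne : A * B ≠ 0 := by
        intro h0
        rw [mul_assoc ((-1) ^ m : ℂ), h0] at hAB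
        simp at hAB
      rw [eq_div_iff hne, neg_pow]
      linear_combination (Real.pi : ℂ) ^ m * hAB
    rw [← hB _ _ hγ]
    ring
  · obtain ⟨φ', hφ', hφφ'⟩ := exists_contDiff_eventuallyEq hr₀s.isCompact e.open_target hr₀t
      (SmoothFn.contDiffOn_symm hd.chart hφs)
    obtain ⟨F, H, hF, hFt, hFH, hH⟩ := hexp g (fun z => a' z - 2 * φ' z) hgsm hgs
      (ha'.sub (contDiff_const.mul hφ'))
    have hker : ∀ t : ℂ, ∀ w : Cd d, (∀ j, w j ≠ 0) → w ∈ e.target →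
        ker I (fun j => (J j : ℤ)) (fun j => (K j : ℤ)) t w *
          (g w * Complex.exp (t * (a' w - 2 * φ' w : ℝ))) =
        sliceCoeff e 0 (fun x => ((ρ x : ℂ) * (h.nrm x (s x) : ℂ) ^ (2 * t)) • Ω x) w := by
      intro t w hw0 hw
      rw [hd.sliceCoeff_eq_ker hφ ρ t hw hw0]
      congr 1
      have h1 : g w = (ρ (e.symm w) : ℂ) * G w := by
        simp only [hg, hr₀e w hw, Complex.real_smul]
      by_cases hgw : g w = 0
      · rw [← h1, hgw, zero_mul, zero_mul]
      · rw [← h1, (haa' w (hgmem w hgw)).eq_of_nhds, (hφφ' w (hgmem w hgw)).eq_of_nhds]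
        rfl
    have hmeas : MeasurableSet e.target := e.open_target.measurableSet
    have hpre : slice d 0 ⁻¹' e.target = e.target := by
      ext w; rw [mem_preimage]; exact Iff.of_eq (congrArg (· ∈ e.target) (slice_zero_eq d w))
    refine ⟨F, hF, fun t ht => ?_, fun κ hκ => ?_⟩
    · have hint : Integrable (fun w => ker I (fun j => (J j : ℤ)) (fun j => (K j : ℤ)) t w *
          (g w * Complex.exp (t * (a' w - 2 * φ' w : ℝ)))) := by
        refine (hAdm t ht).integrable ?_ hgs.mul_right
        refine hgsm.continuous.mul (Complex.continuous_exp.comp (continuous_const.mul ?_))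
        exact Complex.continuous_ofReal.comp (ha'.sub (contDiff_const.mul hφ')).continuous
      have hae : ∀ᵐ w : Cd d, w ∈ e.target →
          ker I (fun j => (J j : ℤ)) (fun j => (K j : ℤ)) t w *
            (g w * Complex.exp (t * (a' w - 2 * φ' w : ℝ))) =
          sliceCoeff e 0 (fun x => ((ρ x : ℂ) * (h.nrm x (s x) : ℂ) ^ (2 * t)) • Ω x) w := by
        filter_upwards [ae_ne_zero] with w hw0 hw using hker t w hw0 hw
      rw [hpre]
      refine ⟨(integrableOn_congr_fun_ae ((ae_restrict_iff' hmeas).2 hae)).1 hint.integrableOn, ?_⟩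
      rw [hFt t ht]
      refine Eq.trans ?_ (setIntegral_congr_ae hmeas hae)
      refine (setIntegral_eq_integral_of_forall_compl_eq_zero fun w hw => ?_).symm
      rw [image_eq_zero_of_notMem_tsupport fun h' => hw (hgt h'), zero_mul, mul_zero]
    · have h1 := isBigO_laurent hκ hFH hH
      refine h1.congr_left fun z => ?_
      congr 1
      refine Finset.sum_congr rfl fun r hr => ?_
      have hr' : r ≤ κ := by simpa [Nat.lt_succ_iff] using hr
      rw [sum_localCoeff hm γ hgsm hgs ha' hφ' (fun z hz => (hφφ' z (hgmem z hz)).eq_of_nhds) hr' hκ]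

end ChartContribution

end DivInt
end

noncomputable section
namespace DivInt

/-! ### The residue on the deepest stratum -/

set_option linter.unusedSectionVars false

section ResidueIntegral

variable {d : ℕ} {X : Type*} [TopologicalSpace X] [ChartedSpace (Cd d) X]
  [IsManifold 𝓘(ℂ, Cd d) ω X] {L : X → Type*} [TopologicalSpace (TotalSpace ℂ L)]
  [∀ x, AddCommGroup (L x)] [∀ x, Module ℂ (L x)] [∀ x, TopologicalSpace (L x)]
  [FiberBundle ℂ L] [VectorBundle ℂ ℂ L] [ContMDiffVectorBundle ω ℂ L 𝓘(ℂ, Cd d)]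
  {h₀ : LineMetric d L} {s : ∀ x : X, L x} {D : Set X} {Ω : FormField d X (2 * d)} {κ : ℕ}

theorem IsLocalDatum.isSliceChart {e : OpenPartialHomeomorph X (Cd d)} {I J K : Fin d → ℕ}
    {a : Cd d → ℝ} {G : Cd d → ℂ} (hd : IsLocalDatum h₀ s D Ω e κ I J K a G) :
    IsSliceChart (stratum (d := d) D κ) κ e :=
  ⟨hd.chart, hd.exponents.le, fun y hy => (mem_stratum_iff hd.chart hd.mem_iff κ y hy).trans
    (le_card_vanSet_iff hd.exponents.le _)⟩

/-- The integral of the residue in charts with `κ` branches which cover the deepest stratum. The factors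
`-2i` turn `dz_j ∧ dz̄_j` into Lebesgue measure. -/
theorem hasResidueIntegral_of_charts
    (hs : ContMDiff 𝓘(ℂ, Cd d) (𝓘(ℂ, Cd d).prod 𝓘(ℂ, ℂ)) ω
      (fun x => (⟨x, s x⟩ : TotalSpace ℂ L)))
    (hDs : ∀ x, x ∈ D ↔ s x = 0) (hD : IsNormalCrossing (d := d) D)
    {n : ℕ} {e : Fin n → OpenPartialHomeomorph X (Cd d)} {I J K : Fin n → Fin d → ℕ}
    {a : Fin n → Cd d → ℝ} {G : Fin n → Cd d → ℂ}
    (hd : ∀ i, IsLocalDatum h₀ s D Ω (e i) κ (I i) (J i) (K i) (a i) (G i))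
    {ρ : Fin n → X → ℝ} (hρ : ∀ i, SmoothFn (d := d) (ρ i)) (hρe : ∀ i, tsupport (ρ i) ⊆ (e i).source)
    {r₀ : Fin n → Cd d → ℝ} (hr₀ : ∀ i, ContDiff ℝ ∞ (r₀ i)) (hr₀s : ∀ i, HasCompactSupport (r₀ i))
    (hr₀t : ∀ i, tsupport (r₀ i) ⊆ (e i).target)
    (hr₀e : ∀ i, ∀ z ∈ (e i).target, r₀ i z = ρ i ((e i).symm z))
    (hcov : ∀ x ∈ stratum (d := d) D κ, ∃ i, x ∈ (e i).source)
    (hsum : ∀ᶠ x in 𝓝ˢ (stratum (d := d) D κ), ∑ i, ρ i x = 1)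
    {f : X → ℝ} (hf : SmoothFn (d := d) f) :
    HasResidueIntegral s D κ (fun x => (f x : ℂ) • Ω x)
      (∑ i, ((-2 * Complex.I) ^ κ * ((∏ j ∈ Finset.univ.filter (fun j : Fin d => (j : ℕ) < κ),
          (I i j : ℂ)) * ∏ j, (((J i j - 1).factorial * (K i j - 1).factorial : ℕ) : ℂ)))⁻¹ *
        ∫ w, dzMulti (fun j => J i j - 1) (fun j => K i j - 1)
          (fun z => (r₀ i z • G i z) * (f ((e i).symm z) : ℂ)) (slice d κ w)) := by
  classical
  have hI2 : (-2 * Complex.I) ^ κ ≠ 0 := pow_ne_zero _ (by simp)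
  have hsl := fun i => (hd i).isSliceChart
  set oi : Fin n → ℕ := fun i =>
    ∏ j ∈ Finset.univ.filter (fun j : Fin d => (j : ℕ) < κ), I i j with hoi
  set fac : Fin n → ℂ := fun i =>
    ∏ j, (((J i j - 1).factorial * (K i j - 1).factorial : ℕ) : ℂ) with hfac
  -- well defined on the stratum because the product of the exponents does not depend on the chart
  set o : X → ℕ := fun x => if h : ∃ i, x ∈ (e i).source then oi h.choose else 0 with ho
  have hzero : ∀ i, ∀ x ∈ stratum (d := d) D κ, x ∈ (e i).source →
      ∀ j : Fin d, (j : ℕ) < κ → e i x j = 0 := fun i x hx hxe => ((hsl i).2.2 x hxe).1 hx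
  have hoeq : ∀ i, ∀ x ∈ stratum (d := d) D κ, x ∈ (e i).source → o x = oi i := by
    intro i x hx hxe
    have hex : ∃ i, x ∈ (e i).source := ⟨i, hxe⟩
    have h1 : o x = oi hex.choose := dif_pos hex
    obtain ⟨y, hy⟩ := (hd i).factored
    obtain ⟨y', hy'⟩ := (hd hex.choose).factored
    rw [h1]
    exact hy'.prod_eq hs hDs hD (hd i).exponents.le hy hex.choose_spec hxe
      (hzero _ x hx hex.choose_spec) (hzero i x hx hxe)
  set ψ : Fin n → Cd d → ℂ := fun i z =>
    ((-2 * Complex.I) ^ κ)⁻¹ * (G i z * (f ((e i).symm z) : ℂ)) with hψ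
  set H : Fin n → Cd d → ℂ := fun i z => (r₀ i z • G i z) * (f ((e i).symm z) : ℂ) with hH
  set W : Fin n → (Cd d → ℂ) → Cd d → ℂ :=
    fun i => dzMulti (fun j => J i j - 1) (fun j => K i j - 1) with hW
  have hWw : ∀ i, IsWord (W i) := fun i => isWord_dzMulti _ _
  set coef : ∀ i, Cd (d - κ) → ℂ := fun i w =>
    W i (fun z => (ρ i ((e i).symm z) : ℂ) * ψ i z) (slice d κ w) / fac i with hcoef
  set θ : Fin n → FormField d X (2 * (d - κ)) := fun i =>
    mkForm (e i) κ (e i).source (coef i) with hθ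
  have hθc : ∀ i w, slice d κ w ∈ (e i).target → sliceCoeff (e i) κ (θ i) w = coef i w :=
    fun i w hw => sliceCoeff_mkForm (hd i).chart _ hw ((e i).map_target hw)
  have hθ0 : ∀ i, ∀ x ∉ (e i).source, θ i x = 0 := fun i x hx => mkForm_of_notMem _ hx
  have hgs : ∀ i, ContDiff ℝ ∞ (fun z => r₀ i z • G i z) := fun i =>
    contDiff_smul_of_tsupport_subset (e i).open_target (hr₀ i) (hd i).smooth_coeff (hr₀t i)
  have hgsub : ∀ i, tsupport (fun z => r₀ i z • G i z) ⊆ tsupport (r₀ i) := fun i =>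
    closure_mono fun z hz h0 => hz (by simp only [h0, zero_smul])
  have hHs : ∀ i, ContDiff ℝ ∞ (H i) := fun i =>
    contDiff_mul_comp_symm (hd i).chart (hgs i) ((hgsub i).trans (hr₀t i)) hf
  have hHsub : ∀ i, tsupport (H i) ⊆ tsupport (r₀ i) := fun i =>
    (tsupport_mul_subset_left).trans (hgsub i)
  have hHc : ∀ i, HasCompactSupport (H i) := fun i =>
    (hr₀s i).of_isClosed_subset (isClosed_tsupport _) (hHsub i)
  have hcoefH : ∀ i w, slice d κ w ∈ (e i).target →
      coef i w = ((-2 * Complex.I) ^ κ * fac i)⁻¹ * W i (H i) (slice d κ w) := by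
    intro i w hw
    have h1 : (fun z => (ρ i ((e i).symm z) : ℂ) * ψ i z) =ᶠ[𝓝 (slice d κ w)]
        fun z => ((-2 * Complex.I) ^ κ)⁻¹ * H i z := by
      filter_upwards [(e i).open_target.mem_nhds hw] with z hz
      simp only [hψ, hH, hr₀e i z hz, Complex.real_smul]
      ring
    simp only [hcoef]
    rw [((hWw i).congr h1).eq_of_nhds, (hWw i).const_mul _ (hHs i), mul_inv]
    ring
  have hWH0 : ∀ i w, slice d κ w ∉ (e i).target → W i (H i) (slice d κ w) = 0 := fun i w hw =>
    image_eq_zero_of_notMem_tsupport fun h =>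
      hw (hr₀t i (hHsub i ((hWw i).tsupport_subset _ h)))
  have hmeas : ∀ i, MeasurableSet (slice d κ ⁻¹' (e i).target) := fun i =>
    ((e i).open_target.preimage (continuous_slice d κ)).measurableSet
  have hWint : ∀ i, Integrable (fun w => W i (H i) (slice d κ w)) := fun i =>
    (((hWw i).contDiff (hHs i)).continuous.comp (continuous_slice d κ)).integrable_of_hasCompactSupport
      (hasCompactSupport_comp_permSlice ((hWw i).hasCompactSupport (hHc i)) (Equiv.refl _))
  have hval : ∀ i, EqOn (sliceCoeff (e i) κ (fun x => ((o x : ℂ))⁻¹ • θ i x))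
      (fun w => ((-2 * Complex.I) ^ κ * ((oi i : ℂ) * fac i))⁻¹ * W i (H i) (slice d κ w))
      (slice d κ ⁻¹' (e i).target) := by
    intro i w hw
    have h1 := sliceCoeff_smul (e := e i) (fun x => ((o x : ℂ))⁻¹) (θ i) w
    refine h1.trans ?_
    rw [hθc i w hw, hcoefH i w hw,
      hoeq i _ ((hsl i).mem_of_slice hw) ((e i).map_target hw), mul_inv, mul_inv, mul_inv]
    ring
  refine ⟨o, fun x => ∑ i, θ i x, fun x hx => ?_, ?_, ?_⟩
  · obtain ⟨i, hi⟩ := hcov x hx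
    rw [hoeq i x hx hi]
    obtain ⟨y, hy⟩ := (hd i).factored
    exact hy.isOrderProduct hi (hzero i x hx hi)
  · refine ⟨n, e, ρ, J, K, ψ, θ, fun i => ⟨(hd i).chart, (hd i).mem_iff, hρ i, hρe i,
      fun j hj => ((hd i).exponents.pos j hj).2, fun j hj => ((hd i).exponents.zero j hj).2, ?_, ?_,
      hθ0 i, hθc i⟩, hsum, fun x _ => rfl⟩
    · exact contDiffOn_const.mul ((hd i).smooth_coeff.mul
        (Complex.ofRealCLM.contDiff.comp_contDiffOn (SmoothFn.contDiffOn_symm (hd i).chart hf)))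
    · intro w hw hwD
      have h1 := sliceCoeff_smul (e := e i) (c := 0) (fun x => (f x : ℂ)) Ω w
      rw [slice_zero_eq] at h1
      refine h1.trans ?_
      rw [(hd i).coeff_eq w hw hwD, hψ]
      simp only [← mul_assoc, mul_inv_cancel₀ hI2, one_mul]
      ring
  · have h1 := hasIntegralOver_sum (S := stratum (d := d) D κ) (c := κ) (e := e) hsl hcov
      (θ := fun i x => ((o x : ℂ))⁻¹ • θ i x) (η := fun x => ((o x : ℂ))⁻¹ • ∑ i, θ i x)
      (fun i x _ hx => by simp only [hθ0 i x hx, smul_zero]) (fun x _ => Finset.smul_sum)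
      (fun i => (((hWint i).const_mul _).integrableOn).congr_fun (hval i).symm (hmeas i))
    convert! h1 using 1
    refine Finset.sum_congr rfl fun i _ => ?_
    rw [setIntegral_congr_fun (hmeas i) (hval i), setIntegral_eq_integral_of_forall_compl_eq_zero
      fun w hw => by rw [hWH0 i w hw, mul_zero], integral_const_mul]
    simp only [hoi, Nat.cast_prod]
    rfl

end ResidueIntegral

end DivInt
end

noncomputable section
namespace DivInt

/-! ### Globalisation -/

set_option linter.unusedSectionVars false

section Globalisation

variable {d : ℕ} {X : Type*} [TopologicalSpace X] [ChartedSpace (Cd d) X]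
  [IsManifold 𝓘(ℂ, Cd d) ω X] {S : Set X} {c : ℕ}

theorem exists_finite_partition [T2Space X] [CompactSpace X] {U : X → Set X}
    (hU : ∀ x, IsOpen (U x)) (hxU : ∀ x, x ∈ U x) :
    ∃ (n : ℕ) (p : Fin n → X) (ρ : Fin n → X → ℝ), (∀ i, SmoothFn (d := d) (ρ i)) ∧
      (∀ i, tsupport (ρ i) ⊆ U (p i)) ∧ ∀ x, ∑ i, ρ i x = 1 := by
  obtain ⟨t, -, ht⟩ := isCompact_univ.elim_nhds_subcover U fun x _ => (hU x).mem_nhds (hxU x)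
  set p : Fin (Fintype.card t) → X := fun i => ((Fintype.equivFin t).symm i : X) with hp
  obtain ⟨f, hf⟩ := SmoothPartitionOfUnity.exists_isSubordinate 𝓘(ℝ, Cd d) (isClosed_univ (X := X))
    (fun i => U (p i)) (fun i => hU _) (fun x _ => by
      obtain ⟨y, hy, hxy⟩ := mem_iUnion₂.1 (ht (mem_univ x))
      exact mem_iUnion.2 ⟨Fintype.equivFin t ⟨y, hy⟩, by simpa [hp] using hxy⟩)
  refine ⟨_, p, fun i => f i, fun i => (f i).contMDiff, hf, fun x => ?_⟩
  rw [← finsum_eq_sum_of_fintype]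
  exact f.sum_eq_one (mem_univ x)

theorem HolChart.isSliceChart_univ {e : OpenPartialHomeomorph X (Cd d)} (he : HolChart e) :
    IsSliceChart (univ : Set X) 0 e :=
  ⟨he, Nat.zero_le d, fun y _ => by simp⟩

theorem SmoothFn.pow {f : X → ℝ} (hf : SmoothFn (d := d) f) (j : ℕ) :
    SmoothFn (d := d) (fun x => f x ^ j) :=
  (contDiff_id.pow j).contMDiff.comp hf

/-- On the open stratum of index `r`, which is covered by the charts obtained from normal crossings
charts by permutation of the coordinates, an integral operator comes from one differential operator. -/
theorem exists_diffOp_stratum {D : Set X} {n : ℕ} {e : Fin n → OpenPartialHomeomorph X (Cd d)}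
    {m : Fin n → ℕ} (he : ∀ i, HolChart (e i)) (hm : ∀ i, m i ≤ d)
    (hD : ∀ i, ∀ y ∈ (e i).source, y ∈ D ↔ ∃ j : Fin d, (j : ℕ) < m i ∧ e i y j = 0)
    (hcov : ∀ x, ∃ i, x ∈ (e i).source) {r : ℕ} {Λ : (X → ℝ) → ℂ}
    (hΛ : IsIntegralOperator (d := d) (stratum (d := d) D r \ stratum (d := d) D (r + 1)) r Λ) :
    ∃ P : (X → ℝ) → FormField d X (2 * (d - r)),
      IsDiffOp (stratum (d := d) D r \ stratum (d := d) D (r + 1)) r P ∧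
      ∀ f : X → ℝ, SmoothFn (d := d) f →
        HasIntegralOver (stratum (d := d) D r \ stratum (d := d) D (r + 1)) r (P f) (Λ f) := by
  refine hΛ.exists_diffOp (κ := {p : Fin n × Equiv.Perm (Fin d) //
      r ≤ m p.1 ∧ ∀ k : Fin d, (k : ℕ) < r → (p.2 k : ℕ) < m p.1})
    (e' := fun p => permChart (e p.1.1) p.1.2 r (m p.1.1)) (fun p => ?_) fun x hx => ?_
  · have hr := p.2.1.trans (hm p.1.1)
    exact isSliceChart_permChart_of (he _) hr (mem_stratum_diff_iff (he _) (hD _) hr p.2.2)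
  · obtain ⟨i, hi⟩ := hcov x
    rw [Set.mem_sdiff, mem_stratum_iff (he i) (hD i) r x hi,
      mem_stratum_iff (he i) (hD i) (r + 1) x hi] at hx
    have hcard : (vanSet (m i) (e i x)).card = r := by omega
    obtain ⟨σ, hσ⟩ := exists_perm_of_finset (vanSet (m i) (e i x))
    have hoff := mem_offSet_of_vanSet hσ
    rw [hcard] at hσ hoff
    exact ⟨⟨(i, σ), hcard ▸ card_vanSet_le _ _, fun k hk => (mem_vanSet.1 ((hσ k).1 hk)).1⟩,
      mem_permChart_source.2 ⟨hi, hoff⟩⟩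

theorem sum_eq_sum_fin_of_eq_zero {n : ℕ} {p : Fin n → Prop} [DecidablePred p] {M : Type*}
    [AddCommMonoid M] (f : Fin (Fintype.card {i // p i}) ≃ {i // p i}) (g : Fin n → M)
    (hg : ∀ i, ¬ p i → g i = 0) : ∑ i, g i = ∑ k, g (f k) := by
  rw [f.sum_comp (fun i => g i), ← Finset.sum_subtype (Finset.univ.filter p) (by simp) g]
  exact (Finset.sum_subset (Finset.subset_univ _) fun i _ hi => hg i (by simpa using hi)).symm

end Globalisation

end DivInt
end

theorem theorem4p1 {d : ℕ} {X : Type*} [TopologicalSpace X] [T2Space X] [CompactSpace X]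
    [ChartedSpace (DivInt.Cd d) X] [IsManifold 𝓘(ℂ, DivInt.Cd d) ω X]
    {L : X → Type*} [TopologicalSpace (TotalSpace ℂ L)]
    [∀ x, AddCommGroup (L x)] [∀ x, Module ℂ (L x)] [∀ x, TopologicalSpace (L x)]
    [FiberBundle ℂ L] [VectorBundle ℂ ℂ L] [ContMDiffVectorBundle ω ℂ L 𝓘(ℂ, DivInt.Cd d)]
    (s : ∀ x : X, L x)
    (hs : ContMDiff 𝓘(ℂ, DivInt.Cd d) (𝓘(ℂ, DivInt.Cd d).prod 𝓘(ℂ, ℂ)) ω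
      (fun x => (⟨x, s x⟩ : TotalSpace ℂ L)))
    (D : Set X) (hDs : ∀ x, x ∈ D ↔ s x = 0)
    (hD : DivInt.IsNormalCrossing (d := d) D)
    {k l : ℕ} (hkl : k + l = 2 * d)
    (α : DivInt.FormField d X k) (β : DivInt.FormField d X l)
    (hα : DivInt.IsSemiMeromorphic D α) (hβ : DivInt.IsSemiMeromorphic D β)
    (κ : ℕ) (hκ : IsGreatest {r : ℕ | (DivInt.stratum (d := d) D r).Nonempty} κ)
    (h₀ : DivInt.LineMetric d L) :
    ∃ (Q : ℕ → ℕ → (X → ℝ) → DivInt.FormField d X (2 * (d - 0)))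
      (P : (r : ℕ) → ℕ → (X → ℝ) → DivInt.FormField d X (2 * (d - r))),
      (∀ r ≤ κ, ∀ j ≤ κ - r, DivInt.IsDiffOp (univ : Set X) 0 (Q r j) ∧
        DivInt.IsDiffOp (DivInt.stratum (d := d) D r \ DivInt.stratum (d := d) D (r + 1)) r
          (P r j)) ∧
      ∀ (h : DivInt.LineMetric d L) (φ : X → ℝ),
        (∀ x v, h.nrm x v = h₀.nrm x v * Real.exp (-φ x)) →
        ∃ C : ℕ → ℂ,
          DivInt.HasLaurentCoeffs h s (DivInt.wedgeTop hkl α (DivInt.conjForm β)) κ C ∧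
          ∀ r ≤ κ,
            (∃ q : ℕ → ℂ,
              (∀ j ≤ κ - r,
                DivInt.HasIntegralOver (univ : Set X) 0 (Q r j (fun x => φ x ^ j)) (q j)) ∧
              C r = ∑ j ∈ Finset.range (κ - r + 1), q j ∧
              ∃ R : ℂ,
                DivInt.HasResidueIntegral s D κ
                  (fun x => ((φ x ^ (κ - r) : ℝ) : ℂ) •
                    DivInt.wedgeTop hkl α (DivInt.conjForm β) x) R ∧
                q (κ - r) = (-2 * Real.pi * Complex.I) ^ κ * (-2) ^ (κ - r) /
                  ((κ - r).factorial : ℂ) * R) ∧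
            ∃ p : ℕ → ℂ,
              (∀ j ≤ κ - r,
                DivInt.HasIntegralOver
                  (DivInt.stratum (d := d) D r \ DivInt.stratum (d := d) D (r + 1)) r
                  (P r j (fun x => φ x ^ j)) (p j)) ∧
              C r = ∑ j ∈ Finset.range (κ - r + 1), p j := by
  classical
  set Ω := DivInt.wedgeTop hkl α (DivInt.conjForm β) with hΩ
  choose e m I J K a G hx hd using DivInt.exists_localDatum hs hDs hD hkl hα hβ h₀
  obtain ⟨n, c, ρ, hρ, hρe, hρsum⟩ := DivInt.exists_finite_partition (d := d)
    (fun x => (e x).open_source) hx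
  choose r₀ hr₀ hr₀s hr₀t hr₀e using fun i =>
    DivInt.exists_localized (hd (c i)).chart (hρ i) (hρe i)
  choose Λ R hΛu hΛs hΛ0 hΛtop hΛexp using fun i =>
    (hd (c i)).exists_expansion (hr₀ i) (hr₀s i) (hr₀t i) (hr₀e i)
  have hcov : ∀ x, ∃ i, x ∈ (e (c i)).source := by
    intro x
    by_contra hne
    push Not at hne
    have h1 : ∑ i, ρ i x = 0 := Finset.sum_eq_zero fun i _ =>
      image_eq_zero_of_notMem_tsupport fun h => hne i (hρe i h)
    rw [hρsum x] at h1
    exact one_ne_zero h1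
  have hmκ : ∀ i, m (c i) ≤ κ := fun i => (hd (c i)).card_le hκ
  -- the part of degree `j` in the coefficient of `λ^{-r}`, summed over the charts; it has a density both
  -- on `X` and on the open stratum of index `r`
  set Λt : ℕ → ℕ → (X → ℝ) → ℂ := fun r j f => ∑ i, Λ i r j f with hΛt
  have hQ : ∀ r j, ∃ Q, DivInt.IsDiffOp (univ : Set X) 0 Q ∧ ∀ f : X → ℝ,
      DivInt.SmoothFn (d := d) f → DivInt.HasIntegralOver univ 0 (Q f) (Λt r j f) := fun r j =>
    (DivInt.IsIntegralOperator.sum Finset.univ fun i _ => hΛu i r j).exists_diffOp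
      (fun i => (hd (c i)).chart.isSliceChart_univ) fun x _ => hcov x
  have hP : ∀ r j, ∃ P, DivInt.IsDiffOp
      (DivInt.stratum (d := d) D r \ DivInt.stratum (d := d) D (r + 1)) r P ∧ ∀ f : X → ℝ,
      DivInt.SmoothFn (d := d) f → DivInt.HasIntegralOver
        (DivInt.stratum (d := d) D r \ DivInt.stratum (d := d) D (r + 1)) r (P f) (Λt r j f) :=
    fun r j => DivInt.exists_diffOp_stratum (fun i => (hd (c i)).chart)
      (fun i => (hd (c i)).exponents.le) (fun i => (hd (c i)).mem_iff) hcov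
      (DivInt.IsIntegralOperator.sum Finset.univ fun i _ => hΛs i r j)
  choose Q hQd hQi using hQ
  choose P hPd hPi using hP
  refine ⟨Q, P, fun r _ j _ => ⟨hQd r j, hPd r j⟩, fun h φ hφ => ?_⟩
  have hφs : DivInt.SmoothFn (d := d) φ := h.smoothFn_of_eq h₀ hφ
  choose F hF hFt hFO using fun i => hΛexp i h φ hφs hφ
  refine ⟨fun r => ∑ j ∈ Finset.range (κ - r + 1), Λt r j (fun x => φ x ^ j), ?_, fun r hr =>
    ⟨⟨fun j => Λt r j (fun x => φ x ^ j), fun j _ => hQi r j _ (DivInt.SmoothFn.pow hφs j), rfl, ?_⟩,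
      fun j => Λt r j (fun x => φ x ^ j), fun j _ => hPi r j _ (DivInt.SmoothFn.pow hφs j), rfl⟩⟩
  · refine ⟨fun z => ∑ i, F i z, ?_, ⟨∑ i, |R i|, fun z hz => ?_⟩, ?_⟩
    · exact fun x => MeromorphicAt.fun_sum fun i _ => hF i x
    · have hzR : ∀ i, R i < z.re := fun i => lt_of_le_of_lt
        ((le_abs_self _).trans (Finset.single_le_sum (f := fun i => |R i|)
          (fun i _ => abs_nonneg _) (Finset.mem_univ i))) hz
      have h1 := DivInt.hasIntegralOver_sum (S := (univ : Set X)) (c := 0) (e := fun i => e (c i))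
        (θ := fun i x => ((ρ i x : ℂ) * (h.nrm x (s x) : ℂ) ^ (2 * z)) • Ω x)
        (η := fun x => ((h.nrm x (s x) : ℂ) ^ (2 * z)) • Ω x)
        (fun i => (hd (c i)).chart.isSliceChart_univ) (fun x _ => hcov x) ?_ ?_
        (fun i => (hFt i z (hzR i)).1)
      · beta_reduce
        rw [Finset.sum_congr rfl fun i _ => (hFt i z (hzR i)).2]
        exact h1
      · intro i x _ hxi
        rw [image_eq_zero_of_notMem_tsupport fun h' => hxi (hρe i h'), Complex.ofReal_zero, zero_mul,
          zero_smul]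
      · intro x _
        rw [← Finset.sum_smul, ← Finset.sum_mul, ← Complex.ofReal_sum, hρsum, Complex.ofReal_one,
          one_mul]
    · refine (Asymptotics.IsBigO.fun_sum fun i (_ : i ∈ Finset.univ) =>
        hFO i κ (hmκ i)).congr_left fun z => ?_
      rw [Finset.sum_sub_distrib]
      congr 1
      rw [Finset.sum_comm]
      refine Finset.sum_congr rfl fun r _ => ?_
      rw [← Finset.sum_mul, Finset.sum_comm]
  · -- the term of top degree, in which charts with fewer than `κ` branches do not occur
    set f : X → ℝ := fun x => φ x ^ (κ - r) with hf
    have hfs : DivInt.SmoothFn (d := d) f := DivInt.SmoothFn.pow hφs (κ - r)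
    -- the charts which meet the deepest stratum
    set E := (Fintype.equivFin {i : Fin n // m (c i) = κ}).symm
    have hd' : ∀ k, DivInt.IsLocalDatum h₀ s D Ω (e (c (E k))) κ (I (c (E k))) (J (c (E k)))
        (K (c (E k))) (a (c (E k))) (G (c (E k))) := fun k => by
      have h1 := hd (c (E k))
      rwa [(E k).2] at h1
    have hsrc : ∀ i, ∀ x ∈ DivInt.stratum (d := d) D κ, x ∈ (e (c i)).source → m (c i) = κ := by
      intro i x hxD hxe
      have h1 := (DivInt.mem_stratum_iff (hd (c i)).chart (hd (c i)).mem_iff κ x hxe).1 hxD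
      exact le_antisymm (hmκ i) (h1.trans (DivInt.card_vanSet_le _ _))
    refine ⟨_, DivInt.hasResidueIntegral_of_charts hs hDs hD hd' (fun k => hρ (E k))
      (fun k => hρe (E k)) (fun k => hr₀ (E k)) (fun k => hr₀s (E k)) (fun k => hr₀t (E k))
      (fun k => hr₀e (E k)) (fun x hxD => ?_) ?_ hfs, ?_⟩
    · obtain ⟨i, hi⟩ := hcov x
      exact ⟨E.symm ⟨i, hsrc i x hxD hi⟩, by simpa using hi⟩
    · -- the other charts have supports which do not meet the stratum, so that the remaining weights add up
      -- to one near it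
      have hclosed : IsClosed (⋃ i : {i : Fin n // m (c i) ≠ κ}, tsupport (ρ i)) :=
        isClosed_iUnion_of_finite fun i => isClosed_tsupport _
      rw [eventually_nhdsSet_iff_exists]
      refine ⟨_, hclosed.isOpen_compl, fun x hxD hxU => ?_, fun x hx => ?_⟩
      · obtain ⟨i, hi⟩ := mem_iUnion.1 hxU
        exact i.2 (hsrc i x hxD (hρe i hi))
      · rw [← hρsum x]
        refine (DivInt.sum_eq_sum_fin_of_eq_zero E (fun i => ρ i x) fun i hi => ?_).symm
        exact image_eq_zero_of_notMem_tsupport fun h' => hx (mem_iUnion.2 ⟨⟨i, hi⟩, h'⟩)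
    · have h1 : Λt r (κ - r) f = ∑ k, Λ (E k) r (κ - r) f :=
        DivInt.sum_eq_sum_fin_of_eq_zero E (fun i => Λ i r (κ - r) f) fun i hi =>
          hΛ0 i r (κ - r) (by have := hmκ i; omega) f
      refine h1.trans ?_
      rw [Finset.mul_sum]
      refine Finset.sum_congr rfl fun k _ => ?_
      rw [hΛtop (E k) r (κ - r) (by rw [(E k).2]; omega) f hfs, (E k).2]
      -- the factors `(-2i)^κ` of the residue are those of `dz_j ∧ dz̄_j`
      have h2 : (-2 * (Real.pi : ℂ) * Complex.I) ^ κ = (Real.pi : ℂ) ^ κ * (-2 * Complex.I) ^ κ := by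
        rw [← mul_pow]; congr 1; ring
      have h3 : (-2 * Complex.I) ^ κ ≠ 0 := pow_ne_zero _ (by simp)
      have h4 : ∀ {q : ℂ}, q ≠ 0 → ∀ t p b n Z : ℂ,
          t / n * (p / b) * Z = p * q * t / n * ((q * b)⁻¹ * Z) := fun {q} hq t p b n Z => by
        rw [mul_inv]
        linear_combination (-(t / n * (p / b) * Z)) * mul_inv_cancel₀ hq
      rw [h2]
      exact h4 h3 _ _ _ _ _
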